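/- Let $a,b\in\mathbb{C}$ and $P(X)=4X^3-3aX-b$. Let $Q(a,b)\subset\mathbb{P}^3$ be the quartic surface $$y^2zw-4x^3z+3axzw^2-\tfrac12\,(z^2w^2+w^4)+bzw^3=0,$$ let $X(a,b)$ be its minimal resolution (the resolution, as a compact complex surface, that is an isomorphism over the smooth locus and contracts no $(-1)$-curve), and let $\Theta_2\colon X(a,b)\to\mathbb{P}^1$ be the alternate fibration, i.e. the holomorphic map induced by the projection $[x,y,z,w]\mapsto[x,w]$. Such $X(a,b)$ and $\Theta_2$ exist, and the following holds. The singular fibres of $\Theta_2$ are located at $[1,0]$, where the fibre has Kodaira type $\mathrm{I}^*_{12}$, and at the points $[\lambda,1]$ with $\lambda\in\Sigma:=\{\lambda\in\mathbb{C} : P(\lambda)^2=1\}$. One of the following five cases occurs. 1. $a^3\neq(b+1)^2$ and $a^3\neq(b-1)^2$. Both $P-1$ and $P+1$ have three distinct roots, $\Sigma$ consists of six distinct points, and over each of them the fibre has type $\mathrm{I}_1$. 2. $a^3=(b+1)^2$, $b\neq0$, $a\neq0$. The polynomial $P+1$ has three distinct roots, and $P-1$ has a root of order two at $-(b+1)/(2a)$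 and a simple root at $(b+1)/a$. The set $\Sigma$ has exactly five points, $\Sigma=\{-(b+1)/(2a),\,(b+1)/a\}\cup\{\lambda : P(\lambda)=-1\}$; the fibre over $-(b+1)/(2a)$ has type $\mathrm{I}_2$, the other four have type $\mathrm{I}_1$. 3. $a^3=(b-1)^2$, $b\neq0$, $a\neq0$. The polynomial $P-1$ has three distinct roots, and $P+1$ has a root of order two at $-(b-1)/(2a)$ and a simple root at $(b-1)/a$. The set $\Sigma$ has exactly five points, $\Sigma=\{-(b-1)/(2a),\,(b-1)/a\}\cup\{\lambda : P(\lambda)=1\}$; the fibre over $-(b-1)/(2a)$ has type $\mathrm{I}_2$, the other four have type $\mathrm{I}_1$. 4. $a=0$, $b=\pm1$. Then $\Sigma=\{0\}\cup\{\theta/\sqrt[3]{2} : \theta^3=b\}$ has exactly four points; the fibre over $0$ has type $\mathrm{I}_3$, the other three have type $\mathrm{I}_1$. 5. $a^3=1$, $b=0$. Then $P+1=(2X-a^2)^2(X+a^2)$ and $P-1=(2X+a^2)^2(X-a^2)$, and $\Sigma=\{a^2/2,\,-a^2/2,\,-a^2,\,a^2\}$ has exactly four points; the fibres over $\pm a^2/2$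 have type $\mathrm{I}_2$, those over $\pm a^2$ type $\mathrm{I}_1$. -/

import Mathlib

open scoped Manifold ContDiff Topology LinearAlgebra.Projectivization

noncomputable section

namespace Inose

/-! ## Projective spaces and holomorphic maps -/

/-- Complex projective space of dimension `n`. -/
abbrev CP (n : ℕ) : Type := ℙ ℂ (Fin (n + 1) → ℂ)

/-- The two standard affine coordinates of the projective line:
`aff 0 s = [s, 1]` and `aff 1 s = [1, s]`. -/
def aff (k : Fin 2) (s : ℂ) : CP 1 :=
  if k = 0 then Projectivization.mk ℂ ![s, 1] (fun h => one_ne_zero (congrFun h 1))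
  else Projectivization.mk ℂ ![1, s] (fun h => one_ne_zero (congrFun h 0))

/-- The model of complex surfaces (complex manifolds of dimension two). -/
abbrev I2 : ModelWithCorners ℂ (ℂ × ℂ) (ℂ × ℂ) := 𝓘(ℂ, ℂ × ℂ)

section Surface

variable {X : Type} [TopologicalSpace X] [ChartedSpace (ℂ × ℂ) X]

/-- The function `f` is holomorphic in a neighbourhood of `x`. -/
def HolNear (f : X → ℂ) (x : X) : Prop :=
  ∀ᶠ y in 𝓝 x, MDifferentiableAt I2 𝓘(ℂ, ℂ) f y

/-- Near `x`, the map `f` to projective space is given by the homogeneous coordinates `F`, which are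
holomorphic functions without common zero. -/
def IsLocalLift {n : ℕ} (f : X → CP n) (x : X) (F : X → Fin (n + 1) → ℂ) : Prop :=
  ∀ᶠ y in 𝓝 x, MDifferentiableAt I2 𝓘(ℂ, Fin (n + 1) → ℂ) F y ∧
    ∃ h : F y ≠ 0, f y = Projectivization.mk ℂ (F y) h

/-- Holomorphic maps from a complex surface to projective space. -/
def IsHolomorphicToCP {n : ℕ} (f : X → CP n) : Prop :=
  ∀ x, ∃ F, IsLocalLift f x F

/-- The differential of the map `f` to projective space is injective at `x`
(the tangent space of projective space at `[v]` being the quotient by the line through `v`). -/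
def IsImmersionToCPAt {n : ℕ} (f : X → CP n) (x : X) : Prop :=
  ∃ F, IsLocalLift f x F ∧
    ∀ w : TangentSpace I2 x,
      (mfderiv I2 𝓘(ℂ, Fin (n + 1) → ℂ) F x w : Fin (n + 1) → ℂ) ∈ Submodule.span ℂ {F x} → w = 0

/-- `φ` is a holomorphic immersion of the projective line into the surface. -/
def IsImmersedRationalCurve (φ : CP 1 → X) : Prop :=
  ∀ k : Fin 2, MDifferentiable 𝓘(ℂ, ℂ) I2 (fun s => φ (aff k s)) ∧
    ∀ s : ℂ, mfderiv 𝓘(ℂ, ℂ) I2 (fun s => φ (aff k s)) s ≠ 0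

/-- The normal bundle of the immersed rational curve `φ` is isomorphic to the line bundle of degree
`d` on the projective line; for an embedded curve, `d` is the self-intersection number.
Here `ν 0` and `ν 1` are holomorphic vector fields along the two affine pieces of the curve which
are nowhere tangent to it, hence frames of the normal bundle, and on the overlap (with coordinate
`t = s⁻¹`) one has `ν 1 = t ^ d * ν 0` modulo tangent vectors of the curve. -/
def HasNormalDegree [IsManifold I2 ω X] (φ : CP 1 → X) (d : ℤ) : Prop :=
  ∃ ν : Fin 2 → ℂ → ℂ × ℂ,
    (∀ k, MDifferentiable 𝓘(ℂ, ℂ) I2.tangent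
      (fun s => (⟨φ (aff k s), ν k s⟩ : TangentBundle I2 X))) ∧
    (∀ k s, ν k s ∉ Submodule.span ℂ
      {(mfderiv 𝓘(ℂ, ℂ) I2 (fun s => φ (aff k s)) s (1 : ℂ) : ℂ × ℂ)}) ∧
    (∀ s : ℂ, s ≠ 0 → ν 1 s - (s⁻¹) ^ d • ν 0 s⁻¹ ∈ Submodule.span ℂ
      {(mfderiv 𝓘(ℂ, ℂ) I2 (fun s => φ (aff 1 s)) s (1 : ℂ) : ℂ × ℂ)})

/-- A `(-1)`-curve: a smooth rational curve with self-intersection `-1`. -/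
def IsMinusOneCurve [IsManifold I2 ω X] (φ : CP 1 → X) : Prop :=
  IsImmersedRationalCurve φ ∧ Function.Injective φ ∧ HasNormalDegree φ (-1)

end Surface

/-! ## The quartic surface and its minimal resolution -/

/-- The Inose form, in the homogeneous coordinates `[x, y, z, w]`. -/
def form (a b : ℂ) : MvPolynomial (Fin 4) ℂ :=
  let x : MvPolynomial (Fin 4) ℂ := MvPolynomial.X 0
  let y : MvPolynomial (Fin 4) ℂ := MvPolynomial.X 1
  let z : MvPolynomial (Fin 4) ℂ := MvPolynomial.X 2
  let w : MvPolynomial (Fin 4) ℂ := MvPolynomial.X 3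
  y ^ 2 * z * w - 4 * x ^ 3 * z + MvPolynomial.C (3 * a) * x * z * w ^ 2
    - MvPolynomial.C (1 / 2) * (z ^ 2 * w ^ 2 + w ^ 4) + MvPolynomial.C b * z * w ^ 3

/-- The quartic surface `Q(a, b)` in projective space. -/
def quartic (a b : ℂ) : Set (CP 3) :=
  {q | MvPolynomial.eval q.rep (form a b) = 0}

/-- The smooth points of `Q(a, b)`: those at which some partial derivative does not vanish. -/
def quarticReg (a b : ℂ) : Set (CP 3) :=
  {q | q ∈ quartic a b ∧ ∃ i, MvPolynomial.eval q.rep (MvPolynomial.pderiv i (form a b)) ≠ 0}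

section Resolution

variable {X : Type} [TopologicalSpace X] [ChartedSpace (ℂ × ℂ) X]

/-- `π : X → Q(a, b)` is a resolution of singularities: `X` is a compact complex surface, and `π` is
holomorphic, surjective, and biholomorphic over the smooth locus, whose preimage is dense.
(A bijective holomorphic immersion between complex manifolds of the same dimension is
biholomorphic.) -/
structure IsResolution (a b : ℂ) (π : X → CP 3) : Prop where
  compact : CompactSpace X
  t2 : T2Space X
  holomorphic : IsHolomorphicToCP π
  range_eq : Set.range π = quartic a b
  bijective : ∀ q ∈ quarticReg a b, ∃! x, π x = q
  immersion : ∀ x, π x ∈ quarticReg a b → IsImmersionToCPAt π x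
  dense : Dense (π ⁻¹' quarticReg a b)

/-- A resolution is minimal if it contracts no `(-1)`-curve. -/
structure IsMinimalResolution [IsManifold I2 ω X] (a b : ℂ) (π : X → CP 3) : Prop extends
    IsResolution a b π where
  minimal : ∀ φ : CP 1 → X, IsMinusOneCurve φ → ¬ ∃ q, ∀ p, π (φ p) = q

/-- The alternate fibration: the holomorphic map `Θ : X → ℙ¹` induced by the projection
`[x, y, z, w] ↦ [x, w]`. -/
structure IsAlternateFibration (π : X → CP 3) (Θ : X → CP 1) : Prop where
  holomorphic : IsHolomorphicToCP Θ
  induced : ∀ (p : X) (h : ![(π p).rep 0, (π p).rep 3] ≠ 0),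
    Θ p = Projectivization.mk ℂ ![(π p).rep 0, (π p).rep 3] h

/-! ## Singular fibres and their Kodaira types -/

/-- `f` is a local equation near `x` of the (scheme-theoretic) fibre of `Θ` over `t`. -/
def IsLocalEquation (Θ : X → CP 1) (t : CP 1) (x : X) (f : X → ℂ) : Prop :=
  ∃ F, IsLocalLift Θ x F ∧ f = fun y => t.rep 1 * F y 0 - t.rep 0 * F y 1

/-- The fibre of `Θ` over `t` is singular, i.e. `t` is a critical value of `Θ`. -/
def IsSingularFibre (Θ : X → CP 1) (t : CP 1) : Prop :=
  ∃ x f, Θ x = t ∧ IsLocalEquation Θ t x f ∧ mfderiv I2 𝓘(ℂ, ℂ) f x = 0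

/-- The function `u` vanishes along the branch of the curve `φ` through the point `φ p`. -/
def VanishesAlong (u : X → ℂ) (φ : CP 1 → X) (p : CP 1) : Prop :=
  ∀ k s, aff k s = p → ∀ᶠ r in 𝓝 s, u (φ (aff k r)) = 0

/-- The fibre of `Θ` over `t` is, as a divisor, the sum of the rational curves `φ i` with
multiplicities `m i`, its only singularities apart from multiplicities being normal crossings of two
branches, and its dual graph has the adjacency matrix `A`: for `i ≠ j`, the curves `φ i` and `φ j`
meet in `A i j` points, and `A i i` is twice the number of nodes of the curve `φ i` (each node is
counted by two ordered pairs of distinct parameters), so that `φ i` is smooth for `A i i = 0`. -/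
def IsFibreOfRationalCurves (Θ : X → CP 1) (t : CP 1) {ι : Type}
    (m : ι → ℕ) (A : ι → ι → ℕ) : Prop :=
  ∃ φ : ι → CP 1 → X,
    (∀ i, IsImmersedRationalCurve (φ i)) ∧
    (⋃ i, Set.range (φ i)) = Θ ⁻¹' {t} ∧
    (∀ i j, {c : CP 1 × CP 1 | (i, c.1) ≠ (j, c.2) ∧ φ i c.1 = φ j c.2}.encard = A i j) ∧
    (∀ i p, (∀ j q, φ j q = φ i p → (j, q) = (i, p)) →
      ∃ f h u : X → ℂ, IsLocalEquation Θ t (φ i p) f ∧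
        HolNear h (φ i p) ∧ HolNear u (φ i p) ∧
        h (φ i p) ≠ 0 ∧ mfderiv I2 𝓘(ℂ, ℂ) u (φ i p) ≠ 0 ∧ VanishesAlong u (φ i) p ∧
        ∀ᶠ y in 𝓝 (φ i p), f y = h y * u y ^ m i) ∧
    (∀ i p j q, (i, p) ≠ (j, q) → φ i p = φ j q →
      ∃ f h u v : X → ℂ, IsLocalEquation Θ t (φ i p) f ∧
        HolNear h (φ i p) ∧ HolNear u (φ i p) ∧ HolNear v (φ i p) ∧
        h (φ i p) ≠ 0 ∧
        (∀ w : TangentSpace I2 (φ i p), mfderiv I2 𝓘(ℂ, ℂ) u (φ i p) w = 0 →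
          mfderiv I2 𝓘(ℂ, ℂ) v (φ i p) w = 0 → w = 0) ∧
        VanishesAlong u (φ i) p ∧ VanishesAlong v (φ j) q ∧
        ∀ᶠ y in 𝓝 (φ i p), f y = h y * u y ^ m i * v y ^ m j)

/-- Kodaira type `I_n`, `n ≥ 1`: a cycle of `n` rational curves of multiplicity one (for `n = 1` a
rational curve with one node, for `n = 2` two smooth rational curves meeting in two points). -/
def IsTypeI (Θ : X → CP 1) (t : CP 1) (n : ℕ) : Prop :=
  1 ≤ n ∧ IsFibreOfRationalCurves Θ t (ι := ZMod n) (fun _ => 1)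
    (fun i j => (if j = i + 1 then 1 else 0) + (if i = j + 1 then 1 else 0))

/-- The dual graph of a fibre of type `I*_n`: a chain of `n + 1` vertices (on the left), with two
further vertices attached to each of the two ends of the chain. -/
def starGraph (n : ℕ) : Fin (n + 1) ⊕ Fin 4 → Fin (n + 1) ⊕ Fin 4 → ℕ
  | .inl i, .inl j => if i.val + 1 = j.val ∨ j.val + 1 = i.val then 1 else 0
  | .inl i, .inr k => if (k.val < 2 ∧ i.val = 0) ∨ (2 ≤ k.val ∧ i.val = n) then 1 else 0
  | .inr k, .inl i => if (k.val < 2 ∧ i.val = 0) ∨ (2 ≤ k.val ∧ i.val = n) then 1 else 0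
  | .inr _, .inr _ => 0

/-- Kodaira type `I*_n`: the curves of the chain have multiplicity two, the four others
multiplicity one. -/
def IsTypeIStar (Θ : X → CP 1) (t : CP 1) (n : ℕ) : Prop :=
  IsFibreOfRationalCurves Θ t (Sum.elim (fun _ : Fin (n + 1) => 2) (fun _ : Fin 4 => 1))
    (starGraph n)

end Resolution

/-- The polynomial `P = 4 X ^ 3 - 3 a X - b`. -/
def poly (a b : ℂ) : Polynomial ℂ :=
  4 * Polynomial.X ^ 3 - Polynomial.C (3 * a) * Polynomial.X - Polynomial.C b

/-- The set of all `l` with `P(l) ^ 2 = 1`. -/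
def singSet (a b : ℂ) : Set ℂ := {l | (poly a b).eval l ^ 2 = 1}

end Inose

end

open scoped Manifold ContDiff Topology LinearAlgebra.Projectivization

noncomputable section

namespace Inose

open Set Filter

/-! ## Complex surfaces from analytically compatible parametrizations -/

/-! Where w = 1, the quartic is y² = P(x) + h(z) with h(z) = (z + 1/z)/2. A smooth model is written
down by explicit charts, and every assertion is checked in those charts.

Affine singularities. The projection to x fails to be smooth only where y = 0 and z = ±1, so P(x) =
-z = ±1. Let P(l) = ε = ±1 and z = -εt², d = (t - 1/t)/2, κ² = -2ε. The equation becomes (y - κd)(y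
+ κd) = P(x) - P(l) = (x - l)ⁿ q(x), where n = `nmult a b l` and q(l) ≠ 0. This is AB = Cⁿ with C =
x - l. Its toric resolution has n charts with C = uv, and the fibre x = l is uv = 0 in each of them.
The n - 1 exceptional curves, closed up by the strict transform of the fibre (rational, parametrized
by t), form a cycle of length n: Kodaira type I_n (`isTypeI`).

Infinity. Put ξ = 1/x and T(ξ) = ξ³P(1/ξ), so T(0) = 4, and set S = √T/(yξ), G = ξ - S². The
equation becomes z/(1 + z²) = S²ξ³/(2TG). Expanding ξ³ = (G + S²)³, the only term that is not
holomorphic is S⁸/G. Hence both over z = 0 and over z = ∞ the surface is resolved by the charts of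
AB = C⁸ with A = G, C = S, and z is recovered by inverting the Joukowski map. On these charts ξ = A
+ C² vanishes to order min(i, 2) along the i-th curve, and what remains of its zero set is a curve
crossing the second one at A/C² = -1. The two chains are joined by a middle curve, along which ξ =
r². Altogether 13 double curves in a chain carry two simple curves at each end: type I*₁₂
(`isTypeIStar`).

The surface. A point is an abstract label: affine coordinates, or a position on one of the curves
just named, where points on a toric chain are recorded by all values A/Cⁱ in ℂ ∪ {∞}. Charts with
equal labels are related by analytic maps (`rel_of_pt_eq`). The Hausdorff property follows because
the projections to [x, w], [x, y, w] and [z, w] separate all points except those on one toric chain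
(`eq_or_of_separate`), and there the gluing relation is closed (`torRel`). Compactness follows from
convergence of every ultrafilter of generic points in some chart (`exists_limit`).

Resolution and minimality. The map to the quartic is given by explicit homogeneous coordinates. Its
smooth points are the images of four kinds of labels (`regular_cases`), over which injectivity and
immersivity are checked. The form dx ∧ dy/((z - 1/z)/2) extends to a nowhere vanishing holomorphic
two-form (`volumeForm`). Contracting it with the velocity of a rational curve trivializes the normal
bundle up to the factor t⁻² of the tangent bundle, so the normal degree -1 is impossible by
Liouville's theorem (`ParamAtlas.VolumeForm.not_isMinusOneCurve`). There are then no (-1)-curves at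
all.

Finally dx vanishes in the finite part only at the origins of the node charts, which locates the
singular fibres (`isSingularFibre_iff`). The five cases reduce to computing the multiplicity `nmult`
of the roots of P ∓ 1, governed by the discriminant conditions a³ = (b ± 1)². -/

/-- A family of injective parametrizations by open subsets of `ℂ × ℂ` which covers the set `X` and
whose transition maps are analytic. -/
structure ParamAtlas (X K : Type) where
  U : K → Set (ℂ × ℂ)
  ψ : K → ℂ × ℂ → X
  isOpen_U : ∀ k, IsOpen (U k)
  inj : ∀ k, InjOn (ψ k) (U k)
  cover : ∀ x, ∃ k, ∃ c ∈ U k, ψ k c = x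
  compat : ∀ k l c d, c ∈ U k → d ∈ U l → ψ k c = ψ l d →
    ∃ τ : ℂ × ℂ → ℂ × ℂ, AnalyticAt ℂ τ c ∧ τ c = d ∧ ∀ᶠ c' in 𝓝 c, ψ l (τ c') = ψ k c'

namespace ParamAtlas

variable {X K : Type}

/-- The set `X` with the structure of a complex surface given by the atlas. -/
def Space (_ : ParamAtlas X K) : Type := X

variable (𝒜 : ParamAtlas X K)

/-- The parametrizations, as maps to the surface. -/
def par (k : K) : ℂ × ℂ → 𝒜.Space := 𝒜.ψ k

instance : TopologicalSpace 𝒜.Space where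
  IsOpen V := ∀ k, IsOpen (𝒜.U k ∩ 𝒜.par k ⁻¹' V)
  isOpen_univ k := by simpa using 𝒜.isOpen_U k
  isOpen_inter V W hV hW k := by
    rw [preimage_inter, inter_inter_distrib_left]
    exact (hV k).inter (hW k)
  isOpen_sUnion S hS k := by
    rw [preimage_sUnion, inter_iUnion₂]
    exact isOpen_biUnion fun V hV => hS V hV k

variable {𝒜}

lemma U_mem_nhds {k : K} {c : ℂ × ℂ} (hc : c ∈ 𝒜.U k) : 𝒜.U k ∈ 𝓝 c :=
  (𝒜.isOpen_U k).mem_nhds hc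

/-- Openness has to be tested in every other chart, where the preimage of the image contains the set
of points that the transition map `τ` sends into `O`; continuity of `τ` suffices. -/
lemma isOpen_image {k : K} {O : Set (ℂ × ℂ)} (hO : IsOpen O) (hOU : O ⊆ 𝒜.U k) :
    IsOpen (𝒜.par k '' O) := by
  intro l
  rw [isOpen_iff_mem_nhds]
  rintro d ⟨hd, c, hcO, hcd⟩
  obtain ⟨τ, hτ, hτd, h⟩ := 𝒜.compat l k d c hd (hOU hcO) hcd.symm
  have h1 : ∀ᶠ d' in 𝓝 d, τ d' ∈ O :=
    hτ.continuousAt.eventually (by rw [hτd]; exact hO.mem_nhds hcO)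
  filter_upwards [h, h1, U_mem_nhds hd] with d' h2 h3 h4
  exact ⟨h4, τ d', h3, h2⟩

lemma continuousOn_par (k : K) : ContinuousOn (𝒜.par k) (𝒜.U k) :=
  (continuousOn_open_iff (𝒜.isOpen_U k)).2 fun _ ht => ht k

lemma injOn_par (k : K) : InjOn (𝒜.par k) (𝒜.U k) := 𝒜.inj k

lemma exists_par (x : 𝒜.Space) : ∃ k, ∃ c ∈ 𝒜.U k, 𝒜.par k c = x := 𝒜.cover x

/-- This turns every local statement on the surface into a statement about germs in `ℂ × ℂ`; all
later local computations pass through it. -/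
lemma nhds_par {k : K} {c : ℂ × ℂ} (hc : c ∈ 𝒜.U k) :
    𝓝 (𝒜.par k c) = map (𝒜.par k) (𝓝 c) := by
  apply le_antisymm
  · intro s hs
    rw [mem_map] at hs
    obtain ⟨O, hO, hOo, hcO⟩ := mem_nhds_iff.1 (inter_mem hs (U_mem_nhds hc))
    refine mem_of_superset ((isOpen_image hOo fun x hx => (hO hx).2).mem_nhds ⟨c, hcO, rfl⟩) ?_
    rintro _ ⟨x, hx, rfl⟩
    exact (hO hx).1
  · exact ((continuousOn_par k).continuousAt (U_mem_nhds hc))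

lemma eventually_par {k : K} {c : ℂ × ℂ} (hc : c ∈ 𝒜.U k) {p : 𝒜.Space → Prop} :
    (∀ᶠ y in 𝓝 (𝒜.par k c), p y) ↔ ∀ᶠ c' in 𝓝 c, p (𝒜.par k c') := by
  rw [nhds_par hc, eventually_map]

variable (𝒜) in
/-- The chart inverse to a parametrization. -/
def chart (k : K) : OpenPartialHomeomorph 𝒜.Space (ℂ × ℂ) :=
  (OpenPartialHomeomorph.ofContinuousOpenRestrict
    ((injOn_par k).toPartialEquiv (𝒜.par k) (𝒜.U k)) (continuousOn_par k)
    (by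
      intro O hO
      obtain ⟨V, hV, rfl⟩ := isOpen_induced_iff.1 hO
      have : ((𝒜.U k).domRestrict (𝒜.par k)) '' (Subtype.val ⁻¹' V) = 𝒜.par k '' (𝒜.U k ∩ V) := by
        ext y
        constructor
        · rintro ⟨⟨x, hx⟩, hxV, rfl⟩
          exact ⟨x, ⟨hx, hxV⟩, rfl⟩
        · rintro ⟨x, ⟨hx, hxV⟩, rfl⟩
          exact ⟨⟨x, hx⟩, hxV, rfl⟩
      exact this ▸ isOpen_image ((𝒜.isOpen_U k).inter hV) inter_subset_left)
    (𝒜.isOpen_U k)).symm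

lemma chart_par {k : K} {c : ℂ × ℂ} (hc : c ∈ 𝒜.U k) : 𝒜.chart k (𝒜.par k c) = c :=
  (𝒜.chart k).right_inv hc

lemma par_mem_source {k : K} {c : ℂ × ℂ} (hc : c ∈ 𝒜.U k) : 𝒜.par k c ∈ (𝒜.chart k).source :=
  ⟨c, hc, rfl⟩

instance : ChartedSpace (ℂ × ℂ) 𝒜.Space where
  atlas := range 𝒜.chart
  chartAt x := 𝒜.chart (exists_par x).choose
  mem_chart_source x := by
    obtain ⟨c, hc, h⟩ := (exists_par x).choose_spec
    exact ⟨c, hc, h⟩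
  chart_mem_atlas x := ⟨_, rfl⟩

lemma chart_mem_atlas (k : K) : 𝒜.chart k ∈ atlas (ℂ × ℂ) 𝒜.Space := ⟨k, rfl⟩

variable (𝒜) in
lemma exists_chartAt_eq (x : 𝒜.Space) : ∃ k, chartAt (ℂ × ℂ) x = 𝒜.chart k := ⟨_, rfl⟩

/-- `compat` only provides some analytic lift `τ`; injectivity of the target parametrization
identifies it with the actual change of charts. -/
lemma analyticAt_transition {k l : K} {c d : ℂ × ℂ} (hc : c ∈ 𝒜.U k) (hd : d ∈ 𝒜.U l)
    (h : 𝒜.par k c = 𝒜.par l d) : AnalyticAt ℂ (fun c' => 𝒜.chart l (𝒜.par k c')) c := by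
  obtain ⟨τ, hτ, hτd, hh⟩ := 𝒜.compat k l c d hc hd h
  refine hτ.congr ?_
  have h1 : ∀ᶠ c' in 𝓝 c, τ c' ∈ 𝒜.U l :=
    hτ.continuousAt.eventually (by rw [hτd]; exact U_mem_nhds hd)
  filter_upwards [hh, h1] with c' h2 h3
  have : 𝒜.par k c' = 𝒜.par l (τ c') := h2.symm
  rw [this, chart_par h3]

instance : IsManifold I2 ω 𝒜.Space := by
  apply isManifold_of_contDiffOn
  rintro _ _ ⟨k, rfl⟩ ⟨l, rfl⟩
  rintro c ⟨⟨hc, d, hd, hcd⟩, -⟩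
  exact ((analyticAt_transition (k := k) (l := l) hc hd hcd.symm).contDiffAt).contDiffWithinAt

/-! ### Differentiability and differentials read in the charts -/

section Differentiability

variable {E : Type} [NormedAddCommGroup E] [NormedSpace ℂ E]

lemma mdifferentiableAt_par {k : K} {c : ℂ × ℂ} (hc : c ∈ 𝒜.U k) :
    MDifferentiableAt 𝓘(ℂ, ℂ × ℂ) I2 (𝒜.par k) c :=
  mdifferentiableAt_atlas_symm (I := I2) (chart_mem_atlas k) hc

lemma mdifferentiableAt_chart {k : K} {c : ℂ × ℂ} (hc : c ∈ 𝒜.U k) :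
    MDifferentiableAt I2 𝓘(ℂ, ℂ × ℂ) (𝒜.chart k) (𝒜.par k c) :=
  mdifferentiableAt_atlas (I := I2) (chart_mem_atlas k) (par_mem_source hc)

lemma mdifferentiableAt_iff {k : K} {c : ℂ × ℂ} (hc : c ∈ 𝒜.U k) {f : 𝒜.Space → E} :
    MDifferentiableAt I2 𝓘(ℂ, E) f (𝒜.par k c) ↔
      DifferentiableAt ℂ (fun c' => f (𝒜.par k c')) c := by
  rw [← mdifferentiableAt_iff_differentiableAt]
  constructor
  · intro h
    exact h.comp c (mdifferentiableAt_par hc)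
  · intro h
    have h1 : MDifferentiableAt I2 𝓘(ℂ, E)
        ((fun c' => f (𝒜.par k c')) ∘ 𝒜.chart k) (𝒜.par k c) := by
      refine MDifferentiableAt.comp (I' := 𝓘(ℂ, ℂ × ℂ)) _ ?_ (mdifferentiableAt_chart hc)
      rw [chart_par hc]
      exact h
    refine h1.congr_of_eventuallyEq ?_
    refine (eventually_par hc).2 ?_
    filter_upwards [U_mem_nhds hc] with c' hc'
    simp [chart_par hc']

variable (𝒜) in
/-- The differential of the chart. -/
def dchart (k : K) (c : ℂ × ℂ) : TangentSpace I2 (𝒜.par k c) →L[ℂ] ℂ × ℂ :=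
  mfderiv I2 𝓘(ℂ, ℂ × ℂ) (𝒜.chart k) (𝒜.par k c)

lemma dchart_bijective {k : K} {c : ℂ × ℂ} (hc : c ∈ 𝒜.U k) :
    Function.Bijective (𝒜.dchart k c) :=
  (mdifferentiable_of_mem_atlas (I := I2) (chart_mem_atlas k)).mfderiv_bijective
    (par_mem_source hc)

lemma mfderiv_eq {k : K} {c : ℂ × ℂ} (hc : c ∈ 𝒜.U k) {f : 𝒜.Space → E}
    (hf : DifferentiableAt ℂ (fun c' => f (𝒜.par k c')) c) (w : TangentSpace I2 (𝒜.par k c)) :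
    mfderiv I2 𝓘(ℂ, E) f (𝒜.par k c) w =
      fderiv ℂ (fun c' => f (𝒜.par k c')) c (𝒜.dchart k c w) := by
  have h1 : f =ᶠ[𝓝 (𝒜.par k c)] (fun c' => f (𝒜.par k c')) ∘ 𝒜.chart k := by
    refine (eventually_par hc).2 ?_
    filter_upwards [U_mem_nhds hc] with c' hc'
    simp [chart_par hc']
  have hf' : MDifferentiableAt 𝓘(ℂ, ℂ × ℂ) 𝓘(ℂ, E) (fun c' => f (𝒜.par k c'))
      (𝒜.chart k (𝒜.par k c)) := by
    rw [chart_par hc]; exact hf.mdifferentiableAt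
  have h2 := mfderiv_comp (𝒜.par k c) hf' (mdifferentiableAt_chart hc)
  rw [h1.mfderiv_eq, h2]
  simp only [mfderiv_eq_fderiv]
  have h3 : 𝒜.chart k (𝒜.par k c) = c := chart_par hc
  change fderiv ℂ (fun c' => f (𝒜.par k c')) (𝒜.chart k (𝒜.par k c)) (𝒜.dchart k c w) = _
  rw [h3]

lemma mfderiv_eq_zero_iff {k : K} {c : ℂ × ℂ} (hc : c ∈ 𝒜.U k) {f : 𝒜.Space → E}
    (hf : DifferentiableAt ℂ (fun c' => f (𝒜.par k c')) c) :
    mfderiv I2 𝓘(ℂ, E) f (𝒜.par k c) = 0 ↔ fderiv ℂ (fun c' => f (𝒜.par k c')) c = 0 := by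
  constructor
  · intro h
    refine ContinuousLinearMap.ext fun v => ?_
    obtain ⟨w, rfl⟩ := (dchart_bijective hc).2 v
    rw [← mfderiv_eq hc hf, h]
    rfl
  · intro h
    refine ContinuousLinearMap.ext fun w => ?_
    rw [mfderiv_eq hc hf, h]
    rfl

end Differentiability

section Curves

lemma mdifferentiableAt_par_comp {k : K} {γ : ℂ → ℂ × ℂ} {s : ℂ} (hs : γ s ∈ 𝒜.U k)
    (hγ : DifferentiableAt ℂ γ s) :
    MDifferentiableAt 𝓘(ℂ, ℂ) I2 (fun r => 𝒜.par k (γ r)) s :=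
  (mdifferentiableAt_par hs).comp s hγ.mdifferentiableAt

lemma mfderiv_par_comp_ne_zero {k : K} {γ : ℂ → ℂ × ℂ} {s : ℂ} (hs : γ s ∈ 𝒜.U k)
    (hγ : DifferentiableAt ℂ γ s) (h0 : deriv γ s ≠ 0) :
    mfderiv 𝓘(ℂ, ℂ) I2 (fun r => 𝒜.par k (γ r)) s ≠ 0 := by
  intro h
  have h1 : (fun r => 𝒜.chart k (𝒜.par k (γ r))) =ᶠ[𝓝 s] γ := by
    filter_upwards [hγ.continuousAt.eventually (U_mem_nhds hs)] with r hr
    exact chart_par hr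
  have h2 := mfderiv_comp (I'' := 𝓘(ℂ, ℂ × ℂ)) s (mdifferentiableAt_chart hs)
    (mdifferentiableAt_par_comp hs hγ)
  rw [h] at h2
  have h3 : fderiv ℂ γ s = 0 := by
    rw [← mfderiv_eq_fderiv, ← h1.mfderiv_eq]
    exact h2.trans (ContinuousLinearMap.comp_zero _)
  exact h0 (by rw [← fderiv_apply_one_eq_deriv, h3]; rfl)

end Curves

/-! ### Maps to projective space and separation of points -/

section Projective

variable {n : ℕ}

/-- Homogeneous coordinates near a point in the image of a parametrization. -/
def LiftAt (f : 𝒜.Space → CP n) (k : K) (c : ℂ × ℂ) (L : ℂ × ℂ → Fin (n + 1) → ℂ) : Prop :=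
  AnalyticAt ℂ L c ∧ ∀ᶠ c' in 𝓝 c, ∃ h : L c' ≠ 0, f (𝒜.par k c') = Projectivization.mk ℂ (L c') h

lemma LiftAt.isLocalLift {f : 𝒜.Space → CP n} {k : K} {c : ℂ × ℂ}
    {L : ℂ × ℂ → Fin (n + 1) → ℂ} (hc : c ∈ 𝒜.U k) (h : LiftAt f k c L) :
    IsLocalLift f (𝒜.par k c) (L ∘ 𝒜.chart k) := by
  refine (eventually_par hc).2 ?_
  filter_upwards [h.2, h.1.eventually_analyticAt, U_mem_nhds hc] with c' h1 h2 h3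
  constructor
  · refine (mdifferentiableAt_iff h3).2 (h2.differentiableAt.congr_of_eventuallyEq ?_)
    filter_upwards [U_mem_nhds h3] with c'' h4
    simp [chart_par h4]
  · simpa [chart_par h3] using h1

lemma isHolomorphicToCP_of_liftAt {f : 𝒜.Space → CP n}
    (h : ∀ k, ∀ c ∈ 𝒜.U k, ∃ L, LiftAt f k c L) : IsHolomorphicToCP f := by
  intro x
  obtain ⟨k, c, hc, rfl⟩ := exists_par x
  obtain ⟨L, hL⟩ := h k c hc
  exact ⟨_, hL.isLocalLift hc⟩

/-- Two vectors are proportional exactly when all 2 × 2 minors vanish. A minor of the two lifts that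
is nonzero at `(x, y)` stays nonzero nearby, so the images of points in the two neighbourhoods never
agree. -/
lemma exists_disjoint_nhds_of_ne {f : 𝒜.Space → CP n} (hf : IsHolomorphicToCP f)
    {x y : 𝒜.Space} (hxy : f x ≠ f y) : Disjoint (𝓝 x) (𝓝 y) := by
  obtain ⟨F, hF⟩ := hf x
  obtain ⟨G, hG⟩ := hf y
  obtain ⟨hF0, hFx⟩ := hF.self_of_nhds.2
  obtain ⟨hG0, hGy⟩ := hG.self_of_nhds.2
  have key : ∃ i j, F x i * G y j - F x j * G y i ≠ 0 := by
    by_contra! hcon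
    apply hxy
    rw [hFx, hGy, Projectivization.mk_eq_mk_iff']
    obtain ⟨i, hi⟩ := Function.ne_iff.1 hG0
    refine ⟨F x i / G y i, ?_⟩
    ext j
    have := hcon i j
    simp only [Pi.smul_apply, smul_eq_mul, Pi.zero_apply] at *
    field_simp
    linear_combination this
  obtain ⟨i, j, hij⟩ := key
  have cF := hF.self_of_nhds.1.continuousAt
  have cG := hG.self_of_nhds.1.continuousAt
  rw [continuousAt_pi] at cF cG
  have hcont : ContinuousAt (fun p : 𝒜.Space × 𝒜.Space =>
      F p.1 i * G p.2 j - F p.1 j * G p.2 i) (x, y) := by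
    have a1 : ContinuousAt (fun p : 𝒜.Space × 𝒜.Space => F p.1 i) (x, y) :=
      ContinuousAt.comp (f := Prod.fst) (g := fun y => F y i) (cF i) continuousAt_fst
    have a2 : ContinuousAt (fun p : 𝒜.Space × 𝒜.Space => F p.1 j) (x, y) :=
      ContinuousAt.comp (f := Prod.fst) (g := fun y => F y j) (cF j) continuousAt_fst
    have a3 : ContinuousAt (fun p : 𝒜.Space × 𝒜.Space => G p.2 i) (x, y) :=
      ContinuousAt.comp (f := Prod.snd) (g := fun y => G y i) (cG i) continuousAt_snd
    have a4 : ContinuousAt (fun p : 𝒜.Space × 𝒜.Space => G p.2 j) (x, y) :=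
      ContinuousAt.comp (f := Prod.snd) (g := fun y => G y j) (cG j) continuousAt_snd
    exact (a1.mul a4).sub (a2.mul a3)
  have hev := hcont.eventually_ne hij
  rw [nhds_prod_eq, eventually_prod_iff] at hev
  obtain ⟨p, hp, q, hq, hpq⟩ := hev
  rw [Filter.disjoint_iff]
  refine ⟨_, hp.and hF, _, hq.and hG, ?_⟩
  rw [Set.disjoint_left]
  rintro z ⟨hz1, hz2⟩ ⟨hz3, hz4⟩
  apply hpq hz1 hz3
  obtain ⟨hFz0, hFz⟩ := hz2.2
  obtain ⟨hGz0, hGz⟩ := hz4.2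
  obtain ⟨a, ha⟩ := (Projectivization.mk_eq_mk_iff' ℂ _ _ hFz0 hGz0).1 (hFz.symm.trans hGz)
  rw [← ha]
  simp only [Pi.smul_apply, smul_eq_mul]
  ring

end Projective

end ParamAtlas

@[fun_prop] lemma analyticAt_comp_fst {E : Type} [NormedAddCommGroup E] [NormedSpace ℂ E]
    {f : E → ℂ × ℂ} {x : E} (hf : AnalyticAt ℂ f x) : AnalyticAt ℂ (fun y => (f y).1) x :=
  analyticAt_fst.comp hf

@[fun_prop] lemma analyticAt_comp_snd {E : Type} [NormedAddCommGroup E] [NormedSpace ℂ E]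
    {f : E → ℂ × ℂ} {x : E} (hf : AnalyticAt ℂ f x) : AnalyticAt ℂ (fun y => (f y).2) x :=
  analyticAt_snd.comp hf

/-! ## The principal square root and the inverse of the Joukowski map -/

/-- The principal branch of the square root. -/
def csqrt (z : ℂ) : ℂ := Complex.exp (Complex.log z / 2)

/-- An exponential has no zeros, so this holds even at `0`, where the value is `1`; only `csqrt_sq`
needs the argument to be nonzero. -/
lemma csqrt_ne_zero (z : ℂ) : csqrt z ≠ 0 := Complex.exp_ne_zero _

lemma csqrt_sq {z : ℂ} (hz : z ≠ 0) : csqrt z ^ 2 = z := by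
  rw [csqrt, ← Complex.exp_nat_mul]
  rw [show ((2 : ℕ) : ℂ) * (Complex.log z / 2) = Complex.log z by push_cast; ring]
  exact Complex.exp_log hz

lemma csqrt_re_pos {z : ℂ} (hz : z ∈ Complex.slitPlane) : 0 < (csqrt z).re := by
  rw [csqrt, Complex.exp_re]
  refine mul_pos (Real.exp_pos _) (Real.cos_pos_of_mem_Ioo ?_)
  have h := (Complex.mem_slitPlane_iff_arg.1 hz).1
  have h1 := Complex.arg_le_pi z
  have h2 := Complex.neg_pi_lt_arg z
  have h3 : Complex.arg z < Real.pi := lt_of_le_of_ne h1 h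
  have : (Complex.log z / 2).im = Complex.arg z / 2 := by
    rw [show Complex.log z / 2 = Complex.log z / ((2 : ℝ) : ℂ) by simp, Complex.div_ofReal_im,
      Complex.log_im]
  rw [this]
  constructor <;> linarith

lemma sq_mem_slitPlane {t : ℂ} (ht : 0 < t.re) : t ^ 2 ∈ Complex.slitPlane := by
  rw [Complex.mem_slitPlane_iff]
  by_cases h : t.im = 0
  · left
    rw [sq, Complex.mul_re, h]
    nlinarith
  · right
    rw [sq, Complex.mul_im]
    have : t.re * t.im ≠ 0 := mul_ne_zero ht.ne' h
    intro h'
    apply this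
    linarith

/-- Of the two opposite roots only one has positive real part. This is the device by which branches
of roots are identified throughout: one checks positivity at a point and extends it by continuity.
-/
lemma csqrt_eq_of_sq {z t : ℂ} (ht : 0 < t.re) (h : t ^ 2 = z) : csqrt z = t := by
  have hz : z ∈ Complex.slitPlane := h ▸ sq_mem_slitPlane ht
  have h1 := csqrt_sq (Complex.slitPlane_ne_zero hz)
  have h2 := csqrt_re_pos hz
  have h3 : (csqrt z - t) * (csqrt z + t) = 0 := by linear_combination h1 - h
  rcases mul_eq_zero.1 h3 with h4 | h4
  · exact sub_eq_zero.1 h4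
  · have := congrArg Complex.re h4
    simp only [Complex.add_re, Complex.zero_re] at this
    linarith

lemma analyticAt_csqrt {z : ℂ} (hz : z ∈ Complex.slitPlane) : AnalyticAt ℂ csqrt z :=
  ((analyticAt_id.clog hz).div analyticAt_const two_ne_zero).cexp

lemma _root_.AnalyticAt.csqrt {E : Type} [NormedAddCommGroup E] [NormedSpace ℂ E] {f : E → ℂ}
    {x : E} (hf : AnalyticAt ℂ f x) (hx : f x ∈ Complex.slitPlane) :
    AnalyticAt ℂ (fun y => csqrt (f y)) x :=
  (analyticAt_csqrt hx).comp hf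

/-- The domain of the inverse of `z ↦ z / (1 + z ^ 2)`. -/
def jouDom : Set ℂ := {w | 1 - 4 * w ^ 2 ∈ Complex.slitPlane}

/-- The function `√(1 - 4 w ^ 2)`. -/
def jouRoot (w : ℂ) : ℂ := csqrt (1 - 4 * w ^ 2)

/-- The inverse of the map `z ↦ z / (1 + z ^ 2)` on the unit disc. -/
def jou (w : ℂ) : ℂ := 2 * w / (1 + jouRoot w)

lemma jouRoot_sq {w : ℂ} (hw : w ∈ jouDom) : jouRoot w ^ 2 = 1 - 4 * w ^ 2 :=
  csqrt_sq (Complex.slitPlane_ne_zero hw)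

lemma jouRoot_re_pos {w : ℂ} (hw : w ∈ jouDom) : 0 < (jouRoot w).re := csqrt_re_pos hw

lemma jouRoot_ne_zero (w : ℂ) : jouRoot w ≠ 0 := csqrt_ne_zero _

lemma one_add_jouRoot_ne_zero {w : ℂ} (hw : w ∈ jouDom) : 1 + jouRoot w ≠ 0 := by
  intro h
  have := congrArg Complex.re h
  have h2 := jouRoot_re_pos hw
  simp only [Complex.add_re, Complex.one_re, Complex.zero_re] at this
  linarith

lemma isOpen_jouDom : IsOpen jouDom :=
  Complex.isOpen_slitPlane.preimage (by fun_prop)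

lemma zero_mem_jouDom : (0 : ℂ) ∈ jouDom := by simp [jouDom]

@[simp] lemma jou_zero : jou 0 = 0 := by simp [jou]

lemma jou_eq_zero {w : ℂ} (hw : w ∈ jouDom) : jou w = 0 ↔ w = 0 := by
  simp [jou, one_add_jouRoot_ne_zero hw]

lemma one_add_jou_sq {w : ℂ} (hw : w ∈ jouDom) : 1 + jou w ^ 2 = 2 / (1 + jouRoot w) := by
  have h1 := one_add_jouRoot_ne_zero hw
  have h2 := jouRoot_sq hw
  rw [jou]
  field_simp
  linear_combination h2

lemma one_sub_jou_sq {w : ℂ} (hw : w ∈ jouDom) :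
    1 - jou w ^ 2 = 2 * jouRoot w / (1 + jouRoot w) := by
  have h1 := one_add_jouRoot_ne_zero hw
  have h2 := one_add_jou_sq hw
  rw [show 1 - jou w ^ 2 = 2 - (1 + jou w ^ 2) by ring, h2]
  field_simp
  ring

lemma one_add_jou_sq_ne_zero {w : ℂ} (hw : w ∈ jouDom) : 1 + jou w ^ 2 ≠ 0 := by
  rw [one_add_jou_sq hw]
  exact div_ne_zero two_ne_zero (one_add_jouRoot_ne_zero hw)

lemma one_sub_jou_sq_ne_zero {w : ℂ} (hw : w ∈ jouDom) : 1 - jou w ^ 2 ≠ 0 := by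
  rw [one_sub_jou_sq hw]
  exact div_ne_zero (mul_ne_zero two_ne_zero (jouRoot_ne_zero w)) (one_add_jouRoot_ne_zero hw)

lemma jou_eq {w : ℂ} (hw : w ∈ jouDom) : jou w = (1 + jou w ^ 2) * w := by
  rw [one_add_jou_sq hw, jou]
  ring

/-- With r = `jouRoot w` one has `jou w ^ 2` = (1 - r)/(1 + r), and this Cayley transform sends the
right half plane into the unit disc. -/
lemma norm_jou_lt_one {w : ℂ} (hw : w ∈ jouDom) : ‖jou w‖ < 1 := by
  have h1 := one_add_jouRoot_ne_zero hw
  have h2 : jou w ^ 2 = (1 - jouRoot w) / (1 + jouRoot w) := by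
    have := one_add_jou_sq hw
    rw [show jou w ^ 2 = (1 + jou w ^ 2) - 1 by ring, this]
    field_simp
    ring
  have h3 : ‖1 - jouRoot w‖ < ‖1 + jouRoot w‖ := by
    have hp := jouRoot_re_pos hw
    rw [← sq_lt_sq₀ (norm_nonneg _) (norm_nonneg _), Complex.sq_norm, Complex.sq_norm,
      Complex.normSq_apply, Complex.normSq_apply]
    simp only [Complex.add_re, Complex.sub_re, Complex.one_re, Complex.add_im, Complex.sub_im,
      Complex.one_im]
    nlinarith
  have h4 : ‖jou w‖ ^ 2 < 1 := by
    rw [← norm_pow, h2, norm_div, div_lt_one (norm_pos_iff.2 h1)]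
    exact h3
  nlinarith [norm_nonneg (jou w)]

/-- For |z| < 1 the number r = (1 - z²)/(1 + z²) has positive real part, and r² = 1 - 4w². Hence r
is the principal root `jouRoot w`, and `jou` returns z. -/
lemma jou_of_norm_lt_one {w z : ℂ} (hz : ‖z‖ < 1) (h : w * (1 + z ^ 2) = z) :
    w ∈ jouDom ∧ jou w = z := by
  have hz2 : Complex.normSq z < 1 := by
    rw [Complex.normSq_eq_norm_sq]
    nlinarith [norm_nonneg z]
  have h0 : 1 + z ^ 2 ≠ 0 := by
    intro h0
    rw [h0, mul_zero] at h
    rw [← h] at h0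
    norm_num at h0
  set r := (1 - z ^ 2) / (1 + z ^ 2) with hr
  have hre : 0 < r.re := by
    have : r = (1 - Complex.normSq z ^ 2 + (starRingEnd ℂ (z ^ 2) - z ^ 2)) /
        Complex.normSq (1 + z ^ 2) := by
      have hns : (Complex.normSq (1 + z ^ 2) : ℂ) ≠ 0 := by
        simpa using h0
      rw [hr, div_eq_div_iff h0 hns]
      rw [← Complex.mul_conj (1 + z ^ 2), ← Complex.mul_conj z]
      simp only [map_add, map_one, map_pow]
      ring
    rw [this, Complex.div_ofReal_re]
    apply div_pos
    · have e1 : (starRingEnd ℂ (z ^ 2)).re = (z ^ 2).re := Complex.conj_re _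
      have e2 : ((Complex.normSq z : ℂ) ^ 2).re = Complex.normSq z ^ 2 := by
        rw [← Complex.ofReal_pow, Complex.ofReal_re]
      simp only [Complex.add_re, Complex.sub_re, Complex.one_re, e1, e2]
      nlinarith [Complex.normSq_nonneg z]
    · exact Complex.normSq_pos.2 h0
  have hw : w = z / (1 + z ^ 2) := by rw [eq_div_iff h0, h]
  have hsq : r ^ 2 = 1 - 4 * w ^ 2 := by
    rw [hw, hr]; field_simp; ring
  have hd : w ∈ jouDom := by
    change 1 - 4 * w ^ 2 ∈ Complex.slitPlane
    rw [← hsq]; exact sq_mem_slitPlane hre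
  refine ⟨hd, ?_⟩
  rw [jou, jouRoot, csqrt_eq_of_sq hre hsq, hw, hr]
  field_simp
  ring

lemma _root_.AnalyticAt.jouRoot {E : Type} [NormedAddCommGroup E] [NormedSpace ℂ E] {f : E → ℂ}
    {x : E} (hf : AnalyticAt ℂ f x) (hx : f x ∈ jouDom) :
    AnalyticAt ℂ (fun y => jouRoot (f y)) x :=
  AnalyticAt.csqrt (analyticAt_const.sub (analyticAt_const.mul (hf.pow 2))) hx

lemma _root_.AnalyticAt.jou {E : Type} [NormedAddCommGroup E] [NormedSpace ℂ E] {f : E → ℂ}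
    {x : E} (hf : AnalyticAt ℂ f x) (hx : f x ∈ jouDom) :
    AnalyticAt ℂ (fun y => jou (f y)) x :=
  (analyticAt_const.mul hf).div (analyticAt_const.add (hf.jouRoot hx))
    (one_add_jouRoot_ne_zero hx)

/-! ## Toric charts -/

/-- The inverse, with values in `ℂ ∪ {∞}`. -/
def oinv (z : ℂ) : Option ℂ := if z = 0 then none else some z⁻¹

lemma oinv_injective : Function.Injective oinv := by
  intro z w h
  by_cases hz : z = 0 <;> by_cases hw : w = 0 <;> simp_all [oinv]

lemma oinv_eq_some {z w : ℂ} : oinv z = some w ↔ z ≠ 0 ∧ w = z⁻¹ := by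
  by_cases hz : z = 0
  · simp [oinv, hz]
  · simp [oinv, hz, eq_comm]

/-- The values of the functions `A / C ^ i`, for all `i`, at the point with coordinates `(u, v)` in
the `j`-th chart of the resolution of `A B = C ^ n`. -/
def tseq (j : ℕ) (c : ℂ × ℂ) (i : ℕ) : Option ℂ :=
  if i ≤ j then some (c.2 * (c.1 * c.2) ^ (j - i)) else oinv (c.1 * (c.1 * c.2) ^ (i - j - 1))

lemma tseq_of_le {j i : ℕ} (h : i ≤ j) (c : ℂ × ℂ) :
    tseq j c i = some (c.2 * (c.1 * c.2) ^ (j - i)) := if_pos h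

lemma tseq_of_lt {j i : ℕ} (h : j < i) (c : ℂ × ℂ) :
    tseq j c i = oinv (c.1 * (c.1 * c.2) ^ (i - j - 1)) := if_neg h.not_ge

@[simp] lemma tseq_self (j : ℕ) (c : ℂ × ℂ) : tseq j c j = some c.2 := by
  simp [tseq_of_le le_rfl]

@[simp] lemma tseq_succ (j : ℕ) (c : ℂ × ℂ) : tseq j c (j + 1) = oinv c.1 := by
  simp [tseq_of_lt (Nat.lt_succ_self j)]

/-- The coordinates of chart j' are (C^(j'+1)/A, A/C^j'). In chart j' + k + 1, where A/C^(j'+k+1) =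
v and C = uv, these read (1/(v Cᵏ), v C^(k+1)), which is the point on the left. -/
lemma tseq_down {j' k : ℕ} {c : ℂ × ℂ} (h : c.2 * (c.1 * c.2) ^ k ≠ 0) :
    tseq j' ((c.2 * (c.1 * c.2) ^ k)⁻¹, c.2 * (c.1 * c.2) ^ (k + 1)) = tseq (j' + k + 1) c := by
  have hv : c.2 ≠ 0 := left_ne_zero_of_mul h
  have hk : (c.1 * c.2) ^ k ≠ 0 := right_ne_zero_of_mul h
  have hp : (c.2 * (c.1 * c.2) ^ k)⁻¹ * (c.2 * (c.1 * c.2) ^ (k + 1)) = c.1 * c.2 := by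
    rw [pow_succ, ← mul_assoc c.2, inv_mul_cancel_left₀ h]
  ext1 i
  rcases le_or_gt i j' with hi | hi
  · rw [tseq_of_le hi, tseq_of_le (by omega)]
    simp only [hp]
    rw [mul_assoc, ← pow_add]
    congr 3
    omega
  · rw [tseq_of_lt hi]
    simp only [hp]
    obtain ⟨m, rfl⟩ : ∃ m, i = j' + 1 + m := ⟨i - j' - 1, by omega⟩
    rw [show j' + 1 + m - j' - 1 = m by omega]
    rcases le_or_gt m k with hm | hm
    · rw [tseq_of_le (by omega)]
      obtain ⟨r, rfl⟩ : ∃ r, k = m + r := ⟨k - m, by omega⟩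
      rw [pow_add] at hk ⊢
      have h1 : (c.1 * c.2) ^ m ≠ 0 := left_ne_zero_of_mul hk
      have h2 : (c.1 * c.2) ^ r ≠ 0 := right_ne_zero_of_mul hk
      rw [oinv_eq_some]
      rw [show j' + (m + r) + 1 - (j' + 1 + m) = r by omega]
      generalize c.1 * c.2 = p at h1 h2 ⊢
      constructor
      · positivity
      · field_simp
    · rw [tseq_of_lt (by omega)]
      obtain ⟨r, rfl⟩ : ∃ r, m = k + 1 + r := ⟨m - k - 1, by omega⟩
      congr 1
      rw [show j' + 1 + (k + 1 + r) - (j' + k + 1) - 1 = r by omega]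
      rw [show (c.1 * c.2) ^ (k + 1 + r) = (c.1 * c.2) ^ k * (c.1 * (c.2 * (c.1 * c.2) ^ r)) by ring]
      generalize (c.1 * c.2) ^ k = p at hk ⊢
      field_simp

/-- Inverse of the previous change of charts: from u = C^(j+1)/A the coordinates in chart j + k + 1
are (u C^(k+1), 1/(u Cᵏ)). -/
lemma tseq_up {j k : ℕ} {c : ℂ × ℂ} (h : c.1 * (c.1 * c.2) ^ k ≠ 0) :
    tseq (j + k + 1) (c.1 * (c.1 * c.2) ^ (k + 1), (c.1 * (c.1 * c.2) ^ k)⁻¹) = tseq j c := by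
  have hv : c.1 ≠ 0 := left_ne_zero_of_mul h
  have hk : (c.1 * c.2) ^ k ≠ 0 := right_ne_zero_of_mul h
  have hp : (c.1 * (c.1 * c.2) ^ (k + 1)) * (c.1 * (c.1 * c.2) ^ k)⁻¹ = c.1 * c.2 := by
    rw [pow_succ]; field_simp
  ext1 i
  rcases le_or_gt i j with hi | hi
  · rw [tseq_of_le hi, tseq_of_le (by omega)]
    simp only [hp]
    rw [show j + k + 1 - i = k + 1 + (j - i) by omega, pow_add, pow_succ]
    congr 1
    field_simp
  · rw [tseq_of_lt hi]
    obtain ⟨m, rfl⟩ : ∃ m, i = j + 1 + m := ⟨i - j - 1, by omega⟩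
    rw [show j + 1 + m - j - 1 = m by omega]
    rcases le_or_gt m k with hm | hm
    · rw [tseq_of_le (by omega)]
      simp only [hp]
      obtain ⟨r, rfl⟩ : ∃ r, k = m + r := ⟨k - m, by omega⟩
      rw [pow_add] at hk ⊢
      have h1 : (c.1 * c.2) ^ m ≠ 0 := left_ne_zero_of_mul hk
      have h2 : (c.1 * c.2) ^ r ≠ 0 := right_ne_zero_of_mul hk
      rw [eq_comm, oinv_eq_some, show j + (m + r) + 1 - (j + 1 + m) = r by omega]
      generalize c.1 * c.2 = p at h1 h2 ⊢
      constructor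
      · positivity
      · field_simp
    · rw [tseq_of_lt (by omega)]
      simp only [hp]
      obtain ⟨r, rfl⟩ : ∃ r, m = k + 1 + r := ⟨m - k - 1, by omega⟩
      congr 1
      rw [show j + 1 + (k + 1 + r) - (j + k + 1) - 1 = r by omega]
      rw [pow_add (c.1 * c.2) (k + 1) r]
      ring

/-- Two charts of the resolution of `A B = C ^ n` are related by an analytic coordinate change. -/
lemma tseq_compat {j j' : ℕ} {c d : ℂ × ℂ} (h : tseq j c = tseq j' d) :
    ∃ τ : ℂ × ℂ → ℂ × ℂ, AnalyticAt ℂ τ c ∧ τ c = d ∧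
      ∀ᶠ c' in 𝓝 c, tseq j' (τ c') = tseq j c' ∧ (τ c').1 * (τ c').2 = c'.1 * c'.2 := by
  rcases lt_trichotomy j j' with hj | rfl | hj
  · obtain ⟨k, rfl⟩ : ∃ k, j' = j + k + 1 := ⟨j' - j - 1, by omega⟩
    -- The terms of the sequence at the chart index and at the next index are the coordinate v and
    -- the inverse of u. Reading them off for `d` expresses `d` through `c`.
    have h1 := congrFun h (j + k + 1)
    rw [tseq_self, tseq_of_lt (by omega), show j + k + 1 - j - 1 = k by omega, oinv_eq_some] at h1
    have h2 := congrFun h (j + k + 1 + 1)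
    rw [tseq_succ, tseq_of_lt (by omega)] at h2
    have h2 := oinv_injective h2
    rw [show j + k + 1 + 1 - j - 1 = k + 1 by omega] at h2
    have han : AnalyticAt ℂ (fun c : ℂ × ℂ => c.1 * (c.1 * c.2) ^ k) c := by fun_prop
    refine ⟨fun c => (c.1 * (c.1 * c.2) ^ (k + 1), (c.1 * (c.1 * c.2) ^ k)⁻¹), ?_, ?_, ?_⟩
    · exact AnalyticAt.prod (by fun_prop) (han.inv h1.1)
    · exact Prod.ext h2 h1.2.symm
    · filter_upwards [han.continuousAt.eventually_ne h1.1] with c' hc'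
      refine ⟨tseq_up hc', ?_⟩
      have hv : c'.1 ≠ 0 := left_ne_zero_of_mul hc'
      have hk : (c'.1 * c'.2) ^ k ≠ 0 := right_ne_zero_of_mul hc'
      simp only [pow_succ]
      field_simp
  · have h1 := congrFun h j
    have h2 := congrFun h (j + 1)
    rw [tseq_self, tseq_self, Option.some_inj] at h1
    rw [tseq_succ, tseq_succ] at h2
    exact ⟨id, analyticAt_id, Prod.ext (oinv_injective h2) h1, by simp⟩
  · obtain ⟨k, rfl⟩ : ∃ k, j = j' + k + 1 := ⟨j - j' - 1, by omega⟩
    have h1 := congrFun h (j' + 1)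
    rw [tseq_succ, tseq_of_le (by omega), show j' + k + 1 - (j' + 1) = k by omega, eq_comm,
      oinv_eq_some] at h1
    have h2 := congrFun h j'
    rw [tseq_self, tseq_of_le (by omega), show j' + k + 1 - j' = k + 1 by omega,
      Option.some_inj] at h2
    have h0 : c.2 * (c.1 * c.2) ^ k ≠ 0 := by rw [h1.2]; exact inv_ne_zero h1.1
    have han : AnalyticAt ℂ (fun c : ℂ × ℂ => c.2 * (c.1 * c.2) ^ k) c := by fun_prop
    refine ⟨fun c => ((c.2 * (c.1 * c.2) ^ k)⁻¹, c.2 * (c.1 * c.2) ^ (k + 1)), ?_, ?_, ?_⟩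
    · exact AnalyticAt.prod (han.inv h0) (by fun_prop)
    · exact Prod.ext (by simp [h1.2]) h2
    · filter_upwards [han.continuousAt.eventually_ne h0] with c' hc'
      refine ⟨tseq_down hc', ?_⟩
      simp only [pow_succ]
      rw [← mul_assoc c'.2, inv_mul_cancel_left₀ hc']

/-- The coordinate `A` in the `j`-th chart of the resolution of `A B = C ^ n`. -/
def torA (j : ℕ) (c : ℂ × ℂ) : ℂ := c.2 * (c.1 * c.2) ^ j

/-- The coordinate `B` in the `j`-th chart of the resolution of `A B = C ^ n`. -/
def torB (n j : ℕ) (c : ℂ × ℂ) : ℂ := c.1 * (c.1 * c.2) ^ (n - 1 - j)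

/-- The coordinate `C` in the charts of the resolution of `A B = C ^ n`. -/
def torC (c : ℂ × ℂ) : ℂ := c.1 * c.2

lemma torA_mul_torB {n j : ℕ} (hj : j < n) (c : ℂ × ℂ) :
    torA j c * torB n j c = torC c ^ n := by
  obtain ⟨k, rfl⟩ : ∃ k, n = j + 1 + k := ⟨n - j - 1, by omega⟩
  rw [torA, torB, torC, show j + 1 + k - 1 - j = k by omega, pow_add, pow_succ]
  ring

lemma tseq_zero (j : ℕ) (c : ℂ × ℂ) : tseq j c 0 = some (torA j c) := by
  simp [tseq_of_le (Nat.zero_le j), torA]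

lemma tseq_top {n j : ℕ} (hj : j < n) (c : ℂ × ℂ) : tseq j c n = oinv (torB n j c) := by
  rw [tseq_of_lt hj, torB, Nat.sub_right_comm]

lemma torA_eq_of_tseq_eq {j j' : ℕ} {c d : ℂ × ℂ} (h : tseq j c = tseq j' d) :
    torA j c = torA j' d := by
  have := congrFun h 0
  rwa [tseq_zero, tseq_zero, Option.some_inj] at this

lemma torB_eq_of_tseq_eq {n j j' : ℕ} (hj : j < n) (hj' : j' < n) {c d : ℂ × ℂ}
    (h : tseq j c = tseq j' d) : torB n j c = torB n j' d := by
  have := congrFun h n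
  rw [tseq_top hj, tseq_top hj'] at this
  exact oinv_injective this

@[fun_prop] lemma analyticAt_torA (j : ℕ) (c : ℂ × ℂ) : AnalyticAt ℂ (torA j) c := by
  unfold torA; fun_prop

@[fun_prop] lemma analyticAt_torB (n j : ℕ) (c : ℂ × ℂ) : AnalyticAt ℂ (torB n j) c := by
  unfold torB; fun_prop

@[fun_prop] lemma analyticAt_torC (c : ℂ × ℂ) : AnalyticAt ℂ torC c := by
  unfold torC; fun_prop

/-! ## The points and the charts of the resolution -/

/-- The values of the polynomial `P`. -/
def fP (a b x : ℂ) : ℂ := 4 * x ^ 3 - 3 * a * x - b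

/-- The values of the reciprocal polynomial `ξ ^ 3 P(1 / ξ)`. -/
def fT (a b ξ : ℂ) : ℂ := 4 - 3 * a * ξ ^ 2 - b * ξ ^ 3

/-- The function `(z + 1 / z) / 2`. -/
def fh (z : ℂ) : ℂ := (z + z⁻¹) / 2

lemma fP_inv (a b : ℂ) {ξ : ℂ} (hξ : ξ ≠ 0) : fP a b ξ⁻¹ = fT a b ξ / ξ ^ 3 := by
  rw [fP, fT]; field_simp

lemma fT_zero (a b : ℂ) : fT a b 0 = 4 := by simp [fT]

lemma eval_poly (a b x : ℂ) : (poly a b).eval x = fP a b x := by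
  simp [poly, fP]

lemma fh_inv (z : ℂ) : fh z⁻¹ = fh z := by rw [fh, fh, inv_inv, add_comm]

/-- The points of the resolution: points of the affine part of the quartic, exceptional points over
the nodes `(l, 0, -P(l))`, points of the two sections at infinity over finite `x`, points of the
fibre over `x = ∞`, namely: the two curves which do not meet the sections at the ends of the chain,
the chains over `z = 0` and `z = ∞`, and the middle curve. -/
inductive Pt : Type
  | aff (x y z : ℂ)
  | exc (l : ℂ) (ρ : ℕ → Option ℂ)
  | sec (s : Bool) (x : ℂ)
  | tail (s : Bool) (σ : ℂ)
  | inf (s : Bool) (ρ : ℕ → Option ℂ)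
  | mid (z : ℂ)

/-- The solution `z` of `z / (1 + z ^ 2) = w` near `0` or near `∞`. -/
def zside (s : Bool) (w : ℂ) : ℂ := if s then jou w else (jou w)⁻¹

lemma zside_ne_zero {s : Bool} {w : ℂ} (hw : w ∈ jouDom) (h0 : w ≠ 0) : zside s w ≠ 0 := by
  have := (jou_eq_zero hw).not.2 h0
  cases s <;> simp [zside, this]

lemma fh_zside {s : Bool} {w : ℂ} (hw : w ∈ jouDom) (h0 : w ≠ 0) : fh (zside s w) = 1 / (2 * w) := by
  have h1 : fh (jou w) = 1 / (2 * w) := by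
    have h2 := (jou_eq_zero hw).not.2 h0
    have h3 := jou_eq hw
    rw [fh]
    field_simp
    linear_combination -h3
  cases s
  · simpa [zside, fh_inv] using h1
  · simpa [zside] using h1

/-- The values z = ±1 are the ramification points of w = z/(1 + z²), lying over w = ±1/2; there 1 -
4w² = 0, which is excluded from `jouDom`. -/
lemma zside_sq_ne_one {s : Bool} {w : ℂ} (hw : w ∈ jouDom) : zside s w ^ 2 ≠ 1 := by
  have h1 : jou w ^ 2 ≠ 1 := fun h => one_sub_jou_sq_ne_zero hw (by rw [h, sub_self])
  cases s
  · simpa [zside] using h1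
  · simpa [zside] using h1

lemma _root_.AnalyticAt.zside {E : Type} [NormedAddCommGroup E] [NormedSpace ℂ E] {f : E → ℂ}
    {x : E} {s : Bool} (hf : AnalyticAt ℂ f x) (hx : f x ∈ jouDom) (h0 : f x ≠ 0) :
    AnalyticAt ℂ (fun y => zside s (f y)) x := by
  cases s
  · exact (hf.jou hx).inv ((jou_eq_zero hx).not.2 h0)
  · exact hf.jou hx

/-- The two solutions of h(z) = 1/(2w) are inverse to each other. The norm condition selects the one
that `zside` describes and at the same time puts w into the domain. -/
lemma zside_eq_of_fh {s : Bool} {w z : ℂ} (h : fh z * (2 * w) = 1) (h0 : z ≠ 0)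
    (hs : ‖if s then z else z⁻¹‖ < 1) : w ∈ jouDom ∧ zside s w = z := by
  have key : ∀ t : ℂ, t ≠ 0 → fh t * (2 * w) = 1 → ‖t‖ < 1 → w ∈ jouDom ∧ jou w = t := by
    intro t ht h1 h2
    refine jou_of_norm_lt_one h2 ?_
    rw [fh] at h1
    field_simp at h1
    linear_combination h1
  cases s
  · obtain ⟨h1, h2⟩ := key z⁻¹ (inv_ne_zero h0) (by rwa [fh_inv]) (by simpa using hs)
    exact ⟨h1, by simp [zside, h2]⟩
  · obtain ⟨h1, h2⟩ := key z h0 h (by simpa using hs)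
    exact ⟨h1, by simp [zside, h2]⟩

/-- The indices of the charts: two kinds of charts of the smooth affine part, charts at the
exceptional points over the nodes, charts at the two chains in the fibre over `x = ∞`, at the two
sections, at the two other curves in the fibre over `x = ∞` and at its middle curve. -/
inductive Idx : Type
  | xz (y₀ : ℂ)
  | xy (m₀ : ℂ)
  | node (l : ℂ) (j : ℕ)
  | chain (s : Bool) (j : ℕ)
  | sec (s : Bool)
  | tail (s : Bool)
  | mid

section

variable (a b : ℂ)

/-- The order of vanishing of `P - P(l)` at `l`. -/
def nmult (l : ℂ) : ℕ := (poly a b - Polynomial.C (fP a b l)).rootMultiplicity l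

/-- The quotient of `P - P(l)` by the largest possible power of `X - l`. -/
def nquo (l x : ℂ) : ℂ :=
  ((poly a b - Polynomial.C (fP a b l)) /ₘ
    (Polynomial.X - Polynomial.C l) ^ nmult a b l).eval x

lemma fP_sub (l x : ℂ) : fP a b x - fP a b l = (x - l) ^ nmult a b l * nquo a b l x := by
  have h := congrArg (Polynomial.eval x)
    (Polynomial.pow_mul_divByMonic_rootMultiplicity_eq (poly a b - Polynomial.C (fP a b l)) l)
  simp only [Polynomial.eval_mul, Polynomial.eval_pow, Polynomial.eval_sub, Polynomial.eval_X,
    Polynomial.eval_C, eval_poly] at h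
  exact h.symm

lemma poly_sub_C_ne_zero (t : ℂ) : poly a b - Polynomial.C t ≠ 0 := by
  intro h
  have := congrArg (fun p => p.coeff 3) h
  simp [poly] at this

lemma nquo_self_ne_zero (l : ℂ) : nquo a b l l ≠ 0 :=
  Polynomial.eval_divByMonic_pow_rootMultiplicity_ne_zero l (poly_sub_C_ne_zero a b _)

lemma nmult_pos (l : ℂ) : 0 < nmult a b l := by
  rw [nmult, Polynomial.rootMultiplicity_pos (poly_sub_C_ne_zero a b _)]
  simp [eval_poly]

/-- A square root of `-2 P(l)`. -/
def kap (l : ℂ) : ℂ := csqrt (-2 * fP a b l)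

lemma kap_ne_zero (l : ℂ) : kap a b l ≠ 0 := csqrt_ne_zero _

lemma kap_sq {l : ℂ} (h : fP a b l ^ 2 = 1) : kap a b l ^ 2 = -2 * fP a b l :=
  csqrt_sq (mul_ne_zero (by norm_num) (by rintro h'; rw [h'] at h; norm_num at h))

/-- The coordinate `x` in the charts at a node. -/
def nodeX (l : ℂ) (c : ℂ × ℂ) : ℂ := l + torC c

/-- The local branch `y + κ d` in the charts at a node. -/
def nodeB (l : ℂ) (j : ℕ) (c : ℂ × ℂ) : ℂ :=
  nquo a b l (nodeX l c) * torB (nmult a b l) j c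

/-- The coordinate `y` in the charts at a node. -/
def nodeY (l : ℂ) (j : ℕ) (c : ℂ × ℂ) : ℂ := (torA j c + nodeB a b l j c) / 2

/-- The function `d = (t - 1 / t) / 2` with `z = - P(l) t ^ 2` in the charts at a node. -/
def nodeD (l : ℂ) (j : ℕ) (c : ℂ × ℂ) : ℂ := (nodeB a b l j c - torA j c) / (2 * kap a b l)

/-- The function `t` with `z = - P(l) t ^ 2` in the charts at a node. -/
def nodeT (l : ℂ) (j : ℕ) (c : ℂ × ℂ) : ℂ :=
  nodeD a b l j c + csqrt (1 + nodeD a b l j c ^ 2)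

/-- The coordinate `z` in the charts at a node. -/
def nodeZ (l : ℂ) (j : ℕ) (c : ℂ × ℂ) : ℂ := -fP a b l * nodeT a b l j c ^ 2

/-- The coordinate `ξ = 1 / x` in the charts at the chains. -/
def chXi (j : ℕ) (c : ℂ × ℂ) : ℂ := torA j c + torC c ^ 2

/-- The square root of `ξ ^ 3 P(1 / ξ)` in the charts at the chains. -/
def chQ (j : ℕ) (c : ℂ × ℂ) : ℂ := csqrt (fT a b (chXi j c))

/-- The function `z / (1 + z ^ 2)` in the charts at the chains. -/
def chW (j : ℕ) (c : ℂ × ℂ) : ℂ :=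
  (torC c ^ 2 * torA j c ^ 2 + 3 * torC c ^ 4 * torA j c + 3 * torC c ^ 6 + torB 8 j c) /
    (2 * fT a b (chXi j c))

/-- The function `z / (1 + z ^ 2)` in the charts at the sections. -/
def secW (c : ℂ × ℂ) : ℂ := c.2 ^ 2 / (2 * (1 - c.2 ^ 2 * fP a b c.1))

/-- The function `z / (1 + z ^ 2)` in the charts at the tails. -/
def tailW (c : ℂ × ℂ) : ℂ := c.2 ^ 3 / (2 * (c.1 ^ 2 * c.2 - fT a b c.2))

/-- The square of the function `y / x ^ (3 / 2)` in the chart at the middle curve. -/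
def midR (c : ℂ × ℂ) : ℂ := fT a b (c.1 ^ 2) + fh c.2 * c.1 ^ 6

/-- The domains of the parametrizations. -/
def dom : Idx → Set (ℂ × ℂ)
  | .xz y₀ => {c | c.2 ≠ 0 ∧ (fP a b c.1 + fh c.2) / y₀ ^ 2 ∈ Complex.slitPlane}
  | .xy m₀ => {c | ((c.2 ^ 2 - fP a b c.1) ^ 2 - 1) / m₀ ^ 2 ∈ Complex.slitPlane}
  | .node l j => {c | fP a b l ^ 2 = 1 ∧ j < nmult a b l ∧ nquo a b l (nodeX l c) ≠ 0 ∧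
      1 + nodeD a b l j c ^ 2 ∈ Complex.slitPlane}
  | .chain _ j => {c | j < 8 ∧ fT a b (chXi j c) ∈ Complex.slitPlane ∧ chW a b j c ∈ jouDom}
  | .sec _ => {c | 1 - c.2 ^ 2 * fP a b c.1 ≠ 0 ∧ secW a b c ∈ jouDom}
  | .tail _ => {c | c.1 ^ 2 * c.2 - fT a b c.2 ≠ 0 ∧ tailW a b c ∈ jouDom}
  | .mid => {c | c.2 ≠ 0 ∧ midR a b c ∈ Complex.slitPlane}

/-- The points in the charts that belong to the affine part of the quartic. -/
def isAff : Idx → ℂ × ℂ → Prop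
  | .xz _, _ => True
  | .xy _, _ => True
  | .node l j, c => ¬(torA j c = 0 ∧ torB (nmult a b l) j c = 0)
  | .chain _ j, c => torC c ≠ 0 ∧ chXi j c ≠ 0
  | .sec _, c => c.2 ≠ 0
  | .tail _, c => c.2 ≠ 0
  | .mid, c => c.1 ≠ 0

/-- The coordinate `x` in the charts. -/
def cX : Idx → ℂ × ℂ → ℂ
  | .xz _, c => c.1
  | .xy _, c => c.1
  | .node l _, c => nodeX l c
  | .chain _ j, c => (chXi j c)⁻¹
  | .sec _, c => c.1
  | .tail _, c => c.2⁻¹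
  | .mid, c => (c.1 ^ 2)⁻¹

/-- The coordinate `y` in the charts. -/
def cY : Idx → ℂ × ℂ → ℂ
  | .xz y₀, c => y₀ * csqrt ((fP a b c.1 + fh c.2) / y₀ ^ 2)
  | .xy _, c => c.2
  | .node l j, c => nodeY a b l j c
  | .chain _ j, c => chQ a b j c / (torC c * chXi j c)
  | .sec _, c => c.2⁻¹
  | .tail _, c => c.1 / c.2
  | .mid, c => csqrt (midR a b c) / c.1 ^ 3

/-- The coordinate `z` in the charts. -/
def cZ : Idx → ℂ × ℂ → ℂ
  | .xz _, c => c.2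
  | .xy m₀, c => c.2 ^ 2 - fP a b c.1 +
      m₀ * csqrt (((c.2 ^ 2 - fP a b c.1) ^ 2 - 1) / m₀ ^ 2)
  | .node l j, c => nodeZ a b l j c
  | .chain s j, c => zside s (chW a b j c)
  | .sec s, c => zside s (secW a b c)
  | .tail s, c => zside s (tailW a b c)
  | .mid, c => c.2

/-- The points in the charts that do not belong to the affine part of the quartic. -/
def special : Idx → ℂ × ℂ → Pt
  | .node l j, c => .exc l (tseq j c)
  | .chain s j, c =>
    if torC c ≠ 0 then .tail s (chQ a b j c / torC c)
    else if torA j c ≠ 0 then .sec s (torA j c)⁻¹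
    else if torB 8 j c ≠ 0 then .mid (zside s (chW a b j c))
    else .inf s (tseq j c)
  | .sec s, c => .sec s c.1
  | .tail s, c => .tail s c.1
  | .mid, c => .mid c.2
  | _, _ => .mid 0

open Classical in
/-- The parametrizations. -/
def pt (k : Idx) (c : ℂ × ℂ) : Pt :=
  if isAff a b k c then .aff (cX k c) (cY a b k c) (cZ a b k c) else special a b k c

variable {a b}

lemma pt_of_isAff {k : Idx} {c : ℂ × ℂ} (h : isAff a b k c) :
    pt a b k c = .aff (cX k c) (cY a b k c) (cZ a b k c) := if_pos h

lemma pt_of_not_isAff {k : Idx} {c : ℂ × ℂ} (h : ¬isAff a b k c) :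
    pt a b k c = special a b k c := if_neg h

lemma special_ne_aff (k : Idx) (c : ℂ × ℂ) (x y z : ℂ) : special a b k c ≠ .aff x y z := by
  rcases k with _ | _ | _ | ⟨s, j⟩ | _ | _ | _ <;> simp only [special] <;> try simp
  split_ifs <;> simp

/-- Whether a chart point is affine can be read from its label alone, so the condition transfers
between charts with equal labels. -/
lemma isAff_iff {k : Idx} {c : ℂ × ℂ} : isAff a b k c ↔ ∃ x y z, pt a b k c = .aff x y z := by
  constructor
  · intro h
    exact ⟨_, _, _, pt_of_isAff h⟩
  · rintro ⟨x, y, z, h⟩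
    by_contra hc
    rw [pt_of_not_isAff hc] at h
    exact special_ne_aff k c x y z h

/-! ### Analyticity of the coordinates -/

lemma continuous_fP : Continuous (fP a b) := by unfold fP; fun_prop

lemma continuous_fT : Continuous (fT a b) := by unfold fT; fun_prop

lemma _root_.AnalyticAt.fP {E : Type} [NormedAddCommGroup E] [NormedSpace ℂ E] {f : E → ℂ}
    {x : E} (hf : AnalyticAt ℂ f x) : AnalyticAt ℂ (fun y => fP a b (f y)) x := by
  unfold Inose.fP; fun_prop

lemma _root_.AnalyticAt.fT {E : Type} [NormedAddCommGroup E] [NormedSpace ℂ E] {f : E → ℂ}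
    {x : E} (hf : AnalyticAt ℂ f x) : AnalyticAt ℂ (fun y => fT a b (f y)) x := by
  unfold Inose.fT; fun_prop

lemma _root_.AnalyticAt.fh {E : Type} [NormedAddCommGroup E] [NormedSpace ℂ E] {f : E → ℂ}
    {x : E} (hf : AnalyticAt ℂ f x) (h0 : f x ≠ 0) : AnalyticAt ℂ (fun y => fh (f y)) x :=
  (hf.add (hf.inv h0)).div analyticAt_const two_ne_zero

lemma _root_.AnalyticAt.nquo {E : Type} [NormedAddCommGroup E] [NormedSpace ℂ E] {f : E → ℂ}
    {x : E} {l : ℂ} (hf : AnalyticAt ℂ f x) : AnalyticAt ℂ (fun y => nquo a b l (f y)) x := by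
  unfold Inose.nquo
  exact hf.aeval_polynomial _

@[fun_prop] lemma analyticAt_nodeX (l : ℂ) (c : ℂ × ℂ) : AnalyticAt ℂ (nodeX l) c := by
  unfold nodeX; fun_prop

@[fun_prop] lemma analyticAt_nodeB (l : ℂ) (j : ℕ) (c : ℂ × ℂ) :
    AnalyticAt ℂ (nodeB a b l j) c :=
  (analyticAt_nodeX l c).nquo.mul (analyticAt_torB _ j c)

@[fun_prop] lemma analyticAt_nodeY (l : ℂ) (j : ℕ) (c : ℂ × ℂ) :
    AnalyticAt ℂ (nodeY a b l j) c := by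
  unfold nodeY; fun_prop (disch := norm_num)

@[fun_prop] lemma analyticAt_nodeD (l : ℂ) (j : ℕ) (c : ℂ × ℂ) :
    AnalyticAt ℂ (nodeD a b l j) c :=
  ((analyticAt_nodeB l j c).sub (analyticAt_torA j c)).div analyticAt_const
    (mul_ne_zero two_ne_zero (kap_ne_zero a b l))

lemma analyticAt_nodeT {l : ℂ} {j : ℕ} {c : ℂ × ℂ} (hc : c ∈ dom a b (.node l j)) :
    AnalyticAt ℂ (nodeT a b l j) c :=
  (analyticAt_nodeD l j c).add
    ((analyticAt_const.add ((analyticAt_nodeD l j c).pow 2)).csqrt hc.2.2.2)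

lemma analyticAt_nodeZ {l : ℂ} {j : ℕ} {c : ℂ × ℂ} (hc : c ∈ dom a b (.node l j)) :
    AnalyticAt ℂ (nodeZ a b l j) c :=
  analyticAt_const.mul ((analyticAt_nodeT hc).pow 2)

@[fun_prop] lemma analyticAt_chXi (j : ℕ) (c : ℂ × ℂ) : AnalyticAt ℂ (chXi j) c := by
  unfold chXi; fun_prop

lemma fT_chXi_ne_zero {s : Bool} {j : ℕ} {c : ℂ × ℂ} (hc : c ∈ dom a b (.chain s j)) :
    fT a b (chXi j c) ≠ 0 := Complex.slitPlane_ne_zero hc.2.1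

lemma analyticAt_chQ {s : Bool} {j : ℕ} {c : ℂ × ℂ} (hc : c ∈ dom a b (.chain s j)) :
    AnalyticAt ℂ (chQ a b j) c :=
  (analyticAt_chXi j c).fT.csqrt hc.2.1

lemma analyticAt_chW {j : ℕ} {c : ℂ × ℂ} (hc : fT a b (chXi j c) ≠ 0) :
    AnalyticAt ℂ (chW a b j) c :=
  AnalyticAt.div (by fun_prop) (analyticAt_const.mul (analyticAt_chXi j c).fT)
    (mul_ne_zero two_ne_zero hc)

lemma analyticAt_secW {c : ℂ × ℂ} (hc : 1 - c.2 ^ 2 * fP a b c.1 ≠ 0) :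
    AnalyticAt ℂ (secW a b) c :=
  AnalyticAt.div (by fun_prop) (by unfold fP; fun_prop) (mul_ne_zero two_ne_zero hc)

lemma analyticAt_tailW {c : ℂ × ℂ} (hc : c.1 ^ 2 * c.2 - fT a b c.2 ≠ 0) :
    AnalyticAt ℂ (tailW a b) c :=
  AnalyticAt.div (by fun_prop) (by unfold fT; fun_prop) (mul_ne_zero two_ne_zero hc)

lemma analyticAt_midR {c : ℂ × ℂ} (hc : c.2 ≠ 0) : AnalyticAt ℂ (midR a b) c :=
  AnalyticAt.add (by unfold fT; fun_prop)
    ((analyticAt_snd.fh hc).mul (by fun_prop))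

lemma isOpen_dom (k : Idx) : IsOpen (dom a b k) := by
  rw [isOpen_iff_mem_nhds]
  intro c hc
  have op := Complex.isOpen_slitPlane
  rcases k with y₀ | m₀ | ⟨l, j⟩ | ⟨s, j⟩ | s | s | _
  · have h1 : AnalyticAt ℂ (fun c : ℂ × ℂ => (fP a b c.1 + fh c.2) / y₀ ^ 2) c := by
      -- If `y₀ = 0` the quotient is `0` by convention, hence not in the slit plane: the chart with
      -- that parameter has empty domain. The same happens for `m₀ = 0`.
      refine AnalyticAt.div (analyticAt_fst.fP.add (analyticAt_snd.fh hc.1)) analyticAt_const ?_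
      intro h
      simpa [h] using hc.2
    filter_upwards [continuousAt_snd.eventually_ne hc.1,
      h1.continuousAt.eventually (op.mem_nhds hc.2)] with c' h2 h3 using ⟨h2, h3⟩
  · have h1 : AnalyticAt ℂ (fun c : ℂ × ℂ => ((c.2 ^ 2 - fP a b c.1) ^ 2 - 1) / m₀ ^ 2) c := by
      refine AnalyticAt.div (by unfold fP; fun_prop) analyticAt_const ?_
      intro h
      simp [dom, h] at hc
    exact h1.continuousAt.eventually (op.mem_nhds hc)
  · filter_upwards [((analyticAt_nodeX l c).nquo).continuousAt.eventually_ne hc.2.2.1,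
      (analyticAt_const.add ((analyticAt_nodeD l j c).pow 2)).continuousAt.eventually
        (op.mem_nhds hc.2.2.2)] with c' h2 h3 using ⟨hc.1, hc.2.1, h2, h3⟩
  · filter_upwards [((analyticAt_chXi j c).fT).continuousAt.eventually (op.mem_nhds hc.2.1),
      (analyticAt_chW (fT_chXi_ne_zero (s := s) hc)).continuousAt.eventually
        (isOpen_jouDom.mem_nhds hc.2.2)] with c' h2 h3 using ⟨hc.1, h2, h3⟩
  · have h1 : AnalyticAt ℂ (fun c : ℂ × ℂ => 1 - c.2 ^ 2 * fP a b c.1) c := by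
      unfold fP; fun_prop
    filter_upwards [h1.continuousAt.eventually_ne hc.1,
      (analyticAt_secW hc.1).continuousAt.eventually (isOpen_jouDom.mem_nhds hc.2)] with c' h2 h3
      using ⟨h2, h3⟩
  · have h1 : AnalyticAt ℂ (fun c : ℂ × ℂ => c.1 ^ 2 * c.2 - fT a b c.2) c := by
      unfold fT; fun_prop
    filter_upwards [h1.continuousAt.eventually_ne hc.1,
      (analyticAt_tailW hc.1).continuousAt.eventually (isOpen_jouDom.mem_nhds hc.2)] with c' h2 h3
      using ⟨h2, h3⟩
  · filter_upwards [continuousAt_snd.eventually_ne hc.1,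
      (analyticAt_midR hc.1).continuousAt.eventually (op.mem_nhds hc.2)] with c' h2 h3
      using ⟨h2, h3⟩

/-- This is the equation at infinity, 2TG·w = S²ξ³ with ξ = G + S². The definition of `chW` is (G +
S²)³S²/(2TG) expanded, with S⁸/G replaced by the toric coordinate B, which makes it meaningful also
where G = 0. -/
lemma chW_mul {j : ℕ} (hj : j < 8) {c : ℂ × ℂ} (h : fT a b (chXi j c) ≠ 0) :
    chW a b j c * (2 * fT a b (chXi j c) * torA j c) = torC c ^ 2 * chXi j c ^ 3 := by
  have h1 := torA_mul_torB hj c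
  rw [chW]
  field_simp
  rw [chXi]
  linear_combination h1

lemma torA_ne_zero_of_torC {j : ℕ} {c : ℂ × ℂ} (h : torC c ≠ 0) : torA j c ≠ 0 :=
  mul_ne_zero (right_ne_zero_of_mul h) (pow_ne_zero _ h)

lemma chW_ne_zero {s : Bool} {j : ℕ} {c : ℂ × ℂ} (hc : c ∈ dom a b (.chain s j))
    (h : isAff a b (.chain s j) c) : chW a b j c ≠ 0 := by
  intro h0
  have := chW_mul hc.1 (fT_chXi_ne_zero hc)
  rw [h0, zero_mul] at this
  exact mul_ne_zero (pow_ne_zero 2 h.1) (pow_ne_zero 3 h.2) this.symm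

lemma secW_ne_zero {s : Bool} {c : ℂ × ℂ} (hc : c ∈ dom a b (.sec s)) (h : c.2 ≠ 0) :
    secW a b c ≠ 0 :=
  div_ne_zero (pow_ne_zero 2 h) (mul_ne_zero two_ne_zero hc.1)

lemma tailW_ne_zero {s : Bool} {c : ℂ × ℂ} (hc : c ∈ dom a b (.tail s)) (h : c.2 ≠ 0) :
    tailW a b c ≠ 0 :=
  div_ne_zero (pow_ne_zero 3 h) (mul_ne_zero two_ne_zero hc.1)

lemma eventually_isAff {k : Idx} {c : ℂ × ℂ} (h : isAff a b k c) :
    ∀ᶠ c' in 𝓝 c, isAff a b k c' := by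
  rcases k with y₀ | m₀ | ⟨l, j⟩ | ⟨s, j⟩ | s | s | _
  · exact Eventually.of_forall fun _ => trivial
  · exact Eventually.of_forall fun _ => trivial
  · rcases not_and_or.1 h with h | h
    · filter_upwards [(analyticAt_torA j c).continuousAt.eventually_ne h] with c' h1 h2 using h1 h2.1
    · filter_upwards [(analyticAt_torB _ j c).continuousAt.eventually_ne h] with c' h1 h2 using
        h1 h2.2
  · exact ((analyticAt_torC c).continuousAt.eventually_ne h.1).and
      ((analyticAt_chXi j c).continuousAt.eventually_ne h.2)
  · exact continuousAt_snd.eventually_ne h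
  · exact continuousAt_snd.eventually_ne h
  · exact continuousAt_fst.eventually_ne h

lemma analyticAt_cX {k : Idx} {c : ℂ × ℂ} (h : isAff a b k c) : AnalyticAt ℂ (cX k) c := by
  rcases k with y₀ | m₀ | ⟨l, j⟩ | ⟨s, j⟩ | s | s | _
  · exact analyticAt_fst
  · exact analyticAt_fst
  · exact analyticAt_nodeX l c
  · exact (analyticAt_chXi j c).inv h.2
  · exact analyticAt_fst
  · exact analyticAt_snd.inv h
  · exact (analyticAt_fst.pow 2).inv (pow_ne_zero 2 h)

lemma analyticAt_cY {k : Idx} {c : ℂ × ℂ} (hc : c ∈ dom a b k) (h : isAff a b k c) :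
    AnalyticAt ℂ (cY a b k) c := by
  rcases k with y₀ | m₀ | ⟨l, j⟩ | ⟨s, j⟩ | s | s | _
  · refine analyticAt_const.mul (AnalyticAt.csqrt ?_ hc.2)
    refine AnalyticAt.div (analyticAt_fst.fP.add (analyticAt_snd.fh hc.1)) analyticAt_const ?_
    intro h
    simpa [h] using hc.2
  · exact analyticAt_snd
  · exact analyticAt_nodeY l j c
  · exact (analyticAt_chQ hc).div ((analyticAt_torC c).mul (analyticAt_chXi j c))
      (mul_ne_zero h.1 h.2)
  · exact analyticAt_snd.inv h
  · exact analyticAt_fst.div analyticAt_snd h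
  · exact ((analyticAt_midR hc.1).csqrt hc.2).div (analyticAt_fst.pow 3) (pow_ne_zero 3 h)

lemma analyticAt_cZ {k : Idx} {c : ℂ × ℂ} (hc : c ∈ dom a b k) (h : isAff a b k c) :
    AnalyticAt ℂ (cZ a b k) c := by
  rcases k with y₀ | m₀ | ⟨l, j⟩ | ⟨s, j⟩ | s | s | _
  · exact analyticAt_snd
  · refine AnalyticAt.add (by unfold fP; fun_prop) (analyticAt_const.mul (AnalyticAt.csqrt ?_ hc))
    refine AnalyticAt.div (by unfold fP; fun_prop) analyticAt_const ?_
    intro h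
    simp [dom, h] at hc
  · exact analyticAt_nodeZ hc
  · exact (analyticAt_chW (fT_chXi_ne_zero hc)).zside hc.2.2 (chW_ne_zero hc h)
  · exact (analyticAt_secW hc.1).zside hc.2 (secW_ne_zero hc h)
  · exact (analyticAt_tailW hc.1).zside hc.2 (tailW_ne_zero hc h)
  · exact analyticAt_snd

end

variable {a b : ℂ}

/-! ### Points of the affine part -/

variable (a b) in
/-- The equation of the affine part of the quartic, without the points over which the projection
to the `x`-line is not smooth. -/
def AffPt (x y z : ℂ) : Prop :=
  z ≠ 0 ∧ y ^ 2 = fP a b x + fh z ∧ ¬(y = 0 ∧ z ^ 2 = 1)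

/-- The critical points ±1 of h have the critical values ±1, and each value is attained only there:
h² - 1 is the square of (z² - 1)/(2z). -/
lemma sq_eq_one_iff_of_fh {z : ℂ} (hz : z ≠ 0) : z ^ 2 = 1 ↔ fh z ^ 2 = 1 := by
  have : fh z ^ 2 - 1 = ((z ^ 2 - 1) / (2 * z)) ^ 2 := by rw [fh]; field_simp; ring
  rw [← sub_eq_zero, ← sub_eq_zero (a := fh z ^ 2), this]
  simp [hz]

/-- With r = √(1 + d²) and t = d + r one has 1/t = r - d, so t + 1/t = 2r has positive real part. As
Re t and Re(1/t) have the same sign, t lies in the right half plane, which fixes t among ±t. -/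
lemma nodeT_re_pos {l : ℂ} {j : ℕ} {c : ℂ × ℂ} (hc : c ∈ dom a b (.node l j)) :
    0 < (nodeT a b l j c).re ∧
      nodeT a b l j c - (nodeT a b l j c)⁻¹ = 2 * nodeD a b l j c := by
  set d := nodeD a b l j c with hd
  set r := csqrt (1 + d ^ 2) with hr
  have h1 : r ^ 2 = 1 + d ^ 2 := csqrt_sq (Complex.slitPlane_ne_zero hc.2.2.2)
  have h2 : 0 < r.re := csqrt_re_pos hc.2.2.2
  have hT : nodeT a b l j c = d + r := rfl
  rw [hT]
  have h3 : (d + r) * (r - d) = 1 := by linear_combination h1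
  have h4 : (d + r)⁻¹ = r - d := inv_eq_of_mul_eq_one_right h3
  refine ⟨?_, by rw [h4]; ring⟩
  have h5 : ((d + r) + (d + r)⁻¹).re = 2 * r.re := by rw [h4]; simp; ring
  rw [Complex.add_re, Complex.inv_re] at h5
  by_contra hcon
  push Not at hcon
  have : (d + r).re / Complex.normSq (d + r) ≤ 0 :=
    div_nonpos_of_nonpos_of_nonneg hcon (Complex.normSq_nonneg _)
  linarith

/-- The substitution z = -εt² straightens h at its critical point z = -ε: in terms of d = (t -
1/t)/2 it is exactly quadratic. Together with κ² = -2ε this makes y² - h(z) - ε a product of two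
linear forms in y and d. -/
lemma fh_nodeZ {ε t d : ℂ} (hε : ε ^ 2 = 1) (ht : t ≠ 0) (h : t - t⁻¹ = 2 * d) :
    fh (-ε * t ^ 2) = -ε * (1 + 2 * d ^ 2) := by
  have hε0 : ε ≠ 0 := by rintro rfl; norm_num at hε
  have h1 : ε⁻¹ = ε := inv_eq_of_mul_eq_one_right (by rw [← sq, hε])
  have hd : d = (t - t⁻¹) / 2 := by rw [h]; ring
  rw [fh, mul_inv, inv_neg, h1, hd]
  field_simp
  ring

lemma nodeA_mul_nodeB {l : ℂ} {j : ℕ} {c : ℂ × ℂ} (hc : c ∈ dom a b (.node l j)) :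
    torA j c * nodeB a b l j c = fP a b (nodeX l c) - fP a b l := by
  have h1 := fP_sub a b l (nodeX l c)
  have h2 := torA_mul_torB hc.2.1 c
  rw [h1, nodeB, nodeX, add_sub_cancel_left, ← h2]
  ring

lemma nodeY_sub {l : ℂ} {j : ℕ} {c : ℂ × ℂ} :
    nodeY a b l j c - kap a b l * nodeD a b l j c = torA j c := by
  have := kap_ne_zero a b l
  rw [nodeY, nodeD]; field_simp; ring

lemma nodeY_add {l : ℂ} {j : ℕ} {c : ℂ × ℂ} :
    nodeY a b l j c + kap a b l * nodeD a b l j c = nodeB a b l j c := by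
  have := kap_ne_zero a b l
  rw [nodeY, nodeD]; field_simp; ring

lemma affPt_of_isAff {k : Idx} {c : ℂ × ℂ} (hc : c ∈ dom a b k) (h : isAff a b k c) :
    AffPt a b (cX k c) (cY a b k c) (cZ a b k c) := by
  -- In the charts where z is defined by inverting z/(1 + z²) = w, the surface equation is
  -- equivalent to 2w(y² - P(x)) = 1, since h(z) = 1/(2w).
  have aux : ∀ {s : Bool} {x y w : ℂ}, w ∈ jouDom → w * (2 * (y ^ 2 - fP a b x)) = 1 →
      AffPt a b x y (zside s w) := by
    intro s x y w hw h1
    have h0 : w ≠ 0 := left_ne_zero_of_mul_eq_one h1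
    refine ⟨zside_ne_zero hw h0, ?_, fun h => zside_sq_ne_one hw h.2⟩
    rw [fh_zside hw h0, ← h1]
    field_simp
    ring
  rcases k with y₀ | m₀ | ⟨l, j⟩ | ⟨s, j⟩ | s | s | _
  · have hy : y₀ ≠ 0 := by rintro rfl; simpa using hc.2
    refine ⟨hc.1, ?_, fun h => mul_ne_zero hy (csqrt_ne_zero _) h.1⟩
    simp only [cX, cY, cZ]
    rw [mul_pow, csqrt_sq (Complex.slitPlane_ne_zero hc.2)]
    field_simp
  · have hm : m₀ ≠ 0 := by rintro rfl; simp [dom] at hc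
    have hs := csqrt_sq (Complex.slitPlane_ne_zero hc)
    simp only [cX, cY, cZ]
    set H := c.2 ^ 2 - fP a b c.1 with hH
    set r := csqrt ((H ^ 2 - 1) / m₀ ^ 2) with hr
    have h1 : (H + m₀ * r) * (H - m₀ * r) = 1 := by
      field_simp at hs
      linear_combination -hs
    have h2 : (H + m₀ * r)⁻¹ = H - m₀ * r := inv_eq_of_mul_eq_one_right h1
    have h0 : H + m₀ * r ≠ 0 := left_ne_zero_of_mul_eq_one h1
    have h3 : fh (H + m₀ * r) = H := by rw [fh, h2]; ring
    refine ⟨h0, by rw [h3]; ring, fun h => ?_⟩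
    rw [sq_eq_one_iff_of_fh h0, h3] at h
    have := Complex.slitPlane_ne_zero hc
    rw [h.2] at this
    simp at this
  · obtain ⟨h1, h2⟩ := nodeT_re_pos hc
    have ht : nodeT a b l j c ≠ 0 := by
      intro h'; rw [h'] at h1; simp at h1
    have hε := hc.1
    have hε0 : fP a b l ≠ 0 := by intro h'; rw [h'] at hε; norm_num at hε
    have hh := fh_nodeZ hε ht h2
    have hAB := nodeA_mul_nodeB hc
    have hk := kap_sq a b hε
    simp only [cX, cY, cZ]
    have hy : nodeY a b l j c ^ 2 = fP a b (nodeX l c) + fh (nodeZ a b l j c) := by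
      rw [nodeZ, hh]
      linear_combination hAB + (nodeY a b l j c + kap a b l * nodeD a b l j c) *
        nodeY_sub (a := a) (b := b) (l := l) (j := j) (c := c) +
        torA j c * nodeY_add (a := a) (b := b) (l := l) (j := j) (c := c) +
        nodeD a b l j c ^ 2 * hk
    refine ⟨mul_ne_zero (neg_ne_zero.2 hε0) (pow_ne_zero 2 ht), hy, fun h' => ?_⟩
    rw [nodeZ, sq_eq_one_iff_of_fh (mul_ne_zero (neg_ne_zero.2 hε0) (pow_ne_zero 2 ht)), hh] at h'
    obtain ⟨hy0, hz⟩ := h'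
    -- z² = 1 means (1 + 2d²)² = 1, so d = 0 or 1 + d² = 0. The second is excluded by the slit
    -- plane; in the first, y = 0 forces A = B = 0, which is the exceptional locus.
    have hd : nodeD a b l j c ^ 2 * (1 + nodeD a b l j c ^ 2) = 0 := by
      linear_combination hz / 4 - (1 + 2 * nodeD a b l j c ^ 2) ^ 2 / 4 * hε
    rcases mul_eq_zero.1 hd with hd | hd
    · have hd : nodeD a b l j c = 0 := pow_eq_zero_iff two_ne_zero |>.1 hd
      apply h
      have e1 := nodeY_sub (a := a) (b := b) (l := l) (j := j) (c := c)
      have e2 := nodeY_add (a := a) (b := b) (l := l) (j := j) (c := c)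
      rw [hy0, hd] at e1 e2
      refine ⟨by rw [← e1]; ring, ?_⟩
      have : nodeB a b l j c = 0 := by rw [← e2]; ring
      exact (mul_eq_zero.1 this).resolve_left hc.2.2.1
    · exact Complex.slitPlane_ne_zero hc.2.2.2 hd
  · refine aux hc.2.2 ?_
    have hT := fT_chXi_ne_zero hc
    have h1 := chW_mul hc.1 hT
    have hQ : chQ a b j c ^ 2 = fT a b (chXi j c) := csqrt_sq hT
    have hγ : torA j c = chXi j c - torC c ^ 2 := by rw [chXi]; ring
    have hS := h.1
    have hξ := h.2
    simp only [cX, cY]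
    rw [fP_inv a b hξ, div_pow, hQ]
    rw [hγ] at h1
    field_simp
    linear_combination h1
  · refine aux hc.2 ?_
    simp only [cX, cY]
    have h1 := hc.1
    have h2 : c.2 ≠ 0 := h
    rw [secW]
    field_simp
  · refine aux hc.2 ?_
    simp only [cX, cY]
    have h1 : c.2 * c.1 ^ 2 - fT a b c.2 ≠ 0 := mul_comm (c.1 ^ 2) c.2 ▸ hc.1
    have h2 : c.2 ≠ 0 := h
    rw [tailW, fP_inv a b h2]
    field_simp
  · have h1 : c.1 ≠ 0 := h
    have h2 := Complex.slitPlane_ne_zero hc.2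
    refine ⟨hc.1, ?_, fun h' => div_ne_zero (csqrt_ne_zero _) (pow_ne_zero 3 h1) h'.1⟩
    simp only [cX, cY, cZ]
    rw [div_pow, csqrt_sq h2, midR, fP_inv a b (pow_ne_zero 2 h1)]
    field_simp

/-! ### Coordinate changes at points of the affine part -/

/-- Off the exceptional locus the toric resolution is injective. If C ≠ 0, both coordinates follow
by dividing A and B by powers of C. If C = 0, a nonzero A or B can only occur with exponent zero, so
it is itself a coordinate. -/
lemma torC_torA_torB_injective {n j : ℕ} {c d : ℂ × ℂ} (h1 : torC c = torC d)
    (h2 : torA j c = torA j d) (h3 : torB n j c = torB n j d)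
    (h : ¬(torA j c = 0 ∧ torB n j c = 0)) : c = d := by
  rw [torA, torA] at h2
  rw [torB, torB] at h3
  rw [torA, torB] at h
  rw [torC, torC] at h1
  rw [← h1] at h2 h3
  by_cases h0 : c.1 * c.2 = 0
  · rcases not_and_or.1 h with h' | h'
    · have e : (c.1 * c.2) ^ j ≠ 0 := right_ne_zero_of_mul h'
      have hc2 := left_ne_zero_of_mul h'
      have e2 : c.2 = d.2 := mul_right_cancel₀ e h2
      rw [e2] at h1 hc2
      exact Prod.ext (mul_right_cancel₀ hc2 h1) e2
    · have e : (c.1 * c.2) ^ (n - 1 - j) ≠ 0 := right_ne_zero_of_mul h'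
      have hc2 := left_ne_zero_of_mul h'
      have e2 : c.1 = d.1 := mul_right_cancel₀ e h3
      rw [e2] at h1 hc2
      exact Prod.ext e2 (mul_left_cancel₀ hc2 h1)
  · exact Prod.ext (mul_right_cancel₀ (pow_ne_zero _ h0) h3)
      (mul_right_cancel₀ (pow_ne_zero _ h0) h2)

/-- Away from A = B = 0 the coordinates are quotients: v = A/Cʲ and u = C/v if A ≠ 0, and
symmetrically with B otherwise. The power of C in the denominator is nonzero even when C vanishes,
because then the exponent must be zero. -/
lemma tor_lift {n j : ℕ} (hj : j < n) {A B C : ℂ × ℂ → ℂ} {c d : ℂ × ℂ}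
    (hA : AnalyticAt ℂ A c) (hB : AnalyticAt ℂ B c) (hC : AnalyticAt ℂ C c)
    (hAB : ∀ᶠ c' in 𝓝 c, A c' * B c' = C c' ^ n) (eA : torA j d = A c) (eB : torB n j d = B c)
    (eC : torC d = C c) (h : ¬(torA j d = 0 ∧ torB n j d = 0)) :
    ∃ τ : ℂ × ℂ → ℂ × ℂ, AnalyticAt ℂ τ c ∧ τ c = d ∧
      ∀ᶠ c' in 𝓝 c, torA j (τ c') = A c' ∧ torB n j (τ c') = B c' ∧ torC (τ c') = C c' := by
  obtain ⟨k, rfl⟩ : ∃ k, n = j + 1 + k := ⟨n - j - 1, by omega⟩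
  have hk : j + 1 + k - 1 - j = k := by omega
  simp only [torB, hk] at *
  rw [torA] at h
  by_cases hcase : d.2 * (d.1 * d.2) ^ j = 0
  · have h' : d.1 * (d.1 * d.2) ^ k ≠ 0 := fun h0 => h ⟨hcase, h0⟩
    have hd1 : d.1 ≠ 0 := left_ne_zero_of_mul h'
    have hdk : (d.1 * d.2) ^ k ≠ 0 := right_ne_zero_of_mul h'
    have hCk : (C c) ^ k ≠ 0 := by rw [← eC]; exact hdk
    have hBc : B c ≠ 0 := by rw [← eB]; exact h'
    have e1 : B c / C c ^ k = d.1 := by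
      rw [← eB, ← eC, torC, mul_div_assoc, div_self hdk, mul_one]
    have han : AnalyticAt ℂ (fun c => B c / C c ^ k) c := hB.div (hC.pow k) hCk
    have h0 : B c / C c ^ k ≠ 0 := by rw [e1]; exact hd1
    refine ⟨fun c => (B c / C c ^ k, C c / (B c / C c ^ k)), han.prod (hC.div han h0), ?_, ?_⟩
    · simp only [e1]
      rw [← eC, torC]
      exact Prod.ext rfl (by simp [hd1])
    · filter_upwards [hAB, (hC.pow k).continuousAt.eventually_ne hCk,
        hB.continuousAt.eventually_ne hBc] with c' h1 h2 h3
      have h2 : C c' ^ k ≠ 0 := h2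
      have e3 : B c' / C c' ^ k * (C c' / (B c' / C c' ^ k)) = C c' := by field_simp
      simp only [torA, torC, e3]
      refine ⟨?_, by field_simp, trivial⟩
      field_simp
      linear_combination -h1
  · have h' := hcase
    have hd1 : d.2 ≠ 0 := left_ne_zero_of_mul h'
    have hdk : (d.1 * d.2) ^ j ≠ 0 := right_ne_zero_of_mul h'
    have hCk : (C c) ^ j ≠ 0 := by rw [← eC]; exact hdk
    have hBc : A c ≠ 0 := by rw [← eA]; exact h'
    have e1 : A c / C c ^ j = d.2 := by
      rw [← eA, ← eC, torC, torA, mul_div_assoc, div_self hdk, mul_one]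
    have han : AnalyticAt ℂ (fun c => A c / C c ^ j) c := hA.div (hC.pow j) hCk
    have h0 : A c / C c ^ j ≠ 0 := by rw [e1]; exact hd1
    refine ⟨fun c => (C c / (A c / C c ^ j), A c / C c ^ j), (hC.div han h0).prod han, ?_, ?_⟩
    · simp only [e1]
      rw [← eC, torC]
      exact Prod.ext (by simp [hd1]) rfl
    · filter_upwards [hAB, (hC.pow j).continuousAt.eventually_ne hCk,
        hA.continuousAt.eventually_ne hBc] with c' h1 h2 h3
      have h2 : C c' ^ j ≠ 0 := h2
      have e3 : C c' / (A c' / C c' ^ j) * (A c' / C c' ^ j) = C c' := by field_simp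
      simp only [torA, torC, e3]
      refine ⟨by field_simp, ?_, trivial⟩
      field_simp
      linear_combination -h1

lemma eventually_re_pos {f : ℂ × ℂ → ℂ} {c : ℂ × ℂ} (hf : ContinuousAt f c) (h : 0 < (f c).re) :
    ∀ᶠ c' in 𝓝 c, 0 < (f c').re :=
  (Complex.continuous_re.continuousAt.comp hf).eventually (lt_mem_nhds h)

/-- Near the given point both `zside s (w c')` and `Z c'` solve h(z) = 1/(2w). Being inside the unit
disc (after inversion if `s` is false) is an open condition, and only one of the two solutions
satisfies it. -/
lemma eventually_zside {s : Bool} {w Z : ℂ × ℂ → ℂ} {c : ℂ × ℂ} (hZ : AnalyticAt ℂ Z c)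
    (hw : w c ∈ jouDom) (hv : ∀ᶠ c' in 𝓝 c, Z c' ≠ 0 ∧ fh (Z c') * (2 * w c') = 1)
    (e : zside s (w c) = Z c) : ∀ᶠ c' in 𝓝 c, zside s (w c') = Z c' := by
  have h0 := hv.self_of_nhds.1
  have han : AnalyticAt ℂ (fun c' => if s then Z c' else (Z c')⁻¹) c := by
    cases s
    · exact hZ.inv h0
    · exact hZ
  have hlt : ‖if s then Z c else (Z c)⁻¹‖ < 1 := by
    have := norm_jou_lt_one hw
    rw [← e]
    cases s <;> simpa [zside] using this
  have hev := han.continuousAt.norm.eventually (gt_mem_nhds hlt)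
  filter_upwards [hv, hev] with c' h1 h2
  exact (zside_eq_of_fh h1.2 h1.1 h2).2

/-- At a point of the affine part, the inverse of a parametrization is analytic in the coordinates
`x`, `y` and `z`. -/
lemma exists_lift {k : Idx} {c d : ℂ × ℂ} (hd : d ∈ dom a b k) (h : isAff a b k d)
    {X Y Z : ℂ × ℂ → ℂ} (hX : AnalyticAt ℂ X c) (hY : AnalyticAt ℂ Y c) (hZ : AnalyticAt ℂ Z c)
    (hv : ∀ᶠ c' in 𝓝 c, Z c' ≠ 0 ∧ Y c' ^ 2 = fP a b (X c') + fh (Z c'))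
    (eX : cX k d = X c) (eY : cY a b k d = Y c) (eZ : cZ a b k d = Z c) :
    ∃ τ : ℂ × ℂ → ℂ × ℂ, AnalyticAt ℂ τ c ∧ τ c = d ∧
      ∀ᶠ c' in 𝓝 c, pt a b k (τ c') = .aff (X c') (Y c') (Z c') := by
  have finish : ∀ τ : ℂ × ℂ → ℂ × ℂ, AnalyticAt ℂ τ c → τ c = d →
      (∀ᶠ c' in 𝓝 c, cX k (τ c') = X c' ∧ cY a b k (τ c') = Y c' ∧ cZ a b k (τ c') = Z c') →
      ∃ τ : ℂ × ℂ → ℂ × ℂ, AnalyticAt ℂ τ c ∧ τ c = d ∧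
      ∀ᶠ c' in 𝓝 c, pt a b k (τ c') = .aff (X c') (Y c') (Z c') := by
    intro τ hτ hτd hev
    refine ⟨τ, hτ, hτd, ?_⟩
    have h1 := hτ.continuousAt.eventually (hτd ▸ eventually_isAff h)
    filter_upwards [hev, h1] with c' h2 h3
    rw [pt_of_isAff h3, h2.1, h2.2.1, h2.2.2]
  have hZ0 := hv.self_of_nhds.1
  rcases k with y₀ | m₀ | ⟨l, j⟩ | ⟨s, j⟩ | s | s | _
  · have hy : y₀ ≠ 0 := by rintro rfl; simpa using hd.2
    simp only [cX, cY, cZ] at eX eY eZ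
    refine finish (fun c' => (X c', Z c')) (hX.prod hZ) (Prod.ext eX.symm eZ.symm) ?_
    -- The branch of the root in this chart is the one for which y/y₀ has positive real part; this
    -- persists near `c` and forces the chart's y to equal `Y`.
    have hre : 0 < (Y c / y₀).re := by
      rw [← eY, mul_div_cancel_left₀ _ hy]
      exact csqrt_re_pos hd.2
    filter_upwards [hv, eventually_re_pos (hY.div analyticAt_const hy).continuousAt hre]
      with c' h1 h2
    have h2 : 0 < (Y c' / y₀).re := h2
    refine ⟨rfl, ?_, rfl⟩
    simp only [cY]
    rw [csqrt_eq_of_sq h2 (by rw [div_pow, h1.2]), mul_div_cancel₀ _ hy]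
  · have hm : m₀ ≠ 0 := by rintro rfl; simp [dom] at hd
    have hmid := affPt_of_isAff hd h
    simp only [cX, cY, cZ] at eX eY eZ hmid
    refine finish (fun c' => (X c', Y c')) (hX.prod hY) (Prod.ext eX.symm eY.symm) ?_
    have hre : 0 < ((Z c - (Z c)⁻¹) / 2 / m₀).re := by
      have hs := csqrt_re_pos hd
      have e1 : fh (Z c) = d.2 ^ 2 - fP a b d.1 := by
        have := hv.self_of_nhds.2
        rw [eX, eY]; linear_combination -this
      have : (Z c - (Z c)⁻¹) / 2 = Z c - fh (Z c) := by rw [fh]; ring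
      rw [this, e1, ← eZ, add_sub_cancel_left, mul_div_cancel_left₀ _ hm]
      exact hs
    have han : AnalyticAt ℂ (fun c' => (Z c' - (Z c')⁻¹) / 2 / m₀) c :=
      ((hZ.sub (hZ.inv hZ0)).div analyticAt_const two_ne_zero).div analyticAt_const hm
    filter_upwards [hv, eventually_re_pos han.continuousAt hre] with c' h1 h2
    refine ⟨rfl, rfl, ?_⟩
    simp only [cZ]
    have e1 : Y c' ^ 2 - fP a b (X c') = fh (Z c') := by rw [h1.2]; ring
    rw [e1, csqrt_eq_of_sq h2, mul_div_cancel₀ _ hm, fh]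
    · ring
    · rw [div_pow]
      congr 1
      have := h1.1
      rw [fh]; field_simp; ring
  · obtain ⟨ht, hdt⟩ := nodeT_re_pos hd
    have hε := hd.1
    have hε0 : fP a b l ≠ 0 := by intro h'; rw [h'] at hε; norm_num at hε
    have hk := kap_sq a b hε
    have hk0 := kap_ne_zero a b l
    have hq := hd.2.2.1
    have e1 := nodeY_sub (a := a) (b := b) (l := l) (j := j) (c := d)
    have e2 := nodeY_add (a := a) (b := b) (l := l) (j := j) (c := d)
    simp only [cX, cY, cZ] at eX eY eZ
    -- The coordinate t is recovered from Z as the root of -P(l)Z in the right half plane; then d, A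
    -- = y - κd, B = (y + κd)/q and C = x - l follow, and `tor_lift` gives the chart coordinates.
    set T : ℂ × ℂ → ℂ := fun c' => csqrt (-fP a b l * Z c') with hT
    have hTsq : -fP a b l * Z c = nodeT a b l j d ^ 2 := by
      rw [← eZ, nodeZ]; linear_combination nodeT a b l j d ^ 2 * hε
    have hTc : T c = nodeT a b l j d := csqrt_eq_of_sq ht hTsq.symm
    have hTan : AnalyticAt ℂ T c :=
      (analyticAt_const.mul hZ).csqrt (by
        change -fP a b l * Z c ∈ _
        rw [hTsq]; exact sq_mem_slitPlane ht)
    have hT0 : T c ≠ 0 := csqrt_ne_zero _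
    set D : ℂ × ℂ → ℂ := fun c' => (T c' - (T c')⁻¹) / 2 with hD
    have hDan : AnalyticAt ℂ D c :=
      (hTan.sub (hTan.inv hT0)).div analyticAt_const two_ne_zero
    have hDc : D c = nodeD a b l j d := by rw [hD]; simp only [hTc, hdt]; ring
    have hqX : nquo a b l (X c) ≠ 0 := by rw [← eX]; exact hq
    have hB : AnalyticAt ℂ (fun c' => (Y c' + kap a b l * D c') / nquo a b l (X c')) c :=
      (hY.add (analyticAt_const.mul hDan)).div hX.nquo hqX
    have hA : AnalyticAt ℂ (fun c' => Y c' - kap a b l * D c') c :=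
      hY.sub (analyticAt_const.mul hDan)
    have hC : AnalyticAt ℂ (fun c' => X c' - l) c := hX.sub analyticAt_const
    have hDh : ∀ c', Z c' ≠ 0 → fh (Z c') = -fP a b l * (1 + 2 * D c' ^ 2) := by
      intro c' h0
      have hT2 : T c' ^ 2 = -fP a b l * Z c' := csqrt_sq (mul_ne_zero (neg_ne_zero.2 hε0) h0)
      have := fh_nodeZ (t := T c') (d := D c') hε (csqrt_ne_zero _) (by simp only [hD]; ring)
      rw [← this, hT2]
      congr 1
      linear_combination -Z c' * hε
    have hev : ∀ᶠ c' in 𝓝 c, nquo a b l (X c') ≠ 0 ∧ Z c' ≠ 0 ∧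
        Y c' ^ 2 = fP a b (X c') + fh (Z c') :=
      (hX.nquo.continuousAt.eventually_ne hqX).and hv
    obtain ⟨τ, hτ, hτd, hτe⟩ := tor_lift (n := nmult a b l) (j := j) hd.2.1 hA hB hC
      (by
        filter_upwards [hev] with c' h1
        have h2 := fP_sub a b l (X c')
        have h3 := hDh c' h1.2.1
        have h4 := h1.1
        have h5 : (Y c' - kap a b l * D c') * (Y c' + kap a b l * D c') =
            (X c' - l) ^ nmult a b l * nquo a b l (X c') := by
          rw [← h2]
          linear_combination h1.2.2 + h3 - D c' ^ 2 * hk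
        rw [← mul_div_assoc, h5, mul_div_assoc, div_self h4, mul_one])
      (d := d) (by rw [hDc, ← eY, e1]) (by rw [hDc, ← eY, e2, nodeB, ← eX]; field_simp)
      (by rw [← eX, nodeX]; ring) h
    refine finish τ hτ hτd ?_
    filter_upwards [hτe, hev, eventually_re_pos hTan.continuousAt (hTc.symm ▸ ht)]
      with c' h1 h2 h3
    have f1 : nodeX l (τ c') = X c' := by rw [nodeX, h1.2.2]; ring
    have f2 : nodeB a b l j (τ c') = Y c' + kap a b l * D c' := by
      have := h2.1
      rw [nodeB, f1, h1.2.1]; field_simp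
    have f3 : nodeD a b l j (τ c') = D c' := by
      rw [nodeD, f2, h1.1]; field_simp; ring
    refine ⟨f1, ?_, ?_⟩
    · simp only [cY]
      rw [nodeY, f2, h1.1]; ring
    · have hT0 : T c' ≠ 0 := csqrt_ne_zero _
      have hre : 0 < ((T c' + (T c')⁻¹) / 2).re := by
        have : ((T c')⁻¹).re = (T c').re / Complex.normSq (T c') := Complex.inv_re _
        have h4 : 0 < ((T c')⁻¹).re := this ▸ div_pos h3 (Complex.normSq_pos.2 hT0)
        rw [show (T c' + (T c')⁻¹) / 2 = (T c' + (T c')⁻¹) / ((2 : ℝ) : ℂ) by simp,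
          Complex.div_ofReal_re, Complex.add_re]
        linarith
      have f4 : csqrt (1 + D c' ^ 2) = (T c' + (T c')⁻¹) / 2 :=
        csqrt_eq_of_sq hre (by simp only [hD]; field_simp; ring)
      have f5 : nodeT a b l j (τ c') = T c' := by
        rw [nodeT, f3, f4]; simp only [hD]; ring
      simp only [cZ]
      rw [nodeZ, f5, csqrt_sq (mul_ne_zero (neg_ne_zero.2 hε0) h2.2.1)]
      linear_combination Z c' * hε
  · obtain ⟨hS, hξ⟩ := h
    have hT := fT_chXi_ne_zero hd
    have hw0 := chW_ne_zero hd ⟨hS, hξ⟩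
    simp only [cX, cY, cZ] at eX eY eZ
    have hX0 : X c ≠ 0 := by rw [← eX]; exact inv_ne_zero hξ
    have hY0 : Y c ≠ 0 := by
      rw [← eY]; exact div_ne_zero (csqrt_ne_zero _) (mul_ne_zero hS hξ)
    have eξ : (X c)⁻¹ = chXi j d := by rw [← eX, inv_inv]
    set Ξ : ℂ × ℂ → ℂ := fun c' => (X c')⁻¹ with hΞ
    have hΞan : AnalyticAt ℂ Ξ c := hX.inv hX0
    -- Inversion of the chain coordinates: S = √T(ξ)/(yξ), then A = ξ - S². Since S ≠ 0 implies A ≠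
    -- 0 at points of the chart, B can be taken as S⁸/A.
    set S : ℂ × ℂ → ℂ := fun c' => csqrt (fT a b (Ξ c')) / (Y c' * Ξ c') with hSdef
    have hSan : AnalyticAt ℂ S c := by
      refine AnalyticAt.div (hΞan.fT.csqrt ?_) (hY.mul hΞan) (mul_ne_zero hY0 (inv_ne_zero hX0))
      simp only [hΞ, eξ]; exact hd.2.1
    have eS : S c = torC d := by
      simp only [hSdef, hΞ, eξ, ← eY]
      have := csqrt_ne_zero (fT a b (chXi j d))
      rw [chQ]
      field_simp
    set G : ℂ × ℂ → ℂ := fun c' => Ξ c' - S c' ^ 2 with hG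
    have eG : G c = torA j d := by
      simp only [hG, eS, hΞ, eξ, chXi]; ring
    have hGan : AnalyticAt ℂ G c := hΞan.sub (hSan.pow 2)
    have hG0 : G c ≠ 0 := by rw [eG]; exact torA_ne_zero_of_torC hS
    have hBan : AnalyticAt ℂ (fun c' => S c' ^ 8 / G c') c := (hSan.pow 8).div hGan hG0
    have hGev := hGan.continuousAt.eventually_ne hG0
    obtain ⟨τ, hτ, hτd, hτe⟩ := tor_lift (n := 8) (j := j) hd.1 hGan hBan hSan
      (by filter_upwards [hGev] with c' h1 using mul_div_cancel₀ _ h1)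
      (d := d) eG.symm (by
        rw [eS, eG, ← torA_mul_torB hd.1, mul_div_cancel_left₀ _ (torA_ne_zero_of_torC hS)])
      eS.symm (fun h' => torA_ne_zero_of_torC hS h'.1)
    refine finish τ hτ hτd ?_
    have fξ : ∀ᶠ c' in 𝓝 c, chXi j (τ c') = Ξ c' ∧ torC (τ c') = S c' ∧ torA j (τ c') = G c' := by
      filter_upwards [hτe] with c' h1
      refine ⟨?_, h1.2.2, h1.1⟩
      rw [chXi, h1.1, h1.2.2]; simp only [hG]; ring
    have hTev : ∀ᶠ c' in 𝓝 c, fT a b (Ξ c') ≠ 0 :=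
      hΞan.fT.continuousAt.eventually_ne (by simp only [hΞ, eξ]; exact hT)
    have hZev : ∀ᶠ c' in 𝓝 c, zside s (chW a b j (τ c')) = Z c' := by
      refine eventually_zside hZ (by rw [hτd]; exact hd.2.2) ?_ (by rw [hτd]; exact eZ)
      filter_upwards [fξ, hv, hGev, hTev, hX.continuousAt.eventually_ne hX0,
        hY.continuousAt.eventually_ne hY0] with c' h1 h2 h3 h4 h5 h6
      refine ⟨h2.1, ?_⟩
      have g1 := chW_mul (a := a) (b := b) hd.1 (c := τ c') (by rw [h1.1]; exact h4)
      rw [h1.1, h1.2.1, h1.2.2] at g1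
      have g2 : S c' ^ 2 * (Y c' * Ξ c') ^ 2 = fT a b (Ξ c') := by
        have : Y c' * Ξ c' ≠ 0 := mul_ne_zero h6 (inv_ne_zero h5)
        simp only [hSdef]
        rw [div_pow, csqrt_sq h4, div_mul_cancel₀ _ (pow_ne_zero 2 this)]
      have h7 : Ξ c' ≠ 0 := inv_ne_zero h5
      have g3 : fh (Z c') = Y c' ^ 2 - fT a b (Ξ c') / Ξ c' ^ 3 := by
        rw [← fP_inv a b h7, inv_inv, h2.2]; ring
      have hS0 : S c' ≠ 0 := by
        intro h0; rw [h0] at g2; apply h4; rw [← g2]; ring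
      -- The surface equation multiplied by S²ξ³ reads h(z)S²ξ³ = T·G; compared with `chW_mul` it
      -- gives h(z)·2w = 1.
      have g4 : fh (Z c') * (S c' ^ 2 * Ξ c' ^ 3) = fT a b (Ξ c') * G c' := by
        rw [g3]; simp only [hG]; field_simp
        linear_combination Ξ c' * g2
      have g5 : fT a b (Ξ c') * G c' ≠ 0 := mul_ne_zero h4 h3
      apply mul_right_cancel₀ g5
      rw [← g4]
      linear_combination fh (Z c') * g1 +
        (fh (Z c') * (2 * chW a b j (τ c'))) * g4
    filter_upwards [fξ, hZev, hX.continuousAt.eventually_ne hX0,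
      hY.continuousAt.eventually_ne hY0] with c' h1 h2 h3 h4
    refine ⟨?_, ?_, h2⟩
    · simp only [cX, h1.1, hΞ, inv_inv]
    · simp only [cY, chQ, h1.1, h1.2.1, hSdef]
      have h7 : Ξ c' ≠ 0 := inv_ne_zero h3
      have := csqrt_ne_zero (fT a b (Ξ c'))
      field_simp
  · have h : d.2 ≠ 0 := h
    simp only [cX, cY, cZ] at eX eY eZ
    have hY0 : Y c ≠ 0 := by rw [← eY]; exact inv_ne_zero h
    have e : (X c, (Y c)⁻¹) = d := Prod.ext eX.symm (by rw [← eY, inv_inv])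
    refine finish (fun c' => (X c', (Y c')⁻¹)) (hX.prod (hY.inv hY0)) e ?_
    have hden : ∀ᶠ c' in 𝓝 c, 1 - ((Y c')⁻¹) ^ 2 * fP a b (X c') ≠ 0 := by
      have han : AnalyticAt ℂ (fun c' => 1 - ((Y c')⁻¹) ^ 2 * fP a b (X c')) c :=
        analyticAt_const.sub (((hY.inv hY0).pow 2).mul hX.fP)
      refine han.continuousAt.eventually_ne ?_
      have := hd.1
      rw [← e] at this
      exact this
    have hev := hY.continuousAt.eventually_ne hY0
    have hZev : ∀ᶠ c' in 𝓝 c, zside s (secW a b (X c', (Y c')⁻¹)) = Z c' := by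
      refine eventually_zside hZ (by rw [e]; exact hd.2) ?_ (by rw [e]; exact eZ)
      filter_upwards [hv, hev, hden] with c' h2 h3 h4
      refine ⟨h2.1, ?_⟩
      have : fh (Z c') = Y c' ^ 2 - fP a b (X c') := by rw [h2.2]; ring
      rw [this, secW]
      field_simp at h4 ⊢
      exact div_self (div_ne_zero_iff.1 h4).1
    filter_upwards [hZev] with c' h1
    exact ⟨rfl, by simp [cY], h1⟩
  · have h : d.2 ≠ 0 := h
    simp only [cX, cY, cZ] at eX eY eZ
    have hX0 : X c ≠ 0 := by rw [← eX]; exact inv_ne_zero h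
    have e : (Y c / X c, (X c)⁻¹) = d :=
      Prod.ext (by rw [← eX, ← eY]; simp only; field_simp) (by rw [← eX, inv_inv])
    refine finish (fun c' => (Y c' / X c', (X c')⁻¹)) ((hY.div hX hX0).prod (hX.inv hX0)) e ?_
    have hev := hX.continuousAt.eventually_ne hX0
    have hden : ∀ᶠ c' in 𝓝 c, (Y c' / X c') ^ 2 * (X c')⁻¹ - fT a b (X c')⁻¹ ≠ 0 := by
      have han : AnalyticAt ℂ (fun c' => (Y c' / X c') ^ 2 * (X c')⁻¹ - fT a b (X c')⁻¹) c :=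
        (((hY.div hX hX0).pow 2).mul (hX.inv hX0)).sub (hX.inv hX0).fT
      refine han.continuousAt.eventually_ne ?_
      have := hd.1
      rw [← e] at this
      exact this
    have hZev : ∀ᶠ c' in 𝓝 c, zside s (tailW a b (Y c' / X c', (X c')⁻¹)) = Z c' := by
      refine eventually_zside hZ (by rw [e]; exact hd.2) ?_ (by rw [e]; exact eZ)
      filter_upwards [hv, hev, hden] with c' h2 h3 h4
      refine ⟨h2.1, ?_⟩
      have h5 : fh (Z c') = Y c' ^ 2 - fT a b (X c')⁻¹ * X c' ^ 3 := by
        have := fP_inv a b (inv_ne_zero h3)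
        rw [inv_inv] at this
        rw [h2.2, this]; field_simp; ring
      have h6 : fh (Z c') = ((Y c' / X c') ^ 2 * (X c')⁻¹ - fT a b (X c')⁻¹) * X c' ^ 3 := by
        rw [h5]; field_simp
      rw [h6, tailW]
      simp only
      generalize (Y c' / X c') ^ 2 * (X c')⁻¹ - fT a b (X c')⁻¹ = t at h4 ⊢
      field_simp
    filter_upwards [hZev, hev] with c' h1 h2
    refine ⟨by simp [cX], ?_, h1⟩
    simp only [cY]
    field_simp
  · have h : d.1 ≠ 0 := h
    simp only [cX, cY, cZ] at eX eY eZ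
    have hX0 : X c ≠ 0 := by rw [← eX]; exact inv_ne_zero (pow_ne_zero 2 h)
    have hY0 : Y c ≠ 0 := by rw [← eY]; exact div_ne_zero (csqrt_ne_zero _) (pow_ne_zero 3 h)
    -- In the middle chart x = r⁻² and y = √R·r⁻³, hence R = y²/x³ and r = √R·x/y.
    have e0 : Y c ^ 2 / X c ^ 3 = midR a b d := by
      rw [← eY, ← eX, div_pow, csqrt_sq (Complex.slitPlane_ne_zero hd.2)]
      field_simp
    have han : AnalyticAt ℂ (fun c' => csqrt (Y c' ^ 2 / X c' ^ 3)) c :=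
      ((hY.pow 2).div (hX.pow 3) (pow_ne_zero 3 hX0)).csqrt (by simpa [e0] using hd.2)
    have e1 : csqrt (Y c ^ 2 / X c ^ 3) * X c / Y c = d.1 := by
      rw [e0, ← eX, ← eY]
      have := csqrt_ne_zero (midR a b d)
      field_simp
    refine finish (fun c' => (csqrt (Y c' ^ 2 / X c' ^ 3) * X c' / Y c', Z c'))
      (((han.mul hX).div hY hY0).prod hZ) (Prod.ext e1 eZ.symm) ?_
    filter_upwards [hv, hX.continuousAt.eventually_ne hX0, hY.continuousAt.eventually_ne hY0]
      with c' h1 h2 h3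
    set r := csqrt (Y c' ^ 2 / X c' ^ 3) with hr
    have hr2 : r ^ 2 = Y c' ^ 2 / X c' ^ 3 := csqrt_sq (by positivity)
    have hr0 : r ≠ 0 := csqrt_ne_zero _
    have e2 : (r * X c' / Y c') ^ 2 = (X c')⁻¹ := by
      rw [div_pow, mul_pow, hr2]; field_simp
    refine ⟨?_, ?_, rfl⟩
    · simp only [cX, e2, inv_inv]
    · have e3 : midR a b (r * X c' / Y c', Z c') = Y c' ^ 2 / X c' ^ 3 := by
        have := fP_inv a b (inv_ne_zero h2)
        rw [inv_inv] at this
        rw [midR]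
        simp only [e2]
        rw [show (r * X c' / Y c') ^ 6 = ((r * X c' / Y c') ^ 2) ^ 3 by ring, e2, h1.2, this]
        field_simp
      simp only [cY]
      rw [e3, ← hr, show (r * X c' / Y c') ^ 3 = (r * X c' / Y c') ^ 2 * (r * X c' / Y c') by ring,
        e2]
      field_simp

/-! ### Injectivity of the parametrizations -/

lemma jou_injOn : InjOn jou jouDom := by
  intro w hw w' hw' h
  have h1 := jou_eq hw
  have h2 := jou_eq hw'
  rw [← h] at h2
  exact mul_left_cancel₀ (one_add_jou_sq_ne_zero hw) (h1.symm.trans h2)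

lemma zside_injOn (s : Bool) : InjOn (zside s) jouDom := by
  intro w hw w' hw' h
  cases s
  · exact jou_injOn hw hw' (inv_injective (by simpa [zside] using h))
  · exact jou_injOn hw hw' (by simpa [zside] using h)

lemma eq_of_tseq_eq {j : ℕ} {c d : ℂ × ℂ} (h : tseq j c = tseq j d) : c = d := by
  have h1 := congrFun h j
  have h2 := congrFun h (j + 1)
  rw [tseq_self, tseq_self, Option.some_inj] at h1
  rw [tseq_succ, tseq_succ] at h2
  exact Prod.ext (oinv_injective h2) h1

lemma torB_eq_div {j : ℕ} (hj : j < 8) {c : ℂ × ℂ} (h : torA j c ≠ 0) :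
    torB 8 j c = torC c ^ 8 / torA j c := by
  rw [eq_div_iff h, mul_comm, torA_mul_torB hj]

lemma eq_of_torC_torA {j : ℕ} (hj : j < 8) {c d : ℂ × ℂ} (h1 : torC c = torC d)
    (h2 : torA j c = torA j d) (h : torA j c ≠ 0) : c = d := by
  refine torC_torA_torB_injective (n := 8) h1 h2 ?_ fun h' => h h'.1
  rw [torB_eq_div hj h, torB_eq_div hj (h2 ▸ h), h1, h2]

lemma pt_injOn (k : Idx) : InjOn (pt a b k) (dom a b k) := by
  intro c hc d hd h
  by_cases hA : isAff a b k c
  · have hB : isAff a b k d := by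
      rw [isAff_iff, ← h, ← isAff_iff]; exact hA
    rw [pt_of_isAff hA, pt_of_isAff hB, Pt.aff.injEq] at h
    obtain ⟨eX, eY, eZ⟩ := h
    rcases k with y₀ | m₀ | ⟨l, j⟩ | ⟨s, j⟩ | s | s | _
    · exact Prod.ext eX eZ
    · exact Prod.ext eX eY
    · simp only [cX, cY, cZ] at eX eY eZ
      obtain ⟨h1, h2⟩ := nodeT_re_pos hc
      obtain ⟨h3, h4⟩ := nodeT_re_pos hd
      have hε : fP a b l ≠ 0 := by
        have := hc.1
        intro h'; rw [h'] at this; norm_num at this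
      have h5 : nodeT a b l j c ^ 2 = nodeT a b l j d ^ 2 := by
        rw [nodeZ, nodeZ] at eZ
        exact mul_left_cancel₀ (neg_ne_zero.2 hε) eZ
      have h6 : nodeT a b l j c = nodeT a b l j d := by
        rw [← csqrt_eq_of_sq h1 h5, csqrt_eq_of_sq h3 rfl]
      have h7 : nodeD a b l j c = nodeD a b l j d := by
        rw [h6, h4] at h2
        exact (mul_left_cancel₀ two_ne_zero h2).symm
      have hC : torC c = torC d := add_left_cancel eX
      have hA' : torA j c = torA j d := by rw [← nodeY_sub, ← nodeY_sub, eY, h7]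
      have hB' : nodeB a b l j c = nodeB a b l j d := by rw [← nodeY_add, ← nodeY_add, eY, h7]
      refine torC_torA_torB_injective hC hA' ?_ hA
      rw [nodeB, nodeB, eX] at hB'
      exact mul_left_cancel₀ hd.2.2.1 hB'
    · simp only [cX, cY] at eX eY
      have eξ : chXi j c = chXi j d := inv_injective eX
      have eQ : chQ a b j c = chQ a b j d := by rw [chQ, chQ, eξ]
      have eS : torC c = torC d := by
        rw [eξ, eQ] at eY
        have h0 : chQ a b j d ≠ 0 := csqrt_ne_zero _
        have h1 := hA.1
        have h2 := hB.1
        have h3 := hB.2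
        field_simp at eY
        exact eY.symm
      refine eq_of_torC_torA hc.1 eS ?_ (torA_ne_zero_of_torC hA.1)
      rw [chXi, chXi, eS] at eξ
      exact add_right_cancel eξ
    · exact Prod.ext eX (inv_injective eY)
    · simp only [cX, cY] at eX eY
      have e2 := inv_injective eX
      refine Prod.ext ?_ e2
      rw [e2] at eY
      have hB : d.2 ≠ 0 := hB
      field_simp at eY
      exact eY
    · simp only [cX, cY, cZ] at eX eY eZ
      have e2 : c.1 ^ 2 = d.1 ^ 2 := inv_injective eX
      have hR : midR a b c = midR a b d := by
        rw [midR, midR, show c.1 ^ 6 = (c.1 ^ 2) ^ 3 by ring, e2, eZ]; ring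
      have hA : c.1 ≠ 0 := hA
      have hB : d.1 ≠ 0 := hB
      rw [hR] at eY
      have h0 := csqrt_ne_zero (midR a b d)
      refine Prod.ext ?_ eZ
      field_simp at eY
      have : c.1 * c.1 ^ 2 = d.1 * c.1 ^ 2 := by rw [e2]; linear_combination -eY - c.1 * e2
      exact mul_right_cancel₀ (pow_ne_zero 2 hA) this
  · have hB : ¬isAff a b k d := by
      rw [isAff_iff, ← h, ← isAff_iff]; exact hA
    rw [pt_of_not_isAff hA, pt_of_not_isAff hB] at h
    rcases k with y₀ | m₀ | ⟨l, j⟩ | ⟨s, j⟩ | s | s | _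
    · exact absurd trivial hA
    · exact absurd trivial hA
    · simp only [special, Pt.exc.injEq, true_and] at h
      exact eq_of_tseq_eq h
    · simp only [isAff, not_and_or, not_not] at hA hB
      simp only [special] at h
      -- The constructor of the label tells which stratum of the chain chart the point lies on, so
      -- only the four cases with the same constructor on both sides survive.
      split_ifs at h with h1 h2 h3 h4 h5 h6 h7 h8 h9 h10 h11
      · have e1 := hA.resolve_left h1
        have e2 := hB.resolve_left h2
        simp only [Pt.tail.injEq, true_and, chQ, e1, e2] at h
        have h0 := csqrt_ne_zero (fT a b 0)
        have eS : torC c = torC d := by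
          field_simp at h
          exact h.symm
        refine eq_of_torC_torA hc.1 eS ?_ (torA_ne_zero_of_torC h1)
        rw [chXi] at e1 e2
        rw [eS] at e1
        linear_combination e1 - e2
      · simp only [not_not] at h1 h6
        simp only [Pt.sec.injEq, true_and] at h
        exact eq_of_torC_torA hc.1 (h1.trans h6.symm) (inv_injective h) h5
      · simp only [not_not] at *
        rw [Pt.mid.injEq] at h
        have e := zside_injOn s hc.2.2 hd.2.2 h
        have eA : torA j c = torA j d := by simp_all
        have eC : torC c = torC d := by simp_all
        refine torC_torA_torB_injective (n := 8) eC eA ?_ fun h' => by simp_all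
        rw [chW, chW, chXi, chXi, eA, eC] at e
        have hT : fT a b (torA j d + torC d ^ 2) ≠ 0 := fT_chXi_ne_zero hd
        field_simp at e
        exact add_left_cancel e
      · simp only [Pt.inf.injEq, true_and] at h
        exact eq_of_tseq_eq h
    · simp only [special, Pt.sec.injEq, true_and] at h
      exact Prod.ext h ((not_not.1 hA).trans (not_not.1 hB).symm)
    · simp only [special, Pt.tail.injEq, true_and] at h
      exact Prod.ext h ((not_not.1 hA).trans (not_not.1 hB).symm)
    · simp only [special, Pt.mid.injEq] at h
      exact Prod.ext ((not_not.1 hA).trans (not_not.1 hB).symm) h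

/-! ### Coordinate changes between the charts -/

/-- The parametrization `k` near `c` factors through the parametrization `l` near `d`. -/
def Rel (a b : ℂ) (k : Idx) (c : ℂ × ℂ) (l : Idx) (d : ℂ × ℂ) : Prop :=
  ∃ τ : ℂ × ℂ → ℂ × ℂ, AnalyticAt ℂ τ c ∧ τ c = d ∧ ∀ᶠ c' in 𝓝 c, pt a b l (τ c') = pt a b k c'

lemma Rel.refl (k : Idx) (c : ℂ × ℂ) : Rel a b k c k c :=
  ⟨id, analyticAt_id, rfl, Eventually.of_forall fun _ => rfl⟩

lemma Rel.trans {k l m : Idx} {c d e : ℂ × ℂ} (h1 : Rel a b k c l d) (h2 : Rel a b l d m e) :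
    Rel a b k c m e := by
  obtain ⟨τ, hτ, hτd, h⟩ := h1
  obtain ⟨σ, hσ, hσd, h'⟩ := h2
  refine ⟨σ ∘ τ, AnalyticAt.comp (hτd ▸ hσ) hτ, by simp [hτd, hσd], ?_⟩
  filter_upwards [h, hτ.continuousAt.eventually (hτd ▸ h')] with c' h3 h4
  rw [Function.comp_apply, h4, h3]

/-- At affine points x, y, z are analytic functions of the first chart, and `exists_lift` expresses
the second chart's coordinates analytically through them. -/
lemma rel_of_isAff {k l : Idx} {c d : ℂ × ℂ} (hc : c ∈ dom a b k) (hd : d ∈ dom a b l)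
    (h : pt a b k c = pt a b l d) (hA : isAff a b k c) : Rel a b k c l d := by
  have hB : isAff a b l d := by
    rw [isAff_iff, ← h, ← isAff_iff]; exact hA
  rw [pt_of_isAff hA, pt_of_isAff hB, Pt.aff.injEq] at h
  have hev : ∀ᶠ c' in 𝓝 c, c' ∈ dom a b k ∧ isAff a b k c' :=
    (show ∀ᶠ c' in 𝓝 c, c' ∈ dom a b k from (isOpen_dom k).mem_nhds hc).and (eventually_isAff hA)
  obtain ⟨τ, hτ, hτd, h1⟩ := exists_lift hd hB (analyticAt_cX hA) (analyticAt_cY hc hA)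
    (analyticAt_cZ hc hA)
    (by
      filter_upwards [hev] with c' h2
      have := affPt_of_isAff h2.1 h2.2
      exact ⟨this.1, this.2.1⟩)
    h.1.symm h.2.1.symm h.2.2.symm
  refine ⟨τ, hτ, hτd, ?_⟩
  filter_upwards [h1, hev] with c' h2 h3
  rw [h2, pt_of_isAff h3.2]

/-- The label depends only on A, B, C and the sequence of values A/Cⁱ; the sequence itself contains
A (its term 0) and B (the inverse of its term n). -/
lemma pt_node_congr {l : ℂ} {j j' : ℕ} (hj : j < nmult a b l) (hj' : j' < nmult a b l)
    {c d : ℂ × ℂ} (h : tseq j c = tseq j' d) (hC : torC c = torC d) :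
    pt a b (.node l j) c = pt a b (.node l j') d := by
  have hA := torA_eq_of_tseq_eq h
  have hB := torB_eq_of_tseq_eq hj hj' h
  have e : isAff a b (.node l j) c ↔ isAff a b (.node l j') d := by simp only [isAff, hA, hB]
  by_cases hd : isAff a b (.node l j') d
  · rw [pt_of_isAff (e.2 hd), pt_of_isAff hd]
    simp only [cX, cY, cZ, nodeZ, nodeT, nodeD, nodeY, nodeB, nodeX, hA, hB, hC]
  · rw [pt_of_not_isAff (e.not.2 hd), pt_of_not_isAff hd]
    simp only [special, h]

lemma pt_chain_congr {s : Bool} {j j' : ℕ} (hj : j < 8) (hj' : j' < 8)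
    {c d : ℂ × ℂ} (h : tseq j c = tseq j' d) (hC : torC c = torC d) :
    pt a b (.chain s j) c = pt a b (.chain s j') d := by
  have hA := torA_eq_of_tseq_eq h
  have hB := torB_eq_of_tseq_eq hj hj' h
  have e : isAff a b (.chain s j) c ↔ isAff a b (.chain s j') d := by simp only [isAff, chXi, hA, hC]
  by_cases hd : isAff a b (.chain s j') d
  · rw [pt_of_isAff (e.2 hd), pt_of_isAff hd]
    simp only [cX, cY, cZ, chQ, chW, chXi, hA, hB, hC]
  · rw [pt_of_not_isAff (e.not.2 hd), pt_of_not_isAff hd]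
    simp only [special, chQ, chW, chXi, hA, hB, hC, h]

lemma chW_eq {j : ℕ} (hj : j < 8) {c : ℂ × ℂ} (h : fT a b (chXi j c) ≠ 0) (hA : torA j c ≠ 0) :
    chW a b j c = torC c ^ 2 * chXi j c ^ 3 / (2 * fT a b (chXi j c) * torA j c) := by
  rw [eq_div_iff (mul_ne_zero (mul_ne_zero two_ne_zero h) hA), chW_mul hj h]

/-- The section coordinates are (x, 1/y) = (1/ξ, Sξ/√T). The formula also holds at S = 0, where both
sides are the point of the section over 1/ξ. -/
lemma pt_sec_of_chain {s : Bool} {j : ℕ} (hj : j < 8) {c : ℂ × ℂ} (hT : fT a b (chXi j c) ≠ 0)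
    (hA : torA j c ≠ 0) (hξ : chXi j c ≠ 0) :
    pt a b (.sec s) ((chXi j c)⁻¹, torC c * chXi j c / chQ a b j c) = pt a b (.chain s j) c := by
  have hQ0 : chQ a b j c ≠ 0 := csqrt_ne_zero _
  have hQ : chQ a b j c ^ 2 = fT a b (chXi j c) := csqrt_sq hT
  by_cases hS : torC c = 0
  · rw [pt_of_not_isAff (by simp [isAff, hS]), pt_of_not_isAff (by simp [isAff, hS])]
    simp [special, hS, hA, chXi]
  · have h0 : isAff a b (.sec s) ((chXi j c)⁻¹, torC c * chXi j c / chQ a b j c) :=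
      div_ne_zero (mul_ne_zero hS hξ) hQ0
    rw [pt_of_isAff h0, pt_of_isAff (k := .chain s j) ⟨hS, hξ⟩]
    simp only [cX, cY, cZ, inv_div]
    congr 2
    rw [chW_eq hj hT hA, secW]
    simp only
    rw [fP_inv a b hξ, div_pow, hQ]
    have h1 : torA j c = chXi j c - torC c ^ 2 := by rw [chXi]; ring
    rw [h1] at hA ⊢
    have h2 : 1 - (torC c * chXi j c) ^ 2 / fT a b (chXi j c) *
        (fT a b (chXi j c) / chXi j c ^ 3) = (chXi j c - torC c ^ 2) / chXi j c := by
      field_simp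
    rw [h2]
    field_simp

/-- The tail coordinates are (y/x, ξ) = (√T/S, ξ). They remain valid at ξ = 0, where both sides are
a point of the tail. -/
lemma pt_tail_of_chain {s : Bool} {j : ℕ} (hj : j < 8) {c : ℂ × ℂ} (hT : fT a b (chXi j c) ≠ 0)
    (hS : torC c ≠ 0) :
    pt a b (.tail s) (chQ a b j c / torC c, chXi j c) = pt a b (.chain s j) c := by
  have hQ0 : chQ a b j c ≠ 0 := csqrt_ne_zero _
  have hQ : chQ a b j c ^ 2 = fT a b (chXi j c) := csqrt_sq hT
  by_cases hξ : chXi j c = 0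
  · rw [pt_of_not_isAff (by simp [isAff, hξ]), pt_of_not_isAff (by simp [isAff, hξ])]
    simp [special, hS]
  · have h0 : isAff a b (.tail s) (chQ a b j c / torC c, chXi j c) := hξ
    rw [pt_of_isAff h0, pt_of_isAff (k := .chain s j) ⟨hS, hξ⟩]
    simp only [cX, cY, cZ]
    rw [div_div]
    congr 2
    have hA := torA_ne_zero_of_torC (j := j) hS
    rw [chW_eq hj hT hA, tailW]
    simp only
    rw [div_pow, hQ]
    have h1 : torA j c = chXi j c - torC c ^ 2 := by rw [chXi]; ring
    rw [h1] at hA ⊢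
    have h2 : fT a b (chXi j c) / torC c ^ 2 * chXi j c - fT a b (chXi j c) =
        fT a b (chXi j c) * (chXi j c - torC c ^ 2) / torC c ^ 2 := by
      field_simp
    rw [h2]
    field_simp

/-- The function `A / C ^ 2` in the charts at the chains. -/
def chRho (j : ℕ) (c : ℂ × ℂ) : ℂ := c.2 * (c.1 * c.2) ^ (j - 2)

lemma torA_eq_chRho {j : ℕ} (hj : 2 ≤ j) (c : ℂ × ℂ) : torA j c = torC c ^ 2 * chRho j c := by
  obtain ⟨k, rfl⟩ : ∃ k, j = k + 2 := ⟨j - 2, by omega⟩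
  rw [torA, torC, chRho, Nat.add_sub_cancel]; ring

lemma chXi_eq_chRho {j : ℕ} (hj : 2 ≤ j) (c : ℂ × ℂ) :
    chXi j c = torC c ^ 2 * (1 + chRho j c) := by
  rw [chXi, torA_eq_chRho hj]; ring

lemma torB_mul_chRho {j : ℕ} (hj : 2 ≤ j) (hj' : j < 8) (c : ℂ × ℂ) :
    torB 8 j c * chRho j c = torC c ^ 6 := by
  obtain ⟨k, rfl⟩ : ∃ k, j = k + 2 := ⟨j - 2, by omega⟩
  rw [torB, chRho, torC, Nat.add_sub_cancel,
    show (c.1 * c.2) ^ 6 = (c.1 * c.2) ^ 1 * (c.1 * c.2) ^ (8 - 1 - (k + 2)) * (c.1 * c.2) ^ k by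
      rw [← pow_add, ← pow_add]; congr 1; omega]
  ring

lemma chW_eq_chRho {j : ℕ} (hj : 2 ≤ j) (hj' : j < 8) (c : ℂ × ℂ) :
    chW a b j c = torB 8 j c * (1 + chRho j c) ^ 3 / (2 * fT a b (chXi j c)) := by
  rw [chW, torA_eq_chRho hj]
  congr 1
  linear_combination -(chRho j c ^ 2 + 3 * chRho j c + 3) * torB_mul_chRho hj hj' c

lemma analyticAt_chRho (j : ℕ) (c : ℂ × ℂ) : AnalyticAt ℂ (chRho j) c := by
  unfold chRho; fun_prop

/-- The coordinate `r` at the middle curve in the charts at the chains. -/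
def chMidR (a b : ℂ) (j : ℕ) (c : ℂ × ℂ) : ℂ :=
  torC c * csqrt (fT a b (chXi j c) * (1 + chRho j c)) / chQ a b j c

/-- With ρ = A/C² one has ξ = S²(1 + ρ) and R = T(1 + ρ). Taking r = S√R/√T gives r² = ξ, and this
sign of r also reproduces y. -/
lemma pt_mid_of_chain {s : Bool} {j : ℕ} (hj : 2 ≤ j) {c : ℂ × ℂ} (hc : c ∈ dom a b (.chain s j))
    (hB : torB 8 j c ≠ 0) (hρ : 1 + chRho j c ≠ 0) :
    pt a b .mid (chMidR a b j c, zside s (chW a b j c)) = pt a b (.chain s j) c := by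
  have hQ0 : chQ a b j c ≠ 0 := csqrt_ne_zero _
  have hT := fT_chXi_ne_zero hc
  have hQ : chQ a b j c ^ 2 = fT a b (chXi j c) := csqrt_sq hT
  have hY := csqrt_sq (mul_ne_zero hT hρ)
  have hY0 := csqrt_ne_zero (fT a b (chXi j c) * (1 + chRho j c))
  by_cases hS : torC c = 0
  · have hA : torA j c = 0 := by rw [torA_eq_chRho hj, hS]; ring
    rw [pt_of_not_isAff (by simp [isAff, hS, chMidR]), pt_of_not_isAff (by simp [isAff, hS])]
    simp [special, hS, hA, hB]
  · have hξ : chXi j c ≠ 0 := by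
      rw [chXi_eq_chRho hj]; exact mul_ne_zero (pow_ne_zero 2 hS) hρ
    have h0 : isAff a b .mid (chMidR a b j c, zside s (chW a b j c)) :=
      div_ne_zero (mul_ne_zero hS hY0) hQ0
    rw [pt_of_isAff h0,
      pt_of_isAff (k := .chain s j) ⟨hS, hξ⟩]
    have hr2 : chMidR a b j c ^ 2 = chXi j c := by
      rw [chMidR, div_pow, mul_pow, hY, hQ, chXi_eq_chRho hj]
      rw [chXi_eq_chRho hj] at hT
      field_simp
    have hR : midR a b (chMidR a b j c, zside s (chW a b j c)) =
        fT a b (chXi j c) * (1 + chRho j c) := by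
      rw [midR]
      simp only
      rw [show chMidR a b j c ^ 6 = (chMidR a b j c ^ 2) ^ 3 by ring, hr2,
        fh_zside hc.2.2 (chW_ne_zero hc ⟨hS, hξ⟩), chW_eq hc.1 hT (torA_ne_zero_of_torC hS),
        torA_eq_chRho hj]
      have : chRho j c ≠ 0 := by
        intro h; apply torA_ne_zero_of_torC (j := j) hS; rw [torA_eq_chRho hj, h, mul_zero]
      field_simp
    simp only [cX, cY, cZ]
    rw [hr2, hR]
    congr 1
    rw [show chMidR a b j c ^ 3 = chMidR a b j c ^ 2 * chMidR a b j c by ring, hr2, chMidR]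
    field_simp

/-- A point with C = 0 and A ≠ 0 exists only in the chart j = 0, where A = v. The inverse change of
coordinates is (u, v) = (S/G, G) with S = √T/(yξ) and G = ξ - S². -/
lemma rel_sec {s : Bool} {j : ℕ} {c : ℂ × ℂ} (hc : c ∈ dom a b (.chain s j)) (hS : torC c = 0)
    (hA : torA j c ≠ 0) : Rel a b (.chain s j) c (.sec s) ((torA j c)⁻¹, 0) ∧
      Rel a b (.sec s) ((torA j c)⁻¹, 0) (.chain s j) c := by
  have hξc : chXi j c = torA j c := by rw [chXi, hS]; ring
  have hξ : chXi j c ≠ 0 := by rwa [hξc]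
  have hT := fT_chXi_ne_zero hc
  have hj := hc.1
  have hj0 : j = 0 := by
    by_contra h0
    apply hA
    rw [torA, show c.1 * c.2 = 0 from hS, zero_pow h0, mul_zero]
  subst hj0
  constructor
  · refine ⟨fun c => ((chXi 0 c)⁻¹, torC c * chXi 0 c / chQ a b 0 c),
      ((analyticAt_chXi 0 c).inv hξ).prod
        (((analyticAt_torC c).mul (analyticAt_chXi 0 c)).div (analyticAt_chQ hc)
          (csqrt_ne_zero _)), by simp [hS, hξc], ?_⟩
    filter_upwards [(analyticAt_chXi 0 c).continuousAt.eventually_ne hξ,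
      (analyticAt_torA 0 c).continuousAt.eventually_ne hA,
      (analyticAt_chXi 0 c).fT.continuousAt.eventually_ne hT] with c' h1 h2 h3
    exact pt_sec_of_chain hj h3 h2 h1
  · set e : ℂ × ℂ := ((torA 0 c)⁻¹, 0) with he
    have he1 : e.1 ≠ 0 := inv_ne_zero hA
    have he2 : (e.1)⁻¹ = chXi 0 c := by rw [he, hξc, inv_inv]
    set ξ : ℂ × ℂ → ℂ := fun d => (d.1)⁻¹ with hξdef
    set S : ℂ × ℂ → ℂ := fun d => d.2 * csqrt (fT a b (ξ d)) / ξ d with hSdef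
    set G : ℂ × ℂ → ℂ := fun d => ξ d - S d ^ 2 with hG
    have aξ : AnalyticAt ℂ ξ e := analyticAt_fst.inv he1
    have aS : AnalyticAt ℂ S e :=
      (analyticAt_snd.mul (aξ.fT.csqrt (by
        change fT a b (e.1)⁻¹ ∈ _
        rw [he2]; exact hc.2.1))).div aξ (inv_ne_zero he1)
    have aG : AnalyticAt ℂ G e := aξ.sub (aS.pow 2)
    have eS : S e = 0 := by simp [hSdef, he]
    have eG : G e = torA 0 c := by
      simp only [hG, eS]; simp [hξdef, he]
    have hG0 : G e ≠ 0 := by rw [eG]; exact hA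
    refine ⟨fun d => (S d / G d, G d), (aS.div aG hG0).prod aG, ?_, ?_⟩
    · simp only [eS, eG, zero_div]
      have h2 : c.2 ≠ 0 := by simpa [torA] using hA
      have h1 : c.1 = 0 := (mul_eq_zero.1 hS).resolve_right h2
      exact Prod.ext h1.symm (by simp [torA])
    · filter_upwards [aG.continuousAt.eventually_ne hG0,
        (aξ.fT.continuousAt).eventually_ne (y := 0) (by
          change fT a b (e.1)⁻¹ ≠ 0
          rw [he2]; exact hT),
        aξ.continuousAt.eventually_ne (inv_ne_zero he1)] with d h1 h2 h3
      have f1 : torC (S d / G d, G d) = S d := div_mul_cancel₀ _ h1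
      have f2 : torA 0 (S d / G d, G d) = G d := by simp [torA]
      have f3 : chXi 0 (S d / G d, G d) = ξ d := by rw [chXi, f1, f2]; simp [hG]
      rw [← pt_sec_of_chain hj (by rw [f3]; exact h2) (by rw [f2]; exact h1) (by rw [f3]; exact h3)]
      rw [chQ, f3, f1]
      congr 1
      have := csqrt_ne_zero (fT a b (ξ d))
      refine Prod.ext (by simp [hξdef]) ?_
      simp only [hSdef]
      have h3 : ξ d ≠ 0 := h3
      field_simp

/-- Here S is nonzero and the toric coordinates are recovered from σ = y/x and ξ by S = √T(ξ)/σ, G =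
ξ - S², B = S⁸/G. -/
lemma rel_tail {s : Bool} {j : ℕ} {c : ℂ × ℂ} (hc : c ∈ dom a b (.chain s j)) (hS : torC c ≠ 0)
    (hξ : chXi j c = 0) : Rel a b (.chain s j) c (.tail s) (chQ a b j c / torC c, 0) ∧
      Rel a b (.tail s) (chQ a b j c / torC c, 0) (.chain s j) c := by
  have hT := fT_chXi_ne_zero hc
  have hj := hc.1
  constructor
  · refine ⟨fun c => (chQ a b j c / torC c, chXi j c),
      ((analyticAt_chQ hc).div (analyticAt_torC c) hS).prod (analyticAt_chXi j c),
      by simp [hξ], ?_⟩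
    filter_upwards [(analyticAt_torC c).continuousAt.eventually_ne hS,
      (analyticAt_chXi j c).fT.continuousAt.eventually_ne hT] with c' h1 h2
    exact pt_tail_of_chain hj h2 h1
  · set e : ℂ × ℂ := (chQ a b j c / torC c, 0) with he
    have hQ0 : chQ a b j c ≠ 0 := csqrt_ne_zero _
    have he1 : e.1 ≠ 0 := div_ne_zero hQ0 hS
    set S : ℂ × ℂ → ℂ := fun d => csqrt (fT a b d.2) / d.1 with hSdef
    set G : ℂ × ℂ → ℂ := fun d => d.2 - S d ^ 2 with hG
    have aS : AnalyticAt ℂ S e :=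
      (analyticAt_snd.fT.csqrt (by
        change fT a b 0 ∈ _
        rw [← hξ]; exact hc.2.1)).div analyticAt_fst he1
    have aG : AnalyticAt ℂ G e := analyticAt_snd.sub (aS.pow 2)
    have eS : S e = torC c := by
      simp only [hSdef, he]
      rw [← hξ, ← chQ]
      field_simp
    have eG : G e = torA j c := by
      simp only [hG, eS]
      rw [chXi] at hξ
      simp only [he]
      linear_combination -hξ
    have hA := torA_ne_zero_of_torC (j := j) hS
    have hG0 : G e ≠ 0 := by rw [eG]; exact hA
    have hS0 : S e ≠ 0 := by rw [eS]; exact hS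
    obtain ⟨τ, hτ, hτc, h⟩ := tor_lift hj aG ((aS.pow 8).div aG hG0) aS
      (by filter_upwards [aG.continuousAt.eventually_ne hG0] with d h1 using mul_div_cancel₀ _ h1)
      (d := c) eG.symm (by simp only [Pi.div_apply, Pi.pow_apply]; rw [torB_eq_div hj hA, eS, eG]) eS.symm (fun h => hA h.1)
    refine ⟨τ, hτ, hτc, ?_⟩
    filter_upwards [h, aS.continuousAt.eventually_ne hS0,
      analyticAt_snd.fT.continuousAt.eventually_ne (y := 0) (show fT a b e.2 ≠ 0 by
          simp [he, fT_zero]), continuousAt_fst.eventually_ne he1] with d h1 h2 h3 h4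
    have f3 : chXi j (τ d) = d.2 := by rw [chXi, h1.1, h1.2.2]; simp [hG]
    rw [← pt_tail_of_chain hj (by rw [f3]; exact h3) (by rw [h1.2.2]; exact h2), chQ, f3, h1.2.2]
    congr 1
    have := csqrt_ne_zero (fT a b d.2)
    refine Prod.ext ?_ rfl
    simp only [hSdef]
    field_simp

/-- A point with C = 0 and B ≠ 0 lies in the last chart, j = 7, on the axis v = 0, where B = u and w
= u/8. -/
lemma rel_mid {s : Bool} {j : ℕ} {c : ℂ × ℂ} (hc : c ∈ dom a b (.chain s j)) (hS : torC c = 0)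
    (hB : torB 8 j c ≠ 0) : Rel a b (.chain s j) c .mid (0, zside s (chW a b j c)) ∧
      Rel a b .mid (0, zside s (chW a b j c)) (.chain s j) c := by
  have hj := hc.1
  have hj7 : j = 7 := by
    by_contra h0
    apply hB
    rw [torB, show c.1 * c.2 = 0 from hS, zero_pow (by omega), mul_zero]
  subst hj7
  have hB1 : torB 8 7 c = c.1 := by simp [torB]
  rw [hB1] at hB
  have hc2 : c.2 = 0 := (mul_eq_zero.1 hS).resolve_left hB
  have hρ : chRho 7 c = 0 := by simp [chRho, hc2]
  have hξ : chXi 7 c = 0 := by rw [chXi_eq_chRho (by norm_num), hS]; ring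
  have hW : chW a b 7 c = c.1 / 8 := by
    rw [chW_eq_chRho (by norm_num) (by norm_num), hρ, hξ, fT_zero, hB1]; norm_num
  have hW0 : chW a b 7 c ≠ 0 := by rw [hW]; exact div_ne_zero hB (by norm_num)
  constructor
  · refine ⟨fun c => (chMidR a b 7 c, zside s (chW a b 7 c)), ?_, by simp [chMidR, hS], ?_⟩
    · refine AnalyticAt.prod (AnalyticAt.div ((analyticAt_torC c).mul (AnalyticAt.csqrt ?_ ?_))
        (analyticAt_chQ hc) (csqrt_ne_zero _)) ?_
      · exact (analyticAt_chXi 7 c).fT.mul (analyticAt_const.add (analyticAt_chRho 7 c))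
      · rw [hξ, hρ, fT_zero]; simp
      · exact (analyticAt_chW (fT_chXi_ne_zero hc)).zside hc.2.2 hW0
    · filter_upwards [(isOpen_dom _).mem_nhds hc, continuousAt_fst.eventually_ne hB,
        (analyticAt_const.add (analyticAt_chRho 7 c)).continuousAt.eventually_ne
          (show (1 : ℂ) + chRho 7 c ≠ 0 by simp [hρ])] with c' h1 h2 h3
      exact pt_mid_of_chain (by norm_num) h1 (by simpa [torB] using h2) h3
  · set e : ℂ × ℂ := (0, zside s (chW a b 7 c)) with he
    have hz0 : e.2 ≠ 0 := zside_ne_zero hc.2.2 hW0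
    have hfe : fh e.2 = 4 / c.1 := by
      rw [he, fh_zside hc.2.2 hW0, hW]; field_simp; norm_num
    have hfe0 : fh e.2 ≠ 0 := by rw [hfe]; exact div_ne_zero (by norm_num) hB
    have hRe : midR a b e = 4 := by simp [midR, he, fT_zero]
    have hse : e ∈ dom a b .mid := ⟨hz0, by rw [hRe]; simp⟩
    have hs4 : csqrt 4 = 2 := csqrt_eq_of_sq (by norm_num) (by norm_num)
    set Y : ℂ × ℂ → ℂ := fun d => csqrt (midR a b d) with hY
    set Q : ℂ × ℂ → ℂ := fun d => csqrt (fT a b (d.1 ^ 2)) with hQ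
    have aY : AnalyticAt ℂ Y e := (analyticAt_midR hz0).csqrt hse.2
    have aQ : AnalyticAt ℂ Q e :=
      (analyticAt_fst.pow 2).fT.csqrt (by simp [he, fT_zero])
    have ah : AnalyticAt ℂ (fun d : ℂ × ℂ => fh d.2) e := analyticAt_snd.fh hz0
    have eY : Y e = 2 := by simp only [hY, hRe, hs4]
    have eQ : Q e = 2 := by simp [hQ, he, fT_zero, hs4]
    have hY0 : ∀ d, Y d ≠ 0 := fun d => csqrt_ne_zero _
    have hQ0 : ∀ d, Q d ≠ 0 := fun d => csqrt_ne_zero _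
    -- With Y = √R and Q = √T: S = Qr/Y and ρ = h(z)r⁶/Q², so u = B = S⁶/ρ = Q⁸/(Y⁶h) and v = S/u =
    -- r h Y⁵/Q⁷. These are analytic where h(z) ≠ 0.
    set τ : ℂ × ℂ → ℂ × ℂ := fun d =>
      (Q d ^ 8 / (Y d ^ 6 * fh d.2), d.1 * fh d.2 * Y d ^ 5 / Q d ^ 7) with hτdef
    have hτe : τ e = c := by
      refine Prod.ext ?_ ?_
      · simp only [hτdef, eQ, eY, hfe]; field_simp; norm_num
      · simp [hτdef, he, hc2]
    have hτ : AnalyticAt ℂ τ e :=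
      ((aQ.pow 8).div ((aY.pow 6).mul ah) (mul_ne_zero (pow_ne_zero 6 (hY0 e)) hfe0)).prod
        (((analyticAt_fst.mul ah).mul (aY.pow 5)).div (aQ.pow 7) (pow_ne_zero 7 (hQ0 e)))
    refine ⟨τ, hτ, hτe, ?_⟩
    have key : ∀ᶠ d in 𝓝 e, d.2 ≠ 0 ∧ fh d.2 ≠ 0 ∧ midR a b d ∈ Complex.slitPlane ∧
        fT a b (d.1 ^ 2) ≠ 0 ∧ τ d ∈ dom a b (.chain s 7) := by
      refine (continuousAt_snd.eventually_ne hz0).and ((ah.continuousAt.eventually_ne hfe0).and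
        (((analyticAt_midR hz0).continuousAt.eventually
          (Complex.isOpen_slitPlane.mem_nhds hse.2)).and
        (((analyticAt_fst.pow 2).fT.continuousAt.eventually_ne (by simp [he, fT_zero])).and
          (hτ.continuousAt.eventually ?_))))
      rw [hτe]; exact (isOpen_dom _).mem_nhds hc
    have vals : ∀ d, fh d.2 ≠ 0 → midR a b d ≠ 0 → fT a b (d.1 ^ 2) ≠ 0 →
        torC (τ d) = Q d * d.1 / Y d ∧ chRho 7 (τ d) = fh d.2 * d.1 ^ 6 / Q d ^ 2 ∧
        1 + chRho 7 (τ d) = Y d ^ 2 / Q d ^ 2 ∧ chXi 7 (τ d) = d.1 ^ 2 ∧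
        fh d.2 * (2 * chW a b 7 (τ d)) = 1 := by
      intro d h1 h2 h3
      have g1 := hY0 d
      have g2 := hQ0 d
      have gY : Y d ^ 2 = midR a b d := csqrt_sq h2
      have gQ : Q d ^ 2 = fT a b (d.1 ^ 2) := csqrt_sq h3
      have f1 : torC (τ d) = Q d * d.1 / Y d := by
        rw [torC]; simp only [hτdef]; field_simp
      have f2 : chRho 7 (τ d) = fh d.2 * d.1 ^ 6 / Q d ^ 2 := by
        have : chRho 7 (τ d) = (τ d).2 * torC (τ d) ^ 5 := rfl
        rw [this, f1]; simp only [hτdef]; field_simp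
      have f3 : 1 + chRho 7 (τ d) = Y d ^ 2 / Q d ^ 2 := by
        rw [f2, eq_div_iff (pow_ne_zero 2 g2), gY, midR, ← gQ]; field_simp
      have f4 : chXi 7 (τ d) = d.1 ^ 2 := by
        rw [chXi_eq_chRho (by norm_num), f3, f1]; field_simp
      refine ⟨f1, f2, f3, f4, ?_⟩
      rw [chW_eq_chRho (by norm_num) (by norm_num), f3, f4, ← gQ]
      have : torB 8 7 (τ d) = (τ d).1 := by simp [torB]
      rw [this]; simp only [hτdef]; field_simp
    have hZ : ∀ᶠ d in 𝓝 e, zside s (chW a b 7 (τ d)) = d.2 := by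
      refine eventually_zside (w := fun d => chW a b 7 (τ d)) analyticAt_snd
        (by simp only [hτe]; exact hc.2.2) ?_ (by simp only [hτe]; rfl)
      filter_upwards [key] with d h1
      exact ⟨h1.1, (vals d h1.2.1 (Complex.slitPlane_ne_zero h1.2.2.1) h1.2.2.2.1).2.2.2.2⟩
    filter_upwards [key, hZ] with d h1 h2
    obtain ⟨f1, f2, f3, f4, f5⟩ := vals d h1.2.1 (Complex.slitPlane_ne_zero h1.2.2.1) h1.2.2.2.1
    have gY : Y d ^ 2 = midR a b d := csqrt_sq (Complex.slitPlane_ne_zero h1.2.2.1)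
    have gQ : Q d ^ 2 = fT a b (d.1 ^ 2) := csqrt_sq h1.2.2.2.1
    rw [← pt_mid_of_chain (by norm_num) h1.2.2.2.2
      (by
        have : torB 8 7 (τ d) = (τ d).1 := by simp [torB]
        rw [this]
        exact div_ne_zero (pow_ne_zero 8 (hQ0 d)) (mul_ne_zero (pow_ne_zero 6 (hY0 d)) h1.2.1))
      (by rw [f3]; exact div_ne_zero (pow_ne_zero 2 (hY0 d)) (pow_ne_zero 2 (hQ0 d))), h2]
    congr 1
    refine Prod.ext ?_ rfl
    have g1 := hY0 d
    have g2 := hQ0 d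
    have f6 : fT a b (chXi 7 (τ d)) * (1 + chRho 7 (τ d)) = midR a b d := by
      rw [f3, f4, ← gQ, ← gY]; field_simp
    have f7 : chQ a b 7 (τ d) = Q d := by rw [chQ, f4]
    simp only [chMidR]
    rw [f6, f7, f1]
    change Q d * d.1 / Y d * Y d / Q d = d.1
    field_simp

/-- The chart with the simplest coordinates at points of the sections, of the ends of the chain and
of the middle curve. -/
def hub : Pt → Idx × (ℂ × ℂ)
  | .sec s x => (.sec s, (x, 0))
  | .tail s σ => (.tail s, (σ, 0))
  | .mid z => (.mid, (0, z))
  | _ => (.mid, 0)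

/-- Points of the sections, tails and middle curve occur in charts of two kinds. Routing every
change of charts through one distinguished chart reduces compatibility to `rel_sec`, `rel_tail` and
`rel_mid`. -/
lemma rel_hub {k : Idx} {c : ℂ × ℂ} (hc : c ∈ dom a b k) (hA : ¬isAff a b k c)
    (h1 : ∀ l ρ, special a b k c ≠ .exc l ρ) (h2 : ∀ s ρ, special a b k c ≠ .inf s ρ) :
    Rel a b k c (hub (pt a b k c)).1 (hub (pt a b k c)).2 ∧
      Rel a b (hub (pt a b k c)).1 (hub (pt a b k c)).2 k c := by
  rw [pt_of_not_isAff hA]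
  rcases k with y₀ | m₀ | ⟨l, j⟩ | ⟨s, j⟩ | s | s | _
  · exact absurd trivial hA
  · exact absurd trivial hA
  · exact absurd rfl (h1 _ _)
  · simp only [isAff, not_and_or, not_not] at hA
    simp only [special] at h2 ⊢
    split_ifs at h2 ⊢ with h3 h4 h5
    · exact rel_tail hc h3 (hA.resolve_left h3)
    · exact rel_sec hc (not_not.1 h3) h4
    · exact rel_mid hc (not_not.1 h3) h5
    · exact absurd rfl (h2 _ _)
  · have : c = (c.1, 0) := Prod.ext rfl (not_not.1 hA)
    simp only [special, hub, ← this]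
    exact ⟨Rel.refl _ _, Rel.refl _ _⟩
  · have : c = (c.1, 0) := Prod.ext rfl (not_not.1 hA)
    simp only [special, hub, ← this]
    exact ⟨Rel.refl _ _, Rel.refl _ _⟩
  · have : c = (0, c.2) := Prod.ext (not_not.1 hA) rfl
    simp only [special, hub, ← this]
    exact ⟨Rel.refl _ _, Rel.refl _ _⟩

lemma special_eq_exc {k : Idx} {c : ℂ × ℂ} {l : ℂ} {ρ : ℕ → Option ℂ}
    (h : special a b k c = .exc l ρ) : ∃ j, k = .node l j ∧ tseq j c = ρ := by
  rcases k with y₀ | m₀ | ⟨l, j⟩ | ⟨s, j⟩ | s | s | _ <;> simp only [special] at h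
  · cases h
  · cases h
  · cases h; exact ⟨j, rfl, rfl⟩
  · split_ifs at h
  · cases h
  · cases h
  · cases h

lemma special_eq_inf {k : Idx} {c : ℂ × ℂ} {s : Bool} {ρ : ℕ → Option ℂ}
    (h : special a b k c = .inf s ρ) : ∃ j, k = .chain s j ∧ tseq j c = ρ ∧ torC c = 0 ∧
      torA j c = 0 ∧ torB 8 j c = 0 := by
  rcases k with y₀ | m₀ | ⟨l, j⟩ | ⟨s, j⟩ | s | s | _ <;> simp only [special] at h
  · cases h
  · cases h
  · cases h
  · split_ifs at h with h1 h2 h3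
    cases h
    exact ⟨j, rfl, rfl, not_not.1 h1, not_not.1 h2, not_not.1 h3⟩
  · cases h
  · cases h
  · cases h

/-- This is the compatibility of the atlas. Affine points use x, y, z; points on exceptional chains
occur only in toric charts of the same node or chain, related by `tseq_compat`; all others factor
through the hub. -/
lemma rel_of_pt_eq {k l : Idx} {c d : ℂ × ℂ} (hc : c ∈ dom a b k) (hd : d ∈ dom a b l)
    (h : pt a b k c = pt a b l d) : Rel a b k c l d := by
  by_cases hA : isAff a b k c
  · exact rel_of_isAff hc hd h hA
  have hB : ¬isAff a b l d := by
    rw [isAff_iff, ← h, ← isAff_iff]; exact hA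
  have h' := h
  rw [pt_of_not_isAff hA, pt_of_not_isAff hB] at h'
  by_cases h1 : ∃ l ρ, special a b k c = .exc l ρ
  · obtain ⟨l₀, ρ, h1⟩ := h1
    obtain ⟨j, rfl, h3⟩ := special_eq_exc h1
    obtain ⟨j', rfl, h4⟩ := special_eq_exc (h'.symm.trans h1)
    obtain ⟨τ, hτ, hτd, hev⟩ := tseq_compat (h3.trans h4.symm)
    refine ⟨τ, hτ, hτd, ?_⟩
    filter_upwards [hev] with c' h5
    exact pt_node_congr hd.2.1 hc.2.1 h5.1 h5.2
  by_cases h2 : ∃ s ρ, special a b k c = .inf s ρ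
  · obtain ⟨s, ρ, h2⟩ := h2
    obtain ⟨j, rfl, h3, -⟩ := special_eq_inf h2
    obtain ⟨j', rfl, h4, -⟩ := special_eq_inf (h'.symm.trans h2)
    obtain ⟨τ, hτ, hτd, hev⟩ := tseq_compat (h3.trans h4.symm)
    refine ⟨τ, hτ, hτd, ?_⟩
    filter_upwards [hev] with c' h5
    exact pt_chain_congr hd.1 hc.1 h5.1 h5.2
  push Not at h1 h2
  have r1 := (rel_hub hc hA h1 h2).1
  have r2 := (rel_hub hd hB (by rwa [← h']) (by rwa [← h'])).2
  rw [← h] at r2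
  exact r1.trans r2

/-! ### Gluing the charts to a complex surface -/

lemma zero_mem_dom_chain (s : Bool) {j : ℕ} (hj : j < 8) : (0 : ℂ × ℂ) ∈ dom a b (.chain s j) := by
  refine ⟨hj, ?_, ?_⟩
  · simp [chXi, torA, torC, fT_zero]
  · simpa [chW, torA, torC, torB] using zero_mem_jouDom

open Classical in
/-- The parametrizations form an atlas of their image. -/
def atl (a b : ℂ) : ParamAtlas {p : Pt // ∃ k, ∃ c ∈ dom a b k, pt a b k c = p} Idx where
  U := dom a b
  -- Outside the domain the value is an arbitrary base point; no axiom of the atlas refers to it.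
  ψ k c := if h : c ∈ dom a b k then ⟨pt a b k c, k, c, h, rfl⟩
    else ⟨pt a b (.chain true 0) 0, _, _, zero_mem_dom_chain true (by norm_num), rfl⟩
  isOpen_U := isOpen_dom
  inj k c hc d hd h := by
    simp only [dif_pos hc, dif_pos hd, Subtype.mk.injEq] at h
    exact pt_injOn k hc hd h
  cover := by
    rintro ⟨p, k, c, hc, h⟩
    exact ⟨k, c, hc, by simp [hc, h]⟩
  compat := by
    intro k l c d hc hd h
    simp only [dif_pos hc, dif_pos hd, Subtype.mk.injEq] at h
    obtain ⟨τ, hτ, hτd, hev⟩ := rel_of_pt_eq hc hd h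
    refine ⟨τ, hτ, hτd, ?_⟩
    have hd' : ∀ᶠ c' in 𝓝 c, τ c' ∈ dom a b l :=
      hτ.continuousAt.eventually (by rw [hτd]; exact (isOpen_dom l).mem_nhds hd)
    filter_upwards [hev, (isOpen_dom k).mem_nhds hc, hd'] with c' h1 h2 h3
    rw [dif_pos h2, dif_pos h3]
    exact Subtype.ext h1

/-- The resolution of the quartic. -/
abbrev Surf (a b : ℂ) : Type := (atl a b).Space

/-- The underlying abstract point. -/
def toPt (p : Surf a b) : Pt := Subtype.val p

lemma toPt_injective : Function.Injective (toPt : Surf a b → Pt) := Subtype.val_injective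

lemma toPt_par {k : Idx} {c : ℂ × ℂ} (hc : c ∈ dom a b k) :
    toPt ((atl a b).par k c) = pt a b k c := by
  change Subtype.val ((atl a b).ψ k c) = _
  simp only [atl, dif_pos hc]

lemma par_eq_par {k l : Idx} {c d : ℂ × ℂ} (hc : c ∈ dom a b k) (hd : d ∈ dom a b l)
    (h : pt a b k c = pt a b l d) : (atl a b).par k c = (atl a b).par l d :=
  toPt_injective (by rw [toPt_par hc, toPt_par hd, h])

/-! ## Holomorphic maps to projective spaces -/

/-- The vectors `v` and `w` are proportional. -/
def Proportional {n : ℕ} (v w : Fin n → ℂ) : Prop := ∃ t : ℂ, t ≠ 0 ∧ v = t • w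

/-- The map to projective space with the given homogeneous coordinates. -/
def toCP {n : ℕ} (V : Pt → Fin (n + 1) → ℂ) (hV : ∀ p, V p ≠ 0) (p : Surf a b) : CP n :=
  Projectivization.mk ℂ (V (toPt p)) (hV _)

lemma liftAt_toCP {n : ℕ} {V : Pt → Fin (n + 1) → ℂ} {hV : ∀ p, V p ≠ 0} {k : Idx} {c : ℂ × ℂ}
    {L : ℂ × ℂ → Fin (n + 1) → ℂ} (hc : c ∈ dom a b k) (hL : AnalyticAt ℂ L c)
    (h : ∀ᶠ c' in 𝓝 c, c' ∈ dom a b k → Proportional (L c') (V (pt a b k c'))) :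
    (atl a b).LiftAt (toCP V hV) k c L := by
  refine ⟨hL, ?_⟩
  filter_upwards [h, (isOpen_dom k).mem_nhds hc] with c' h1 h2
  obtain ⟨t, ht, e⟩ := h1 h2
  refine ⟨by rw [e]; exact smul_ne_zero ht (hV _), ?_⟩
  rw [toCP, Projectivization.mk_eq_mk_iff']
  refine ⟨t⁻¹, ?_⟩
  rw [e, toPt_par h2, inv_smul_smul₀ ht]

/-- Homogeneous coordinates of the alternate fibration. -/
def thetaV : Pt → Fin 2 → ℂ
  | .aff x _ _ => ![x, 1]
  | .exc l _ => ![l, 1]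
  | .sec _ x => ![x, 1]
  | _ => ![1, 0]

lemma thetaV_ne_zero (p : Pt) : thetaV p ≠ 0 := by
  cases p <;> simp [thetaV]

/-- The alternate fibration. -/
def theta (a b : ℂ) : Surf a b → CP 1 := toCP thetaV thetaV_ne_zero

/-- Homogeneous coordinates of the map induced by the projection `[x, y, z, w] ↦ [x, y, w]`. -/
def xyV : Pt → Fin 3 → ℂ
  | .aff x y _ => ![x, y, 1]
  | .exc l _ => ![l, 0, 1]
  | .tail _ σ => ![1, σ, 0]
  | _ => ![0, 1, 0]

lemma xyV_ne_zero (p : Pt) : xyV p ≠ 0 := by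
  cases p <;> simp [xyV]

/-- Homogeneous coordinates of the map induced by the projection `[x, y, z, w] ↦ [z, w]`. -/
def zV (a b : ℂ) : Pt → Fin 2 → ℂ
  | .aff _ _ z => ![z, 1]
  | .exc l _ => ![-fP a b l, 1]
  | .sec s _ => if s then ![0, 1] else ![1, 0]
  | .tail s _ => if s then ![0, 1] else ![1, 0]
  | .inf s _ => if s then ![0, 1] else ![1, 0]
  | .mid z => ![z, 1]

lemma zV_ne_zero (p : Pt) : zV a b p ≠ 0 := by
  cases p <;> simp [zV] <;> split_ifs <;> simp

/-- Homogeneous coordinates of the map to the quartic. -/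
def piV (a b : ℂ) : Pt → Fin 4 → ℂ
  | .aff x y z => ![x, y, z, 1]
  | .exc l _ => ![l, 0, -fP a b l, 1]
  | .sec s _ => if s then ![0, 1, 0, 0] else ![0, 0, 1, 0]
  | .tail s σ => if s then ![1, σ, 0, 0] else ![0, 0, 1, 0]
  | .inf true _ => ![0, 1, 0, 0]
  | .inf false ρ => match ρ 5 with
    | none => ![0, 0, 1, 0]
    | some t => ![0, 1, 4 * t, 0]
  | .mid _ => ![0, 1, 0, 0]

lemma piV_ne_zero (p : Pt) : piV a b p ≠ 0 := by
  rcases p with _ | _ | ⟨s, _⟩ | ⟨s, _⟩ | ⟨s, ρ⟩ | _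
  · simp [piV]
  · simp [piV]
  · cases s <;> simp [piV]
  · cases s <;> simp [piV]
  · cases s
    · rw [piV]
      cases ρ 5 <;> simp
    · simp [piV]
  · simp [piV]

/-- The resolution of the quartic. -/
def piMap (a b : ℂ) : Surf a b → CP 3 := toCP (piV a b) piV_ne_zero

section

variable (a b)

/-- Local homogeneous coordinates of the alternate fibration. -/
def thetaL : Idx → ℂ × ℂ → Fin 2 → ℂ
  | .chain _ j, c => ![1, chXi j c]
  | .tail _, c => ![1, c.2]
  | .mid, c => ![1, c.1 ^ 2]
  | k, c => ![cX k c, 1]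

/-- Local homogeneous coordinates of the projection to `[x, y, w]`. -/
def xyL : Idx → ℂ × ℂ → Fin 3 → ℂ
  | .chain _ j, c => ![torC c, chQ a b j c, torC c * chXi j c]
  | .sec _, c => ![c.1 * c.2, 1, c.2]
  | .tail _, c => ![1, c.1, c.2]
  | .mid, c => ![c.1, csqrt (midR a b c), c.1 ^ 3]
  | k, c => ![cX k c, cY a b k c, 1]

/-- Homogeneous coordinates of `z = zside s w`. -/
def sideV (s : Bool) (w : ℂ) : Fin 2 → ℂ := if s then ![jou w, 1] else ![1, jou w]

/-- Local homogeneous coordinates of the projection to `[z, w]`. -/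
def zL : Idx → ℂ × ℂ → Fin 2 → ℂ
  | .chain s j, c => sideV s (chW a b j c)
  | .sec s, c => sideV s (secW a b c)
  | .tail s, c => sideV s (tailW a b c)
  | k, c => ![cZ a b k c, 1]

end

lemma analyticAt_vec2 {f g : ℂ × ℂ → ℂ} {c : ℂ × ℂ} (hf : AnalyticAt ℂ f c)
    (hg : AnalyticAt ℂ g c) : AnalyticAt ℂ (fun c => ![f c, g c]) c := by
  rw [analyticAt_pi_iff]
  intro i; fin_cases i <;> assumption

lemma analyticAt_vec3 {f g h : ℂ × ℂ → ℂ} {c : ℂ × ℂ} (hf : AnalyticAt ℂ f c)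
    (hg : AnalyticAt ℂ g c) (hh : AnalyticAt ℂ h c) :
    AnalyticAt ℂ (fun c => ![f c, g c, h c]) c := by
  rw [analyticAt_pi_iff]
  intro i; fin_cases i <;> assumption

lemma analyticAt_vec4 {f g h k : ℂ × ℂ → ℂ} {c : ℂ × ℂ} (hf : AnalyticAt ℂ f c)
    (hg : AnalyticAt ℂ g c) (hh : AnalyticAt ℂ h c) (hk : AnalyticAt ℂ k c) :
    AnalyticAt ℂ (fun c => ![f c, g c, h c, k c]) c := by
  rw [analyticAt_pi_iff]
  intro i; fin_cases i <;> assumption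

lemma analyticAt_thetaL (k : Idx) (c : ℂ × ℂ) : AnalyticAt ℂ (thetaL k) c := by
  rcases k with y₀ | m₀ | ⟨l, j⟩ | ⟨s, j⟩ | s | s | _
  · exact analyticAt_vec2 analyticAt_fst analyticAt_const
  · exact analyticAt_vec2 analyticAt_fst analyticAt_const
  · exact analyticAt_vec2 (analyticAt_nodeX l c) analyticAt_const
  · exact analyticAt_vec2 analyticAt_const (analyticAt_chXi j c)
  · exact analyticAt_vec2 analyticAt_fst analyticAt_const
  · exact analyticAt_vec2 analyticAt_const analyticAt_snd
  · exact analyticAt_vec2 analyticAt_const (analyticAt_fst.pow 2)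

lemma special_chain (s : Bool) (j : ℕ) (c : ℂ × ℂ) :
    (torC c ≠ 0 ∧ special a b (.chain s j) c = .tail s (chQ a b j c / torC c)) ∨
    (torC c = 0 ∧ torA j c ≠ 0 ∧ special a b (.chain s j) c = .sec s (torA j c)⁻¹) ∨
    (torC c = 0 ∧ torA j c = 0 ∧ torB 8 j c ≠ 0 ∧
      special a b (.chain s j) c = .mid (zside s (chW a b j c))) ∨
    (torC c = 0 ∧ torA j c = 0 ∧ torB 8 j c = 0 ∧
      special a b (.chain s j) c = .inf s (tseq j c)) := by
  simp only [special]
  split_ifs <;> simp_all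

lemma thetaL_prop {k : Idx} {c : ℂ × ℂ} : Proportional (thetaL k c) (thetaV (pt a b k c)) := by
  by_cases hA : isAff a b k c
  · rw [pt_of_isAff hA]
    rcases k with y₀ | m₀ | ⟨l, j⟩ | ⟨s, j⟩ | s | s | _
    · exact ⟨1, one_ne_zero, by simp [thetaL, thetaV]⟩
    · exact ⟨1, one_ne_zero, by simp [thetaL, thetaV]⟩
    · exact ⟨1, one_ne_zero, by simp [thetaL, thetaV]⟩
    · have := hA.2
      exact ⟨_, this, by simp [thetaL, thetaV, cX, this]⟩
    · exact ⟨1, one_ne_zero, by simp [thetaL, thetaV]⟩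
    · have : c.2 ≠ 0 := hA
      exact ⟨_, this, by simp [thetaL, thetaV, cX, this]⟩
    · have : c.1 ≠ 0 := hA
      exact ⟨_, pow_ne_zero 2 this, by simp [thetaL, thetaV, cX, this]⟩
  · rw [pt_of_not_isAff hA]
    rcases k with y₀ | m₀ | ⟨l, j⟩ | ⟨s, j⟩ | s | s | _
    · exact absurd trivial hA
    · exact absurd trivial hA
    · simp only [isAff, not_not] at hA
      refine ⟨1, one_ne_zero, ?_⟩
      have : torC c = 0 := by
        by_contra h; exact torA_ne_zero_of_torC h hA.1
      simp [thetaL, thetaV, special, cX, nodeX, this]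
    · simp only [isAff, not_and_or, not_not] at hA
      rcases special_chain (a := a) (b := b) s j c with h | h | h | h
      · rw [h.2]
        exact ⟨1, one_ne_zero, by simp [thetaL, thetaV, hA.resolve_left h.1]⟩
      · rw [h.2.2]
        exact ⟨_, h.2.1, by simp [thetaL, thetaV, chXi, h.1, h.2.1]⟩
      · rw [h.2.2.2]
        exact ⟨1, one_ne_zero, by simp [thetaL, thetaV, chXi, h.1, h.2.1]⟩
      · rw [h.2.2.2]
        exact ⟨1, one_ne_zero, by simp [thetaL, thetaV, chXi, h.1, h.2.1]⟩
    · exact ⟨1, one_ne_zero, by simp [thetaL, thetaV, special, cX]⟩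
    · exact ⟨1, one_ne_zero, by simp [thetaL, thetaV, special, not_not.1 hA]⟩
    · exact ⟨1, one_ne_zero, by simp [thetaL, thetaV, special, not_not.1 hA]⟩

lemma liftAt_theta {k : Idx} {c : ℂ × ℂ} (hc : c ∈ dom a b k) :
    (atl a b).LiftAt (theta a b) k c (thetaL k) :=
  liftAt_toCP hc (analyticAt_thetaL k c) (Eventually.of_forall fun _ _ => thetaL_prop)

lemma analyticAt_xyL {k : Idx} {c : ℂ × ℂ} (hc : c ∈ dom a b k) : AnalyticAt ℂ (xyL a b k) c := by
  rcases k with y₀ | m₀ | ⟨l, j⟩ | ⟨s, j⟩ | s | s | _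
  · exact analyticAt_vec3 analyticAt_fst (analyticAt_cY hc trivial) analyticAt_const
  · exact analyticAt_vec3 analyticAt_fst (analyticAt_cY hc trivial) analyticAt_const
  · exact analyticAt_vec3 (analyticAt_nodeX l c) (analyticAt_nodeY l j c) analyticAt_const
  · exact analyticAt_vec3 (analyticAt_torC c) (analyticAt_chQ hc)
      ((analyticAt_torC c).mul (analyticAt_chXi j c))
  · exact analyticAt_vec3 (analyticAt_fst.mul analyticAt_snd) analyticAt_const analyticAt_snd
  · exact analyticAt_vec3 analyticAt_const analyticAt_fst analyticAt_snd
  · exact analyticAt_vec3 analyticAt_fst ((analyticAt_midR hc.1).csqrt hc.2) (analyticAt_fst.pow 3)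

lemma xyL_prop {k : Idx} {c : ℂ × ℂ} : Proportional (xyL a b k c) (xyV (pt a b k c)) := by
  by_cases hA : isAff a b k c
  · rw [pt_of_isAff hA]
    rcases k with y₀ | m₀ | ⟨l, j⟩ | ⟨s, j⟩ | s | s | _
    · exact ⟨1, one_ne_zero, by simp [xyL, xyV]⟩
    · exact ⟨1, one_ne_zero, by simp [xyL, xyV]⟩
    · exact ⟨1, one_ne_zero, by simp [xyL, xyV]⟩
    · have h1 := hA.1
      have h2 := hA.2
      refine ⟨_, mul_ne_zero h1 h2, ?_⟩
      simp only [xyL, xyV, cX, cY, Matrix.smul_cons, smul_eq_mul, Matrix.smul_empty]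
      congr 1 <;> [skip; congr 1] <;> [skip; skip; simp]
      · field_simp
      · field_simp
    · have : c.2 ≠ 0 := hA
      exact ⟨_, this, by simp [xyL, xyV, cX, cY, this, mul_comm]⟩
    · have : c.2 ≠ 0 := hA
      refine ⟨_, this, ?_⟩
      simp [xyL, xyV, cX, cY, this]
      field_simp
    · have : c.1 ≠ 0 := hA
      refine ⟨_, pow_ne_zero 3 this, ?_⟩
      simp only [xyL, xyV, cX, cY, Matrix.smul_cons, smul_eq_mul, Matrix.smul_empty]
      congr 1 <;> [skip; congr 1] <;> [skip; skip; simp]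
      · field_simp
      · field_simp
  · rw [pt_of_not_isAff hA]
    rcases k with y₀ | m₀ | ⟨l, j⟩ | ⟨s, j⟩ | s | s | _
    · exact absurd trivial hA
    · exact absurd trivial hA
    · simp only [isAff, not_not] at hA
      refine ⟨1, one_ne_zero, ?_⟩
      have : torC c = 0 := by
        by_contra h; exact torA_ne_zero_of_torC h hA.1
      simp [xyL, xyV, special, cX, cY, nodeX, nodeY, nodeB, this, hA.1, hA.2]
    · simp only [isAff, not_and_or, not_not] at hA
      have hQ : chQ a b j c ≠ 0 := csqrt_ne_zero _
      rcases special_chain (a := a) (b := b) s j c with h | h | h | h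
      · rw [h.2]
        refine ⟨_, h.1, ?_⟩
        have := h.1
        simp [xyL, xyV, hA.resolve_left h.1]
        field_simp
      · rw [h.2.2]
        exact ⟨_, hQ, by simp [xyL, xyV, h.1]⟩
      · rw [h.2.2.2]
        exact ⟨_, hQ, by simp [xyL, xyV, h.1]⟩
      · rw [h.2.2.2]
        exact ⟨_, hQ, by simp [xyL, xyV, h.1]⟩
    · exact ⟨1, one_ne_zero, by simp [xyL, xyV, special, not_not.1 hA]⟩
    · exact ⟨1, one_ne_zero, by simp [xyL, xyV, special, not_not.1 hA]⟩
    · exact ⟨_, csqrt_ne_zero (midR a b c), by simp [xyL, xyV, special, not_not.1 hA]⟩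

lemma analyticAt_sideV {s : Bool} {f : ℂ × ℂ → ℂ} {c : ℂ × ℂ} (hf : AnalyticAt ℂ f c)
    (h : f c ∈ jouDom) : AnalyticAt ℂ (fun c => sideV s (f c)) c := by
  cases s
  · exact analyticAt_vec2 analyticAt_const (hf.jou h)
  · exact analyticAt_vec2 (hf.jou h) analyticAt_const

lemma analyticAt_zL {k : Idx} {c : ℂ × ℂ} (hc : c ∈ dom a b k) : AnalyticAt ℂ (zL a b k) c := by
  rcases k with y₀ | m₀ | ⟨l, j⟩ | ⟨s, j⟩ | s | s | _
  · exact analyticAt_vec2 (analyticAt_cZ hc trivial) analyticAt_const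
  · exact analyticAt_vec2 (analyticAt_cZ hc trivial) analyticAt_const
  · exact analyticAt_vec2 (analyticAt_nodeZ hc) analyticAt_const
  · exact analyticAt_sideV (analyticAt_chW (fT_chXi_ne_zero hc)) hc.2.2
  · exact analyticAt_sideV (analyticAt_secW hc.1) hc.2
  · exact analyticAt_sideV (analyticAt_tailW hc.1) hc.2
  · exact analyticAt_vec2 analyticAt_snd analyticAt_const

lemma sideV_prop {s : Bool} {w : ℂ} (hw : w ∈ jouDom) (h0 : w ≠ 0) :
    Proportional (sideV s w) ![zside s w, 1] := by
  have := (jou_eq_zero hw).not.2 h0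
  cases s
  · exact ⟨_, this, by simp [sideV, zside, this]⟩
  · exact ⟨1, one_ne_zero, by simp [sideV, zside]⟩

lemma zL_prop {k : Idx} {c : ℂ × ℂ} (hc : c ∈ dom a b k) :
    Proportional (zL a b k c) (zV a b (pt a b k c)) := by
  by_cases hA : isAff a b k c
  · rw [pt_of_isAff hA]
    rcases k with y₀ | m₀ | ⟨l, j⟩ | ⟨s, j⟩ | s | s | _
    · exact ⟨1, one_ne_zero, by simp [zL, zV]⟩
    · exact ⟨1, one_ne_zero, by simp [zL, zV]⟩
    · exact ⟨1, one_ne_zero, by simp [zL, zV]⟩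
    · exact sideV_prop hc.2.2 (chW_ne_zero hc hA)
    · exact sideV_prop hc.2 (secW_ne_zero hc hA)
    · exact sideV_prop hc.2 (tailW_ne_zero hc hA)
    · exact ⟨1, one_ne_zero, by simp [zL, zV]⟩
  · rw [pt_of_not_isAff hA]
    have s0 : ∀ s : Bool, sideV s 0 = if s then ![0, 1] else ![1, 0] := by
      intro s; cases s <;> simp [sideV]
    rcases k with y₀ | m₀ | ⟨l, j⟩ | ⟨s, j⟩ | s | s | _
    · exact absurd trivial hA
    · exact absurd trivial hA
    · simp only [isAff, not_not] at hA
      refine ⟨1, one_ne_zero, ?_⟩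
      have h1 : csqrt 1 = 1 := csqrt_eq_of_sq (by simp) (by simp)
      simp [zL, zV, special, cZ, nodeZ, nodeT, nodeD, nodeB, hA.1, hA.2, h1]
    · simp only [isAff, not_and_or, not_not] at hA
      rcases special_chain (a := a) (b := b) s j c with h | h | h | h
      · rw [h.2]
        have h1 := chW_mul (a := a) (b := b) hc.1 (fT_chXi_ne_zero hc)
        rw [hA.resolve_left h.1] at h1
        have h2 : chW a b j c = 0 := by
          refine (mul_eq_zero.1 (h1.trans (by simp))).resolve_right
            (mul_ne_zero (mul_ne_zero two_ne_zero (by simp [fT_zero])) (torA_ne_zero_of_torC h.1))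
        exact ⟨1, one_ne_zero, by simp [zL, zV, h2, s0]⟩
      · rw [h.2.2]
        have h2 : chW a b j c = 0 := by
          rw [chW_eq hc.1 (fT_chXi_ne_zero hc) h.2.1, h.1]; simp
        exact ⟨1, one_ne_zero, by simp [zL, zV, h2, s0]⟩
      · rw [h.2.2.2]
        refine sideV_prop hc.2.2 ?_
        rw [chW, h.1, h.2.1]
        refine div_ne_zero (by simpa using h.2.2.1) (mul_ne_zero two_ne_zero (fT_chXi_ne_zero hc))
      · rw [h.2.2.2]
        have h2 : chW a b j c = 0 := by
          rw [chW, h.1, h.2.1, h.2.2.1]; simp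
        exact ⟨1, one_ne_zero, by simp [zL, zV, h2, s0]⟩
    · exact ⟨1, one_ne_zero, by simp [zL, zV, special, secW, not_not.1 hA, s0]⟩
    · exact ⟨1, one_ne_zero, by simp [zL, zV, special, tailW, not_not.1 hA, s0]⟩
    · exact ⟨1, one_ne_zero, by simp [zL, zV, special, cZ]⟩

lemma isHolomorphicToCP_theta : IsHolomorphicToCP (theta a b) :=
  ParamAtlas.isHolomorphicToCP_of_liftAt fun _ _ hc => ⟨_, liftAt_theta hc⟩

lemma isHolomorphicToCP_xy : IsHolomorphicToCP (toCP (a := a) (b := b) xyV xyV_ne_zero) :=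
  ParamAtlas.isHolomorphicToCP_of_liftAt fun _ _ hc =>
    ⟨_, liftAt_toCP hc (analyticAt_xyL hc) (Eventually.of_forall fun _ _ => xyL_prop)⟩

lemma isHolomorphicToCP_z : IsHolomorphicToCP (toCP (a := a) (b := b) (zV a b) zV_ne_zero) :=
  ParamAtlas.isHolomorphicToCP_of_liftAt fun _ _ hc =>
    ⟨_, liftAt_toCP hc (analyticAt_zL hc) (Eventually.of_forall fun _ => zL_prop)⟩

/-! ### The Hausdorff property -/

/-- Hausdorff criterion for a gluing: two points are separated if the identifications between their
charts lie in a closed relation that does not contain the pair. -/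
lemma _root_.Inose.ParamAtlas.disjoint_nhds {X K : Type} {𝒜 : ParamAtlas X K} {k l : K}
    {c d : ℂ × ℂ} (hc : c ∈ 𝒜.U k) (hd : d ∈ 𝒜.U l) {R : Set ((ℂ × ℂ) × (ℂ × ℂ))}
    (hR : IsClosed R) (h : ∀ c' ∈ 𝒜.U k, ∀ d' ∈ 𝒜.U l, 𝒜.par k c' = 𝒜.par l d' → (c', d') ∈ R)
    (hcd : (c, d) ∉ R) : Disjoint (𝓝 (𝒜.par k c)) (𝓝 (𝒜.par l d)) := by
  have h1 : Rᶜ ∈ 𝓝 (c, d) := hR.isOpen_compl.mem_nhds hcd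
  rw [nhds_prod_eq, mem_prod_iff] at h1
  obtain ⟨s, hs, t, ht, hst⟩ := h1
  rw [ParamAtlas.nhds_par hc, ParamAtlas.nhds_par hd, Filter.disjoint_iff]
  refine ⟨_, image_mem_map (inter_mem hs (ParamAtlas.U_mem_nhds hc)), _,
    image_mem_map (inter_mem ht (ParamAtlas.U_mem_nhds hd)), ?_⟩
  rw [Set.disjoint_left]
  rintro _ ⟨c', hc', rfl⟩ ⟨d', hd', e⟩
  exact hst ⟨hc'.1, hd'.1⟩ (h c' hc'.2 d' hd'.2 e.symm)

/-- The relation between the coordinates in two charts of the resolution of `A B = C ^ n`. -/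
def torRel (k : ℕ) : Set ((ℂ × ℂ) × (ℂ × ℂ)) :=
  {p | p.2.2 * (p.1.1 * (p.1.1 * p.1.2) ^ k) = 1 ∧ p.1.1 * p.1.2 = p.2.1 * p.2.2}

lemma isClosed_torRel (k : ℕ) : IsClosed (torRel k) :=
  (isClosed_eq (by fun_prop) (by fun_prop)).inter (isClosed_eq (by fun_prop) (by fun_prop))

lemma tseq_eq_of_torRel {j k : ℕ} {c d : ℂ × ℂ} (h : (c, d) ∈ torRel k) :
    tseq j c = tseq (j + k + 1) d := by
  obtain ⟨h1, h2⟩ := h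
  simp only at h1 h2
  have h3 : c.1 * (c.1 * c.2) ^ k ≠ 0 := right_ne_zero_of_mul (h1 ▸ one_ne_zero)
  rw [← tseq_up h3]
  congr 1
  have e2 : (c.1 * (c.1 * c.2) ^ k)⁻¹ = d.2 := inv_eq_of_mul_eq_one_left h1
  refine Prod.ext ?_ e2
  simp only [pow_succ]
  linear_combination (c.1 * (c.1 * c.2) ^ k) * h2 + d.1 * h1

lemma torRel_of_tseq_eq {j k : ℕ} {c d : ℂ × ℂ} (h : tseq j c = tseq (j + k + 1) d) :
    (c, d) ∈ torRel k := by
  have h1 := congrFun h (j + k + 1)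
  rw [tseq_self, tseq_of_lt (by omega), show j + k + 1 - j - 1 = k by omega, oinv_eq_some] at h1
  have h2 := congrFun h (j + k + 1 + 1)
  rw [tseq_succ, tseq_of_lt (by omega)] at h2
  have h2 := oinv_injective h2
  rw [show j + k + 1 + 1 - j - 1 = k + 1 by omega] at h2
  constructor
  · simp only [h1.2, inv_mul_cancel₀ h1.1]
  · simp only [← h2, h1.2, pow_succ]
    have := h1.1
    have hv := left_ne_zero_of_mul this
    have hk := right_ne_zero_of_mul this
    field_simp

/-- Where C ≠ 0, equality of A in the two charts becomes v'uCᵏ = 1 after cancelling C^(j+1). -/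
lemma torRel_of_torC {j k : ℕ} {c d : ℂ × ℂ} (h0 : torC c ≠ 0) (hC : torC c = torC d)
    (hA : torA j c = torA (j + k + 1) d) : (c, d) ∈ torRel k := by
  refine ⟨?_, hC⟩
  rw [torA, torA] at hA
  rw [torC] at h0
  rw [torC, torC] at hC
  simp only
  rw [← hC] at hA
  apply mul_right_cancel₀ (pow_ne_zero (j + 1) h0)
  generalize hp : c.1 * c.2 = p at *
  have : d.2 * (c.1 * p ^ k) * p ^ (j + 1) = c.1 * (d.2 * p ^ (j + k + 1)) := by ring
  rw [this, ← hA, ← mul_assoc, hp]; ring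

/-- All identifications between two charts of one node, affine or exceptional, satisfy the
polynomial relation `torRel`, which is closed even though the transition map is only partially
defined. -/
lemma torRel_of_node {l : ℂ} {j k : ℕ} {c d : ℂ × ℂ} (hc : c ∈ dom a b (.node l j))
    (hd : d ∈ dom a b (.node l (j + k + 1)))
    (h : pt a b (.node l j) c = pt a b (.node l (j + k + 1)) d) : (c, d) ∈ torRel k := by
  by_cases hA : isAff a b (.node l j) c
  · have hB : isAff a b (.node l (j + k + 1)) d := by
      rw [isAff_iff, ← h, ← isAff_iff]; exact hA
    rw [pt_of_isAff hA, pt_of_isAff hB, Pt.aff.injEq] at h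
    obtain ⟨eX, eY, eZ⟩ := h
    simp only [cX, cY, cZ] at eX eY eZ
    obtain ⟨h1, h2⟩ := nodeT_re_pos hc
    obtain ⟨h3, h4⟩ := nodeT_re_pos hd
    have hε : fP a b l ≠ 0 := by
      have := hc.1
      intro h'; rw [h'] at this; norm_num at this
    have h5 : nodeT a b l j c ^ 2 = nodeT a b l (j + k + 1) d ^ 2 := by
      rw [nodeZ, nodeZ] at eZ
      exact mul_left_cancel₀ (neg_ne_zero.2 hε) eZ
    have h6 : nodeT a b l j c = nodeT a b l (j + k + 1) d := by
      rw [← csqrt_eq_of_sq h1 h5, csqrt_eq_of_sq h3 rfl]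
    have h7 : nodeD a b l j c = nodeD a b l (j + k + 1) d := by
      rw [h6, h4] at h2
      exact (mul_left_cancel₀ two_ne_zero h2).symm
    have hC : torC c = torC d := add_left_cancel eX
    have hA' : torA j c = torA (j + k + 1) d := by rw [← nodeY_sub, ← nodeY_sub, eY, h7]
    have hB' : nodeB a b l j c = nodeB a b l (j + k + 1) d := by
      rw [← nodeY_add, ← nodeY_add, eY, h7]
    refine torRel_of_torC (j := j) ?_ hC hA'
    -- If C = 0, then A vanishes because the second chart has positive index, and B vanishes because
    -- the first chart is not the last one; so the point would be exceptional.
    intro h0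
    apply hA
    constructor
    · rw [hA', torA, show d.1 * d.2 = 0 by rw [← h0, hC]; rfl, zero_pow (by omega), mul_zero]
    · have := hd.2.1
      rw [torB, show c.1 * c.2 = 0 from h0, zero_pow (by omega), mul_zero]
  · have hB : ¬isAff a b (.node l (j + k + 1)) d := by
      rw [isAff_iff, ← h, ← isAff_iff]; exact hA
    rw [pt_of_not_isAff hA, pt_of_not_isAff hB] at h
    simp only [special, Pt.exc.injEq, true_and] at h
    exact torRel_of_tseq_eq h

lemma torRel_of_chain {s : Bool} {j k : ℕ} {c d : ℂ × ℂ} (hd : d ∈ dom a b (.chain s (j + k + 1)))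
    (h : pt a b (.chain s j) c = pt a b (.chain s (j + k + 1)) d) : (c, d) ∈ torRel k := by
  by_cases hA : isAff a b (.chain s j) c
  · have hB : isAff a b (.chain s (j + k + 1)) d := by
      rw [isAff_iff, ← h, ← isAff_iff]; exact hA
    rw [pt_of_isAff hA, pt_of_isAff hB, Pt.aff.injEq] at h
    obtain ⟨eX, eY, -⟩ := h
    simp only [cX, cY] at eX eY
    have eξ : chXi j c = chXi (j + k + 1) d := inv_injective eX
    have eQ : chQ a b j c = chQ a b (j + k + 1) d := by rw [chQ, chQ, eξ]
    have eS : torC c = torC d := by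
      rw [eξ, eQ] at eY
      have h0 : chQ a b (j + k + 1) d ≠ 0 := csqrt_ne_zero _
      have h1 := hA.1
      have h2 := hB.1
      have h3 := hB.2
      field_simp at eY
      exact eY.symm
    refine torRel_of_torC (j := j) hA.1 eS ?_
    rw [chXi, chXi, eS] at eξ
    exact add_right_cancel eξ
  · have hB : ¬isAff a b (.chain s (j + k + 1)) d := by
      rw [isAff_iff, ← h, ← isAff_iff]; exact hA
    rw [pt_of_not_isAff hA, pt_of_not_isAff hB] at h
    simp only [isAff, not_and_or, not_not] at hA hB
    simp only [special] at h
    split_ifs at h with h1 h2 h3 h4 h5 h6 h7 h8 h9 h10 h11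
    · have e1 := hA.resolve_left h1
      have e2 := hB.resolve_left h2
      simp only [Pt.tail.injEq, true_and, chQ, e1, e2] at h
      have h0 := csqrt_ne_zero (fT a b 0)
      have eS : torC c = torC d := by
        field_simp at h
        exact h.symm
      refine torRel_of_torC (j := j) h1 eS ?_
      rw [chXi] at e1 e2
      rw [eS] at e1
      linear_combination e1 - e2
    · exfalso
      simp only [not_not] at h6
      apply h7
      rw [torA, show d.1 * d.2 = 0 from h6, zero_pow (by omega), mul_zero]
    · exfalso
      simp only [not_not] at *
      have := hd.1
      refine absurd ?_ ‹torB 8 j c ≠ 0›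
      rw [torB, show c.1 * c.2 = 0 from h1, zero_pow (by omega), mul_zero]
    · simp only [Pt.inf.injEq, true_and] at h
      exact torRel_of_tseq_eq h

lemma par_eq_iff {k l : Idx} {c d : ℂ × ℂ} (hc : c ∈ dom a b k) (hd : d ∈ dom a b l) :
    (atl a b).par k c = (atl a b).par l d ↔ pt a b k c = pt a b l d :=
  ⟨fun h => by rw [← toPt_par hc, h, toPt_par hd], par_eq_par hc hd⟩

lemma disjoint_nhds_of_torRel {κ : ℕ → Idx} (hκ : ∀ j k c d, c ∈ dom a b (κ j) →
      d ∈ dom a b (κ (j + k + 1)) → pt a b (κ j) c = pt a b (κ (j + k + 1)) d → (c, d) ∈ torRel k)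
    {j j' : ℕ} {c d : ℂ × ℂ} (hc : c ∈ dom a b (κ j)) (hd : d ∈ dom a b (κ j'))
    (h : tseq j c ≠ tseq j' d) :
    Disjoint (𝓝 ((atl a b).par (κ j) c)) (𝓝 ((atl a b).par (κ j') d)) := by
  rcases lt_trichotomy j j' with hj | rfl | hj
  · obtain ⟨k, rfl⟩ : ∃ k, j' = j + k + 1 := ⟨j' - j - 1, by omega⟩
    exact ParamAtlas.disjoint_nhds hc hd (isClosed_torRel k)
      (fun c' hc' d' hd' e => hκ j k c' d' hc' hd' ((par_eq_iff hc' hd').1 e))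
      fun h' => h (tseq_eq_of_torRel h')
  · refine ParamAtlas.disjoint_nhds hc hd (isClosed_diagonal) ?_ ?_
    · intro c' hc' d' hd' e
      exact ParamAtlas.injOn_par _ hc' hd' e
    · intro h'
      apply h
      rw [show c = d from h']
  · obtain ⟨k, rfl⟩ : ∃ k, j = j' + k + 1 := ⟨j - j' - 1, by omega⟩
    exact (ParamAtlas.disjoint_nhds hd hc (isClosed_torRel k)
      (fun c' hc' d' hd' e => hκ j' k c' d' hc' hd' ((par_eq_iff hc' hd').1 e))
      fun h' => h (tseq_eq_of_torRel h').symm).symm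

lemma exists_pt (p : Surf a b) : ∃ k, ∃ c ∈ dom a b k, (atl a b).par k c = p :=
  ParamAtlas.exists_par p

lemma affPt_of_toPt {p : Surf a b} {x y z : ℂ} (h : toPt p = .aff x y z) : AffPt a b x y z := by
  obtain ⟨k, c, hc, rfl⟩ := exists_pt p
  rw [toPt_par hc] at h
  have hA : isAff a b k c := isAff_iff.2 ⟨x, y, z, h⟩
  rw [pt_of_isAff hA, Pt.aff.injEq] at h
  obtain ⟨rfl, rfl, rfl⟩ := h
  exact affPt_of_isAff hc hA

lemma exists_node_of_toPt {p : Surf a b} {l : ℂ} {ρ : ℕ → Option ℂ} (h : toPt p = .exc l ρ) :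
    ∃ j, ∃ c ∈ dom a b (.node l j), (atl a b).par (.node l j) c = p ∧ tseq j c = ρ ∧
      torA j c = 0 ∧ torB (nmult a b l) j c = 0 := by
  obtain ⟨k, c, hc, rfl⟩ := exists_pt p
  rw [toPt_par hc] at h
  have hA : ¬isAff a b k c := by rw [isAff_iff, h]; simp
  rw [pt_of_not_isAff hA] at h
  obtain ⟨j, rfl, h1⟩ := special_eq_exc h
  simp only [isAff, not_not] at hA
  exact ⟨j, c, hc, rfl, h1, hA⟩

lemma exists_chain_of_toPt {p : Surf a b} {s : Bool} {ρ : ℕ → Option ℂ} (h : toPt p = .inf s ρ) :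
    ∃ j, ∃ c ∈ dom a b (.chain s j), (atl a b).par (.chain s j) c = p ∧ tseq j c = ρ ∧
      torC c = 0 ∧ torA j c = 0 ∧ torB 8 j c = 0 := by
  obtain ⟨k, c, hc, rfl⟩ := exists_pt p
  rw [toPt_par hc] at h
  have hA : ¬isAff a b k c := by rw [isAff_iff, h]; simp
  rw [pt_of_not_isAff hA] at h
  obtain ⟨j, rfl, h1⟩ := special_eq_inf h
  exact ⟨j, c, hc, rfl, h1⟩

lemma mid_ne_zero {p : Surf a b} {z : ℂ} (h : toPt p = .mid z) : z ≠ 0 := by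
  obtain ⟨k, c, hc, rfl⟩ := exists_pt p
  rw [toPt_par hc] at h
  have hA : ¬isAff a b k c := by rw [isAff_iff, h]; simp
  rw [pt_of_not_isAff hA] at h
  rcases k with y₀ | m₀ | ⟨l, j⟩ | ⟨s, j⟩ | s | s | _
  · exact absurd trivial hA
  · exact absurd trivial hA
  · simp [special] at h
  · rcases special_chain (a := a) (b := b) s j c with h' | h' | h' | h'
    · rw [h'.2] at h; cases h
    · rw [h'.2.2] at h; cases h
    · rw [h'.2.2.2] at h; cases h
      refine zside_ne_zero hc.2.2 ?_
      rw [chW, h'.1, h'.2.1]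
      exact div_ne_zero (by simpa using h'.2.2.1) (mul_ne_zero two_ne_zero (fT_chXi_ne_zero hc))
    · rw [h'.2.2.2] at h; cases h
  · simp [special] at h
  · simp [special] at h
  · simp only [special, Pt.mid.injEq] at h
    exact h ▸ hc.1

lemma toCP_eq_iff {n : ℕ} {V : Pt → Fin (n + 1) → ℂ} {hV : ∀ p, V p ≠ 0} {p q : Surf a b} :
    toCP V hV p = toCP V hV q ↔ ∃ t : ℂ, t • V (toPt q) = V (toPt p) :=
  Projectivization.mk_eq_mk_iff' ℂ _ _ _ _

/-- The affine coordinates and the positions on sections, tails and middle curve are visible in one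
of the three projections. Only the position on the exceptional curves over one node, or on one chain
at infinity, is lost. Affine labels cannot collide with nodes since `AffPt` excludes y = 0, z² = 1.
-/
lemma eq_or_of_separate {p q : Surf a b} (h1 : theta a b p = theta a b q)
    (h2 : toCP (a := a) (b := b) xyV xyV_ne_zero p = toCP xyV xyV_ne_zero q)
    (h3 : toCP (a := a) (b := b) (zV a b) zV_ne_zero p = toCP (zV a b) zV_ne_zero q) :
    p = q ∨ (∃ l ρ ρ', toPt p = .exc l ρ ∧ toPt q = .exc l ρ') ∨
      ∃ s ρ ρ', toPt p = .inf s ρ ∧ toPt q = .inf s ρ' := by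
  rw [theta, toCP_eq_iff] at h1
  rw [toCP_eq_iff] at h2 h3
  obtain ⟨t₁, h1⟩ := h1
  obtain ⟨t₂, h2⟩ := h2
  obtain ⟨t₃, h3⟩ := h3
  rcases hp : toPt p with ⟨x, y, z⟩ | ⟨l, ρ⟩ | ⟨s, x⟩ | ⟨s, σ⟩ | ⟨s, ρ⟩ | z <;>
  rcases hq : toPt q with ⟨x', y', z'⟩ | ⟨l', ρ'⟩ | ⟨s', x'⟩ | ⟨s', σ'⟩ | ⟨s', ρ'⟩ | z' <;>
  rw [hp, hq] at h1 h2 h3 <;>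
  simp only [thetaV, xyV, zV, funext_iff, Fin.forall_fin_succ, Pi.smul_apply, smul_eq_mul] at h1 h2 h3 <;>
  simp at h1 h2 <;> try (first | cases s | skip) <;> try (first | cases s' | skip) <;> simp at h3
  all_goals first
    | (exfalso; have := mid_ne_zero hp; grind)
    | (exfalso; have := mid_ne_zero hq; grind)
    | (exfalso; grind)
    | (left; apply toPt_injective; rw [hp, hq]; grind)
    | (exfalso; have := (affPt_of_toPt hp).2.2
       obtain ⟨_, _, hc, _⟩ := exists_node_of_toPt hq
       have := hc.1; grind)
    | (exfalso; have := (affPt_of_toPt hq).2.2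
       obtain ⟨_, _, hc, _⟩ := exists_node_of_toPt hp
       have := hc.1; grind)
    | (right; left; exact ⟨l, ρ, ρ', rfl, by grind⟩)
    | (right; right; exact ⟨_, ρ, ρ', rfl, rfl⟩)

instance : T2Space (Surf a b) := by
  rw [t2Space_iff_disjoint_nhds]
  intro p q hpq
  by_cases h1 : theta a b p = theta a b q
  swap
  · exact ParamAtlas.exists_disjoint_nhds_of_ne isHolomorphicToCP_theta h1
  by_cases h2 : toCP (a := a) (b := b) xyV xyV_ne_zero p = toCP xyV xyV_ne_zero q
  swap
  · exact ParamAtlas.exists_disjoint_nhds_of_ne isHolomorphicToCP_xy h2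
  by_cases h3 : toCP (a := a) (b := b) (zV a b) zV_ne_zero p = toCP (zV a b) zV_ne_zero q
  swap
  · exact ParamAtlas.exists_disjoint_nhds_of_ne isHolomorphicToCP_z h3
  rcases eq_or_of_separate h1 h2 h3 with h | ⟨l, ρ, ρ', hp, hq⟩ | ⟨s, ρ, ρ', hp, hq⟩
  · exact absurd h hpq
  · obtain ⟨j, c, hc, rfl, e, -⟩ := exists_node_of_toPt hp
    obtain ⟨j', d, hd, rfl, e', -⟩ := exists_node_of_toPt hq
    refine disjoint_nhds_of_torRel (κ := fun j => .node l j)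
      (fun j k c d hc hd h => torRel_of_node hc hd h) hc hd ?_
    rintro h
    apply hpq
    apply toPt_injective
    rw [hp, hq, ← e, ← e', h]
  · obtain ⟨j, c, hc, rfl, e, -⟩ := exists_chain_of_toPt hp
    obtain ⟨j', d, hd, rfl, e', -⟩ := exists_chain_of_toPt hq
    refine disjoint_nhds_of_torRel (κ := fun j => .chain s j)
      (fun j k c d hc hd h => torRel_of_chain hd h) hc hd ?_
    rintro h
    apply hpq
    apply toPt_injective
    rw [hp, hq, ← e, ← e', h]

/-! ### Generic points -/

/-- If f took values in the finite set F near c, continuity would make it locally constant, hence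
constant by the identity theorem. -/
lemma dense_notMem_finite {f : ℂ × ℂ → ℂ} (hf : ∀ c, AnalyticAt ℂ f c) {c₁ c₂ : ℂ × ℂ}
    (h : f c₁ ≠ f c₂) {F : Set ℂ} (hF : F.Finite) : Dense {c | f c ∉ F} := by
  intro c
  rw [mem_closure_iff_frequently]
  intro hev
  simp only [not_not, mem_ofPred_eq] at hev
  have h1 : ∀ᶠ c' in 𝓝 c, f c' ∉ F \ {f c} :=
    (hf c).continuousAt.eventually ((hF.sdiff).isClosed.isOpen_compl.mem_nhds (by simp))
  have h2 : f =ᶠ[𝓝 c] fun _ => f c := by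
    filter_upwards [hev, h1] with c' h3 h4
    by_contra h5
    exact h4 ⟨h3, h5⟩
  have h3 := AnalyticOnNhd.eq_of_eventuallyEq (f := f) (g := fun _ => f c) (fun c _ => hf c)
    (fun _ _ => analyticAt_const) h2
  rw [h3] at h
  exact h rfl

lemma isOpen_notMem_finite {f : ℂ × ℂ → ℂ} (hf : ∀ c, AnalyticAt ℂ f c) {F : Set ℂ}
    (hF : F.Finite) : IsOpen {c | f c ∉ F} :=
  hF.isClosed.isOpen_compl.preimage
    (continuous_iff_continuousAt.2 fun c => (hf c).continuousAt)

lemma finite_singSet : (singSet a b).Finite := by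
  have h : (poly a b ^ 2 - 1) ≠ 0 := by
    intro h
    have h1 : (poly a b).natDegree = 3 := by unfold poly; compute_degree!
    have h2 := congrArg Polynomial.natDegree (sub_eq_zero.1 h)
    rw [Polynomial.natDegree_pow, h1, Polynomial.natDegree_one] at h2
    norm_num at h2
  refine (Polynomial.finite_setOfPred_isRoot h).subset ?_
  intro l hl
  have hl : (poly a b).eval l ^ 2 = 1 := hl
  change Polynomial.eval l _ = 0
  rw [Polynomial.eval_sub, Polynomial.eval_pow, hl]
  simp

lemma mem_singSet {l : ℂ} : l ∈ singSet a b ↔ fP a b l ^ 2 = 1 := by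
  rw [singSet, mem_ofPred_eq, eval_poly]

/-- The points of the affine part over which the alternate fibration is smooth. -/
def IsGen (a b : ℂ) (p : Pt) : Prop :=
  ∃ x y z, p = .aff x y z ∧ x ∉ singSet a b

lemma dense_isGen_chart {k : Idx} : Dense {c | isAff a b k c ∧ cX k c ∉ singSet a b} := by
  have hF : (singSet a b).Finite := finite_singSet
  have h0 : ({0} : Set ℂ).Finite := finite_singleton 0
  have hF' : ((fun x => x⁻¹) '' singSet a b ∪ {0}).Finite := (hF.image _).union h0
  have hfst : ∀ c : ℂ × ℂ, AnalyticAt ℂ (fun c : ℂ × ℂ => c.1) c := fun c => analyticAt_fst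
  have hsnd : ∀ c : ℂ × ℂ, AnalyticAt ℂ (fun c : ℂ × ℂ => c.2) c := fun c => analyticAt_snd
  have e1 : (fun c : ℂ × ℂ => c.1) (0, 0) ≠ (fun c : ℂ × ℂ => c.1) (1, 1) := zero_ne_one
  have e2 : (fun c : ℂ × ℂ => c.2) (0, 0) ≠ (fun c : ℂ × ℂ => c.2) (1, 1) := zero_ne_one
  have hinv : ∀ ξ : ℂ, ξ ∉ (fun x => x⁻¹) '' singSet a b ∪ {0} → ξ ≠ 0 ∧ ξ⁻¹ ∉ singSet a b := by
    intro ξ h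
    exact ⟨fun h' => h (Or.inr h'), fun h' => h (Or.inl ⟨_, h', inv_inv _⟩)⟩
  rcases k with y₀ | m₀ | ⟨l, j⟩ | ⟨s, j⟩ | s | s | _
  · exact (dense_notMem_finite hfst e1 hF).mono fun c hc => ⟨trivial, hc⟩
  · exact (dense_notMem_finite hfst e1 hF).mono fun c hc => ⟨trivial, hc⟩
  · have hC : ∀ c, AnalyticAt ℂ torC c := analyticAt_torC
    have eC : torC (0, 0) ≠ torC (1, 1) := by simp [torC]
    refine ((dense_notMem_finite hC eC h0).inter_of_isOpen_left
      (dense_notMem_finite (c₁ := (0, 0)) (c₂ := (1, 1)) (f := nodeX l) (analyticAt_nodeX l)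
        (by simpa [nodeX] using eC) hF) (isOpen_notMem_finite hC h0)).mono ?_
    rintro c ⟨h1, h2⟩
    exact ⟨fun h => torA_ne_zero_of_torC h1 h.1, h2⟩
  · have hC : ∀ c, AnalyticAt ℂ torC c := analyticAt_torC
    have eC : torC (0, 0) ≠ torC (1, 1) := by simp [torC]
    refine ((dense_notMem_finite hC eC h0).inter_of_isOpen_left
      (dense_notMem_finite (c₁ := (0, 0)) (c₂ := (1, 1)) (f := chXi j) (analyticAt_chXi j)
        (by norm_num [chXi, torA, torC]) hF') (isOpen_notMem_finite hC h0)).mono ?_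
    rintro c ⟨h1, h2⟩
    obtain ⟨h3, h4⟩ := hinv _ h2
    exact ⟨⟨h1, h3⟩, h4⟩
  · refine ((dense_notMem_finite hsnd e2 h0).inter_of_isOpen_left
      (dense_notMem_finite hfst e1 hF) (isOpen_notMem_finite hsnd h0)).mono ?_
    rintro c ⟨h1, h2⟩
    exact ⟨h1, h2⟩
  · refine (dense_notMem_finite hsnd e2 hF').mono ?_
    intro c h
    exact hinv _ h
  · refine (dense_notMem_finite (f := fun c => c.1 ^ 2) (c₁ := (0, 0)) (c₂ := (1, 1))
      (fun c => analyticAt_fst.pow 2) (by simp) hF').mono ?_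
    intro c h
    obtain ⟨h1, h2⟩ := hinv _ h
    exact ⟨fun h' => h1 (by simp [show c.1 = 0 from h']), h2⟩

lemma dense_isGen : Dense {p : Surf a b | IsGen a b (toPt p)} := by
  intro p
  obtain ⟨k, c, hc, rfl⟩ := exists_pt p
  rw [mem_closure_iff_frequently]
  intro hev
  rw [ParamAtlas.eventually_par hc] at hev
  refine (mem_closure_iff_frequently.1 (dense_isGen_chart (a := a) (b := b) (k := k) c)) ?_
  filter_upwards [hev, (isOpen_dom k).mem_nhds hc] with c' h1 h2 h3
  apply h1
  exact ⟨cX k c', cY a b k c', cZ a b k c', by rw [toPt_par h2, pt_of_isAff h3.1], h3.2⟩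

/-! ### Recognizing points in the charts -/

lemma pt_eq_aff {k : Idx} {c : ℂ × ℂ} {x y z : ℂ} (hA : isAff a b k c) (hx : cX k c = x)
    (hy : cY a b k c = y) (hz : cZ a b k c = z) : pt a b k c = .aff x y z := by
  rw [pt_of_isAff hA, hx, hy, hz]

lemma pt_sec_eq {s : Bool} {x y z : ℂ} (h : AffPt a b x y z) (hy : y ≠ 0)
    (hd : 1 - (y⁻¹) ^ 2 * fP a b x ≠ 0) (hs : ‖if s then z else z⁻¹‖ < 1) :
    pt a b (.sec s) (x, y⁻¹) = .aff x y z := by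
  refine pt_eq_aff (show y⁻¹ ≠ 0 from inv_ne_zero hy) rfl (inv_inv y) ?_
  refine (zside_eq_of_fh ?_ h.1 hs).2
  have : fh z = y ^ 2 - fP a b x := by rw [h.2.1]; ring
  rw [this, secW]
  have h4 : y ^ 2 - fP a b x ≠ 0 := by
    intro h'; apply hd; field_simp; rw [h']; simp
  field_simp

lemma pt_tail_eq {s : Bool} {x y z : ℂ} (h : AffPt a b x y z) (hx : x ≠ 0)
    (hd : (y / x) ^ 2 * x⁻¹ - fT a b x⁻¹ ≠ 0) (hs : ‖if s then z else z⁻¹‖ < 1) :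
    pt a b (.tail s) (y / x, x⁻¹) = .aff x y z := by
  refine pt_eq_aff (show x⁻¹ ≠ 0 from inv_ne_zero hx) (inv_inv x)
    (by simp only [cY]; field_simp) ?_
  refine (zside_eq_of_fh ?_ h.1 hs).2
  have h5 : fh z = y ^ 2 - fT a b x⁻¹ * x ^ 3 := by
    have := fP_inv a b (inv_ne_zero hx)
    rw [inv_inv] at this
    rw [h.2.1, this]; field_simp; ring
  have h6 : fh z = ((y / x) ^ 2 * x⁻¹ - fT a b x⁻¹) * x ^ 3 := by
    rw [h5]; field_simp
  rw [h6, tailW]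
  simp only
  generalize (y / x) ^ 2 * x⁻¹ - fT a b x⁻¹ = t at hd ⊢
  field_simp

lemma pt_mid_eq {x y z : ℂ} (h : AffPt a b x y z) (hx : x ≠ 0) (hy : y ≠ 0) :
    pt a b .mid (csqrt (y ^ 2 / x ^ 3) * x / y, z) = .aff x y z := by
  set r := csqrt (y ^ 2 / x ^ 3) with hr
  have hr2 : r ^ 2 = y ^ 2 / x ^ 3 := csqrt_sq (by positivity)
  have hr0 : r ≠ 0 := csqrt_ne_zero _
  have e2 : (r * x / y) ^ 2 = x⁻¹ := by
    rw [div_pow, mul_pow, hr2]; field_simp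
  refine pt_eq_aff (show r * x / y ≠ 0 by positivity) ?_ ?_ rfl
  · simp only [cX, e2, inv_inv]
  · have e3 : midR a b (r * x / y, z) = y ^ 2 / x ^ 3 := by
      have := fP_inv a b (inv_ne_zero hx)
      rw [inv_inv] at this
      rw [midR]
      simp only [e2]
      rw [show (r * x / y) ^ 6 = ((r * x / y) ^ 2) ^ 3 by ring, e2, h.2.1, this]
      field_simp
    simp only [cY]
    rw [e3, ← hr, show (r * x / y) ^ 3 = (r * x / y) ^ 2 * (r * x / y) by ring, e2]
    field_simp

lemma pt_node_eq {l : ℂ} {j : ℕ} {c : ℂ × ℂ} {x y z t : ℂ} (hε : fP a b l ^ 2 = 1)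
    (ht : 0 < t.re) (htz : t ^ 2 = -fP a b l * z) (hC : torC c = x - l) (hxl : x ≠ l)
    (hA : torA j c = y - kap a b l * ((t - t⁻¹) / 2))
    (hB : nquo a b l x * torB (nmult a b l) j c = y + kap a b l * ((t - t⁻¹) / 2)) :
    pt a b (.node l j) c = .aff x y z := by
  have hk0 := kap_ne_zero a b l
  have ht0 : t ≠ 0 := by rintro rfl; simp at ht
  have f1 : nodeX l c = x := by rw [nodeX, hC]; ring
  have f2 : nodeB a b l j c = y + kap a b l * ((t - t⁻¹) / 2) := by rw [nodeB, f1, hB]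
  have f3 : nodeD a b l j c = (t - t⁻¹) / 2 := by
    rw [nodeD, f2, hA]; field_simp; ring
  have hC0 : torC c ≠ 0 := by rw [hC]; exact sub_ne_zero.2 hxl
  refine pt_eq_aff (fun h => torA_ne_zero_of_torC hC0 h.1) f1 ?_ ?_
  · simp only [cY]
    rw [nodeY, f2, hA]; ring
  · have hre : 0 < ((t + t⁻¹) / 2).re := by
      have : (t⁻¹).re = t.re / Complex.normSq t := Complex.inv_re _
      have h4 : 0 < (t⁻¹).re := this ▸ div_pos ht (Complex.normSq_pos.2 ht0)
      rw [show (t + t⁻¹) / 2 = (t + t⁻¹) / ((2 : ℝ) : ℂ) by simp,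
        Complex.div_ofReal_re, Complex.add_re]
      linarith
    have f4 : csqrt (1 + ((t - t⁻¹) / 2) ^ 2) = (t + t⁻¹) / 2 :=
      csqrt_eq_of_sq hre (by field_simp; ring)
    have f5 : nodeT a b l j c = t := by
      rw [nodeT, f3, f4]; ring
    simp only [cZ]
    rw [nodeZ, f5, htz]
    linear_combination z * hε

lemma pt_chain_eq {s : Bool} {j : ℕ} (hj : j < 8) {c : ℂ × ℂ} {x y z : ℂ} (h : AffPt a b x y z)
    (hx : x ≠ 0) (hT : fT a b x⁻¹ ≠ 0) (hξ : chXi j c = x⁻¹)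
    (hS : torC c * (y / x) = csqrt (fT a b x⁻¹)) (hs : ‖if s then z else z⁻¹‖ < 1) :
    pt a b (.chain s j) c = .aff x y z := by
  have hQ0 := csqrt_ne_zero (fT a b x⁻¹)
  have hQ : csqrt (fT a b x⁻¹) ^ 2 = fT a b x⁻¹ := csqrt_sq hT
  have hS0 : torC c ≠ 0 := left_ne_zero_of_mul (hS ▸ hQ0)
  have hy : y ≠ 0 := by rintro rfl; rw [zero_div, mul_zero] at hS; exact hQ0 hS.symm
  have hA0 := torA_ne_zero_of_torC (j := j) hS0
  refine pt_eq_aff ⟨hS0, by rw [hξ]; exact inv_ne_zero hx⟩ ?_ ?_ ?_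
  · simp only [cX, hξ, inv_inv]
  · simp only [cY, chQ, hξ, ← hS]
    field_simp
  · refine (zside_eq_of_fh ?_ h.1 hs).2
    have g1 := chW_mul (a := a) (b := b) hj (c := c) (by rw [hξ]; exact hT)
    rw [hξ] at g1
    have hA : torA j c = x⁻¹ - torC c ^ 2 := by rw [← hξ, chXi]; ring
    have g3 : fh z = y ^ 2 - fT a b x⁻¹ / (x⁻¹) ^ 3 := by
      rw [← fP_inv a b (inv_ne_zero hx), inv_inv, h.2.1]; ring
    have g4 : fh z * (torC c ^ 2 * (x⁻¹) ^ 3) = fT a b x⁻¹ * torA j c := by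
      rw [← hS] at hQ
      rw [g3, hA]; field_simp
      field_simp at hQ
      linear_combination hQ
    apply mul_right_cancel₀ (mul_ne_zero hT hA0)
    linear_combination fh z * g1 + g4

/-! ### Compactness -/

/-- Given an ultrafilter U, the open members of U together with D generate a proper filter; an
ultrafilter refining it contains D and converges to some x. If a closed neighbourhood of x were not
in U, its open complement would be, contradicting that convergence. Regularity supplies the closed
neighbourhoods. -/
lemma compactSpace_of_dense {X : Type*} [TopologicalSpace X] [RegularSpace X] {D : Set X}
    (hD : Dense D) (h : ∀ U : Ultrafilter X, D ∈ U → ∃ x, (U : Filter X) ≤ 𝓝 x) :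
    CompactSpace X := by
  refine ⟨isCompact_iff_ultrafilter_le_nhds.2 fun U _ => ?_⟩
  let G : Filter X := (⨅ O : {O : Set X // IsOpen O ∧ O ∈ U}, 𝓟 (O : Set X)) ⊓ 𝓟 D
  have hdir : Directed (· ≥ ·) fun O : {O : Set X // IsOpen O ∧ O ∈ U} => 𝓟 (O : Set X) := by
    intro O O'
    exact ⟨⟨O ∩ O', O.2.1.inter O'.2.1, inter_mem O.2.2 O'.2.2⟩, by simp, by simp⟩
  have : Nonempty {O : Set X // IsOpen O ∧ O ∈ U} := ⟨⟨univ, isOpen_univ, univ_mem⟩⟩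
  have hG : G.NeBot := by
    rw [Filter.inf_principal_neBot_iff]
    intro V hV
    obtain ⟨O, hO⟩ := (mem_iInf_of_directed hdir V).1 hV
    obtain ⟨x, hx⟩ := hD.inter_open_nonempty O O.2.1 (U.nonempty_of_mem O.2.2)
    exact ⟨x, hO hx.1, hx.2⟩
  obtain ⟨x, hx⟩ := h (Ultrafilter.of G) (Ultrafilter.of_le G
    (mem_inf_of_right (mem_principal_self D)))
  refine ⟨x, trivial, ?_⟩
  intro N hN
  obtain ⟨C, hC, hCc, hCN⟩ := exists_mem_nhds_isClosed_subset hN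
  refine mem_of_superset ?_ hCN
  by_contra hCU
  have h1 : Cᶜ ∈ U := Ultrafilter.compl_mem_iff_notMem.2 hCU
  have h2 : Cᶜ ∈ G := mem_inf_of_left
    (mem_iInf_of_mem ⟨Cᶜ, hCc.isOpen_compl, h1⟩ (mem_principal_self _))
  have h3 : Cᶜ ∈ Ultrafilter.of G := Ultrafilter.of_le G h2
  exact Ultrafilter.compl_mem_iff_notMem.1 h3 (hx hC)

/-- This is compactness of the Riemann sphere, phrased for one ultrafilter. -/
lemma Ultrafilter.tendsto_nhds_or_inv {α : Type*} (U : Ultrafilter α) (f : α → ℂ) :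
    (∃ w, Tendsto f U (𝓝 w)) ∨ (Tendsto (fun p => (f p)⁻¹) U (𝓝 0) ∧ ∀ᶠ p in U, f p ≠ 0) := by
  by_cases h : ∃ R, ∀ᶠ p in U, ‖f p‖ ≤ R
  · obtain ⟨R, hR⟩ := h
    left
    obtain ⟨w, -, hw⟩ := (isCompact_closedBall (0 : ℂ) R).ultrafilter_le_nhds (U.map f)
      (by
        rw [le_principal_iff]
        change ∀ᶠ p in U, f p ∈ Metric.closedBall 0 R
        simpa using hR)
    exact ⟨w, hw⟩
  · right
    push Not at h
    have h1 : Tendsto f U (Bornology.cobounded ℂ) := by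
      rw [← tendsto_norm_atTop_iff_cobounded, tendsto_atTop]
      intro R
      filter_upwards [h R] with p hp using hp.le
    refine ⟨tendsto_inv₀_cobounded.comp h1, ?_⟩
    filter_upwards [h 0] with p hp using norm_pos_iff.1 hp

/-- No choice of branch is needed: along an ultrafilter the function converges or tends to infinity,
and the second contradicts convergence of its square. -/
lemma Ultrafilter.tendsto_of_sq {α : Type*} (U : Ultrafilter α) {f : α → ℂ} {w : ℂ}
    (h : Tendsto (fun p => f p ^ 2) U (𝓝 w)) : ∃ w', Tendsto f U (𝓝 w') ∧ w' ^ 2 = w := by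
  rcases Ultrafilter.tendsto_nhds_or_inv U f with ⟨w', hw'⟩ | ⟨h1, h2⟩
  · exact ⟨w', hw', tendsto_nhds_unique (hw'.pow 2) h⟩
  · exfalso
    have h3 := h.mul (h1.pow 2)
    have h4 : Tendsto (fun p => f p ^ 2 * (f p)⁻¹ ^ 2) U (𝓝 1) := by
      refine tendsto_const_nhds.congr' ?_
      filter_upwards [h2] with p hp
      field_simp
    have := tendsto_nhds_unique h3 h4
    simp at this

/-- If `A → 0`, `C → 0` and `C ^ n / A → 0`, then the points converge in one of the charts of the
resolution of `A B = C ^ n`. -/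
lemma Ultrafilter.exists_tor {α : Type*} (U : Ultrafilter α) {A B C : α → ℂ} {n : ℕ}
    (hA : Tendsto A U (𝓝 0)) (hB : Tendsto B U (𝓝 0))
    (hC0 : ∀ᶠ p in U, C p ≠ 0) (hAB : ∀ᶠ p in U, A p * B p = C p ^ n) :
    ∃ j < n, ∃ c : α → ℂ × ℂ, ∃ c₀, Tendsto c U (𝓝 c₀) ∧ torA j c₀ = 0 ∧ torB n j c₀ = 0 ∧
      ∀ᶠ p in U, torC (c p) = C p ∧ torA j (c p) = A p ∧ torB n j (c p) = B p := by
  classical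
  have hA0 : ∀ᶠ p in U, A p ≠ 0 := by
    filter_upwards [hC0, hAB] with p h1 h2 h3
    rw [h3, zero_mul] at h2
    exact pow_ne_zero n h1 h2.symm
  let Q : ℕ → Prop := fun i => ∃ w, Tendsto (fun p => A p / C p ^ i) U (𝓝 w)
  have hQ0 : Q 0 := ⟨0, by simpa using hA⟩
  have hQn : ¬Q n := by
    rintro ⟨w, hw⟩
    have h1 := hw.mul hB
    have h2 : Tendsto (fun p => A p / C p ^ n * B p) U (𝓝 1) := by
      refine tendsto_const_nhds.congr' ?_
      filter_upwards [hC0, hAB] with p h1 h2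
      have := pow_ne_zero n h1
      rw [div_mul_eq_mul_div, h2, div_self this]
    have := tendsto_nhds_unique h1 h2
    simp at this
  -- A/C⁰ = A converges, while A/Cⁿ = 1/B does not. If j + 1 is the first exponent for which A/Cⁱ
  -- fails to converge, then v = A/Cʲ converges and u = C^(j+1)/A tends to 0, so chart j captures
  -- the limit.
  have hex : ∃ i, ¬Q i := ⟨n, hQn⟩
  set m := Nat.find hex with hm
  have hm0 : m ≠ 0 := by
    intro h0
    have := Nat.find_spec hex
    rw [← hm, h0] at this
    exact this hQ0
  obtain ⟨j, hj⟩ : ∃ j, m = j + 1 := ⟨m - 1, by omega⟩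
  have hmn : m ≤ n := Nat.find_min' hex hQn
  have hQj : Q j := not_not.1 (Nat.find_min hex (by omega))
  have hQj1 : ¬Q (j + 1) := hj ▸ Nat.find_spec hex
  obtain ⟨v, hv⟩ := hQj
  obtain ⟨hu, -⟩ := (Ultrafilter.tendsto_nhds_or_inv U _).resolve_left hQj1
  have key : ∀ᶠ p in U, torC ((A p / C p ^ (j + 1))⁻¹, A p / C p ^ j) = C p ∧
      torA j ((A p / C p ^ (j + 1))⁻¹, A p / C p ^ j) = A p ∧
      torB n j ((A p / C p ^ (j + 1))⁻¹, A p / C p ^ j) = B p := by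
    filter_upwards [hA0, hC0, hAB] with p h1 h2 h3
    have e1 : (A p / C p ^ (j + 1))⁻¹ * (A p / C p ^ j) = C p := by
      field_simp; ring
    refine ⟨e1, ?_, ?_⟩
    · rw [torA]; simp only [e1]; field_simp
    · rw [torB]; simp only [e1]
      apply mul_left_cancel₀ h1
      rw [h3, inv_div]
      obtain ⟨i, hi⟩ : ∃ i, n = j + 1 + i := ⟨n - j - 1, by omega⟩
      rw [hi, show j + 1 + i - 1 - j = i by omega]
      field_simp
      ring
  refine ⟨j, by omega, _, (0, v), hu.prodMk_nhds hv, ?_, ?_, key⟩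
  · refine tendsto_nhds_unique ?_ hA
    refine (((analyticAt_torA j (0, v)).continuousAt.tendsto.comp (hu.prodMk_nhds hv))).congr' ?_
    filter_upwards [key] with p hp using hp.2.1
  · refine tendsto_nhds_unique ?_ hB
    refine (((analyticAt_torB n j (0, v)).continuousAt.tendsto.comp (hu.prodMk_nhds hv))).congr' ?_
    filter_upwards [key] with p hp using hp.2.2

lemma le_nhds_par {U : Ultrafilter (Surf a b)} {k : Idx} {c : Surf a b → ℂ × ℂ} {c₀ : ℂ × ℂ}
    (h₀ : c₀ ∈ dom a b k) (hc : Tendsto c U (𝓝 c₀)) (h : ∀ᶠ p in U, pt a b k (c p) = toPt p) :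
    ∃ x, (U : Filter (Surf a b)) ≤ 𝓝 x := by
  refine ⟨(atl a b).par k c₀, ?_⟩
  have h1 : Tendsto (fun p => (atl a b).par k (c p)) U (𝓝 ((atl a b).par k c₀)) :=
    ((ParamAtlas.continuousOn_par k).continuousAt (ParamAtlas.U_mem_nhds h₀)).tendsto.comp hc
  have h2 : map (fun p => (atl a b).par k (c p)) U = map id U := by
    refine Filter.map_congr ?_
    filter_upwards [h, hc.eventually ((isOpen_dom k).mem_nhds h₀)] with p h2 h3
    exact toPt_injective (by rw [toPt_par h3, h2]; rfl)
  rw [map_id] at h2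
  exact h2.ge.trans h1

/-- The affine coordinates of a point. -/
def affX (p : Pt) : ℂ := match p with | .aff x _ _ => x | _ => 0

/-- The affine coordinates of a point. -/
def affY (p : Pt) : ℂ := match p with | .aff _ y _ => y | _ => 0

/-- The affine coordinates of a point. -/
def affZ (p : Pt) : ℂ := match p with | .aff _ _ z => z | _ => 0

/-- The limits of x and z, and then of y (for finite x) or of y/x (for x → ∞), in ℂ ∪ {∞} decide in
which kind of chart the limit lies; in each case the chart coordinates converge to a point of the
chart's domain. -/
lemma exists_limit (U : Ultrafilter (Surf a b)) (hU : {p : Surf a b | IsGen a b (toPt p)} ∈ U) :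
    ∃ x, (U : Filter (Surf a b)) ≤ 𝓝 x := by
  obtain ⟨x, hx⟩ : ∃ x : Surf a b → ℂ, x = fun p => affX (toPt p) := ⟨_, rfl⟩
  obtain ⟨y, hy⟩ : ∃ y : Surf a b → ℂ, y = fun p => affY (toPt p) := ⟨_, rfl⟩
  obtain ⟨z, hz⟩ : ∃ z : Surf a b → ℂ, z = fun p => affZ (toPt p) := ⟨_, rfl⟩
  have hp : ∀ᶠ p in U, toPt p = .aff (x p) (y p) (z p) ∧ AffPt a b (x p) (y p) (z p) ∧
      x p ∉ singSet a b := by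
    filter_upwards [hU] with p hp
    obtain ⟨x', y', z', h, h'⟩ := hp
    have := affPt_of_toPt h
    rw [hx, hy, hz]
    simp only [h, affX, affY, affZ]
    exact ⟨trivial, this, h'⟩
  clear hx hy hz
  -- the function `z` near `0` and `∞`
  have zcases : (∃ z₀, z₀ ≠ 0 ∧ Tendsto z U (𝓝 z₀)) ∨ ∃ s : Bool,
      Tendsto (fun p => if s then z p else (z p)⁻¹) U (𝓝 0) ∧
      Tendsto (fun p => (fh (z p))⁻¹) U (𝓝 0) ∧ (∀ᶠ p in U, fh (z p) ≠ 0) ∧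
      ∀ᶠ p in U, ‖if s then z p else (z p)⁻¹‖ < 1 := by
    have aux : ∀ t : Surf a b → ℂ, Tendsto t U (𝓝 0) → (∀ᶠ p in U, t p ≠ 0) →
        Tendsto (fun p => (fh (t p))⁻¹) U (𝓝 0) ∧ ∀ᶠ p in U, fh (t p) ≠ 0 := by
      intro t ht ht0
      have h1 : Tendsto (fun p => 1 + t p ^ 2) U (𝓝 1) := by
        simpa using tendsto_const_nhds.add (ht.pow 2)
      have h2 := h1.eventually_ne one_ne_zero
      constructor
      · have h3 : Tendsto (fun p => 2 * t p / (1 + t p ^ 2)) U (𝓝 0) := by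
          have := (ht.const_mul 2).div h1 one_ne_zero
          rw [mul_zero, zero_div] at this
          exact this
        refine h3.congr' ?_
        filter_upwards [ht0, h2] with p h4 h5
        have : (t p + (t p)⁻¹) / 2 = (1 + t p ^ 2) / (2 * t p) := by field_simp; ring
        rw [fh, this, inv_div]
      · filter_upwards [ht0, h2] with p h4 h5 h6
        apply h5
        rw [fh] at h6
        field_simp at h6
        linear_combination h6
    have hz0 : ∀ᶠ p in U, z p ≠ 0 := hp.mono fun p h => h.2.1.1
    rcases Ultrafilter.tendsto_nhds_or_inv U z with ⟨z₀, h0⟩ | ⟨h1, h2⟩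
    · by_cases hz : z₀ = 0
      · right
        rw [hz] at h0
        obtain ⟨h3, h4⟩ := aux z h0 hz0
        refine ⟨true, by simpa using h0, h3, h4, ?_⟩
        have := h0.norm.eventually (gt_mem_nhds (show ‖(0 : ℂ)‖ < 1 by simp))
        simpa using this
      · exact Or.inl ⟨z₀, hz, h0⟩
    · right
      obtain ⟨h3, h4⟩ := aux _ h1 (h2.mono fun p h => inv_ne_zero h)
      simp only [fh_inv] at h3 h4
      refine ⟨false, by simpa using h1, h3, h4, ?_⟩
      have := h1.norm.eventually (gt_mem_nhds (show ‖(0 : ℂ)‖ < 1 by simp))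
      simpa using this
  have hcP : Continuous (fP a b) := continuous_fP
  have hcT : Continuous (fT a b) := continuous_fT
  rcases Ultrafilter.tendsto_nhds_or_inv U x with ⟨x₀, hx₀⟩ | ⟨hξ, hx0⟩
  · have hP := (hcP.tendsto x₀).comp hx₀
    rcases zcases with ⟨z₀, hz0, hz⟩ | ⟨s, hs, hh, hh0, hs1⟩
    · have hfh : Tendsto (fun p => fh (z p)) U (𝓝 (fh z₀)) :=
        ((analyticAt_id.fh hz0).continuousAt.tendsto).comp hz
      have hy2 : Tendsto (fun p => y p ^ 2) U (𝓝 (fP a b x₀ + fh z₀)) := by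
        refine (hP.add hfh).congr' ?_
        filter_upwards [hp] with p h using h.2.1.2.1.symm
      obtain ⟨y₀, hy, hy₀⟩ := Ultrafilter.tendsto_of_sq U hy2
      by_cases hy0 : y₀ = 0
      · by_cases hz1 : z₀ ^ 2 = 1
        · -- a node
          have hz0' : z₀⁻¹ = z₀ := inv_eq_of_mul_eq_one_right (by rw [← sq, hz1])
          have hfz : fh z₀ = z₀ := by rw [fh, hz0']; ring
          rw [hy0, hfz] at hy₀
          have hPx : fP a b x₀ = -z₀ := by linear_combination -hy₀
          have hε : fP a b x₀ ^ 2 = 1 := by rw [hPx, neg_sq, hz1]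
          set t : Surf a b → ℂ := fun p => csqrt (-fP a b x₀ * z p) with ht
          have htz : ∀ᶠ p in U, t p ^ 2 = -fP a b x₀ * z p := by
            filter_upwards [hp] with p h
            exact csqrt_sq (mul_ne_zero (by rw [hPx]; simpa using hz0) h.2.1.1)
          have e1 : -fP a b x₀ * z₀ = 1 := by rw [hPx, neg_neg, ← sq, hz1]
          have hs1 : csqrt 1 = 1 := csqrt_eq_of_sq (by simp) (by simp)
          have ht1 : Tendsto t U (𝓝 1) := by
            have h1 : Tendsto (fun p => -fP a b x₀ * z p) U (𝓝 1) := by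
              rw [← e1]; exact hz.const_mul _
            have h2 := (analyticAt_csqrt (z := 1) (by simp)).continuousAt.tendsto
            rw [hs1] at h2
            exact h2.comp h1
          have htre : ∀ᶠ p in U, 0 < (t p).re :=
            ((Complex.continuous_re.tendsto 1).comp ht1).eventually
              (lt_mem_nhds (show (0 : ℝ) < (1 : ℂ).re by simp))
          have hD : Tendsto (fun p => (t p - (t p)⁻¹) / 2) U (𝓝 0) := by
            have := (ht1.sub (ht1.inv₀ one_ne_zero)).div_const 2
            simpa using this
          have hq : Tendsto (fun p => nquo a b x₀ (x p)) U (𝓝 (nquo a b x₀ x₀)) :=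
            ((analyticAt_id.nquo).continuousAt.tendsto).comp hx₀
          have hq0 := nquo_self_ne_zero a b x₀
          have hA : Tendsto (fun p => y p - kap a b x₀ * ((t p - (t p)⁻¹) / 2)) U (𝓝 0) := by
            have := hy.sub (hD.const_mul (kap a b x₀))
            simpa [hy0] using this
          have hB : Tendsto (fun p => (y p + kap a b x₀ * ((t p - (t p)⁻¹) / 2)) /
              nquo a b x₀ (x p)) U (𝓝 0) := by
            have := (hy.add (hD.const_mul (kap a b x₀))).div hq hq0
            rw [hy0, mul_zero, add_zero, zero_div] at this
            exact this
          have hne : ∀ᶠ p in U, x p ≠ x₀ := by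
            filter_upwards [hp] with p h h'
            exact h.2.2 (h' ▸ mem_singSet.2 hε)
          obtain ⟨j, hj, c, c₀, hc, hcA, hcB, hev⟩ := Ultrafilter.exists_tor U
            (C := fun p => x p - x₀) (n := nmult a b x₀) hA hB
            (hne.mono fun p h => sub_ne_zero.2 h)
            (by
              filter_upwards [hp, htz, hq.eventually_ne hq0, htre] with p h1 h2 h3 h4
              have ht0 : t p ≠ 0 := by intro h0; rw [h0] at h4; simp at h4
              have h5 := fP_sub a b x₀ (x p)
              have h6 := fh_nodeZ (d := (t p - (t p)⁻¹) / 2) hε ht0 (by ring)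
              rw [h2, show -fP a b x₀ * (-fP a b x₀ * z p) = z p by linear_combination z p * hε] at h6
              have hk := kap_sq a b hε
              rw [← mul_div_assoc, div_eq_iff h3, ← h5]
              linear_combination h1.2.1.2.1 + h6 - ((t p - (t p)⁻¹) / 2) ^ 2 * hk)
          refine le_nhds_par (k := .node x₀ j) (c₀ := c₀) ?_ hc ?_
          · have hC : torC c₀ = 0 := by
              by_contra h; exact torA_ne_zero_of_torC h hcA
            refine ⟨hε, hj, by simpa [nodeX, hC] using hq0, ?_⟩
            simp [nodeD, nodeB, hcA, hcB]
          · filter_upwards [hev, hp, htz, htre, hne, hq.eventually_ne hq0] with p h1 h2 h3 h4 h5 h6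
            rw [h2.1]
            refine pt_node_eq hε h4 h3 h1.1 h5 h1.2.1 ?_
            rw [h1.2.2, mul_div_cancel₀ _ h6]
        · -- a point at which `x` and `y` are coordinates
          set m₀ : ℂ := (z₀ - z₀⁻¹) / 2 with hm
          have hm0 : m₀ ≠ 0 := by
            intro h; apply hz1
            rw [hm] at h
            field_simp at h
            linear_combination h
          have hms : ((y₀ ^ 2 - fP a b x₀) ^ 2 - 1) / m₀ ^ 2 = 1 := by
            rw [hy₀, div_eq_one_iff_eq (pow_ne_zero 2 hm0), hm, fh]; field_simp; ring
          refine le_nhds_par (k := .xy m₀) (c := fun p => (x p, y p)) (c₀ := (x₀, y₀)) ?_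
            (hx₀.prodMk_nhds hy) ?_
          · have h : ((y₀ ^ 2 - fP a b x₀) ^ 2 - 1) / m₀ ^ 2 ∈ Complex.slitPlane := by
              rw [hms]; simp
            exact h
          · have h1 : Tendsto (fun p => (z p - (z p)⁻¹) / 2 / m₀) U (𝓝 1) := by
              have := ((hz.sub (hz.inv₀ hz0)).div_const 2).div_const m₀
              rwa [← hm, div_self hm0] at this
            have h2 := ((Complex.continuous_re.tendsto 1).comp h1).eventually
              (lt_mem_nhds (show (0 : ℝ) < (1 : ℂ).re by simp))
            filter_upwards [hp, h2] with p h3 h4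
            have h4 : 0 < ((z p - (z p)⁻¹) / 2 / m₀).re := h4
            rw [h3.1]
            refine pt_eq_aff trivial rfl rfl ?_
            simp only [cZ]
            have e1 : y p ^ 2 - fP a b (x p) = fh (z p) := by rw [h3.2.1.2.1]; ring
            rw [e1, csqrt_eq_of_sq h4, mul_div_cancel₀ _ hm0, fh]
            · ring
            · rw [div_pow]
              congr 1
              have := h3.2.1.1
              rw [fh]; field_simp; ring
      · refine le_nhds_par (k := .xz y₀) (c := fun p => (x p, z p)) (c₀ := (x₀, z₀)) ?_
            (hx₀.prodMk_nhds hz) ?_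
        · refine ⟨hz0, ?_⟩
          simp only [← hy₀, div_self (pow_ne_zero 2 hy0)]
          simp
        · have h1 : Tendsto (fun p => y p / y₀) U (𝓝 1) := by
            have := hy.div_const y₀
            rwa [div_self hy0] at this
          have h2 := ((Complex.continuous_re.tendsto 1).comp h1).eventually
            (lt_mem_nhds (show (0 : ℝ) < (1 : ℂ).re by simp))
          filter_upwards [hp, h2] with p h3 h4
          have h4 : 0 < (y p / y₀).re := h4
          rw [h3.1]
          refine pt_eq_aff trivial rfl ?_ rfl
          simp only [cY]
          rw [csqrt_eq_of_sq h4 (by rw [div_pow, h3.2.1.2.1]), mul_div_cancel₀ _ hy0]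
    · -- the sections
      have h1 : Tendsto (fun p => fP a b (x p) * (fh (z p))⁻¹ + 1) U (𝓝 1) := by
        simpa using (hP.mul hh).add_const 1
      have h2 := h1.eventually_ne one_ne_zero
      have hyz : ∀ᶠ p in U, y p ^ 2 = (fP a b (x p) * (fh (z p))⁻¹ + 1) * fh (z p) := by
        filter_upwards [hp, hh0] with p h3 h4
        rw [h3.2.1.2.1]; field_simp
      have hy0 : ∀ᶠ p in U, y p ≠ 0 := by
        filter_upwards [hyz, hh0, h2] with p h3 h4 h5 h6
        rw [h6] at h3
        exact mul_ne_zero h5 h4 (by rw [← h3]; ring)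
      have hyi : Tendsto (fun p => (y p)⁻¹ ^ 2) U (𝓝 0) := by
        have := hh.div h1 one_ne_zero
        rw [zero_div] at this
        refine this.congr' ?_
        filter_upwards [hyz, hh0, h2] with p h3 h4 h5
        simp only [Pi.div_apply]
        rw [inv_pow, h3]
        field_simp
      obtain ⟨w, hw, hw2⟩ := Ultrafilter.tendsto_of_sq U hyi
      have hw0 : w = 0 := by simpa using hw2
      rw [hw0] at hw
      refine le_nhds_par (k := .sec s) (c := fun p => (x p, (y p)⁻¹)) (c₀ := (x₀, 0)) ?_
        (hx₀.prodMk_nhds hw) ?_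
      · refine ⟨by simp, by simpa [secW] using zero_mem_jouDom⟩
      · have h3 : Tendsto (fun p => 1 - (y p)⁻¹ ^ 2 * fP a b (x p)) U (𝓝 1) := by
          simpa using tendsto_const_nhds.sub (hyi.mul hP)
        filter_upwards [hp, hy0, h3.eventually_ne one_ne_zero, hs1] with p h4 h5 h6 h7
        rw [h4.1]
        exact pt_sec_eq h4.2.1 h5 h6 h7
  · have hT : Tendsto (fun p => fT a b (x p)⁻¹) U (𝓝 4) := by
      have := (hcT.tendsto 0).comp hξ
      rwa [fT_zero] at this
    have hT0 := hT.eventually_ne (show (4 : ℂ) ≠ 0 by norm_num)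
    -- the equation at infinity
    have heq : ∀ᶠ p in U, fh (z p) * (x p)⁻¹ ^ 3 = (y p / x p) ^ 2 * (x p)⁻¹ - fT a b (x p)⁻¹ := by
      filter_upwards [hp, hx0] with p h1 h2
      have := fP_inv a b (inv_ne_zero h2)
      rw [inv_inv] at this
      have h3 := h1.2.1.2.1
      rw [this] at h3
      field_simp at h3 ⊢
      linear_combination -h3
    rcases Ultrafilter.tendsto_nhds_or_inv U (fun p => y p / x p) with ⟨σ, hσ⟩ | ⟨hσ, hσ0⟩
    · -- the tails
      have hlim : Tendsto (fun p => (y p / x p) ^ 2 * (x p)⁻¹ - fT a b (x p)⁻¹) U (𝓝 (-4)) := by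
        simpa using ((hσ.pow 2).mul hξ).sub hT
      rcases zcases with ⟨z₀, hz0, hz⟩ | ⟨s, hs, hh, hh0, hs1⟩
      -- If y/x is bounded as x → ∞, the equation forces h(z)ξ³ → -4, so h(z) is unbounded and z
      -- cannot have a finite nonzero limit.
      · exfalso
        have hfh : Tendsto (fun p => fh (z p)) U (𝓝 (fh z₀)) :=
          ((analyticAt_id.fh hz0).continuousAt.tendsto).comp hz
        have := tendsto_nhds_unique ((hfh.mul (hξ.pow 3)).congr' heq) hlim
        norm_num at this
      · refine le_nhds_par (k := .tail s) (c := fun p => (y p / x p, (x p)⁻¹)) (c₀ := (σ, 0)) ?_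
          (hσ.prodMk_nhds hξ) ?_
        · refine ⟨by simp [fT_zero], by simpa [tailW] using zero_mem_jouDom⟩
        · filter_upwards [hp, hx0, hlim.eventually_ne (show (-4 : ℂ) ≠ 0 by norm_num), hs1] with p h1 h2 h3 h4
          rw [h1.1]
          exact pt_tail_eq h1.2.1 h2 h3 h4
    · have hs4 : csqrt 4 = 2 := csqrt_eq_of_sq (by norm_num) (by norm_num)
      have hy0 : ∀ᶠ p in U, y p ≠ 0 := hσ0.mono fun p h => (div_ne_zero_iff.1 h).1
      have hsq : ∀ f : Surf a b → ℂ, Tendsto f U (𝓝 4) → Tendsto (fun p => csqrt (f p)) U (𝓝 2) := by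
        intro f hf
        have h2 := (analyticAt_csqrt (z := 4) (by simp)).continuousAt.tendsto
        rw [hs4] at h2
        exact h2.comp hf
      rcases zcases with ⟨z₀, hz0, hz⟩ | ⟨s, hs, hh, hh0, hs1⟩
      · -- the middle curve
        have hfh : Tendsto (fun p => fh (z p)) U (𝓝 (fh z₀)) :=
          ((analyticAt_id.fh hz0).continuousAt.tendsto).comp hz
        have hR : Tendsto (fun p => y p ^ 2 / x p ^ 3) U (𝓝 4) := by
          have : Tendsto (fun p => fh (z p) * (x p)⁻¹ ^ 3 + fT a b (x p)⁻¹) U (𝓝 4) := by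
            simpa using (hfh.mul (hξ.pow 3)).add hT
          refine this.congr' ?_
          filter_upwards [heq, hx0] with p h1 h2
          rw [h1]; field_simp; ring
        refine le_nhds_par (k := .mid) (c := fun p => (csqrt (y p ^ 2 / x p ^ 3) * x p / y p, z p))
          (c₀ := (0, z₀)) ?_ (Tendsto.prodMk_nhds ?_ hz) ?_
        · exact ⟨hz0, by simp [midR, fT_zero]⟩
        · have := (hsq _ hR).mul hσ
          rw [mul_zero] at this
          refine this.congr fun p => ?_
          rw [inv_div, mul_div_assoc]
        · filter_upwards [hp, hx0, hy0] with p h1 h2 h3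
          rw [h1.1]
          exact pt_mid_eq h1.2.1 h2 h3
      · -- the chains
        set S : Surf a b → ℂ := fun p => csqrt (fT a b (x p)⁻¹) * (y p / x p)⁻¹ with hS
        have hSlim : Tendsto S U (𝓝 0) := by
          have := (hsq _ hT).mul hσ
          rw [mul_zero] at this
          exact this
        have hS0 : ∀ᶠ p in U, S p ≠ 0 :=
          hσ0.mono fun p h => mul_ne_zero (csqrt_ne_zero _) (inv_ne_zero h)
        set G : Surf a b → ℂ := fun p => (x p)⁻¹ - S p ^ 2 with hG
        have hGlim : Tendsto G U (𝓝 0) := by simpa using hξ.sub (hSlim.pow 2)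
        have hS2 : ∀ᶠ p in U, S p ^ 2 * (y p / x p) ^ 2 = fT a b (x p)⁻¹ := by
          filter_upwards [hσ0, hT0] with p h1 h2
          simp only [hS]
          rw [mul_pow, csqrt_sq h2, inv_pow, mul_assoc, inv_mul_cancel₀ (pow_ne_zero 2 h1), mul_one]
        have hGh : ∀ᶠ p in U, fh (z p) * (x p)⁻¹ ^ 3 * S p ^ 2 = fT a b (x p)⁻¹ * G p := by
          filter_upwards [heq, hS2] with p h1 h2
          rw [h1]; simp only [hG]
          linear_combination (x p)⁻¹ * h2
        have hG0 : ∀ᶠ p in U, G p ≠ 0 := by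
          filter_upwards [hGh, hh0, hS0, hx0] with p h1 h2 h3 h4 h5
          rw [h5, mul_zero] at h1
          exact mul_ne_zero (mul_ne_zero h2 (pow_ne_zero 3 (inv_ne_zero h4))) (pow_ne_zero 2 h3) h1
        have hB : Tendsto (fun p => S p ^ 8 / G p) U (𝓝 0) := by
          -- If B = S⁸/G does not tend to 0, then G/S⁸ converges, so ρ = G/S² → 0 and (1 + ρ)³ → 1.
          -- But (1 + ρ)³ = ξ³/S⁶ = (G/S⁸)·T/h(z), which tends to 0 because h(z) → ∞.
          by_contra hcon
          have h1 : ∃ w, Tendsto (fun p => G p / S p ^ 8) U (𝓝 w) := by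
            rcases Ultrafilter.tendsto_nhds_or_inv U (fun p => G p / S p ^ 8) with h | ⟨h, -⟩
            · exact h
            · simp only [inv_div] at h
              exact absurd h hcon
          obtain ⟨w, hw⟩ := h1
          have h2 : Tendsto (fun p => G p / S p ^ 2) U (𝓝 0) := by
            have := hw.mul (hSlim.pow 6)
            norm_num at this
            refine this.congr' ?_
            filter_upwards [hS0] with p h3
            field_simp
          have h3 : Tendsto (fun p => (1 + G p / S p ^ 2) ^ 3) U (𝓝 1) := by
            simpa using ((tendsto_const_nhds (x := (1 : ℂ))).add h2).pow 3
          have h4 : Tendsto (fun p => (G p / S p ^ 8) * fT a b (x p)⁻¹ * (fh (z p))⁻¹) U (𝓝 0) := by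
            simpa using (hw.mul hT).mul hh
          refine one_ne_zero (tendsto_nhds_unique h3 (h4.congr' ?_))
          filter_upwards [hS0, hGh, hh0] with p h5 h6 h7
          have h8 : (x p)⁻¹ = G p + S p ^ 2 := by simp only [hG]; ring
          have h9 : G p * fT a b (x p)⁻¹ * (fh (z p))⁻¹ = (x p)⁻¹ ^ 3 * S p ^ 2 := by
            rw [mul_comm (G p), ← h6]; field_simp
          rw [div_mul_eq_mul_div, div_mul_eq_mul_div, h9, h8]
          field_simp
          ring
        obtain ⟨j, hj, c, c₀, hc, hcA, hcB, hev⟩ := Ultrafilter.exists_tor U (C := S) (n := 8)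
          hGlim hB hS0 (by filter_upwards [hG0] with p h1 using mul_div_cancel₀ _ h1)
        refine le_nhds_par (k := .chain s j) (c₀ := c₀) ?_ hc ?_
        · have hC : torC c₀ = 0 := by
            by_contra h; exact torA_ne_zero_of_torC h hcA
          refine ⟨hj, by simp [chXi, hC, hcA, fT_zero], ?_⟩
          simpa [chW, hC, hcA, hcB] using zero_mem_jouDom
        · filter_upwards [hev, hp, hx0, hT0, hs1, hσ0] with p h1 h2 h3 h4 h5 h6
          rw [h2.1]
          refine pt_chain_eq hj h2.2.1 h3 h4 ?_ ?_ h5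
          · rw [chXi, h1.1, h1.2.1]; simp only [hG]; ring
          · rw [h1.1]; simp only [hS]
            rw [mul_assoc, inv_mul_cancel₀ h6, mul_one]

instance : CompactSpace (Surf a b) := by
  have : LocallyCompactSpace (Surf a b) := ChartedSpace.locallyCompactSpace (ℂ × ℂ) _
  exact compactSpace_of_dense dense_isGen exists_limit

/-! ## The map to the quartic -/

/-- The function `C ^ 5 / A` in the charts at the chains with index at most four. -/
def chIota (j : ℕ) (c : ℂ × ℂ) : ℂ := c.1 * (c.1 * c.2) ^ (4 - j)

/-- The function `A / C ^ 5` in the charts at the chains with index at least five. -/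
def chRho5 (j : ℕ) (c : ℂ × ℂ) : ℂ := c.2 * (c.1 * c.2) ^ (j - 5)

section

variable (a b)

/-- The function `1 / (z S ξ)` in the charts at the chain over `z = ∞`. -/
def chM (j : ℕ) (c : ℂ × ℂ) : ℂ :=
  (1 + jou (chW a b j c) ^ 2) * (torC c * torA j c + 2 * torC c ^ 3 + chIota j c) /
    (2 * fT a b (chXi j c))

/-- The function `z S ξ` in the charts at the chain over `z = ∞`. -/
def chN (j : ℕ) (c : ℂ × ℂ) : ℂ :=
  2 * fT a b (chXi j c) * chRho5 j c / ((1 + jou (chW a b j c) ^ 2) * (1 + chRho j c) ^ 2)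

/-- The function `1 / (z ŷ ^ 2)` in the chart at the section over `z = ∞`. -/
def secM (c : ℂ × ℂ) : ℂ := (1 + jou (secW a b c) ^ 2) / (2 * (1 - c.2 ^ 2 * fP a b c.1))

/-- The function `1 / (z ξ)` in the chart at the tail over `z = ∞`. -/
def tailM (c : ℂ × ℂ) : ℂ :=
  c.2 ^ 2 * (1 + jou (tailW a b c) ^ 2) / (2 * (c.1 ^ 2 * c.2 - fT a b c.2))

/-- Local homogeneous coordinates of the map to the quartic. -/
def piL : Idx → ℂ × ℂ → Fin 4 → ℂ
  | .chain true j, c => ![torC c, chQ a b j c, jou (chW a b j c) * (torC c * chXi j c),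
      torC c * chXi j c]
  | .chain false j, c => if j ≤ 4 then
      ![torC c * chM a b j c, chQ a b j c * chM a b j c, 1, jou (chW a b j c)]
      else ![torC c, chQ a b j c, chN a b j c, torC c * chXi j c]
  | .sec true, c => ![c.1 * c.2, 1, jou (secW a b c) * c.2, c.2]
  | .sec false, c => ![c.1 * c.2 ^ 2 * secM a b c, c.2 * secM a b c, 1, c.2 ^ 2 * secM a b c]
  | .tail true, c => ![1, c.1, jou (tailW a b c) * c.2, c.2]
  | .tail false, c => ![tailM a b c, c.1 * tailM a b c, 1, jou (tailW a b c)]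
  | .mid, c => ![c.1, csqrt (midR a b c), c.2 * c.1 ^ 3, c.1 ^ 3]
  | k, c => ![cX k c, cY a b k c, cZ a b k c, 1]

/-- The points in the charts at which `piL` consists of homogeneous coordinates. -/
def piGood : Idx → ℂ × ℂ → Prop
  | .chain false j, c => j ≤ 4 ∨ 1 + chRho j c ≠ 0
  | _, _ => True

end

lemma analyticAt_chIota (j : ℕ) (c : ℂ × ℂ) : AnalyticAt ℂ (chIota j) c := by
  unfold chIota; fun_prop

lemma analyticAt_chRho5 (j : ℕ) (c : ℂ × ℂ) : AnalyticAt ℂ (chRho5 j) c := by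
  unfold chRho5; fun_prop

lemma analyticAt_jou_chW {s : Bool} {j : ℕ} {c : ℂ × ℂ} (hc : c ∈ dom a b (.chain s j)) :
    AnalyticAt ℂ (fun c => jou (chW a b j c)) c :=
  (analyticAt_chW (fT_chXi_ne_zero hc)).jou hc.2.2

lemma analyticAt_chM {s : Bool} {j : ℕ} {c : ℂ × ℂ} (hc : c ∈ dom a b (.chain s j)) :
    AnalyticAt ℂ (chM a b j) c := by
  refine AnalyticAt.div (AnalyticAt.mul (analyticAt_const.add ((analyticAt_jou_chW hc).pow 2))
    (AnalyticAt.add (by fun_prop) (analyticAt_chIota j c)))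
    (analyticAt_const.mul (analyticAt_chXi j c).fT) (mul_ne_zero two_ne_zero (fT_chXi_ne_zero hc))

lemma analyticAt_piL {k : Idx} {c : ℂ × ℂ} (hc : c ∈ dom a b k) (hg : piGood k c) :
    AnalyticAt ℂ (piL a b k) c := by
  rcases k with y₀ | m₀ | ⟨l, j⟩ | ⟨s, j⟩ | s | s | _
  · exact analyticAt_vec4 analyticAt_fst (analyticAt_cY hc trivial) analyticAt_snd analyticAt_const
  · exact analyticAt_vec4 analyticAt_fst analyticAt_snd (analyticAt_cZ hc trivial) analyticAt_const
  · exact analyticAt_vec4 (analyticAt_nodeX l c) (analyticAt_nodeY l j c) (analyticAt_nodeZ hc)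
      analyticAt_const
  · have hCX := (analyticAt_torC c).mul (analyticAt_chXi j c)
    cases s
    · by_cases hj : j ≤ 4
      · have e : piL a b (.chain false j) = fun c => ![torC c * chM a b j c,
            chQ a b j c * chM a b j c, 1, jou (chW a b j c)] := by
          funext c; simp only [piL, hj, if_true]
        rw [e]
        exact analyticAt_vec4 ((analyticAt_torC c).mul (analyticAt_chM hc))
          ((analyticAt_chQ hc).mul (analyticAt_chM hc)) analyticAt_const (analyticAt_jou_chW hc)
      · have e : piL a b (.chain false j) = fun c => ![torC c, chQ a b j c, chN a b j c,
            torC c * chXi j c] := by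
          funext c; simp only [piL, hj, if_false]
        rw [e]
        refine analyticAt_vec4 (analyticAt_torC c) (analyticAt_chQ hc) ?_ hCX
        refine AnalyticAt.div
          ((analyticAt_const.mul (analyticAt_chXi j c).fT).mul (analyticAt_chRho5 j c))
          ((analyticAt_const.add ((analyticAt_jou_chW hc).pow 2)).mul
            ((analyticAt_const.add (analyticAt_chRho j c)).pow 2)) ?_
        exact mul_ne_zero (one_add_jou_sq_ne_zero hc.2.2) (pow_ne_zero 2 (hg.resolve_left hj))
    · exact analyticAt_vec4 (analyticAt_torC c) (analyticAt_chQ hc)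
        ((analyticAt_jou_chW hc).mul hCX) hCX
  · have hJ := (analyticAt_secW hc.1).jou hc.2
    have hM : AnalyticAt ℂ (secM a b) c := by
      refine AnalyticAt.div (analyticAt_const.add (hJ.pow 2)) ?_ (mul_ne_zero two_ne_zero hc.1)
      unfold fP; fun_prop
    cases s
    · exact analyticAt_vec4 ((analyticAt_fst.mul (analyticAt_snd.pow 2)).mul hM)
        (analyticAt_snd.mul hM) analyticAt_const ((analyticAt_snd.pow 2).mul hM)
    · exact analyticAt_vec4 (analyticAt_fst.mul analyticAt_snd) analyticAt_const
        (hJ.mul analyticAt_snd) analyticAt_snd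
  · have hJ := (analyticAt_tailW hc.1).jou hc.2
    have hM : AnalyticAt ℂ (tailM a b) c := by
      refine AnalyticAt.div ((analyticAt_snd.pow 2).mul (analyticAt_const.add (hJ.pow 2))) ?_
        (mul_ne_zero two_ne_zero hc.1)
      unfold fT; fun_prop
    cases s
    · exact analyticAt_vec4 hM (analyticAt_fst.mul hM) analyticAt_const hJ
    · exact analyticAt_vec4 analyticAt_const analyticAt_fst (hJ.mul analyticAt_snd) analyticAt_snd
  · exact analyticAt_vec4 analyticAt_fst ((analyticAt_midR hc.1).csqrt hc.2)
      (analyticAt_snd.mul (analyticAt_fst.pow 3)) (analyticAt_fst.pow 3)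

lemma chIota_mul_torA {j : ℕ} (hj : j ≤ 4) (c : ℂ × ℂ) : chIota j c * torA j c = torC c ^ 5 := by
  obtain ⟨k, hk⟩ : ∃ k, 4 = j + k := ⟨4 - j, by omega⟩
  rw [chIota, torA, torC, show 4 - j = k by omega, show 5 = j + k + 1 by omega]; ring

lemma chRho_eq_chRho5 {j : ℕ} (hj : 5 ≤ j) (c : ℂ × ℂ) : chRho j c = torC c ^ 3 * chRho5 j c := by
  obtain ⟨k, rfl⟩ : ∃ k, j = k + 5 := ⟨j - 5, by omega⟩
  rw [chRho, torC, chRho5, Nat.add_sub_cancel, show k + 5 - 2 = k + 3 by omega]; ring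

/-- Over z = ∞ one has 1/z = (1 + z⁻²)w, and w/(Sξ) = S(G + S²)²/(2TG) = (SG + 2S³ + S⁵/G)/(2T). The
term S⁵/G is holomorphic exactly in the charts j ≤ 4, where it is `chIota`. -/
lemma jou_chW_eq_mul_chM {s : Bool} {j : ℕ} (hj : j ≤ 4) {c : ℂ × ℂ}
    (hc : c ∈ dom a b (.chain s j)) (hS : torC c ≠ 0) :
    jou (chW a b j c) = torC c * chXi j c * chM a b j c := by
  have hT := fT_chXi_ne_zero hc
  have hA := torA_ne_zero_of_torC (j := j) hS
  have h1 := chIota_mul_torA hj c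
  have e := chW_eq hc.1 hT hA
  rw [jou_eq hc.2.2, chM]
  generalize 1 + jou (chW a b j c) ^ 2 = K
  rw [e]
  field_simp
  have hx : chXi j c = torA j c + torC c ^ 2 := rfl
  linear_combination -K * chXi j c * h1 +
    K * torC c * chXi j c * (chXi j c + torA j c + torC c ^ 2) * hx

/-- For j ≥ 5 the quotient A/C⁵ is holomorphic instead. From w = B(1 + ρ)³/(2T), ξ = C²(1 + ρ) and
B·A/C⁵ = C³ one finds zSξ = 2T(A/C⁵)/((1 + z⁻²)(1 + ρ)²). -/
lemma jou_chW_mul_chN {s : Bool} {j : ℕ} (hj : 5 ≤ j) {c : ℂ × ℂ}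
    (hc : c ∈ dom a b (.chain s j)) (hρ : 1 + chRho j c ≠ 0) :
    jou (chW a b j c) * chN a b j c = torC c * chXi j c := by
  have hT := fT_chXi_ne_zero hc
  have h0 := one_add_jou_sq_ne_zero hc.2.2
  have hB := torB_mul_chRho (by omega : 2 ≤ j) hc.1 c
  have e := chW_eq_chRho (a := a) (b := b) (by omega : 2 ≤ j) hc.1 c

  rw [jou_eq hc.2.2, chN]
  generalize 1 + jou (chW a b j c) ^ 2 = K at h0 ⊢
  rw [e]
  generalize fT a b (chXi j c) = t at hT ⊢
  have h1 : torB 8 j c * chRho5 j c = torC c ^ 3 := by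
    obtain ⟨k, rfl⟩ : ∃ k, j = k + 5 := ⟨j - 5, by omega⟩
    have := hc.1
    obtain ⟨m, hm⟩ : ∃ m, 2 = k + m := ⟨2 - k, by omega⟩
    rw [torB, chRho5, torC, Nat.add_sub_cancel, show 8 - 1 - (k + 5) = m by omega,
      show 3 = k + m + 1 by omega]
    ring
  rw [chXi_eq_chRho (by omega)]
  field_simp
  linear_combination h1

lemma Proportional.of_vec4 {t x y z w x' y' z' w' : ℂ} (ht : t ≠ 0) (h1 : x = t * x')
    (h2 : y = t * y') (h3 : z = t * z') (h4 : w = t * w') :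
    Proportional ![x, y, z, w] ![x', y', z', w'] :=
  ⟨t, ht, by simp [h1, h2, h3, h4]⟩

lemma piL_prop_aff {k : Idx} {c : ℂ × ℂ} (hc : c ∈ dom a b k) (hg : piGood k c)
    (hA : isAff a b k c) : Proportional (piL a b k c) (piV a b (pt a b k c)) := by
  rw [pt_of_isAff hA]
  rcases k with y₀ | m₀ | ⟨l, j⟩ | ⟨s, j⟩ | s | s | _
  · exact ⟨1, one_ne_zero, by simp [piL, piV]⟩
  · exact ⟨1, one_ne_zero, by simp [piL, piV]⟩
  · exact ⟨1, one_ne_zero, by simp [piL, piV]⟩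
  · have hW := chW_ne_zero hc hA
    have hJ := (jou_eq_zero hc.2.2).not.2 hW
    have hA1 := hA.1
    have hA2 := hA.2
    cases s
    · by_cases hj : j ≤ 4
      · have h1 := jou_chW_eq_mul_chM hj hc hA1
        simp only [piL, hj, if_true, piV, cX, cY, cZ, zside]
        refine Proportional.of_vec4 hJ ?_ ?_ ?_ (mul_one _).symm
        · rw [h1]; field_simp
        · rw [h1]; field_simp
        · simp [hJ]
      · have h1 := jou_chW_mul_chN (by omega) hc (hg.resolve_left hj)
        simp only [piL, hj, if_false, piV, cX, cY, cZ, zside]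
        refine Proportional.of_vec4 (mul_ne_zero hA1 hA2) ?_ ?_ ?_ (mul_one _).symm
        · field_simp
        · field_simp
        · rw [← h1]; simp; field_simp
    · simp only [piL, piV, cX, cY, cZ, zside]
      refine Proportional.of_vec4 (mul_ne_zero hA1 hA2) ?_ ?_ ?_ (mul_one _).symm
      · field_simp
      · field_simp
      · simp; ring
  · have h0 : c.2 ≠ 0 := hA
    have hJ := (jou_eq_zero hc.2).not.2 (secW_ne_zero hc h0)
    cases s
    · have h1 : jou (secW a b c) = c.2 ^ 2 * secM a b c := by
        conv_lhs => rw [jou_eq hc.2]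
        rw [secM]
        conv_lhs => arg 2; rw [secW]
        ring
      simp only [piL, piV, cX, cY, cZ, zside]
      refine Proportional.of_vec4 hJ ?_ ?_ ?_ ?_
      · rw [h1]; ring
      · rw [h1]; field_simp
      · simp [hJ]
      · rw [h1]; ring
    · simp only [piL, piV, cX, cY, cZ, zside]
      refine Proportional.of_vec4 h0 (mul_comm _ _) ?_ ?_ (mul_one _).symm
      · field_simp
      · simp; ring
  · have h0 : c.2 ≠ 0 := hA
    have hJ := (jou_eq_zero hc.2).not.2 (tailW_ne_zero hc h0)
    cases s
    · have h1 : jou (tailW a b c) = c.2 * tailM a b c := by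
        conv_lhs => rw [jou_eq hc.2]
        rw [tailM]
        conv_lhs => arg 2; rw [tailW]
        ring
      simp only [piL, piV, cX, cY, cZ, zside]
      refine Proportional.of_vec4 hJ ?_ ?_ ?_ (mul_one _).symm
      · rw [h1]; field_simp
      · rw [h1]; field_simp
      · simp [hJ]
    · simp only [piL, piV, cX, cY, cZ, zside]
      refine Proportional.of_vec4 h0 ?_ ?_ ?_ (mul_one _).symm
      · field_simp
      · field_simp
      · simp; ring
  · have h0 : c.1 ≠ 0 := hA
    simp only [piL, piV, cX, cY, cZ]
    refine Proportional.of_vec4 (pow_ne_zero 3 h0) ?_ ?_ ?_ (mul_one _).symm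
    · field_simp
    · field_simp
    · ring

lemma chW_eq_zero_of_chXi {s : Bool} {j : ℕ} {c : ℂ × ℂ} (hc : c ∈ dom a b (.chain s j))
    (hS : torC c ≠ 0) (hξ : chXi j c = 0) : chW a b j c = 0 := by
  rw [chW_eq hc.1 (fT_chXi_ne_zero hc) (torA_ne_zero_of_torC hS), hξ]; simp

lemma eq_zero_of_torC {j n : ℕ} {c : ℂ × ℂ} (hS : torC c = 0) :
    (torA j c ≠ 0 → j = 0) ∧ (torB n j c ≠ 0 → n - 1 - j = 0) := by
  constructor
  · intro h
    by_contra h0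
    apply h
    rw [torA, show c.1 * c.2 = 0 from hS, zero_pow h0, mul_zero]
  · intro h
    by_contra h0
    apply h
    rw [torB, show c.1 * c.2 = 0 from hS, zero_pow h0, mul_zero]

lemma csqrt_four : csqrt 4 = 2 := csqrt_eq_of_sq (by norm_num) (by norm_num)

lemma piL_prop_special {k : Idx} {c : ℂ × ℂ} (hc : c ∈ dom a b k) (hg : piGood k c)
    (hA : ¬isAff a b k c) : Proportional (piL a b k c) (piV a b (pt a b k c)) := by
  rw [pt_of_not_isAff hA]
  rcases k with y₀ | m₀ | ⟨l, j⟩ | ⟨s, j⟩ | s | s | _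
  · exact absurd trivial hA
  · exact absurd trivial hA
  · simp only [isAff, not_not] at hA
    refine ⟨1, one_ne_zero, ?_⟩
    have hC : torC c = 0 := by
      by_contra h; exact torA_ne_zero_of_torC h hA.1
    have h1 : csqrt 1 = 1 := csqrt_eq_of_sq (by simp) (by simp)
    simp [piL, piV, special, cX, cY, cZ, nodeX, nodeY, nodeZ, nodeT, nodeD, nodeB, hA.1, hA.2, h1, hC]
  · simp only [isAff, not_and_or, not_not] at hA
    have hQ0 : chQ a b j c ≠ 0 := csqrt_ne_zero _
    cases s
    · by_cases hj : j ≤ 4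
      · simp only [piL, hj, if_true]
        rcases special_chain (a := a) (b := b) false j c with h | h | h | h
        · have hξ := hA.resolve_left h.1
          have hW := chW_eq_zero_of_chXi hc h.1 hξ
          have hM : chM a b j c = 0 := by
            -- Multiplied by A, the bracket in `chM` is C(A + C²)² = Cξ², which vanishes on the
            -- tail.
            have h1 : torA j c * (torC c * torA j c + 2 * torC c ^ 3 + chIota j c) = 0 := by
              have h2 := chIota_mul_torA hj c
              rw [chXi] at hξ
              linear_combination h2 + torC c * (torA j c + torC c ^ 2) * hξ
            rw [chM, (mul_eq_zero.1 h1).resolve_left (torA_ne_zero_of_torC h.1)]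
            simp
          rw [h.2]
          exact ⟨1, one_ne_zero, by simp [piV, hM, hW]⟩
        · obtain rfl := (eq_zero_of_torC (n := 8) h.1).1 h.2.1
          have hM : chM a b 0 c = 0 := by
            rw [chM, h.1, chIota, show c.1 * c.2 = 0 from h.1]; simp
          have hW : chW a b 0 c = 0 := by
            rw [chW_eq hc.1 (fT_chXi_ne_zero hc) h.2.1, h.1]; simp
          rw [h.2.2]
          exact ⟨1, one_ne_zero, by simp [piV, hM, hW]⟩
        · have := (eq_zero_of_torC (n := 8) h.1).2 h.2.2.1
          omega
        · have hξ : chXi j c = 0 := by rw [chXi, h.1, h.2.1]; simp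
          have hW : chW a b j c = 0 := by
            rw [chW, h.1, h.2.1, h.2.2.1]; simp
          have hM : chM a b j c = chIota j c / 8 := by
            rw [chM, hW, h.1, hξ, fT_zero]; norm_num
          -- At such a point A/C⁵ = 1/ι with ι = `chIota`, while the local coordinates are [0,
          -- 2·ι/8, 1, 0]; up to the factor ι/4 this is [0, 1, 4/ι, 0], which explains the 4 in
          -- `piV`.
          rw [h.2.2.2, piV, tseq_of_lt (by omega), show 5 - j - 1 = 4 - j by omega]
          by_cases h0 : chIota j c = 0
          · have e : oinv (c.1 * (c.1 * c.2) ^ (4 - j)) = none := if_pos h0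
            rw [e]
            rw [h0] at hM
            exact ⟨1, one_ne_zero, by simp [hM, h.1, hW]⟩
          · have e : oinv (c.1 * (c.1 * c.2) ^ (4 - j)) = some (chIota j c)⁻¹ := if_neg h0
            rw [e]
            refine Proportional.of_vec4 (t := chIota j c / 4) (div_ne_zero h0 (by norm_num))
              ?_ ?_ ?_ ?_
            · rw [h.1]; ring
            · rw [hM, chQ, hξ, fT_zero, csqrt_four]; ring
            · field_simp
            · rw [hW]; simp
      · simp only [piL, hj, if_false]
        have hρ := hg.resolve_left hj
        rcases special_chain (a := a) (b := b) false j c with h | h | h | h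
        · have hξ := hA.resolve_left h.1
          rw [chXi_eq_chRho (by omega)] at hξ
          exact absurd hξ (mul_ne_zero (pow_ne_zero 2 h.1) hρ)
        · obtain rfl := (eq_zero_of_torC (n := 8) h.1).1 h.2.1
          omega
        · have := hc.1
          have h7 := (eq_zero_of_torC (n := 8) h.1).2 h.2.2.1
          obtain rfl : j = 7 := by omega
          have hN : chN a b 7 c = 0 := by
            rw [chN, chRho5, show c.1 * c.2 = 0 from h.1]; simp
          rw [h.2.2.2]
          exact ⟨_, hQ0, by simp [piV, hN, h.1]⟩
        · have hξ : chXi j c = 0 := by rw [chXi, h.1, h.2.1]; simp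
          have hW : chW a b j c = 0 := by
            rw [chW, h.1, h.2.1, h.2.2.1]; simp
          have hρ0 : chRho j c = 0 := by rw [chRho_eq_chRho5 (by omega), h.1]; simp
          rw [h.2.2.2, piV, tseq_of_le (by omega)]
          refine Proportional.of_vec4 (t := 2) two_ne_zero ?_ ?_ ?_ ?_
          · rw [h.1]; simp
          · rw [chQ, hξ, fT_zero, csqrt_four]; ring
          · rw [chN, hW, hρ0, hξ, fT_zero, chRho5]; simp; ring
          · rw [h.1]; simp
    · simp only [piL]
      rcases special_chain (a := a) (b := b) true j c with h | h | h | h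
      · have hξ := hA.resolve_left h.1
        have hS := h.1
        rw [h.2]
        simp only [piV, if_true]
        refine Proportional.of_vec4 h.1 (mul_one _).symm ?_ ?_ ?_
        · field_simp
        · rw [hξ]; simp
        · rw [hξ]
      · rw [h.2.2]
        exact ⟨_, hQ0, by simp [piV, h.1]⟩
      · rw [h.2.2.2]
        exact ⟨_, hQ0, by simp [piV, h.1]⟩
      · rw [h.2.2.2]
        exact ⟨_, hQ0, by simp [piV, h.1]⟩
  · have h0 : c.2 = 0 := not_not.1 hA
    cases s
    · exact ⟨1, one_ne_zero, by simp [piL, piV, special, h0]⟩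
    · exact ⟨1, one_ne_zero, by simp [piL, piV, special, h0]⟩
  · have h0 : c.2 = 0 := not_not.1 hA
    cases s
    · exact ⟨1, one_ne_zero, by simp [piL, piV, special, h0, tailM, tailW]⟩
    · exact ⟨1, one_ne_zero, by simp [piL, piV, special, h0]⟩
  · have h0 : c.1 = 0 := not_not.1 hA
    exact ⟨_, csqrt_ne_zero (midR a b c), by simp [piL, piV, special, h0]⟩

lemma eventually_piGood {k : Idx} {c : ℂ × ℂ} (hg : piGood k c) : ∀ᶠ c' in 𝓝 c, piGood k c' := by
  rcases k with y₀ | m₀ | ⟨l, j⟩ | ⟨s, j⟩ | s | s | _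
  all_goals try exact Eventually.of_forall fun _ => trivial
  cases s
  · rcases hg with hg | hg
    · exact Eventually.of_forall fun _ => Or.inl hg
    · filter_upwards [(analyticAt_const.add (analyticAt_chRho j c)).continuousAt.eventually_ne hg]
        with c' h using Or.inr h
  · exact Eventually.of_forall fun _ => trivial

lemma liftAt_pi {k : Idx} {c : ℂ × ℂ} (hc : c ∈ dom a b k) (hg : piGood k c) :
    (atl a b).LiftAt (piMap a b) k c (piL a b k) := by
  refine liftAt_toCP hc (analyticAt_piL hc hg) ?_
  filter_upwards [eventually_piGood hg] with c' h1 h2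
  by_cases hA : isAff a b k c'
  · exact piL_prop_aff h2 h1 hA
  · exact piL_prop_special h2 h1 hA

/-- Every point of the affine part lies in one of the first two kinds of charts. -/
lemma exists_chart_of_affPt {x y z : ℂ} (h : AffPt a b x y z) :
    (y ≠ 0 ∧ (x, z) ∈ dom a b (.xz y) ∧ pt a b (.xz y) (x, z) = .aff x y z) ∨
    ((z - z⁻¹) / 2 ≠ 0 ∧ (x, y) ∈ dom a b (.xy ((z - z⁻¹) / 2)) ∧
      pt a b (.xy ((z - z⁻¹) / 2)) (x, y) = .aff x y z) := by
  have hs1 : csqrt 1 = 1 := csqrt_eq_of_sq (by simp) (by simp)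
  have hz0 := h.1
  by_cases hy : y = 0
  · right
    have hz1 : z ^ 2 ≠ 1 := fun h' => h.2.2 ⟨hy, h'⟩
    set m₀ : ℂ := (z - z⁻¹) / 2 with hm
    have hm0 : m₀ ≠ 0 := by
      intro h; apply hz1
      rw [hm] at h
      field_simp at h
      linear_combination h
    have e1 : y ^ 2 - fP a b x = fh z := by rw [h.2.1]; ring
    have hms : ((y ^ 2 - fP a b x) ^ 2 - 1) / m₀ ^ 2 = 1 := by
      rw [e1, div_eq_one_iff_eq (pow_ne_zero 2 hm0), hm, fh]; field_simp; ring
    refine ⟨hm0, ?_, pt_eq_aff trivial rfl rfl ?_⟩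
    · have h : ((y ^ 2 - fP a b x) ^ 2 - 1) / m₀ ^ 2 ∈ Complex.slitPlane := by
        rw [hms]; simp
      exact h
    · simp only [cZ]
      rw [hms, hs1, e1, hm, fh]; ring
  · left
    have e : (fP a b x + fh z) / y ^ 2 = 1 := by
      rw [← h.2.1, div_self (pow_ne_zero 2 hy)]
    refine ⟨hy, ⟨hz0, by simp only [e]; simp⟩, pt_eq_aff trivial rfl ?_ rfl⟩
    simp only [cY]
    rw [e, hs1, mul_one]

lemma exists_of_affPt {x y z : ℂ} (h : AffPt a b x y z) : ∃ p : Surf a b, toPt p = .aff x y z := by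
  rcases exists_chart_of_affPt h with h | h
  · exact ⟨(atl a b).par _ _, (toPt_par h.2.1).trans h.2.2⟩
  · exact ⟨(atl a b).par _ _, (toPt_par h.2.1).trans h.2.2⟩

lemma zero_mem_dom_sec (s : Bool) (x : ℂ) : (x, (0 : ℂ)) ∈ dom a b (.sec s) := by
  refine ⟨by simp, by simpa [secW] using zero_mem_jouDom⟩

lemma zero_mem_dom_tail (s : Bool) (σ : ℂ) : (σ, (0 : ℂ)) ∈ dom a b (.tail s) := by
  refine ⟨by simp [fT_zero], by simpa [tailW] using zero_mem_jouDom⟩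

lemma zero_mem_dom_mid {z : ℂ} (hz : z ≠ 0) : ((0 : ℂ), z) ∈ dom a b .mid :=
  ⟨hz, by simp [midR, fT_zero]⟩

lemma mem_dom_node {l : ℂ} (hl : fP a b l ^ 2 = 1) {j : ℕ} (hj : j < nmult a b l) {c : ℂ × ℂ}
    (hA : torA j c = 0) (hB : torB (nmult a b l) j c = 0) : c ∈ dom a b (.node l j) := by
  have hC : torC c = 0 := by
    by_contra h; exact torA_ne_zero_of_torC h hA
  exact ⟨hl, hj, by simpa [nodeX, hC] using nquo_self_ne_zero a b l, by simp [nodeD, nodeB, hA, hB]⟩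

lemma mem_dom_chain (s : Bool) {j : ℕ} (hj : j < 8) {c : ℂ × ℂ} (hA : torA j c = 0)
    (hB : torB 8 j c = 0) : c ∈ dom a b (.chain s j) := by
  have hC : torC c = 0 := by
    by_contra h; exact torA_ne_zero_of_torC h hA
  refine ⟨hj, by simp [chXi, hC, hA, fT_zero], ?_⟩
  simpa [chW, hC, hA, hB] using zero_mem_jouDom

/-- Every point lies in a chart with good homogeneous coordinates. -/
lemma exists_piGood (p : Surf a b) : ∃ k, ∃ c ∈ dom a b k, (atl a b).par k c = p ∧ piGood k c := by
  obtain ⟨k, c, hc, rfl⟩ := exists_pt p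
  rcases k with y₀ | m₀ | ⟨l, j⟩ | ⟨s, j⟩ | s | s | _
  all_goals try exact ⟨_, c, hc, rfl, trivial⟩
  by_cases hA : isAff a b (.chain s j) c
  · have haff := affPt_of_isAff hc hA
    have e := pt_of_isAff hA
    rcases exists_chart_of_affPt haff with h | h
    · exact ⟨_, _, h.2.1, par_eq_par h.2.1 hc (h.2.2.trans e.symm), trivial⟩
    · exact ⟨_, _, h.2.1, par_eq_par h.2.1 hc (h.2.2.trans e.symm), trivial⟩
  · have hA' := hA
    simp only [isAff, not_and_or, not_not] at hA
    rcases special_chain (a := a) (b := b) s j c with h | h | h | h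
    -- For j ≥ 2, points with C ≠ 0 and ξ = 0 have 1 + ρ = 0, so the coordinates of the chain chart
    -- may fail there; the tail chart replaces it.
    · refine ⟨_, _, zero_mem_dom_tail s (chQ a b j c / torC c), par_eq_par (zero_mem_dom_tail s _) hc ?_, trivial⟩
      rw [pt_of_not_isAff hA', h.2, pt_of_not_isAff (by simp [isAff])]
      rfl
    · obtain rfl := (eq_zero_of_torC (n := 8) h.1).1 h.2.1
      exact ⟨_, c, hc, rfl, by cases s <;> simp [piGood]⟩
    · have := hc.1
      have h7 := (eq_zero_of_torC (n := 8) h.1).2 h.2.2.1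
      obtain rfl : j = 7 := by omega
      refine ⟨_, c, hc, rfl, ?_⟩
      cases s
      · right
        rw [chRho_eq_chRho5 (by omega), h.1]; simp
      · trivial
    · refine ⟨_, c, hc, rfl, ?_⟩
      cases s
      · by_cases hj : j ≤ 4
        · exact Or.inl hj
        · right
          rw [chRho_eq_chRho5 (by omega), h.1]; simp
      · trivial

lemma isHolomorphicToCP_pi : IsHolomorphicToCP (piMap a b) := by
  intro p
  obtain ⟨k, c, hc, rfl, hg⟩ := exists_piGood p
  exact ⟨_, (liftAt_pi hc hg).isLocalLift hc⟩

/-! ## The resolution of the quartic -/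

section

variable (a b)

/-- The values of the Inose form. -/
def qF (v : Fin 4 → ℂ) : ℂ :=
  v 1 ^ 2 * v 2 * v 3 - 4 * v 0 ^ 3 * v 2 + 3 * a * v 0 * v 2 * v 3 ^ 2
    - 1 / 2 * (v 2 ^ 2 * v 3 ^ 2 + v 3 ^ 4) + b * v 2 * v 3 ^ 3

/-- The values of the partial derivatives of the Inose form. -/
def qD (v : Fin 4 → ℂ) : Fin 4 → ℂ :=
  ![-12 * v 0 ^ 2 * v 2 + 3 * a * v 2 * v 3 ^ 2, 2 * v 1 * v 2 * v 3,
    v 1 ^ 2 * v 3 - 4 * v 0 ^ 3 + 3 * a * v 0 * v 3 ^ 2 - v 2 * v 3 ^ 2 + b * v 3 ^ 3,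
    v 1 ^ 2 * v 2 + 6 * a * v 0 * v 2 * v 3 - v 2 ^ 2 * v 3 - 2 * v 3 ^ 3 + 3 * b * v 2 * v 3 ^ 2]

lemma eval_form (v : Fin 4 → ℂ) : MvPolynomial.eval v (form a b) = qF a b v := by
  simp [form, qF]

lemma eval_pderiv_form (v : Fin 4 → ℂ) (i : Fin 4) :
    MvPolynomial.eval v (MvPolynomial.pderiv i (form a b)) = qD a b v i := by
  have h4 : (4 : MvPolynomial (Fin 4) ℂ) = MvPolynomial.C 4 := (map_ofNat _ 4).symm
  fin_cases i <;>
    simp [form, qD, h4, MvPolynomial.pderiv_X] <;> ring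

lemma qF_smul (t : ℂ) (v : Fin 4 → ℂ) : qF a b (t • v) = t ^ 4 * qF a b v := by
  simp [qF]; ring

lemma qD_smul (t : ℂ) (v : Fin 4 → ℂ) (i : Fin 4) : qD a b (t • v) i = t ^ 3 * qD a b v i := by
  fin_cases i <;> simp [qD] <;> ring

end

lemma mk_mem_quartic {v : Fin 4 → ℂ} (hv : v ≠ 0) :
    (Projectivization.mk ℂ v hv : CP 3) ∈ quartic a b ↔ qF a b v = 0 := by
  obtain ⟨t, ht⟩ := Projectivization.exists_smul_eq_mk_rep ℂ v hv
  rw [quartic, mem_ofPred_eq, eval_form, ← ht, Units.smul_def, qF_smul]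
  simp

lemma mk_mem_quarticReg {v : Fin 4 → ℂ} (hv : v ≠ 0) :
    (Projectivization.mk ℂ v hv : CP 3) ∈ quarticReg a b ↔ qF a b v = 0 ∧ ∃ i, qD a b v i ≠ 0 := by
  rw [quarticReg, mem_ofPred_eq, mk_mem_quartic]
  obtain ⟨t, ht⟩ := Projectivization.exists_smul_eq_mk_rep ℂ v hv
  simp [eval_pderiv_form, ← ht, Units.smul_def, qD_smul]

lemma qF_aff {x y z : ℂ} (hz : z ≠ 0) :
    qF a b ![x, y, z, 1] = 0 ↔ y ^ 2 = fP a b x + fh z := by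
  have : qF a b ![x, y, z, 1] = z * (y ^ 2 - (fP a b x + fh z)) := by
    simp [qF, fP, fh]; field_simp; ring
  rw [this, mul_eq_zero, or_iff_right hz, sub_eq_zero]

lemma fP_sq_of_mem_node {l : ℂ} {j : ℕ} {c : ℂ × ℂ} (hc : c ∈ dom a b (.node l j)) :
    fP a b l ^ 2 = 1 := hc.1

lemma qF_piV (p : Surf a b) : qF a b (piV a b (toPt p)) = 0 := by
  rcases h : toPt p with ⟨x, y, z⟩ | ⟨l, ρ⟩ | ⟨s, x⟩ | ⟨s, σ⟩ | ⟨s, ρ⟩ | z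
  · have h1 := affPt_of_toPt h
    exact (qF_aff h1.1).2 h1.2.1
  · obtain ⟨j, c, hc, -⟩ := exists_node_of_toPt h
    have h1 := fP_sq_of_mem_node hc
    have h2 : qF a b ![l, 0, -fP a b l, 1] = (fP a b l ^ 2 - 1) / 2 := by simp [qF, fP]; ring
    rw [piV, h2, h1]; simp
  · cases s <;> simp [piV, qF]
  · cases s <;> simp [piV, qF]
  · cases s
    · rw [piV]
      cases ρ 5 <;> simp [qF]
    · simp [piV, qF]
  · simp [piV, qF]

lemma pt_sec_zero (s : Bool) (x : ℂ) : pt a b (.sec s) (x, 0) = .sec s x :=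
  pt_of_not_isAff (by simp [isAff])

lemma pt_tail_zero (s : Bool) (σ : ℂ) : pt a b (.tail s) (σ, 0) = .tail s σ :=
  pt_of_not_isAff (by simp [isAff])

lemma pt_mid_zero (z : ℂ) : pt a b .mid (0, z) = .mid z :=
  pt_of_not_isAff (by simp [isAff])

lemma pt_node_special {l : ℂ} {j : ℕ} {c : ℂ × ℂ} (hA : torA j c = 0)
    (hB : torB (nmult a b l) j c = 0) : pt a b (.node l j) c = .exc l (tseq j c) :=
  pt_of_not_isAff (by simp [isAff, hA, hB])

lemma pt_chain_special {s : Bool} {j : ℕ} {c : ℂ × ℂ} (hA : torA j c = 0)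
    (hB : torB 8 j c = 0) : pt a b (.chain s j) c = .inf s (tseq j c) := by
  have hC : torC c = 0 := by
    by_contra h; exact torA_ne_zero_of_torC h hA
  rw [pt_of_not_isAff (by simp [isAff, hC])]
  simp [special, hC, hA, hB]

/-- The fifth curve of the chain over z = ∞ is mapped isomorphically onto the line x = w = 0, with
A/C⁵ as coordinate. In chart 4 it is the axis v = 0, and A/C⁵ = 1/u. -/
lemma piV_inf_four {u : ℂ} (hu : u ≠ 0) :
    piV a b (.inf false (tseq 4 (u, 0))) = ![0, 1, 4 * u⁻¹, 0] := by
  have e : tseq 4 (u, 0) 5 = some u⁻¹ := by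
    rw [tseq_succ]; simp [oinv, hu]
  rw [piV, e]

/-- Where w ≠ 0, a point is an affine label or a node. The section w = 0 of the quartic is x³z = 0,
that is, the two lines z = w = 0 and x = w = 0, which are hit by a tail over z = 0, by the fifth
curve over z = ∞, and by sections at the points [0, 1, 0, 0] and [0, 0, 1, 0]. -/
lemma exists_proportional {v : Fin 4 → ℂ} (hv : v ≠ 0) (h : qF a b v = 0) :
    ∃ p : Surf a b, Proportional v (piV a b (toPt p)) := by
  have hv' : v = ![v 0, v 1, v 2, v 3] := by ext i; fin_cases i <;> rfl
  by_cases h3 : v 3 = 0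
  · have h02 : v 0 ^ 3 * v 2 = 0 := by
      simp only [qF, h3] at h
      linear_combination -h / 4
    by_cases h2 : v 2 = 0
    · by_cases h0 : v 0 = 0
      · refine ⟨(atl a b).par (.sec true) (0, 0), ?_⟩
        rw [toPt_par (zero_mem_dom_sec _ _), pt_sec_zero, hv', h0, h2, h3]
        refine Proportional.of_vec4 (t := v 1) ?_ ?_ ?_ ?_ ?_ <;> simp
        intro h1; apply hv; rw [hv', h0, h1, h2, h3]; ext i; fin_cases i <;> rfl
      · refine ⟨(atl a b).par (.tail true) (v 1 / v 0, 0), ?_⟩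
        rw [toPt_par (zero_mem_dom_tail _ _), pt_tail_zero, hv', h2, h3]
        exact Proportional.of_vec4 h0 (by simp) (by simp; field_simp) (by simp) (by simp)
    · have h0 : v 0 = 0 := by simpa [h2] using h02
      by_cases h1 : v 1 = 0
      · refine ⟨(atl a b).par (.sec false) (0, 0), ?_⟩
        rw [toPt_par (zero_mem_dom_sec _ _), pt_sec_zero, hv', h0, h1, h3]
        exact Proportional.of_vec4 h2 (by simp) (by simp) (by simp) (by simp)
      · have hA : torA 4 (4 * v 1 / v 2, 0) = 0 := by simp [torA]
        have hB : torB 8 4 (4 * v 1 / v 2, 0) = 0 := by simp [torB]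
        refine ⟨(atl a b).par (.chain false 4) (4 * v 1 / v 2, 0), ?_⟩
        rw [toPt_par (mem_dom_chain false (by norm_num) hA hB), pt_chain_special hA hB,
          piV_inf_four (div_ne_zero (mul_ne_zero (by norm_num) h1) h2)]
        conv => arg 1; rw [hv', h0, h3]
        exact Proportional.of_vec4 h1 (by simp) (by simp) (by field_simp) (by simp)
  · set x := v 0 / v 3 with hx
    set y := v 1 / v 3 with hy
    set z := v 2 / v 3 with hz
    have e : v = v 3 • ![x, y, z, 1] := by
      conv_lhs => rw [hv']
      rw [hx, hy, hz]
      simp [mul_div_cancel₀ _ h3]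
    rw [e, qF_smul, mul_eq_zero, or_iff_right (pow_ne_zero 4 h3)] at h
    have hz0 : z ≠ 0 := by
      intro h0; simp [qF, h0] at h
    have h1 := (qF_aff hz0).1 h
    by_cases h2 : y = 0 ∧ z ^ 2 = 1
    · have hzi : z⁻¹ = z := by
        exact inv_eq_of_mul_eq_one_right (by rw [← h2.2]; ring)
      have hP : fP a b x = -z := by
        rw [h2.1, fh, hzi] at h1; linear_combination -h1
      have hA : torA 0 (0, 0) = 0 := by simp [torA]
      have hB : torB (nmult a b x) 0 (0, 0) = 0 := by simp [torB]
      refine ⟨(atl a b).par (.node x 0) (0, 0), ?_⟩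
      rw [toPt_par (mem_dom_node (by rw [hP, neg_sq, h2.2]) (nmult_pos a b x) hA hB),
        pt_node_special hA hB]
      exact ⟨v 3, h3, by rw [piV, hP, neg_neg, ← h2.1]; exact e⟩
    · obtain ⟨p, hp⟩ := exists_of_affPt (a := a) (b := b) ⟨hz0, h1, h2⟩
      exact ⟨p, v 3, h3, by rw [hp]; exact e⟩

lemma range_piMap : range (piMap a b) = quartic a b := by
  ext q
  constructor
  · rintro ⟨p, rfl⟩
    exact (mk_mem_quartic _).2 (qF_piV p)
  · induction q using Projectivization.ind with
    | h v hv =>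
      intro h
      obtain ⟨p, t, ht, e⟩ := exists_proportional hv ((mk_mem_quartic hv).1 h)
      refine ⟨p, ?_⟩
      rw [piMap, toCP, Projectivization.mk_eq_mk_iff']
      exact ⟨t⁻¹, by rw [e, inv_smul_smul₀ ht]⟩

lemma nmult_eq_one {l : ℂ} (h : 12 * l ^ 2 - 3 * a ≠ 0) : nmult a b l = 1 := by
  refine le_antisymm ?_ (nmult_pos a b l)
  by_contra! h1
  apply h
  have := ((Polynomial.one_lt_rootMultiplicity_iff_isRoot (poly_sub_C_ne_zero a b _)).1 h1).2
  simp [poly, Polynomial.IsRoot] at this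
  linear_combination this

/-- The gradient vanishes at [0, 1, 0, 0], at [0, 0, 1, 0] and at every node with P'(l) = 0, which
disposes of all curves that are contracted. A node with P'(l) ≠ 0 has multiplicity one and needs no
exceptional curve. -/
lemma regular_cases {p : Surf a b} (h : piMap a b p ∈ quarticReg a b) :
    (∃ x y z, toPt p = .aff x y z) ∨
    (∃ l, fP a b l ^ 2 = 1 ∧ nmult a b l = 1 ∧ toPt p = .exc l (tseq 0 (0, 0))) ∨
    (∃ σ, toPt p = .tail true σ) ∨ ∃ u ≠ 0, toPt p = .inf false (tseq 4 (u, 0)) := by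
  obtain ⟨i, hi⟩ := ((mk_mem_quarticReg _).1 h).2
  rcases hp : toPt p with ⟨x, y, z⟩ | ⟨l, ρ⟩ | ⟨s, x⟩ | ⟨s, σ⟩ | ⟨s, ρ⟩ | z
  · exact Or.inl ⟨x, y, z, rfl⟩
  · right; left
    obtain ⟨j, c, hc, -, hρ, hA, hB⟩ := exists_node_of_toPt hp
    have h1 := fP_sq_of_mem_node hc
    have hn : nmult a b l = 1 := by
      apply nmult_eq_one
      intro h2
      apply hi
      rw [hp]
      fin_cases i
      · simp [qD, piV]; linear_combination fP a b l * h2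
      · simp [qD, piV]
      · simp [qD, piV, fP]; ring
      · simp [qD, piV]
        have : fP a b l = 4 * l ^ 3 - 3 * a * l - b := rfl
        linear_combination -l * fP a b l * h2 + 2 * h1 - 3 * fP a b l * this
    have hj := hc.2.1
    rw [hn] at hj hB
    obtain rfl : j = 0 := by omega
    refine ⟨l, h1, hn, ?_⟩
    have e1 : c.2 = 0 := by simpa [torA] using hA
    have e2 : c.1 = 0 := by simpa [torB] using hB
    rw [← hρ, show c = (0, 0) from Prod.ext e2 e1]
  · rw [hp] at hi
    cases s <;> fin_cases i <;> simp [qD, piV] at hi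
  · rw [hp] at hi
    cases s
    · fin_cases i <;> simp [qD, piV] at hi
    · exact Or.inr (Or.inr (Or.inl ⟨σ, rfl⟩))
  · obtain ⟨j, c, hc, -, hρ, hC, hA, hB⟩ := exists_chain_of_toPt hp
    rw [hp] at hi
    cases s
    · right; right; right
      rcases h5 : ρ 5 with _ | t
      · simp only [piV, h5] at hi
        fin_cases i <;> simp [qD] at hi
      · have ht : t ≠ 0 := by
          rintro rfl
          simp only [piV, h5] at hi
          fin_cases i <;> simp [qD] at hi
        refine ⟨t⁻¹, inv_ne_zero ht, ?_⟩
        congr 1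
        rw [← hρ] at h5 ⊢
        -- A finite nonzero value of A/C⁵ with C = 0 occurs only on the axis u = 0 of chart 5 or on
        -- the axis v = 0 of chart 4; the first is rewritten in chart 4.
        rcases le_or_gt 5 j with hj | hj
        · rw [tseq_of_le hj, Option.some.injEq] at h5
          have hC' : c.1 * c.2 = 0 := hC
          obtain rfl : j = 5 := by
            by_contra h6
            rw [hC', zero_pow (by omega), mul_zero] at h5
            exact ht h5.symm
          have e2 : c.2 = t := by simpa using h5
          have e1 : c.1 = 0 := by
            rw [e2] at hC'
            exact (mul_eq_zero.1 hC').resolve_right ht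
          rw [show c = (0, t) from Prod.ext e1 e2]
          simpa using (tseq_down (j' := 4) (k := 0) (c := (0, t)) (by simpa using ht)).symm
        · rw [tseq_of_lt hj] at h5
          have hC' : c.1 * c.2 = 0 := hC
          have h6 : c.1 * (c.1 * c.2) ^ (5 - j - 1) = t⁻¹ := by
            rw [(oinv_eq_some.1 h5).2, inv_inv]
          obtain rfl : j = 4 := by
            by_contra h7
            rw [hC', zero_pow (by omega), mul_zero] at h6
            exact inv_ne_zero ht h6.symm
          have e1 : c.1 = t⁻¹ := by simpa using h6
          have e2 : c.2 = 0 := by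
            rw [e1] at hC'
            exact (mul_eq_zero.1 hC').resolve_left (inv_ne_zero ht)
          rw [show c = (t⁻¹, 0) from Prod.ext e1 e2]
    · fin_cases i <;> simp [qD, piV] at hi
  · rw [hp] at hi
    fin_cases i <;> simp [qD, piV] at hi

lemma piMap_eq_iff {p q : Surf a b} :
    piMap a b p = piMap a b q ↔ ∃ t : ℂ, t • piV a b (toPt q) = piV a b (toPt p) := toCP_eq_iff

lemma eq_of_piMap_eq {p q : Surf a b} (hp : piMap a b p ∈ quarticReg a b)
    (h : piMap a b p = piMap a b q) : p = q := by
  have hq := regular_cases (h ▸ hp)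
  obtain ⟨t, ht⟩ := piMap_eq_iff.1 h
  have h0 := congrFun ht 0
  have h1 := congrFun ht 1
  have h2 := congrFun ht 2
  have h3 := congrFun ht 3
  -- An affine label never has the coordinates (l, 0, -P(l)) of a node, since y = 0 and z² = 1 are
  -- excluded there.
  have key : ∀ {p : Surf a b} {x y z : ℂ}, toPt p = .aff x y z → ∀ l, fP a b l ^ 2 = 1 →
      ¬(0 = y ∧ fP a b l = -z) := by
    intro p x y z e l hl he
    refine (affPt_of_toPt e).2.2 ⟨he.1.symm, ?_⟩
    rw [← hl, he.2]; ring
  apply toPt_injective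
  rcases regular_cases hp with ⟨x, y, z, ep⟩ | ⟨l, hl, -, ep⟩ | ⟨σ, ep⟩ | ⟨u, hu, ep⟩ <;>
  rcases hq with ⟨x', y', z', eq⟩ | ⟨l', hl', -, eq⟩ | ⟨σ', eq⟩ | ⟨u', hu', eq⟩ <;>
  (try have k1 := key ep) <;> (try have k2 := key eq) <;>
  rw [ep, eq] at h0 h1 h2 h3 <;> rw [ep, eq] <;>
  (try rw [piV_inf_four hu] at h0 h1 h2 h3) <;> (try rw [piV_inf_four hu'] at h0 h1 h2 h3) <;>
  simp [piV] at h0 h1 h2 h3 ⊢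
  · simp_all
  · exact k1 l' hl' ⟨h1, by rw [← h2, h3]; ring⟩
  · exact k2 l hl ⟨by simpa [h3, eq_comm] using h1, by rw [← neg_eq_iff_eq_neg, ← h2, h3, one_mul]⟩
  · simpa [h3, eq_comm] using h0
  · simp [h3] at h0
  · simp [h3] at h0
  · simpa [h0, eq_comm] using h1
  · simp [h3] at h1
  · simp [h0] at h1
  · have : u = u' := by simpa [h1, eq_comm] using h2
    rw [this]

/-! ### Immersions -/

/-- When one homogeneous coordinate is constantly 1, the corresponding component of any derivative
is 0. A derivative proportional to the vector itself must therefore vanish. -/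
lemma isImmersionToCPAt_of_liftAt {X K : Type} {𝒜 : ParamAtlas X K} {n : ℕ} {f : 𝒜.Space → CP n}
    {k : K} {c : ℂ × ℂ} {L : ℂ × ℂ → Fin (n + 1) → ℂ} (hc : c ∈ 𝒜.U k) (h : 𝒜.LiftAt f k c L)
    {i₀ : Fin (n + 1)} (h1 : ∀ c', L c' i₀ = 1)
    (h2 : ∀ w, (∀ i, fderiv ℂ (fun c' => L c' i) c w = 0) → w = 0) :
    IsImmersionToCPAt f (𝒜.par k c) := by
  refine ⟨_, h.isLocalLift hc, fun w hw => ?_⟩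
  have hL := h.1.differentiableAt
  have e : (fun c' => (L ∘ 𝒜.chart k) (𝒜.par k c')) =ᶠ[𝓝 c] L := by
    filter_upwards [ParamAtlas.U_mem_nhds hc] with c' h4
    simp [ParamAtlas.chart_par h4]
  rw [ParamAtlas.mfderiv_eq hc (hL.congr_of_eventuallyEq e), e.fderiv_eq] at hw
  have hc' : (L ∘ 𝒜.chart k) (𝒜.par k c) = L c := e.self_of_nhds
  obtain ⟨t, ht⟩ : ∃ t : ℂ, t • L c = fderiv ℂ L c (𝒜.dchart k c w) := by
    rw [hc'] at hw
    exact (Submodule.mem_span_singleton (R := ℂ) (M := Fin (n + 1) → ℂ)).1 hw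
  have hi : ∀ i, fderiv ℂ (fun c' => L c' i) c (𝒜.dchart k c w) =
      fderiv ℂ L c (𝒜.dchart k c w) i := fun i => by
    rw [fderiv_pi (fun i => differentiableAt_pi.1 hL i)]; rfl
  have h0 := hi i₀
  rw [← ht, Pi.smul_apply, h1] at h0
  simp only [h1, fderiv_fun_const, Pi.zero_apply, zero_apply] at h0
  have ht0 : t = 0 := by simpa using h0.symm
  rw [ht0, zero_smul] at ht
  apply (ParamAtlas.dchart_bijective hc).1
  rw [map_zero]
  exact h2 _ fun i => by rw [hi, ← ht]; rfl

lemma prod_eq_zero {c w : ℂ × ℂ} (h1 : fderiv ℂ (fun c : ℂ × ℂ => c.1) c w = 0)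
    (h2 : fderiv ℂ (fun c : ℂ × ℂ => c.2) c w = 0) : w = 0 := by
  rw [fderiv_fst] at h1
  rw [fderiv_snd] at h2
  exact Prod.ext h1 h2

lemma fderiv_fun_mul_apply {f g : ℂ × ℂ → ℂ} {c : ℂ × ℂ} (hf : AnalyticAt ℂ f c)
    (hg : AnalyticAt ℂ g c) (w : ℂ × ℂ) :
    fderiv ℂ (fun c => f c * g c) c w = f c * fderiv ℂ g c w + g c * fderiv ℂ f c w := by
  rw [fderiv_fun_mul hf.differentiableAt hg.differentiableAt]; rfl

/-- The differential of a holomorphic function is the derivative along lines. -/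
lemma fderiv_apply_of_line {f : ℂ × ℂ → ℂ} {c w : ℂ × ℂ} (hf : AnalyticAt ℂ f c) {g : ℂ → ℂ}
    {g' : ℂ} (hg : HasDerivAt g g' 0) (h : ∀ t, f (c + t • w) = g t) : fderiv ℂ f c w = g' := by
  have h1 : HasDerivAt (fun t : ℂ => c + t • w) w 0 := by
    simpa using ((hasDerivAt_id (0 : ℂ)).smul_const w).const_add c
  have h2 : HasFDerivAt f (fderiv ℂ f c) (c + (0 : ℂ) • w) := by
    simpa using hf.differentiableAt.hasFDerivAt
  have h3 := h2.comp_hasDerivAt 0 h1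
  have h4 : f ∘ (fun t : ℂ => c + t • w) = g := funext h
  rw [h4] at h3
  exact h3.unique hg

/-- For n = 1 the chart coordinates are v = y - κd and u = (y + κd)/q, with q(l) ≠ 0. It is enough
to see that dz = 0 implies dd = 0 at the centre. -/
lemma immersion_node {l : ℂ} (hn : nmult a b l = 1) (hc : (0, 0) ∈ dom a b (.node l 0)) :
    IsImmersionToCPAt (piMap a b) ((atl a b).par (.node l 0) (0, 0)) := by
  have hl := fP_sq_of_mem_node hc
  refine isImmersionToCPAt_of_liftAt hc (liftAt_pi hc trivial) (i₀ := 3) (fun _ => rfl) ?_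
  intro w hw
  have hY : fderiv ℂ (nodeY a b l 0) (0, 0) w = 0 := hw 1
  have hZ : fderiv ℂ (nodeZ a b l 0) (0, 0) w = 0 := hw 2
  have hT := analyticAt_nodeT hc
  have hD0 : nodeD a b l 0 (0, 0) = 0 := by simp [nodeD, nodeB, torA, torB]
  have hT0 : nodeT a b l 0 (0, 0) ≠ 0 := by
    intro h; have := (nodeT_re_pos hc).1; rw [h] at this; simp at this
  have hε : fP a b l ≠ 0 := by rintro h; rw [h] at hl; norm_num at hl
  -- From t - 1/t = 2d one gets t² = 2dt + 1, so z = -P(l)(2dt + 1) has the differential -2P(l)t·dd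
  -- at d = 0.
  have e1 : ∀ᶠ c' in 𝓝 ((0, 0) : ℂ × ℂ), nodeZ a b l 0 c' =
      -fP a b l * (2 * (nodeD a b l 0 c' * nodeT a b l 0 c') + 1) := by
    filter_upwards [(isOpen_dom _).mem_nhds hc] with c' hc'
    have h1 := nodeT_re_pos hc'
    have h0 : nodeT a b l 0 c' ≠ 0 := by
      intro h; have := h1.1; rw [h] at this; simp at this
    have h2 := h1.2
    field_simp at h2
    rw [nodeZ]; linear_combination -fP a b l * h2
  have hD : fderiv ℂ (nodeD a b l 0) (0, 0) w = 0 := by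
    rw [EventuallyEq.fderiv_eq e1, fderiv_const_mul (by fun_prop), fderiv_add_const,
      fderiv_const_mul] at hZ
    · simp only [smul_apply, smul_eq_mul,
        fderiv_fun_mul_apply (analyticAt_nodeD l 0 _) hT, hD0] at hZ
      simpa [hε, hT0] using hZ
    · exact ((analyticAt_nodeD l 0 _).mul hT).differentiableAt
  have hA : fderiv ℂ (fun c : ℂ × ℂ => c.2) (0, 0) w = 0 := by
    have : (fun c : ℂ × ℂ => c.2) = fun c => nodeY a b l 0 c - kap a b l * nodeD a b l 0 c := by
      funext c; rw [nodeY_sub]; simp [torA]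
    rw [this, fderiv_fun_sub (analyticAt_nodeY l 0 _).differentiableAt
      ((analyticAt_nodeD l 0 _).differentiableAt.const_mul _), fderiv_const_mul
      (analyticAt_nodeD l 0 _).differentiableAt]
    simp [hY, hD]
  have hB : fderiv ℂ (fun c : ℂ × ℂ => nquo a b l (nodeX l c) * c.1) (0, 0) w = 0 := by
    have : (fun c : ℂ × ℂ => nquo a b l (nodeX l c) * c.1) =
        fun c => nodeY a b l 0 c + kap a b l * nodeD a b l 0 c := by
      funext c; rw [nodeY_add]; simp [nodeB, torB, hn]
    rw [this, fderiv_fun_add (analyticAt_nodeY l 0 _).differentiableAt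
      ((analyticAt_nodeD l 0 _).differentiableAt.const_mul _), fderiv_const_mul
      (analyticAt_nodeD l 0 _).differentiableAt]
    simp [hY, hD]
  rw [fderiv_fun_mul_apply (analyticAt_nodeX l _).nquo analyticAt_fst] at hB
  refine prod_eq_zero ?_ hA
  simpa [nodeX, torC, nquo_self_ne_zero] using hB

/-- At (u, 0) the first coordinate C·M has differential (u/8)·u·dv, so a kernel vector is tangent to
the axis v = 0; along this axis the second coordinate √T·M is u/4. -/
lemma immersion_chain {u : ℂ} (hu : u ≠ 0) (hc : (u, 0) ∈ dom a b (.chain false 4)) :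
    IsImmersionToCPAt (piMap a b) ((atl a b).par (.chain false 4) (u, 0)) := by
  have hg : piGood (.chain false 4) (u, 0) := Or.inl le_rfl
  have hL := liftAt_pi hc hg
  refine isImmersionToCPAt_of_liftAt hc hL (i₀ := 2) (fun _ => by simp [piL]) ?_
  intro w hw
  have hm := analyticAt_chM hc
  have hQ := analyticAt_chQ hc
  have h0 : ∀ t : ℂ, chM a b 4 (t, 0) = t / 8 ∧ chQ a b 4 (t, 0) = 2 := by
    intro t
    have hξ : chXi 4 (t, (0 : ℂ)) = 0 := by simp [chXi, torA, torC]
    have hW : chW a b 4 (t, 0) = 0 := by simp [chW, torA, torC, torB]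
    constructor
    · rw [chM, hW, hξ, fT_zero]; simp [torA, torC, chIota]; norm_num
    · rw [chQ, hξ, fT_zero, csqrt_four]
  have w2 : w.2 = 0 := by
    have h1 : fderiv ℂ (fun c => torC c * chM a b 4 c) (u, 0) w = 0 := by simpa [piL] using hw 0
    rw [fderiv_fun_mul_apply (analyticAt_torC _) hm, (h0 u).1] at h1
    have h2 : fderiv ℂ torC (u, 0) w = u * w.2 := by
      unfold torC
      rw [fderiv_fun_mul_apply analyticAt_fst analyticAt_snd, fderiv_snd, fderiv_fst]
      simp
    rw [h2] at h1
    simpa [torC, hu] using h1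
  have h1 : fderiv ℂ (fun c => chQ a b 4 c * chM a b 4 c) (u, 0) w = 0 := by simpa [piL] using hw 1
  have hg : HasDerivAt (fun t : ℂ => 2 * ((u + t * w.1) / 8)) (2 * (1 * w.1 / 8)) 0 :=
    ((((hasDerivAt_id (0 : ℂ)).mul_const w.1).const_add u).div_const 8).const_mul 2
  rw [fderiv_apply_of_line (f := fun c => chQ a b 4 c * chM a b 4 c) (hQ.mul hm) hg] at h1
  · refine Prod.ext ?_ w2
    simpa using h1
  · intro t
    have : ((u, 0) + t • w : ℂ × ℂ) = (u + t * w.1, 0) := Prod.ext (by simp) (by simp [w2])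
    rw [this]; simp [h0]

lemma immersion_piMap {p : Surf a b} (hp : piMap a b p ∈ quarticReg a b) :
    IsImmersionToCPAt (piMap a b) p := by
  have key : ∀ {k : Idx} {c : ℂ × ℂ} (hc : c ∈ dom a b k), pt a b k c = toPt p →
      p = (atl a b).par k c := fun hc h => toPt_injective (by rw [toPt_par hc, h])
  rcases regular_cases hp with ⟨x, y, z, ep⟩ | ⟨l, hl, hn, ep⟩ | ⟨σ, ep⟩ | ⟨u, hu, ep⟩
  · rcases exists_chart_of_affPt (affPt_of_toPt ep) with ⟨-, hc, h⟩ | ⟨-, hc, h⟩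
    · rw [key hc (h.trans ep.symm)]
      refine isImmersionToCPAt_of_liftAt hc (liftAt_pi hc trivial) (i₀ := 3) (fun _ => rfl) ?_
      exact fun w hw => prod_eq_zero (hw 0) (hw 2)
    · rw [key hc (h.trans ep.symm)]
      refine isImmersionToCPAt_of_liftAt hc (liftAt_pi hc trivial) (i₀ := 3) (fun _ => rfl) ?_
      exact fun w hw => prod_eq_zero (hw 0) (hw 1)
  · have hA : torA 0 (0, 0) = 0 := by simp [torA]
    have hB : torB (nmult a b l) 0 (0, 0) = 0 := by simp [torB]
    have hc := mem_dom_node hl (nmult_pos a b l) hA hB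
    rw [key hc ((pt_node_special hA hB).trans ep.symm)]
    exact immersion_node hn hc
  · have hc := zero_mem_dom_tail (a := a) (b := b) true σ
    rw [key hc ((pt_tail_zero _ _).trans ep.symm)]
    refine isImmersionToCPAt_of_liftAt hc (liftAt_pi hc trivial) (i₀ := 0) (fun _ => rfl) ?_
    exact fun w hw => prod_eq_zero (hw 1) (hw 3)
  · have hA : torA 4 (u, 0) = 0 := by simp [torA]
    have hB : torB 8 4 (u, 0) = 0 := by simp [torB]
    have hc := mem_dom_chain (a := a) (b := b) false (by norm_num : 4 < 8) hA hB
    rw [key hc ((pt_chain_special hA hB).trans ep.symm)]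
    exact immersion_chain hu hc

/-- At w = 1 the derivative in y is 2yz; if y = 0, the derivative in z equals (1/z - z)/2, which
vanishes only for z² = 1. -/
lemma mem_quarticReg_of_aff {p : Surf a b} {x y z : ℂ} (h : toPt p = .aff x y z) :
    piMap a b p ∈ quarticReg a b := by
  refine (mk_mem_quarticReg _).2 ⟨qF_piV p, ?_⟩
  have h1 := affPt_of_toPt h
  rw [h]
  by_cases hy : y = 0
  · refine ⟨2, fun h2 => h1.2.2 ⟨hy, ?_⟩⟩
    have h3 := h1.2.1
    have h0 := h1.1
    simp [qD, piV] at h2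
    rw [fP, fh] at h3
    field_simp at h3
    linear_combination h3 - 2 * z * h2
  · exact ⟨1, by simp [qD, piV, hy, h1.1]⟩

lemma isResolution_piMap : IsResolution a b (piMap a b) where
  compact := inferInstance
  t2 := inferInstance
  holomorphic := isHolomorphicToCP_pi
  range_eq := range_piMap
  bijective q hq := by
    obtain ⟨p, rfl⟩ : q ∈ range (piMap a b) := by rw [range_piMap]; exact hq.1
    exact ⟨p, rfl, fun p' h => (eq_of_piMap_eq hq h.symm).symm⟩
  immersion _ hp := immersion_piMap hp
  dense := by
    refine dense_isGen.mono fun p hp => ?_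
    rcases h : toPt p with ⟨x, y, z⟩ | _ | _ | _ | _ | _
    · exact mem_quarticReg_of_aff h
    all_goals simp [h, IsGen] at hp

lemma isAlternateFibration_theta : IsAlternateFibration (piMap a b) (theta a b) where
  holomorphic := isHolomorphicToCP_theta
  induced p h := by
    obtain ⟨t, ht⟩ := Projectivization.exists_smul_eq_mk_rep ℂ (piV a b (toPt p)) (piV_ne_zero _)
    have ht' : (t : ℂ) • piV a b (toPt p) = (piMap a b p).rep := ht
    have h0 : thetaV (toPt p) = ![piV a b (toPt p) 0, piV a b (toPt p) 3] := by
      have h' : ¬(piV a b (toPt p) 0 = 0 ∧ piV a b (toPt p) 3 = 0) := by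
        rintro ⟨h0, h3⟩
        apply h
        rw [← ht']
        simp [h0, h3]
      generalize toPt p = P at h' ⊢
      rcases P with ⟨x, y, z⟩ | ⟨l, ρ⟩ | ⟨s, x⟩ | ⟨s, σ⟩ | ⟨s, ρ⟩ | z
      · simp [thetaV, piV]
      · simp [thetaV, piV]
      · cases s <;> simp [piV] at h'
      · cases s
        · simp [piV] at h'
        · simp [thetaV, piV]
      · cases s
        · rw [piV] at h'
          cases h5 : ρ 5 <;> simp [h5] at h'
        · simp [piV] at h'
      · simp [piV] at h'
    simp only [theta, toCP]
    rw [Projectivization.mk_eq_mk_iff']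
    refine ⟨(t : ℂ)⁻¹, ?_⟩
    rw [h0, ← ht']
    simp

/-! ## Holomorphic volume forms and minimality -/

/-- The determinant of two vectors. -/
def det2 (v w : ℂ × ℂ) : ℂ := v.1 * w.2 - v.2 * w.1

lemma det2_map (L : ℂ × ℂ →L[ℂ] ℂ × ℂ) (v w : ℂ × ℂ) :
    det2 (L v) (L w) = det2 (L (1, 0)) (L (0, 1)) * det2 v w := by
  have h : ∀ v : ℂ × ℂ, L v = v.1 • L (1, 0) + v.2 • L (0, 1) := by
    intro v
    rw [← map_smul, ← map_smul, ← map_add]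
    congr 1
    ext <;> simp
  rw [h v, h w]
  simp [det2]
  ring

lemma exists_smul_of_det2 {v w : ℂ × ℂ} (h : det2 v w = 0) (hv : v ≠ 0) : ∃ t : ℂ, w = t • v := by
  rw [det2] at h
  by_cases h1 : v.1 = 0
  · have h2 : v.2 ≠ 0 := fun h2 => hv (Prod.ext h1 h2)
    refine ⟨w.2 / v.2, Prod.ext ?_ ?_⟩
    · have : w.1 = 0 := by simpa [h1, h2] using h
      simp [h1, this]
    · simp [h2]
  · refine ⟨w.1 / v.1, Prod.ext ?_ ?_⟩
    · simp [h1]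
    · simp; field_simp; linear_combination h

/-! ### Nowhere vanishing two-forms on a surface given by charts -/

namespace ParamAtlas

variable {X K : Type}

/-- The transition maps. -/
def trans (𝒜 : ParamAtlas X K) (k l : K) (c : ℂ × ℂ) : ℂ × ℂ := 𝒜.chart l (𝒜.par k c)

/-- A nowhere vanishing holomorphic two-form. -/
structure VolumeForm (𝒜 : ParamAtlas X K) where
  dens : K → ℂ × ℂ → ℂ
  differentiableAt : ∀ k, ∀ c ∈ 𝒜.U k, DifferentiableAt ℂ (dens k) c
  ne_zero : ∀ k, ∀ c ∈ 𝒜.U k, dens k c ≠ 0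
  dens_eq : ∀ k l c d, c ∈ 𝒜.U k → d ∈ 𝒜.U l → 𝒜.par k c = 𝒜.par l d → dens k c =
    dens l d * det2 (fderiv ℂ (𝒜.trans k l) c (1, 0)) (fderiv ℂ (𝒜.trans k l) c (0, 1))

variable {𝒜 : ParamAtlas X K}

variable (𝒜) in
/-- The differential of the charts. -/
def dch (k : K) (p : 𝒜.Space) : ℂ × ℂ →L[ℂ] ℂ × ℂ := mfderiv I2 𝓘(ℂ, ℂ × ℂ) (𝒜.chart k) p

lemma dch_eq {k l : K} {c d : ℂ × ℂ} (hc : c ∈ 𝒜.U k) (hd : d ∈ 𝒜.U l)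
    (h : 𝒜.par k c = 𝒜.par l d) (v : ℂ × ℂ) :
    𝒜.dch l (𝒜.par k c) v = fderiv ℂ (𝒜.trans k l) c (𝒜.dch k (𝒜.par k c) v) :=
  mfderiv_eq hc (analyticAt_transition hc hd h).differentiableAt v

/-- The differential of a curve. -/
def dcurve (φ : ℂ → 𝒜.Space) (s : ℂ) : ℂ →L[ℂ] ℂ × ℂ := mfderiv 𝓘(ℂ, ℂ) I2 φ s

/-- The velocity of a curve. -/
def vel (φ : ℂ → 𝒜.Space) (s : ℂ) : ℂ × ℂ := dcurve φ s 1

lemma dch_vel {φ : ℂ → 𝒜.Space} {k : K} {s : ℂ} (hs : φ s ∈ (𝒜.chart k).source)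
    (hφ : MDifferentiableAt 𝓘(ℂ, ℂ) I2 φ s) :
    𝒜.dch k (φ s) (vel φ s) = deriv (fun r => 𝒜.chart k (φ r)) s := by
  obtain ⟨c, hc, e⟩ := hs
  have h1 := mdifferentiableAt_chart hc
  rw [e] at h1
  have h4 := mfderiv_comp (I'' := 𝓘(ℂ, ℂ × ℂ)) s h1 hφ
  rw [← fderiv_apply_one_eq_deriv, ← mfderiv_eq_fderiv]
  exact (congrArg (fun L : ℂ →L[ℂ] ℂ × ℂ => L 1) h4).symm

lemma vel_ne_zero {φ : ℂ → 𝒜.Space} {s : ℂ} (h : mfderiv 𝓘(ℂ, ℂ) I2 φ s ≠ 0) : vel φ s ≠ 0 :=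
  fun h0 => h (ContinuousLinearMap.ext_ring h0 : dcurve φ s = 0)

lemma vel_comp_inv {φ : ℂ → 𝒜.Space} {s : ℂ} (hs : s ≠ 0)
    (hφ : MDifferentiableAt 𝓘(ℂ, ℂ) I2 φ s⁻¹) :
    vel (φ ∘ Inv.inv) s = (-(s ^ 2)⁻¹) • vel φ s⁻¹ := by
  have h2 := mfderiv_comp (I' := 𝓘(ℂ, ℂ)) s hφ (differentiableAt_inv hs).mdifferentiableAt
  have h3 : dcurve (φ ∘ Inv.inv) s = (dcurve φ s⁻¹).comp (fderiv ℂ (Inv.inv : ℂ → ℂ) s) := by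
    rw [dcurve, h2, mfderiv_eq_fderiv]; rfl
  rw [vel, h3, ContinuousLinearMap.comp_apply, fderiv_apply_one_eq_deriv, deriv_inv,
    ← mul_one (-(s ^ 2)⁻¹), ← smul_eq_mul, map_smul]
  simp [vel]

namespace VolumeForm

variable (Ω : VolumeForm 𝒜)

/-- The values of a two-form. -/
def ev (p : 𝒜.Space) (v w : ℂ × ℂ) : ℂ :=
  Ω.dens (exists_par p).choose (𝒜.chart (exists_par p).choose p) *
    det2 (𝒜.dch (exists_par p).choose p v) (𝒜.dch (exists_par p).choose p w)

variable {Ω}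

/-- The value was defined with a chosen chart at each point; the Jacobian factor in `dens_eq` makes
it the same in every chart. -/
lemma ev_eq {k : K} {c : ℂ × ℂ} (hc : c ∈ 𝒜.U k) (v w : ℂ × ℂ) :
    Ω.ev (𝒜.par k c) v w =
      Ω.dens k c * det2 (𝒜.dch k (𝒜.par k c) v) (𝒜.dch k (𝒜.par k c) w) := by
  rw [ev]
  obtain ⟨d, hd, e⟩ := (exists_par (𝒜.par k c)).choose_spec
  generalize (exists_par (𝒜.par k c)).choose = l at *
  have e' : 𝒜.chart l (𝒜.par k c) = d := by rw [← e, chart_par hd]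
  rw [e', Ω.dens_eq k l c d hc hd e.symm, dch_eq hc hd e.symm, dch_eq hc hd e.symm, det2_map]
  ring

lemma ev_self (p : 𝒜.Space) (v : ℂ × ℂ) : Ω.ev p v v = 0 := by
  rw [ev, det2]; ring

lemma ev_smul_left (p : 𝒜.Space) (t : ℂ) (v w : ℂ × ℂ) : Ω.ev p (t • v) w = t * Ω.ev p v w := by
  simp [ev, det2]; ring

lemma ev_smul_right (p : 𝒜.Space) (t : ℂ) (v w : ℂ × ℂ) : Ω.ev p v (t • w) = t * Ω.ev p v w := by
  simp [ev, det2]; ring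

lemma ev_add_right (p : 𝒜.Space) (v w w' : ℂ × ℂ) :
    Ω.ev p v (w + w') = Ω.ev p v w + Ω.ev p v w' := by
  simp [ev, det2]; ring

lemma exists_smul_of_ev {p : 𝒜.Space} {v w : ℂ × ℂ} (h : Ω.ev p v w = 0) (hv : v ≠ 0) :
    ∃ t : ℂ, w = t • v := by
  obtain ⟨k, c, hc, rfl⟩ := exists_par p
  rw [ev_eq hc, mul_eq_zero, or_iff_right (Ω.ne_zero k c hc)] at h
  have inj : Function.Injective (𝒜.dch k (𝒜.par k c)) := (dchart_bijective hc).1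
  obtain ⟨t, ht⟩ := exists_smul_of_det2 h (fun h0 => hv (inj (h0.trans (map_zero _).symm)))
  exact ⟨t, inj (by rw [ht, map_smul])⟩

/-- The values of a two-form on a tangent vector field and another holomorphic vector field along a
holomorphic curve are holomorphic. -/
lemma differentiableAt_ev {φ : ℂ → 𝒜.Space} {ν : ℂ → ℂ × ℂ} (hφ : MDifferentiable 𝓘(ℂ, ℂ) I2 φ)
    {s : ℂ} (hν : MDifferentiableAt 𝓘(ℂ, ℂ) I2.tangent
      (fun s => (⟨φ s, ν s⟩ : TangentBundle I2 𝒜.Space)) s) :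
    DifferentiableAt ℂ
      (fun s => Ω.ev (φ s) (vel φ s) (ν s)) s := by
  obtain ⟨k, hk⟩ := exists_chartAt_eq 𝒜 (φ s)
  have hs : ∀ᶠ r in 𝓝 s, φ r ∈ (𝒜.chart k).source := by
    refine hφ.continuous.continuousAt.eventually ((𝒜.chart k).open_source.mem_nhds ?_)
    rw [← hk]; exact mem_chart_source _ _
  have hγ : ∀ᶠ r in 𝓝 s, DifferentiableAt ℂ (fun r => 𝒜.chart k (φ r)) r := by
    filter_upwards [hs] with r hr
    obtain ⟨c, hc, e⟩ := hr
    have h1 := mdifferentiableAt_chart hc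
    rw [e] at h1
    exact mdifferentiableAt_iff_differentiableAt.1 (h1.comp r (hφ r))
  -- A function of one complex variable that is differentiable on an open set is analytic, so its
  -- derivative is again differentiable.
  have hγ' : AnalyticAt ℂ (fun r => 𝒜.chart k (φ r)) s := by
    obtain ⟨O, hO, hOo, hsO⟩ := mem_nhds_iff.1 hγ
    exact DifferentiableOn.analyticAt (fun r hr => (hO hr).differentiableWithinAt)
      (hOo.mem_nhds hsO)
  -- Holomorphy of a vector field along the curve refers to the trivialization of the tangent bundle
  -- at `φ s`, which is the differential of the chart there.
  have hV : DifferentiableAt ℂ (fun r => 𝒜.dch k (φ r) (ν r)) s := by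
    have h1 := ((mdifferentiableAt_totalSpace I2 _).1 hν).2
    rw [mdifferentiableAt_iff_differentiableAt] at h1
    refine h1.congr_of_eventuallyEq ?_
    filter_upwards [hs] with r hr
    have hr' : φ r ∈ (chartAt (ℂ × ℂ) (φ s)).source := by rwa [hk]
    have h2 := TangentBundle.continuousLinearMapAt_trivializationAt (I := I2) hr'
    have h3 := (trivializationAt (ℂ × ℂ) (TangentSpace I2) (φ s)).continuousLinearMapAt_apply_of_mem
      (R := ℂ) (b := φ r) (by simpa using hr') (ν r)
    rw [← h3, h2, dch]
    have h4 : (extChartAt I2 (φ s) : 𝒜.Space → ℂ × ℂ) = 𝒜.chart k := by rw [← hk]; rfl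
    exact congrArg (fun f : 𝒜.Space → ℂ × ℂ =>
      (mfderiv I2 𝓘(ℂ, ℂ × ℂ) f (φ r) : ℂ × ℂ →L[ℂ] ℂ × ℂ) (ν r)) h4.symm
  have e : (fun s => Ω.ev (φ s) (vel φ s) (ν s)) =ᶠ[𝓝 s]
      fun r => Ω.dens k (𝒜.chart k (φ r)) * det2 (deriv (fun r => 𝒜.chart k (φ r)) r)
        (𝒜.dch k (φ r) (ν r)) := by
    filter_upwards [hs] with r hr
    rw [← dch_vel hr (hφ r)]
    obtain ⟨c, hc, e⟩ := hr
    have h2 := ev_eq (Ω := Ω) hc (vel φ r) (ν r)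
    have h3 := chart_par hc
    rw [e] at h2 h3
    rw [h2, h3]
  refine DifferentiableAt.congr_of_eventuallyEq ?_ e
  obtain ⟨c, hc, h3⟩ := hs.self_of_nhds
  have h4 := Ω.differentiableAt k c hc
  rw [← chart_par hc, h3] at h4
  refine DifferentiableAt.mul (DifferentiableAt.comp s h4 hγ'.differentiableAt) ?_
  have h5 := hγ'.deriv.differentiableAt
  unfold det2
  exact (h5.fst.mul hV.snd).sub (h5.snd.mul hV.fst)

end VolumeForm

end ParamAtlas

lemma aff_one_eq {s : ℂ} (hs : s ≠ 0) : aff 1 s = aff 0 s⁻¹ := by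
  simp only [aff, one_ne_zero, if_false, if_true]
  rw [Projectivization.mk_eq_mk_iff']
  exact ⟨s, by simp [hs]⟩

/-- A surface with a nowhere vanishing holomorphic two-form contains no `(-1)`-curve. -/
lemma ParamAtlas.VolumeForm.not_isMinusOneCurve {X K : Type} {𝒜 : ParamAtlas X K}
    (Ω : VolumeForm 𝒜) (φ : CP 1 → 𝒜.Space) : ¬IsMinusOneCurve φ := by
  rintro ⟨hφ, -, ν, hν, hν', hνd⟩
  -- The two-form evaluated on the velocity and the normal frame gives an entire function on each
  -- affine piece, without zeros since the frame is nowhere tangent.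
  let g : Fin 2 → ℂ → ℂ := fun k s => Ω.ev (φ (aff k s)) (vel (fun s => φ (aff k s)) s) (ν k s)
  have hg : ∀ k, Differentiable ℂ (g k) := fun k s =>
    VolumeForm.differentiableAt_ev (hφ k).1 (hν k s)
  have hg0 : ∀ k s, g k s ≠ 0 := by
    intro k s h
    obtain ⟨t, ht⟩ := VolumeForm.exists_smul_of_ev h (vel_ne_zero ((hφ k).2 s))
    exact hν' k s ((Submodule.mem_span_singleton (R := ℂ) (M := ℂ × ℂ)).2 ⟨t, ht.symm⟩)
  -- The velocity transforms with -s⁻² and the normal frame with (s⁻¹)⁻¹ = s, modulo tangent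
  -- vectors, which the form does not see.
  have key : ∀ s : ℂ, s ≠ 0 → g 1 s = -s⁻¹ * g 0 s⁻¹ := by
    intro s hs
    have h1 : vel (fun s => φ (aff 1 s)) s = (-(s ^ 2)⁻¹) • vel (fun s => φ (aff 0 s)) s⁻¹ := by
      have e : (fun s => φ (aff 1 s)) =ᶠ[𝓝 s] (fun s => φ (aff 0 s)) ∘ Inv.inv := by
        filter_upwards [isOpen_ne.mem_nhds hs] with r hr
        simp [aff_one_eq hr]
      rw [← vel_comp_inv hs ((hφ 0).1 s⁻¹), vel, vel, dcurve, dcurve, e.mfderiv_eq]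
    obtain ⟨t, ht⟩ : ∃ t : ℂ, t • vel (fun s => φ (aff 1 s)) s = ν 1 s - (s⁻¹) ^ (-1 : ℤ) • ν 0 s⁻¹ :=
      (Submodule.mem_span_singleton (R := ℂ) (M := ℂ × ℂ)).1 (hνd s hs)
    have h3 : ν 1 s = s • ν 0 s⁻¹ + t • vel (fun s => φ (aff 1 s)) s := by
      rw [ht]; simp
    simp only [g]
    rw [h3, VolumeForm.ev_add_right, VolumeForm.ev_smul_right, VolumeForm.ev_smul_right,
      VolumeForm.ev_self, h1, VolumeForm.ev_smul_left, aff_one_eq hs]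
    field_simp
    ring
  -- Solving for `g 0` gives `g 0 t` = -t⁻¹·`g 1 t⁻¹`, which tends to 0 at infinity; by Liouville `g
  -- 0` vanishes identically, a contradiction.
  have hlim : Tendsto (g 0) (cocompact ℂ) (𝓝 0) := by
    have h0 : Tendsto (fun t : ℂ => t⁻¹) (cocompact ℂ) (𝓝 0) := by
      rw [← Metric.cobounded_eq_cocompact]; exact tendsto_inv₀_cobounded
    have h1 : Tendsto (fun t : ℂ => -t⁻¹ * g 1 t⁻¹) (cocompact ℂ) (𝓝 (-0 * g 1 0)) :=
      h0.neg.mul (((hg 1).continuous.tendsto 0).comp h0)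
    rw [neg_zero, zero_mul] at h1
    refine h1.congr' ?_
    filter_upwards [(isCompact_singleton (x := (0 : ℂ))).compl_mem_cocompact] with t ht
    have ht : t ≠ 0 := ht
    rw [key t⁻¹ (inv_ne_zero ht), inv_inv]
    field_simp
  exact hg0 0 0 (congrFun ((hg 0).eq_const_of_tendsto_cocompact hlim) 0)

/-! ## The holomorphic two-form on the resolution -/

/-- The Jacobian determinant of two functions. -/
def jac (f g : ℂ × ℂ → ℂ) (c : ℂ × ℂ) : ℂ :=
  fderiv ℂ f c (1, 0) * fderiv ℂ g c (0, 1) - fderiv ℂ f c (0, 1) * fderiv ℂ g c (1, 0)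

section

variable {f g h f' g' : ℂ × ℂ → ℂ} {c : ℂ × ℂ}

lemma jac_congr (hf : f =ᶠ[𝓝 c] f') (hg : g =ᶠ[𝓝 c] g') : jac f g c = jac f' g' c := by
  rw [jac, jac, hf.fderiv_eq, hg.fderiv_eq]

lemma jac_mul (hg : AnalyticAt ℂ g c) (hh : AnalyticAt ℂ h c) :
    jac f (fun c => g c * h c) c = g c * jac f h c + h c * jac f g c := by
  simp only [jac, fderiv_fun_mul_apply hg hh]; ring

lemma jac_add (hg : AnalyticAt ℂ g c) (hh : AnalyticAt ℂ h c) :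
    jac f (fun c => g c + h c) c = jac f g c + jac f h c := by
  simp only [jac, fderiv_fun_add hg.differentiableAt hh.differentiableAt, add_apply]; ring

lemma jac_swap : jac f g c = -jac g f c := by rw [jac, jac]; ring

lemma fderiv_comp_apply {p : ℂ → ℂ} {p' : ℂ} (hf : AnalyticAt ℂ f c)
    (hp : HasDerivAt p p' (f c)) (w : ℂ × ℂ) :
    fderiv ℂ (fun c => p (f c)) c w = p' * fderiv ℂ f c w := by
  have h := hp.comp_hasFDerivAt c hf.differentiableAt.hasFDerivAt
  have h' : fderiv ℂ (fun c => p (f c)) c = _ := h.fderiv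
  rw [h']; rfl

lemma jac_comp_left {p : ℂ → ℂ} {p' : ℂ} (hf : AnalyticAt ℂ f c) (hp : HasDerivAt p p' (f c)) :
    jac (fun c => p (f c)) g c = p' * jac f g c := by
  simp only [jac, fderiv_comp_apply hf hp]; ring

lemma jac_comp {p : ℂ → ℂ} (hf : AnalyticAt ℂ f c) (hp : AnalyticAt ℂ p (f c)) :
    jac f (fun c => p (f c)) c = 0 := by
  simp only [jac, fderiv_comp_apply hf hp.differentiableAt.hasDerivAt]; ring

lemma jac_const (t : ℂ) : jac f (fun _ => t) c = 0 := by simp [jac]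

lemma jac_comp_map {τ : ℂ × ℂ → ℂ × ℂ} (hτ : AnalyticAt ℂ τ c) (hf : AnalyticAt ℂ f (τ c))
    (hg : AnalyticAt ℂ g (τ c)) :
    jac (fun c => f (τ c)) (fun c => g (τ c)) c =
      jac f g (τ c) * det2 (fderiv ℂ τ c (1, 0)) (fderiv ℂ τ c (0, 1)) := by
  have h1 : fderiv ℂ (fun c => f (τ c)) c = _ :=
    fderiv_comp c hf.differentiableAt hτ.differentiableAt
  have h2 : fderiv ℂ (fun c => g (τ c)) c = _ :=
    fderiv_comp c hg.differentiableAt hτ.differentiableAt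
  have h : ∀ (L : ℂ × ℂ →L[ℂ] ℂ) (v : ℂ × ℂ), L v = v.1 * L (1, 0) + v.2 * L (0, 1) := by
    intro L v
    rw [← smul_eq_mul, ← smul_eq_mul, ← map_smul, ← map_smul, ← map_add]
    congr 1
    ext <;> simp
  simp only [jac, h1, h2, ContinuousLinearMap.comp_apply]
  rw [h (fderiv ℂ f (τ c)) (fderiv ℂ τ c (1, 0)), h (fderiv ℂ f (τ c)) (fderiv ℂ τ c (0, 1)),
    h (fderiv ℂ g (τ c)) (fderiv ℂ τ c (1, 0)), h (fderiv ℂ g (τ c)) (fderiv ℂ τ c (0, 1)), det2]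
  ring

end

lemma jac_fst (g : ℂ × ℂ → ℂ) (c : ℂ × ℂ) : jac (fun c => c.1) g c = fderiv ℂ g c (0, 1) := by
  simp [jac, fderiv_fst]

/-- A = vCʲ and dC ∧ dv = v du ∧ dv; the factor Cʲ does not contribute to dC ∧ dA beyond scaling.
With the opposite sign for B, this says that the toric form dC ∧ dA/A equals du ∧ dv in every chart.
-/
lemma jac_torC_torA (j : ℕ) (c : ℂ × ℂ) : jac torC (torA j) c = torA j c := by
  have h1 : jac torC (fun c => c.2) c = c.2 := by
    rw [jac_swap]; unfold torC
    rw [jac_mul analyticAt_fst analyticAt_snd]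
    simp [jac, fderiv_fst, fderiv_snd]
  have h2 : jac torC (fun c => torC c ^ j) c = 0 :=
    jac_comp (p := fun z => z ^ j) (analyticAt_torC c) (by fun_prop)
  have h3 := jac_mul (f := torC) (h := fun c => torC c ^ j) analyticAt_snd
    ((analyticAt_torC c).pow j)
  rw [h1, h2] at h3
  exact h3.trans (by rw [torA, torC]; ring)

lemma jac_torC_torB (n j : ℕ) (c : ℂ × ℂ) : jac torC (torB n j) c = -torB n j c := by
  have h1 : jac torC (fun c => c.1) c = -c.1 := by
    rw [jac_swap]; unfold torC
    rw [jac_mul analyticAt_fst analyticAt_snd]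
    simp [jac, fderiv_fst, fderiv_snd]
  have h2 : jac torC (fun c => torC c ^ (n - 1 - j)) c = 0 :=
    jac_comp (p := fun z => z ^ (n - 1 - j)) (analyticAt_torC c) (by fun_prop)
  have h3 := jac_mul (f := torC) (h := fun c => torC c ^ (n - 1 - j)) analyticAt_fst
    ((analyticAt_torC c).pow (n - 1 - j))
  rw [h1, h2] at h3
  exact h3.trans (by rw [torB, torC]; ring)

/-- The factor contributed by `z = zside s w` to the density of the two-form. -/
def sideDens (s : Bool) (w : ℂ) : ℂ :=
  (if s then 1 else -1) * (1 + jou w ^ 2) / (1 - jou w ^ 2)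

lemma sideDens_ne_zero (s : Bool) {w : ℂ} (hw : w ∈ jouDom) : sideDens s w ≠ 0 :=
  div_ne_zero (mul_ne_zero (by cases s <;> simp) (one_add_jou_sq_ne_zero hw))
    (one_sub_jou_sq_ne_zero hw)

/-- (z - 1/z)/2 divided by (z + 1/z)/2 = 1/(2w) is (z² - 1)/(z² + 1), holomorphic and nonzero at z =
0. Inverting z changes its sign, whence the sign depending on `s`. -/
lemma sideDens_mul (s : Bool) {w : ℂ} (hw : w ∈ jouDom) (h0 : w ≠ 0) :
    sideDens s w * ((zside s w - (zside s w)⁻¹) / 2) = -(1 / (2 * w)) := by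
  have h1 := jou_eq hw
  have h2 := (jou_eq_zero hw).not.2 h0
  have h3 := one_sub_jou_sq_ne_zero hw
  cases s <;> simp [sideDens, zside] <;> field_simp
  · linear_combination h1
  · linear_combination (1 - jou w ^ 2) * h1

lemma analyticAt_sideDens (s : Bool) {f : ℂ × ℂ → ℂ} {c : ℂ × ℂ} (hf : AnalyticAt ℂ f c)
    (h : f c ∈ jouDom) : AnalyticAt ℂ (fun c => sideDens s (f c)) c :=
  (analyticAt_const.mul (analyticAt_const.add ((hf.jou h).pow 2))).div
    (analyticAt_const.sub ((hf.jou h).pow 2)) (one_sub_jou_sq_ne_zero h)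

section

variable (a b)

/-- The densities of the two-form `dx ∧ dy / ((z - 1 / z) / 2)`. -/
def volDens : Idx → ℂ × ℂ → ℂ
  | .xz y₀, c => 1 / (2 * cY a b (.xz y₀) c * c.2)
  | .xy m₀, c => 1 / (m₀ * csqrt (((c.2 ^ 2 - fP a b c.1) ^ 2 - 1) / m₀ ^ 2))
  | .node l j, c => kap a b l / (2 * fP a b l * csqrt (1 + nodeD a b l j c ^ 2))
  | .chain s j, c => sideDens s (chW a b j c) / chQ a b j c
  | .sec s, c => sideDens s (secW a b c) / (1 - c.2 ^ 2 * fP a b c.1)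
  | .tail s, c => -sideDens s (tailW a b c) / (c.1 ^ 2 * c.2 - fT a b c.2)
  | .mid, c => -1 / (csqrt (midR a b c) * c.2)

end

lemma ne_zero_of_dom_xz {y₀ : ℂ} {c : ℂ × ℂ} (hc : c ∈ dom a b (.xz y₀)) : y₀ ≠ 0 := by
  rintro rfl
  simpa using hc.2

lemma ne_zero_of_dom_xy {m₀ : ℂ} {c : ℂ × ℂ} (hc : c ∈ dom a b (.xy m₀)) : m₀ ≠ 0 := by
  rintro rfl
  simp [dom] at hc

lemma analyticAt_volDens {k : Idx} {c : ℂ × ℂ} (hc : c ∈ dom a b k) :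
    AnalyticAt ℂ (volDens a b k) c ∧ volDens a b k c ≠ 0 := by
  rcases k with y₀ | m₀ | ⟨l, j⟩ | ⟨s, j⟩ | s | s | _
  · have h0 : 2 * cY a b (.xz y₀) c * c.2 ≠ 0 := mul_ne_zero (mul_ne_zero two_ne_zero
      (mul_ne_zero (ne_zero_of_dom_xz hc) (csqrt_ne_zero _))) hc.1
    exact ⟨analyticAt_const.div ((analyticAt_const.mul (analyticAt_cY hc trivial)).mul
      analyticAt_snd) h0, one_div_ne_zero h0⟩
  · have h0 := mul_ne_zero (ne_zero_of_dom_xy hc)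
      (csqrt_ne_zero (((c.2 ^ 2 - fP a b c.1) ^ 2 - 1) / m₀ ^ 2))
    refine ⟨analyticAt_const.div (analyticAt_const.mul (AnalyticAt.csqrt ?_ hc)) h0,
      one_div_ne_zero h0⟩
    exact AnalyticAt.div (by unfold fP; fun_prop) analyticAt_const
      (pow_ne_zero 2 (ne_zero_of_dom_xy hc))
  · have h1 : fP a b l ≠ 0 := by
      intro h; have := hc.1; rw [h] at this; norm_num at this
    have h0 := mul_ne_zero (mul_ne_zero two_ne_zero h1) (csqrt_ne_zero (1 + nodeD a b l j c ^ 2))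
    exact ⟨analyticAt_const.div (analyticAt_const.mul
      ((analyticAt_const.add ((analyticAt_nodeD l j c).pow 2)).csqrt hc.2.2.2)) h0,
      div_ne_zero (kap_ne_zero a b l) h0⟩
  · exact ⟨(analyticAt_sideDens s (analyticAt_chW (fT_chXi_ne_zero hc)) hc.2.2).div
      (analyticAt_chQ hc) (csqrt_ne_zero _),
      div_ne_zero (sideDens_ne_zero s hc.2.2) (csqrt_ne_zero _)⟩
  · exact ⟨(analyticAt_sideDens s (analyticAt_secW hc.1) hc.2).div (by unfold fP; fun_prop) hc.1,
      div_ne_zero (sideDens_ne_zero s hc.2) hc.1⟩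
  · exact ⟨(analyticAt_sideDens s (analyticAt_tailW hc.1) hc.2).neg.div (by unfold fT; fun_prop)
      hc.1, div_ne_zero (neg_ne_zero.2 (sideDens_ne_zero s hc.2)) hc.1⟩
  · have h0 := mul_ne_zero (csqrt_ne_zero (midR a b c)) hc.1
    exact ⟨analyticAt_const.div (((analyticAt_midR hc.1).csqrt hc.2).mul analyticAt_snd) h0,
      div_ne_zero (by norm_num) h0⟩

/-- The equation for the derivatives of the coordinates. -/
lemma two_mul_fderiv_cY {k : Idx} {c : ℂ × ℂ} (hc : c ∈ dom a b k) (hA : isAff a b k c)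
    {w : ℂ × ℂ} (h : fderiv ℂ (cX k) c w = 0) : 2 * cY a b k c * fderiv ℂ (cY a b k) c w =
      (1 - ((cZ a b k c)⁻¹) ^ 2) / 2 * fderiv ℂ (cZ a b k) c w := by
  have hX := analyticAt_cX hA
  have hY := analyticAt_cY hc hA
  have hZ := analyticAt_cZ hc hA
  have hz := (affPt_of_isAff hc hA).1
  have e : (fun c => cY a b k c * cY a b k c) =ᶠ[𝓝 c]
      fun c => fP a b (cX k c) + fh (cZ a b k c) := by
    filter_upwards [(isOpen_dom k).mem_nhds hc, eventually_isAff hA] with c' h1 h2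
    rw [← sq]
    exact (affPt_of_isAff h1 h2).2.1
  have h1 := congrArg (fun L : ℂ × ℂ →L[ℂ] ℂ => L w) e.fderiv_eq
  have hp : HasDerivAt (fP a b) (4 * (3 * cX k c ^ 2) - 3 * a) (cX k c) := by
    have := (((hasDerivAt_id (cX k c)).pow 3).const_mul 4).sub
      ((hasDerivAt_id (cX k c)).const_mul (3 * a)) |>.sub_const b
    exact this.congr_deriv (by simp)
  have hh : HasDerivAt fh ((1 - ((cZ a b k c)⁻¹) ^ 2) / 2) (cZ a b k c) := by
    have := ((hasDerivAt_id (cZ a b k c)).add (hasDerivAt_inv hz)).div_const 2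
    exact this.congr_deriv (by rw [inv_pow]; ring)
  have h2 := (hp.comp_hasFDerivAt c hX.differentiableAt.hasFDerivAt).add
    (hh.comp_hasFDerivAt c hZ.differentiableAt.hasFDerivAt)
  have h3 : fderiv ℂ (fun c => fP a b (cX k c) + fh (cZ a b k c)) c = _ := h2.fderiv
  rw [fderiv_fun_mul_apply hY hY, h3] at h1
  simp only [add_apply, smul_apply, smul_eq_mul, h] at h1
  linear_combination h1

/-- On the affine part this says that `volDens` is the density of dx ∧ dy/((z - 1/z)/2). The factors
that could create zeros or poles cancel in each chart: at the nodes and chains by dC ∧ dA = A du ∧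
dv, elsewhere by differentiating the equation. -/
lemma jac_cX_cY {k : Idx} {c : ℂ × ℂ} (hc : c ∈ dom a b k) (hA : isAff a b k c) :
    jac (cX k) (cY a b k) c = volDens a b k c * ((cZ a b k c - (cZ a b k c)⁻¹) / 2) := by
  have hX := analyticAt_cX hA
  have hY := analyticAt_cY hc hA
  rcases k with y₀ | m₀ | ⟨l, j⟩ | ⟨s, j⟩ | s | s | _
  · have h3 : fderiv ℂ (cX (.xz y₀)) c (0, 1) = 0 := by
      change fderiv ℂ (fun c : ℂ × ℂ => c.1) c (0, 1) = 0
      simp [fderiv_fst]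
    have h4 : fderiv ℂ (cZ a b (.xz y₀)) c (0, 1) = 1 := by
      change fderiv ℂ (fun c : ℂ × ℂ => c.2) c (0, 1) = 1
      simp [fderiv_snd]
    have h1 := two_mul_fderiv_cY hc hA h3
    have h0 : cY a b (.xz y₀) c ≠ 0 := mul_ne_zero (ne_zero_of_dom_xz hc) (csqrt_ne_zero _)
    have hz : c.2 ≠ 0 := hc.1
    have h2 : jac (cX (.xz y₀)) (cY a b (.xz y₀)) c = _ := jac_fst _ c
    rw [h2, volDens]
    rw [h4] at h1
    simp only [cZ] at h1 ⊢
    field_simp at h1 ⊢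
    linear_combination h1
  · have h2 : jac (cX (.xy m₀)) (cY a b (.xy m₀)) c = _ := jac_fst _ c
    have h3 : fderiv ℂ (cY a b (.xy m₀)) c (0, 1) = 1 := by
      change fderiv ℂ (fun c : ℂ × ℂ => c.2) c (0, 1) = 1
      simp [fderiv_snd]
    have hm := ne_zero_of_dom_xy hc
    have h0 := csqrt_ne_zero (((c.2 ^ 2 - fP a b c.1) ^ 2 - 1) / m₀ ^ 2)
    have h4 := csqrt_sq (Complex.slitPlane_ne_zero hc)
    have hz := (affPt_of_isAff hc hA).1
    have h5 := (affPt_of_isAff hc hA).2.1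
    rw [h2, h3, volDens]
    have h6 : cZ a b (.xy m₀) c = c.2 ^ 2 - fP a b c.1 +
      m₀ * csqrt (((c.2 ^ 2 - fP a b c.1) ^ 2 - 1) / m₀ ^ 2) := rfl
    have h7 : m₀ * csqrt (((c.2 ^ 2 - fP a b c.1) ^ 2 - 1) / m₀ ^ 2) =
        (cZ a b (.xy m₀) c - (cZ a b (.xy m₀) c)⁻¹) / 2 := by
      simp only [cX, cY, fh] at h5
      linear_combination -h6 - h5
    rw [← h7, one_div_mul_cancel (mul_ne_zero hm h0)]
  · have hC := analyticAt_torC c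
    have hA' := analyticAt_torA j c
    have hq := (analyticAt_nodeX l c).nquo (a := a) (b := b) (l := l)
    have h1 : jac torC (nodeB a b l j) c = -nodeB a b l j c := by
      have h2 := jac_mul (f := torC) hq (analyticAt_torB (nmult a b l) j c)
      have h3 : jac torC (fun c => nquo a b l (nodeX l c)) c = 0 :=
        jac_comp (p := fun z => nquo a b l (l + z)) hC ((analyticAt_const.add analyticAt_id).nquo)
      rw [jac_torC_torB, h3] at h2
      exact h2.trans (by rw [nodeB]; ring)
    have h2 : jac (nodeX l) (nodeY a b l j) c = (torA j c - nodeB a b l j c) / 2 := by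
      have e1 : nodeY a b l j = fun c => (1 / 2) * (torA j c + nodeB a b l j c) := by
        funext c; rw [nodeY]; ring
      have e2 := jac_comp_left (p := fun z => l + z) (p' := 1) (g := nodeY a b l j) hC
        ((hasDerivAt_id _).const_add l)
      refine e2.trans ?_
      rw [e1, jac_mul analyticAt_const (hA'.fun_add (analyticAt_nodeB l j c)), jac_const,
        jac_add hA' (analyticAt_nodeB l j c), jac_torC_torA, h1]
      ring
    have hκ := kap_ne_zero a b l
    have hε := hc.1
    have ht := nodeT_re_pos hc
    have h0 : nodeT a b l j c ≠ 0 := by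
      intro h; have := ht.1; rw [h] at this; simp at this
    have hs0 := csqrt_ne_zero (1 + nodeD a b l j c ^ 2)
    have hs : nodeT a b l j c = nodeD a b l j c + csqrt (1 + nodeD a b l j c ^ 2) := rfl
    have hinv : (nodeT a b l j c)⁻¹ = csqrt (1 + nodeD a b l j c ^ 2) - nodeD a b l j c := by
      linear_combination hs - ht.2
    have hε0 : fP a b l ≠ 0 := by
      intro h; rw [h] at hε; norm_num at hε
    have hεi : (fP a b l)⁻¹ = fP a b l := inv_eq_of_mul_eq_one_right (by rw [← hε]; ring)
    have hD : torA j c - nodeB a b l j c = -2 * kap a b l * nodeD a b l j c := by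
      rw [nodeD]; field_simp; ring
    refine h2.trans ?_
    rw [hD, volDens]
    simp only [cZ, nodeZ]
    rw [mul_inv, inv_neg, hεi, ← inv_pow, hinv, hs]
    field_simp
    ring
  · have hξ0 := hA.2
    have hS0 := hA.1
    have hξ := analyticAt_chXi j c
    have hC := analyticAt_torC c
    have hw := chW_ne_zero hc hA
    have hT := hc.2.1
    have h1 : jac torC (chXi j) c = torA j c := by
      have h2 := jac_add (f := torC) (h := fun c => torC c ^ 2) (analyticAt_torA j c) (hC.pow 2)
      rw [jac_torC_torA, jac_comp (p := fun z => z ^ 2) hC (by fun_prop), add_zero] at h2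
      exact h2
    have hp : AnalyticAt ℂ (fun z => csqrt (fT a b z) / z) (chXi j c) :=
      (analyticAt_id.fT.csqrt hT).div analyticAt_id hξ0
    have h2 : jac (chXi j) (cY a b (.chain s j)) c =
        chQ a b j c / chXi j c * (torA j c / torC c ^ 2) := by
      have e : cY a b (.chain s j) =
          fun c => csqrt (fT a b (chXi j c)) / chXi j c * (torC c)⁻¹ := by
        funext c; simp only [cY, chQ]; rw [div_mul_eq_div_div_swap, div_eq_mul_inv]
      rw [e, jac_mul (g := fun c => csqrt (fT a b (chXi j c)) / chXi j c) (h := fun c => (torC c)⁻¹)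
        (hp.comp hξ) (hC.inv hS0), jac_comp hξ hp, jac_swap,
        jac_comp_left hC (hasDerivAt_inv hS0), h1, chQ]
      field_simp
      ring
    have h3 := jac_comp_left (g := cY a b (.chain s j)) hξ (hasDerivAt_inv hξ0)
    refine h3.trans ?_
    have hQ : chQ a b j c ^ 2 = fT a b (chXi j c) := csqrt_sq (fT_chXi_ne_zero hc)
    have hQ0 : chQ a b j c ≠ 0 := csqrt_ne_zero _
    have h4 := chW_mul hc.1 (fT_chXi_ne_zero hc)
    rw [h2, volDens]
    simp only [cZ]
    rw [div_mul_eq_mul_div (sideDens s _), sideDens_mul s hc.2.2 hw]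
    rw [← hQ] at h4
    field_simp
    linear_combination -h4
  · have h0 : c.2 ≠ 0 := hA
    have hw := secW_ne_zero hc hA
    have h2 : jac (cX (.sec s)) (cY a b (.sec s)) c = _ := jac_fst _ c
    have h3 : fderiv ℂ (cY a b (.sec s)) c (0, 1) = -1 / c.2 ^ 2 := by
      have := fderiv_comp_apply analyticAt_snd (hasDerivAt_inv h0) (0, 1)
      refine this.trans ?_
      simp [fderiv_snd]; ring
    have h4 := sideDens_mul s hc.2 hw
    rw [h2, h3, volDens]
    simp only [cZ]
    rw [div_mul_eq_mul_div, h4, secW]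
    have := hc.1
    field_simp
  · have h0 : c.2 ≠ 0 := hA
    have hw := tailW_ne_zero hc hA
    have h1 : jac (fun c => c.2) (cY a b (.tail s)) c = -(c.2)⁻¹ := by
      have e : cY a b (.tail s) = fun c => c.1 * (c.2)⁻¹ := by
        funext c; simp only [cY, div_eq_mul_inv]
      rw [e, jac_mul (h := fun c => (c.2)⁻¹) analyticAt_fst (analyticAt_snd.inv h0),
        jac_comp (p := fun z => z⁻¹) analyticAt_snd (analyticAt_id.inv h0)]
      simp [jac, fderiv_fst, fderiv_snd]
    have h2 := jac_comp_left (g := cY a b (.tail s)) analyticAt_snd (hasDerivAt_inv h0)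
    refine h2.trans ?_
    have h3 := hc.1
    rw [h1, volDens]
    simp only [cZ]
    rw [div_mul_eq_mul_div, neg_mul (sideDens s _), sideDens_mul s hc.2 hw, tailW]
    generalize c.1 ^ 2 * c.2 - fT a b c.2 = t at h3
    field_simp
  · have h0 : c.1 ≠ 0 := hA
    have hp : HasDerivAt (fun z : ℂ => (z ^ 2)⁻¹) (-2 / c.1 ^ 3) c.1 := by
      refine ((hasDerivAt_pow 2 c.1).inv (pow_ne_zero 2 h0)).congr_deriv ?_
      field_simp; simp [mul_comm]
    have h1 : fderiv ℂ (cX .mid) c (0, 1) = 0 := by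
      refine (fderiv_comp_apply analyticAt_fst hp (0, 1)).trans ?_
      simp [fderiv_fst]
    have h2 : fderiv ℂ (cZ a b .mid) c (0, 1) = 1 := by
      change fderiv ℂ (fun c : ℂ × ℂ => c.2) c (0, 1) = 1
      simp [fderiv_snd]
    have h3 := two_mul_fderiv_cY hc hA h1
    refine (jac_comp_left (g := cY a b .mid) analyticAt_fst hp).trans ?_
    rw [jac_fst, volDens]
    rw [h2] at h3
    have hz := hc.1
    have hR := csqrt_ne_zero (midR a b c)
    have e : cY a b .mid c = csqrt (midR a b c) / c.1 ^ 3 := rfl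
    rw [e] at h3
    simp only [cZ] at h3 ⊢
    field_simp at h3 ⊢
    linear_combination -h3

/-- The points of the affine part with `z ^ 2 ≠ 1` are dense. -/
lemma dense_aff : Dense {p : Surf a b | ∃ x y z, toPt p = .aff x y z ∧ z ^ 2 ≠ 1} := by
  have h1 : {p : Surf a b | IsGen a b (toPt p)} ⊆
      closure {p : Surf a b | ∃ x y z, toPt p = .aff x y z ∧ z ^ 2 ≠ 1} := by
    intro p hp
    rcases h : toPt p with ⟨x, y, z⟩ | _ | _ | _ | _ | _
    · by_cases hz : z ^ 2 = 1
      -- If z² = 1 the point has y ≠ 0, so x and z are coordinates and z can be moved alone; the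
      -- chart with coordinates x, y requires (z - 1/z)/2 ≠ 0.
      · rcases exists_chart_of_affPt (affPt_of_toPt h) with ⟨hy, hc, e⟩ | ⟨hm, -, -⟩
        · have e' : p = (atl a b).par (.xz y) (x, z) :=
            toPt_injective (by rw [toPt_par hc, e, h])
          rw [e', mem_closure_iff_frequently, ParamAtlas.nhds_par hc, frequently_map]
          have h2 : ∃ᶠ t : ℂ in 𝓝 z, t ^ 2 ≠ 1 := by
            intro h4
            refine infinite_of_mem_nhds z h4 ((toFinite {1, -1}).subset fun t ht => ?_)
            exact sq_eq_one_iff.1 (not_not.1 ht)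
          have h3 : ∀ᶠ t : ℂ in 𝓝 z, (x, t) ∈ dom a b (.xz y) :=
            (Continuous.prodMk_right x).continuousAt.eventually ((isOpen_dom _).mem_nhds hc)
          have h4 : Tendsto (fun t : ℂ => (x, t)) (𝓝 z) (𝓝 (x, z)) :=
            (Continuous.prodMk_right x).continuousAt
          refine h4.frequently ((h2.and_eventually h3).mono fun t ht => ?_)
          exact ⟨x, _, t, (toPt_par ht.2).trans (pt_of_isAff trivial), ht.1⟩
        · refine absurd ?_ hm
          have h0 := (affPt_of_toPt h).1
          field_simp
          rw [hz]; simp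
      · exact subset_closure ⟨x, y, z, h, hz⟩
    all_goals simp [h, IsGen] at hp
  exact dense_closure.1 (dense_isGen.mono h1)

/-- The two-form on the resolution. -/
def volumeForm (a b : ℂ) : (atl a b).VolumeForm where
  dens := volDens a b
  differentiableAt _ _ hc := (analyticAt_volDens hc).1.differentiableAt
  ne_zero _ _ hc := (analyticAt_volDens hc).2
  dens_eq k l c d hc hd h := by
    have hτ := ParamAtlas.analyticAt_transition hc hd h
    change AnalyticAt ℂ ((atl a b).trans k l) c at hτ
    have hτd : (atl a b).trans k l c = d := by
      rw [ParamAtlas.trans, h, ParamAtlas.chart_par hd]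
    have hev : ∀ᶠ c' in 𝓝 c, c' ∈ dom a b k ∧ (atl a b).trans k l c' ∈ dom a b l ∧
        AnalyticAt ℂ ((atl a b).trans k l) c' ∧
        pt a b l ((atl a b).trans k l c') = pt a b k c' := by
      have h1 : ∀ᶠ p in 𝓝 ((atl a b).par k c), p ∈ ((atl a b).chart l).source := by
        refine ((atl a b).chart l).open_source.mem_nhds ?_
        rw [h]; exact ParamAtlas.par_mem_source hd
      filter_upwards [(ParamAtlas.eventually_par hc).1 h1, (isOpen_dom k).mem_nhds hc,
        hτ.eventually_analyticAt] with c' h2 h3 h4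
      obtain ⟨d', hd', e⟩ := h2
      have h5 : (atl a b).trans k l c' = d' := by
        rw [ParamAtlas.trans, ← e, ParamAtlas.chart_par hd']
      rw [h5]
      exact ⟨h3, hd', h4, (par_eq_iff hd' h3).1 e⟩
    -- On the affine part with z² ≠ 1 the transformation law is the chain rule for dx ∧ dy, divided
    -- by the common nonzero factor (z - 1/z)/2. These points are dense, so the law extends to `c`
    -- by continuity.
    have key : ∃ᶠ c' in 𝓝 c, volDens a b k c' = volDens a b l ((atl a b).trans k l c') *
        det2 (fderiv ℂ ((atl a b).trans k l) c' (1, 0))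
          (fderiv ℂ ((atl a b).trans k l) c' (0, 1)) := by
      have h1 := mem_closure_iff_frequently.1 (dense_aff ((atl a b).par k c))
      rw [ParamAtlas.nhds_par hc, frequently_map] at h1
      refine (h1.and_eventually hev.eventually_nhds).mono ?_
      rintro c' ⟨⟨x, y, z, h2, h3⟩, h4⟩
      obtain ⟨hc', hd', hτ', e⟩ := h4.self_of_nhds
      have h2 : pt a b k c' = .aff x y z := (toPt_par hc').symm.trans h2
      have hA := isAff_iff.2 ⟨x, y, z, h2⟩
      have hA' := isAff_iff.2 ⟨x, y, z, e.trans h2⟩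
      have h5 : ∀ᶠ c'' in 𝓝 c', cX k c'' = cX l ((atl a b).trans k l c'') ∧
          cY a b k c'' = cY a b l ((atl a b).trans k l c'') ∧
          cZ a b k c'' = cZ a b l ((atl a b).trans k l c'') := by
        filter_upwards [h4, eventually_isAff hA] with c'' h5 h6
        have h7 := h5.2.2.2
        rw [pt_of_isAff h6] at h7
        rw [pt_of_isAff (isAff_iff.2 ⟨_, _, _, h7⟩)] at h7
        simpa using h7.symm
      have h6 := jac_congr (h5.mono fun _ h => h.1) (h5.mono fun _ h => h.2.1)
      rw [jac_comp_map hτ' (analyticAt_cX hA') (analyticAt_cY hd' hA'), jac_cX_cY hc' hA,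
        jac_cX_cY hd' hA', ← h5.self_of_nhds.2.2] at h6
      have h7 : cZ a b k c' = z := by
        rw [pt_of_isAff hA] at h2
        simp at h2; exact h2.2.2
      have hz : (cZ a b k c' - (cZ a b k c')⁻¹) / 2 ≠ 0 := by
        rw [h7]
        have h0 := (affPt_of_isAff hc' hA).1
        rw [h7] at h0
        intro h8; apply h3
        field_simp at h8
        linear_combination h8
      apply mul_right_cancel₀ hz
      rw [h6]; ring
    have hl := (analyticAt_volDens hd).1.continuousAt
    rw [← hτd] at hl ⊢
    have h8 : ContinuousAt (fun c' => volDens a b l ((atl a b).trans k l c') *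
        det2 (fderiv ℂ ((atl a b).trans k l) c' (1, 0))
          (fderiv ℂ ((atl a b).trans k l) c' (0, 1))) c := by
      refine ContinuousAt.mul (ContinuousAt.comp hl hτ.continuousAt) ?_
      have h9 := hτ.fderiv.continuousAt
      unfold det2
      fun_prop
    exact tendsto_nhds_unique_of_frequently_eq (analyticAt_volDens hc).1.continuousAt h8 key

lemma isMinimalResolution_piMap : IsMinimalResolution a b (piMap a b) where
  toIsResolution := isResolution_piMap
  minimal φ h := absurd h ((volumeForm a b).not_isMinusOneCurve φ)

/-! ## Fibres of the alternate fibration -/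

section

variable {X K : Type} {𝒜 : ParamAtlas X K} {k : K} {c : ℂ × ℂ}

lemma ParamAtlas.comp_chart_eventuallyEq {E : Type} (hc : c ∈ 𝒜.U k) (u : ℂ × ℂ → E) :
    (fun c' => (u ∘ 𝒜.chart k) (𝒜.par k c')) =ᶠ[𝓝 c] u := by
  filter_upwards [ParamAtlas.U_mem_nhds hc] with c' h
  simp [ParamAtlas.chart_par h]

lemma ParamAtlas.holNear (hc : c ∈ 𝒜.U k) {u : ℂ × ℂ → ℂ} (hu : AnalyticAt ℂ u c) :
    HolNear (u ∘ 𝒜.chart k) (𝒜.par k c) := by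
  refine (ParamAtlas.eventually_par hc).2 ?_
  filter_upwards [hu.eventually_analyticAt, ParamAtlas.U_mem_nhds hc] with c' h1 h2
  exact (ParamAtlas.mdifferentiableAt_iff h2).2
    (h1.differentiableAt.congr_of_eventuallyEq (ParamAtlas.comp_chart_eventuallyEq h2 u))

lemma ParamAtlas.mfderiv_comp_chart (hc : c ∈ 𝒜.U k) {u : ℂ × ℂ → ℂ} (hu : AnalyticAt ℂ u c)
    (w : TangentSpace I2 (𝒜.par k c)) :
    (mfderiv I2 𝓘(ℂ, ℂ) (u ∘ 𝒜.chart k) (𝒜.par k c) w : ℂ) = fderiv ℂ u c (𝒜.dchart k c w) := by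
  have e := ParamAtlas.comp_chart_eventuallyEq hc u
  rw [ParamAtlas.mfderiv_eq hc (hu.differentiableAt.congr_of_eventuallyEq e), e.fderiv_eq]

lemma ParamAtlas.mfderiv_comp_chart_eq_zero (hc : c ∈ 𝒜.U k) {u : ℂ × ℂ → ℂ}
    (hu : AnalyticAt ℂ u c) :
    mfderiv I2 𝓘(ℂ, ℂ) (u ∘ 𝒜.chart k) (𝒜.par k c) = 0 ↔ fderiv ℂ u c = 0 := by
  have e := ParamAtlas.comp_chart_eventuallyEq hc u
  have h := ParamAtlas.mfderiv_eq_zero_iff hc (hu.differentiableAt.congr_of_eventuallyEq e)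
  rw [e.fderiv_eq] at h
  exact h

end

lemma aff_zero_eq (l : ℂ) (h : (![l, 1] : Fin 2 → ℂ) ≠ 0) :
    aff 0 l = Projectivization.mk ℂ ![l, 1] h := rfl

lemma aff_one_zero_eq (h : (![1, 0] : Fin 2 → ℂ) ≠ 0) :
    aff 1 0 = Projectivization.mk ℂ ![1, 0] h := rfl

/-- The equation of the fibre over the point with homogeneous coordinates `v`. -/
def fibEq (v : Fin 2 → ℂ) (k : Idx) (c : ℂ × ℂ) : ℂ := v 1 * thetaL k c 0 - v 0 * thetaL k c 1

lemma analyticAt_fibEq (v : Fin 2 → ℂ) (k : Idx) (c : ℂ × ℂ) : AnalyticAt ℂ (fibEq v k) c := by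
  have h := analyticAt_pi_iff.1 (analyticAt_thetaL k c)
  exact (analyticAt_const.mul (h 0)).sub (analyticAt_const.mul (h 1))

/-- The scalar compensates for the representative of the projective point, which is only known up to
a unit. -/
lemma exists_isLocalEquation {v : Fin 2 → ℂ} (hv : v ≠ 0) {k : Idx} {c : ℂ × ℂ}
    (hc : c ∈ dom a b k) : ∃ s : ℂ, s ≠ 0 ∧ IsLocalEquation (theta a b) (Projectivization.mk ℂ v hv)
      ((atl a b).par k c) ((fun c => s * fibEq v k c) ∘ (atl a b).chart k) := by
  obtain ⟨t, ht⟩ := Projectivization.exists_smul_eq_mk_rep ℂ v hv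
  refine ⟨t, t.ne_zero, _, (liftAt_theta hc).isLocalLift hc, ?_⟩
  funext y
  simp only [← ht, Units.smul_def, Function.comp_apply, Pi.smul_apply, smul_eq_mul, fibEq]
  ring

lemma theta_eq_mk_iff {v : Fin 2 → ℂ} (hv : v ≠ 0) {p : Surf a b} :
    theta a b p = Projectivization.mk ℂ v hv ↔
      v 1 * thetaV (toPt p) 0 - v 0 * thetaV (toPt p) 1 = 0 := by
  rw [theta, toCP, Projectivization.mk_eq_mk_iff']
  have h0 := thetaV_ne_zero (toPt p)
  generalize thetaV (toPt p) = w at *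
  constructor
  · rintro ⟨t, rfl⟩
    simp only [Pi.smul_apply, smul_eq_mul]; ring
  · intro h
    by_cases h1 : v 0 = 0
    · have h2 : v 1 ≠ 0 := by
        intro h2; apply hv; ext i; fin_cases i <;> simp [h1, h2]
      have h3 : w 0 = 0 := by simpa [h1, h2] using h
      refine ⟨w 1 / v 1, ?_⟩
      ext i; fin_cases i <;> simp [h1, h2, h3]
    · refine ⟨w 0 / v 0, ?_⟩
      ext i; fin_cases i
      · simp [h1]
      · simp; field_simp; linear_combination h

lemma fibEq_eq_zero {v : Fin 2 → ℂ} (hv : v ≠ 0) {k : Idx} {c : ℂ × ℂ} (hc : c ∈ dom a b k)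
    (h : theta a b ((atl a b).par k c) = Projectivization.mk ℂ v hv) : fibEq v k c = 0 := by
  rw [theta_eq_mk_iff, toPt_par hc] at h
  obtain ⟨t, -, e⟩ := thetaL_prop (a := a) (b := b) (k := k) (c := c)
  rw [fibEq, e]
  simp only [Pi.smul_apply, smul_eq_mul]
  linear_combination t * h

lemma eq_aff (t : CP 1) : t = aff 1 0 ∨ ∃ l, t = aff 0 l := by
  induction t using Projectivization.ind with
  | h v hv =>
    by_cases h1 : v 1 = 0
    · left
      have h0 : v 0 ≠ 0 := by
        intro h0; apply hv; ext i; fin_cases i <;> simp [h0, h1]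
      rw [aff_one_zero_eq (by simp), Projectivization.mk_eq_mk_iff']
      exact ⟨v 0, by ext i; fin_cases i <;> simp [h1]⟩
    · right
      refine ⟨v 0 / v 1, ?_⟩
      rw [aff_zero_eq _ (by simp), Projectivization.mk_eq_mk_iff']
      exact ⟨v 1, by ext i; fin_cases i <;> simp [mul_div_cancel₀ _ h1]⟩

/-- The points of the fibre over `x = l`. -/
lemma theta_eq_aff_zero {l : ℂ} {p : Surf a b} : theta a b p = aff 0 l ↔
    (∃ y z, toPt p = .aff l y z) ∨ (∃ ρ, toPt p = .exc l ρ) ∨ ∃ s, toPt p = .sec s l := by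
  rw [aff_zero_eq _ (by simp), theta_eq_mk_iff]
  rcases toPt p with ⟨x, y, z⟩ | ⟨x, ρ⟩ | ⟨s, x⟩ | ⟨s, σ⟩ | ⟨s, ρ⟩ | z <;> simp [thetaV, sub_eq_zero]

/-- The points of the fibre over `x = ∞`. -/
lemma theta_eq_aff_one {p : Surf a b} : theta a b p = aff 1 0 ↔
    (∃ s σ, toPt p = .tail s σ) ∨ (∃ s ρ, toPt p = .inf s ρ) ∨ ∃ z, toPt p = .mid z := by
  rw [aff_one_zero_eq (by simp), theta_eq_mk_iff]
  rcases toPt p with ⟨x, y, z⟩ | ⟨x, ρ⟩ | ⟨s, x⟩ | ⟨s, σ⟩ | ⟨s, ρ⟩ | z <;> simp [thetaV]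

lemma fderiv_fst_ne_zero (c : ℂ × ℂ) : fderiv ℂ (fun c : ℂ × ℂ => c.1) c ≠ 0 := by
  rw [fderiv_fst]
  intro h
  simpa using congrArg (fun L : ℂ × ℂ →L[ℂ] ℂ => L (1, 0)) h

lemma fderiv_torC_eq_zero {c : ℂ × ℂ} : fderiv ℂ torC c = 0 ↔ c = 0 := by
  have h : ∀ w : ℂ × ℂ, fderiv ℂ torC c w = c.1 * w.2 + c.2 * w.1 := by
    intro w
    unfold torC
    rw [fderiv_fun_mul_apply analyticAt_fst analyticAt_snd, fderiv_fst, fderiv_snd]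
    rfl
  constructor
  · intro h0
    have h1 := h (1, 0)
    have h2 := h (0, 1)
    rw [h0] at h1 h2
    exact Prod.ext (by simpa using h2.symm) (by simpa using h1.symm)
  · rintro rfl
    ext <;> simp [h]

/-- A chart around a point which does not lie over `x = ∞`, in which `x` is regular. -/
lemma exists_chart_finite {l : ℂ} {p : Surf a b} (hp : theta a b p = aff 0 l) :
    ∃ k c, c ∈ dom a b k ∧ p = (atl a b).par k c ∧ (∀ c, thetaL k c = ![cX k c, 1]) ∧
      (fderiv ℂ (cX k) c = 0 → fP a b l ^ 2 = 1 ∧ ∃ j, k = .node l j ∧ c = 0) := by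
  rcases theta_eq_aff_zero.1 hp with ⟨y, z, h⟩ | ⟨ρ, h⟩ | ⟨s, h⟩
  · rcases exists_chart_of_affPt (affPt_of_toPt h) with ⟨-, hc, e⟩ | ⟨-, hc, e⟩
    · exact ⟨_, _, hc, toPt_injective (by rw [toPt_par hc, e, h]), fun _ => rfl,
        fun h0 => absurd h0 (fderiv_fst_ne_zero _)⟩
    · exact ⟨_, _, hc, toPt_injective (by rw [toPt_par hc, e, h]), fun _ => rfl,
        fun h0 => absurd h0 (fderiv_fst_ne_zero _)⟩
  · obtain ⟨j, c, hc, e, -⟩ := exists_node_of_toPt h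
    refine ⟨_, _, hc, e.symm, fun _ => rfl, fun h0 => ⟨hc.1, j, rfl, ?_⟩⟩
    have h1 : fderiv ℂ (fun c => l + torC c) c = 0 := h0
    rw [fderiv_const_add] at h1
    exact fderiv_torC_eq_zero.1 h1
  · exact ⟨_, _, zero_mem_dom_sec s l, toPt_injective (by rw [toPt_par (zero_mem_dom_sec s l), pt_sec_zero, h]),
      fun _ => rfl, fun h0 => absurd h0 (fderiv_fst_ne_zero _)⟩

/-- In the finite part an arbitrary local equation is a unit times x - l, so criticality means dx =
0, which by `exists_chart_finite` happens only at the origin of a node chart; there x - l = uv. Over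
x = ∞ the middle curve has multiplicity two. -/
lemma isSingularFibre_iff {t : CP 1} : IsSingularFibre (theta a b) t ↔
    t = aff 1 0 ∨ ∃ l ∈ singSet a b, t = aff 0 l := by
  constructor
  · rintro ⟨p, f, hp, ⟨F, hF, rfl⟩, hf⟩
    rcases eq_aff t with rfl | ⟨l, rfl⟩
    · exact Or.inl rfl
    right
    obtain ⟨k, c, hc, rfl, hL, hX⟩ := exists_chart_finite hp
    obtain ⟨t, ht⟩ := Projectivization.exists_smul_eq_mk_rep ℂ ![l, 1] (by simp)
    rw [← aff_zero_eq] at ht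
    have hd : DifferentiableAt ℂ (fun c' => F ((atl a b).par k c')) c :=
      (ParamAtlas.mdifferentiableAt_iff hc).1 hF.self_of_nhds.1
    have hXa : AnalyticAt ℂ (cX k) c := by
      have := analyticAt_pi_iff.1 (analyticAt_thetaL k c) 0
      simpa [hL] using this
    have hX0 : cX k c = l := by
      have := fibEq_eq_zero (v := ![l, 1]) (by simp) hc hp
      simp only [fibEq, hL] at this
      simpa [sub_eq_zero] using this
    -- Both lifts represent the same map, so F is proportional to (x, 1) with factor F₁; F₁ does not
    -- vanish at a point over [l, 1].
    have e : (fun c' => (aff 0 l).rep 1 * F ((atl a b).par k c') 0 -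
        (aff 0 l).rep 0 * F ((atl a b).par k c') 1) =ᶠ[𝓝 c]
        fun c' => (t * F ((atl a b).par k c') 1) * (cX k c' - l) := by
      filter_upwards [(ParamAtlas.eventually_par hc).1 hF, (liftAt_theta hc).2] with c' h1 h2
      obtain ⟨-, h3, h4⟩ := h1
      obtain ⟨h5, h6⟩ := h2
      obtain ⟨r, hr⟩ := (Projectivization.mk_eq_mk_iff' ℂ _ _ h3 h5).1 (h4.symm.trans h6)
      rw [← ht, ← hr, hL]
      simp [Units.smul_def]; ring
    have hd1 : DifferentiableAt ℂ (fun c' => (t : ℂ) * F ((atl a b).par k c') 1) c :=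
      (differentiableAt_pi.1 hd 1).const_mul _
    have hd2 : DifferentiableAt ℂ (fun c' => cX k c' - l) c := hXa.differentiableAt.sub_const l
    have h0 := (ParamAtlas.mfderiv_eq_zero_iff hc ((hd1.mul hd2).congr_of_eventuallyEq e)).1 hf
    rw [e.fderiv_eq, fderiv_fun_mul hd1 hd2, fderiv_sub_const] at h0
    have h0 : (t : ℂ) * F ((atl a b).par k c) 1 = 0 ∨ fderiv ℂ (cX k) c = 0 := by
      refine or_iff_not_imp_left.2 fun h => ContinuousLinearMap.ext fun w => ?_
      have h1 := congrArg (fun L : ℂ × ℂ →L[ℂ] ℂ => L w) h0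
      exact (mul_eq_zero.1 (by simpa [hX0, mul_assoc] using h1)).resolve_left
        (right_ne_zero_of_mul h)
    have hF1 : F ((atl a b).par k c) 1 ≠ 0 := by
      obtain ⟨-, h3, h4⟩ := hF.self_of_nhds
      intro h
      rw [h4, aff_zero_eq l (by simp)] at hp
      obtain ⟨r, hr⟩ := (Projectivization.mk_eq_mk_iff' ℂ _ _ h3 _).1 hp
      have hr1 : r = 0 := by simpa [h] using congrFun hr 1
      exact h3 (by rw [← hr, hr1, zero_smul])
    obtain ⟨h1, -⟩ := hX (h0.resolve_left (mul_ne_zero t.ne_zero hF1))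
    exact ⟨l, mem_singSet.2 h1, rfl⟩
  · rintro (rfl | ⟨l, hl, rfl⟩)
    · have hc := zero_mem_dom_mid (a := a) (b := b) one_ne_zero
      obtain ⟨s, -, hs⟩ := exists_isLocalEquation (v := ![1, 0]) (by simp) hc
      refine ⟨_, _, ?_, hs, ?_⟩
      · rw [theta_eq_aff_one, toPt_par hc, pt_mid_zero]
        exact Or.inr (Or.inr ⟨1, rfl⟩)
      · refine (ParamAtlas.mfderiv_comp_chart_eq_zero (𝒜 := atl a b) (u := fun c => s * fibEq _ _ c) hc
          (analyticAt_const.mul (analyticAt_fibEq _ _ _))).2 ?_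
        refine ContinuousLinearMap.ext fun w => ?_
        -- In the middle chart the fibre equation is -r² up to a constant, so its differential
        -- vanishes along r = 0.
        have e : (fun c => s * fibEq ![1, 0] .mid c) = fun c => -s * c.1 * c.1 := by
          funext c; simp [fibEq, thetaL]; ring
        rw [e, fderiv_fun_mul_apply (by fun_prop) analyticAt_fst, fderiv_fun_mul_apply (by fun_prop) analyticAt_fst]
        simp
    · have hc := mem_dom_node (mem_singSet.1 hl) (nmult_pos a b l) (c := 0) (by simp [torA])
        (by simp [torB])
      obtain ⟨s, -, hs⟩ := exists_isLocalEquation (v := ![l, 1]) (by simp) hc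
      refine ⟨_, _, ?_, hs, ?_⟩
      · rw [theta_eq_aff_zero, toPt_par hc, pt_node_special (by simp [torA]) (by simp [torB])]
        exact Or.inr (Or.inl ⟨_, rfl⟩)
      · refine (ParamAtlas.mfderiv_comp_chart_eq_zero (𝒜 := atl a b) (u := fun c => s * fibEq _ _ c) hc
          (analyticAt_const.mul (analyticAt_fibEq _ _ _))).2 ?_
        have e : (fun c => s * fibEq ![l, 1] (.node l 0) c) = fun c => s * torC c := by
          funext c; simp [fibEq, thetaL, cX, nodeX]
        rw [e, fderiv_const_mul (analyticAt_torC _).differentiableAt, fderiv_torC_eq_zero.2 rfl]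
        exact ContinuousLinearMap.ext fun w => mul_zero s

/-! ### Rational curves in the fibres -/

/-- The affine coordinate on the projective line. -/
def cpc (q : CP 1) : Option ℂ := if q.rep 1 = 0 then none else some (q.rep 0 / q.rep 1)

/-- The coordinates of the points of the two affine pieces of the projective line. -/
def cpAff (k : Fin 2) (s : ℂ) : Option ℂ := if k = 0 then some s else oinv s

lemma cpc_aff (k : Fin 2) (s : ℂ) : cpc (aff k s) = cpAff k s := by
  by_cases hk : k = 0
  · subst hk
    obtain ⟨t, ht⟩ := Projectivization.exists_smul_eq_mk_rep ℂ ![s, 1] (by simp)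
    have ht : t • ![s, 1] = (aff 0 s).rep := ht
    simp [cpc, cpAff, ← ht, Units.smul_def]
  · obtain rfl : k = 1 := by omega
    obtain ⟨t, ht⟩ := Projectivization.exists_smul_eq_mk_rep ℂ ![1, s] (by simp)
    have ht : t • ![1, s] = (aff 1 s).rep := ht
    by_cases hs : s = 0
    · subst hs
      simp [cpc, cpAff, ← ht, oinv]
    · have ht0 := t.ne_zero
      simp [cpc, cpAff, ← ht, Units.smul_def, oinv, hs]
      field_simp

lemma cpc_injective : Function.Injective cpc := by
  intro p q h
  rcases eq_aff p with rfl | ⟨l, rfl⟩ <;> rcases eq_aff q with rfl | ⟨l', rfl⟩ <;>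
    simp_all [cpc_aff, cpAff, oinv]

lemma cpc_surjective : Function.Surjective cpc := by
  rintro (_ | s)
  · exact ⟨aff 1 0, by simp [cpc_aff, cpAff, oinv]⟩
  · exact ⟨aff 0 s, by simp [cpc_aff, cpAff]⟩

lemma cpAff_eq {i j : Fin 2} {s r : ℂ} (h : cpAff i s = cpAff j r) :
    (i = j ∧ s = r) ∨ (r ≠ 0 ∧ s = r⁻¹ ∧ ∀ t : ℂ, t ≠ 0 → cpAff i t = cpAff j t⁻¹) := by
  fin_cases i <;> fin_cases j <;> simp_all [cpAff, oinv]
  · obtain ⟨h0, rfl⟩ := h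
    exact ⟨inv_ne_zero h0, (inv_inv s).symm⟩
  · left
    by_cases h1 : s = 0 <;> by_cases h2 : r = 0 <;> simp_all

lemma exists_cpAff (o : Option ℂ) : ∃ i s, cpAff i s = o := by
  obtain _ | s := o
  · exact ⟨1, 0, by simp [cpAff, oinv]⟩
  · exact ⟨0, s, by simp [cpAff]⟩

/-- `γ` is, in the `k`-th chart, an immersed parametrization of the curve `P` near the point with
coordinate `s` of the `n`-th affine piece of the projective line. -/
def IsPath (a b : ℂ) (k : Idx) (P : Option ℂ → Pt) (n : Fin 2) (s : ℂ) (γ : ℂ → ℂ × ℂ) : Prop :=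
  γ s ∈ dom a b k ∧ (∃ d, d ≠ 0 ∧ HasDerivAt γ d s) ∧ ∀ᶠ r in 𝓝 s, pt a b k (γ r) = P (cpAff n r)

/-- The second affine piece differs from the first only by the point at infinity; elsewhere a path
is obtained by composing with s ↦ 1/s. -/
lemma exists_isPath {P : Option ℂ → Pt} (h0 : ∀ s, ∃ k γ, IsPath a b k P 0 s γ)
    (h1 : ∃ k γ, IsPath a b k P 1 0 γ) (n : Fin 2) (s : ℂ) : ∃ k γ, IsPath a b k P n s γ := by
  obtain rfl | rfl : n = 0 ∨ n = 1 := by omega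
  · exact h0 s
  by_cases hs : s = 0
  · rwa [hs]
  obtain ⟨k, γ, h2, ⟨d, hd, h3⟩, h4⟩ := h0 s⁻¹
  refine ⟨k, fun r => γ r⁻¹, h2, ⟨_, smul_ne_zero ?_ hd, h3.scomp s (hasDerivAt_inv hs)⟩, ?_⟩
  · exact neg_ne_zero.2 (inv_ne_zero (pow_ne_zero 2 hs))
  · filter_upwards [(continuousAt_inv₀ hs).eventually h4, isOpen_ne.mem_nhds hs] with r h5 h6
    rw [h5]
    simp [cpAff, oinv, show r ≠ 0 from h6]

/-- The function `u` in the `k`-th chart vanishes along the branch of the curve `P` at `o`. -/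
def VanishesOn (a b : ℂ) (k : Idx) (u : ℂ × ℂ → ℂ) (P : Option ℂ → Pt) (o : Option ℂ) : Prop :=
  ∀ i s, cpAff i s = o → ∀ᶠ r in 𝓝 s, ∀ c ∈ dom a b k, pt a b k c = P (cpAff i r) → u c = 0

lemma VanishesOn.of_forall {k : Idx} {u : ℂ × ℂ → ℂ} {P : Option ℂ → Pt} {o : Option ℂ}
    (h : ∀ o, ∀ c ∈ dom a b k, pt a b k c = P o → u c = 0) : VanishesOn a b k u P o :=
  fun _ _ _ => Eventually.of_forall fun _ c hc e => h _ c hc e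

/-- Near the parameter, chart points with labels on this branch lie on the path itself, because the
chart is injective; so it suffices that u vanishes on the path. The other affine piece follows by
inverting the parameter. -/
lemma IsPath.vanishesOn {k : Idx} {P : Option ℂ → Pt} {n : Fin 2} {s : ℂ} {γ : ℂ → ℂ × ℂ}
    (h : IsPath a b k P n s γ) {u : ℂ × ℂ → ℂ} (hu : ∀ r, u (γ r) = 0) :
    VanishesOn a b k u P (cpAff n s) := by
  obtain ⟨h1, ⟨d, -, h2⟩, h3⟩ := h
  have h4 : ∀ᶠ r in 𝓝 s, ∀ c ∈ dom a b k, pt a b k c = P (cpAff n r) → u c = 0 := by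
    filter_upwards [h3, h2.continuousAt.eventually ((isOpen_dom k).mem_nhds h1)] with r h5 h6 c hc h7
    rw [pt_injOn k hc h6 (h7.trans h5.symm), hu]
  intro i t ht
  rcases cpAff_eq ht with ⟨rfl, rfl⟩ | ⟨hs, rfl, h5⟩
  · exact h4
  · have h6 := (continuousAt_inv₀ (inv_ne_zero hs)).eventually (p := fun r => ∀ c ∈ dom a b k,
      pt a b k c = P (cpAff n r) → u c = 0) (by rwa [inv_inv])
    filter_upwards [h6, isOpen_ne.mem_nhds (inv_ne_zero hs)] with r h7 h8
    rwa [h5 r h8]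

/-- A criterion for the structure of a fibre in terms of charts. -/
lemma isFibreOfRationalCurves {v : Fin 2 → ℂ} (hv : v ≠ 0) {ι : Type} {m : ι → ℕ}
    {A : ι → ι → ℕ} (P : ι → Option ℂ → Pt)
    (imm : ∀ i n s, ∃ k γ, IsPath a b k (P i) n s γ)
    (ran : ∀ p : Surf a b, theta a b p = Projectivization.mk ℂ v hv ↔ ∃ i o, toPt p = P i o)
    (card : ∀ i j, {c : Option ℂ × Option ℂ | (i, c.1) ≠ (j, c.2) ∧ P i c.1 = P j c.2}.encard =
      A i j)
    (smooth : ∀ i o, (∀ j o', P j o' = P i o → (j, o') = (i, o)) →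
      ∃ k, ∃ c ∈ dom a b k, ∃ h u : ℂ × ℂ → ℂ, pt a b k c = P i o ∧ AnalyticAt ℂ h c ∧
        AnalyticAt ℂ u c ∧ h c ≠ 0 ∧ fderiv ℂ u c ≠ 0 ∧ VanishesOn a b k u (P i) o ∧
        ∀ᶠ c' in 𝓝 c, fibEq v k c' = h c' * u c' ^ m i)
    (cross : ∀ i o j o', (i, o) ≠ (j, o') → P i o = P j o' →
      ∃ k, ∃ c ∈ dom a b k, ∃ h u w : ℂ × ℂ → ℂ, pt a b k c = P i o ∧ AnalyticAt ℂ h c ∧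
        AnalyticAt ℂ u c ∧ AnalyticAt ℂ w c ∧ h c ≠ 0 ∧
        (∀ x, fderiv ℂ u c x = 0 → fderiv ℂ w c x = 0 → x = 0) ∧
        VanishesOn a b k u (P i) o ∧ VanishesOn a b k w (P j) o' ∧
        ∀ᶠ c' in 𝓝 c, fibEq v k c' = h c' * u c' ^ m i * w c' ^ m j) :
    IsFibreOfRationalCurves (theta a b) (Projectivization.mk ℂ v hv) m A := by
  have exi : ∀ i o, ∃ p : Surf a b, toPt p = P i o := by
    intro i o
    obtain ⟨n, s, rfl⟩ := exists_cpAff o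
    obtain ⟨k, γ, h1, -, h2⟩ := imm i n s
    exact ⟨_, (toPt_par h1).trans h2.self_of_nhds⟩
  -- The curves on the surface are obtained from labels by choice; labels determine points, so the
  -- charts along `P i` show afterwards that they are holomorphic.
  choose φ hφ using fun i (q : CP 1) => exi i (cpc q)
  have loc : ∀ i n s, ∃ k γ, γ s ∈ dom a b k ∧ DifferentiableAt ℂ γ s ∧ deriv γ s ≠ 0 ∧
      (fun r => φ i (aff n r)) =ᶠ[𝓝 s] fun r => (atl a b).par k (γ r) := by
    intro i n s
    obtain ⟨k, γ, h1, ⟨d, hd, h2⟩, h4⟩ := imm i n s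
    refine ⟨k, γ, h1, h2.differentiableAt, by rwa [h2.deriv], ?_⟩
    filter_upwards [h4, h2.continuousAt.eventually ((isOpen_dom k).mem_nhds h1)] with r h5 h6
    exact toPt_injective (by rw [hφ, toPt_par h6, h5, cpc_aff])
  have himm : ∀ i, IsImmersedRationalCurve (φ i) := by
    intro i n
    refine ⟨fun s => ?_, fun s => ?_⟩
    all_goals
      obtain ⟨k, γ, h1, h2, h3, h4⟩ := loc i n s
    · exact (ParamAtlas.mdifferentiableAt_par_comp (𝒜 := atl a b) h1 h2).congr_of_eventuallyEq h4
    · rw [h4.mfderiv_eq]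
      exact ParamAtlas.mfderiv_par_comp_ne_zero (𝒜 := atl a b) h1 h2 h3
  have van : ∀ {k c u i p}, c ∈ dom a b k → pt a b k c = P i (cpc p) →
      VanishesOn a b k u (P i) (cpc p) → VanishesAlong (u ∘ (atl a b).chart k) (φ i) p := by
    intro k c u i p hc e hu n s hs
    have h1 : φ i (aff n s) ∈ ((atl a b).chart k).source :=
      ⟨c, hc, toPt_injective (by rw [hφ, hs, toPt_par hc, e])⟩
    filter_upwards [hu n s (by rw [← cpc_aff, hs]),
      ((himm i n).1.continuous.continuousAt).eventually
        (((atl a b).chart k).open_source.mem_nhds h1)] with r h2 h3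
    obtain ⟨d, hd, e'⟩ := h3
    rw [← e', Function.comp_apply, ParamAtlas.chart_par hd]
    refine h2 d hd ?_
    rw [← toPt_par hd, e', hφ, cpc_aff]
  have hpar : ∀ {k c i p}, c ∈ dom a b k → pt a b k c = P i (cpc p) →
      φ i p = (atl a b).par k c := fun hc e => toPt_injective (by rw [hφ, toPt_par hc, e])
  refine ⟨φ, himm, ?_, ?_, ?_, ?_⟩
  · ext p
    simp only [mem_iUnion, mem_range, mem_preimage, mem_singleton_iff, ran]
    constructor
    · rintro ⟨i, q, rfl⟩
      exact ⟨i, _, hφ i q⟩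
    · rintro ⟨i, o, h⟩
      obtain ⟨q, rfl⟩ := cpc_surjective o
      exact ⟨i, q, toPt_injective ((hφ i q).trans h.symm)⟩
  · intro i j
    rw [← card i j, ← (cpc_injective.prodMap cpc_injective).encard_image]
    congr 1
    ext ⟨o, o'⟩
    obtain ⟨p, rfl⟩ := cpc_surjective o
    obtain ⟨q, rfl⟩ := cpc_surjective o'
    have e : φ i p = φ j q ↔ P i (cpc p) = P j (cpc q) := by
      rw [← hφ, ← hφ, toPt_injective.eq_iff]
    constructor
    · rintro ⟨⟨p', q'⟩, ⟨h1, h2⟩, h3⟩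
      simp only [Prod.map_apply, Prod.mk.injEq, cpc_injective.eq_iff] at h3
      obtain ⟨rfl, rfl⟩ := h3
      exact ⟨by simpa [cpc_injective.eq_iff] using h1, e.1 h2⟩
    · rintro ⟨h1, h2⟩
      exact ⟨(p, q), ⟨by simpa [cpc_injective.eq_iff] using h1, e.2 h2⟩, rfl⟩
  · intro i p hp
    obtain ⟨k, c, hc, h, u, e, hh, hu, h0, hu0, hv', heq⟩ := smooth i (cpc p) (by
      intro j o' h
      obtain ⟨q, rfl⟩ := cpc_surjective o'
      have := hp j q (toPt_injective (by rw [hφ, hφ, h]))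
      rw [Prod.mk.injEq] at this ⊢
      exact ⟨this.1, congrArg cpc this.2⟩)
    obtain ⟨s, hs, hloc⟩ := exists_isLocalEquation hv hc
    have hsh : AnalyticAt ℂ (fun c => s * h c) c := analyticAt_const.mul hh
    rw [hpar hc e]
    refine ⟨_, _, _, hloc, ParamAtlas.holNear hc hsh, ParamAtlas.holNear hc hu, ?_, ?_,
      van hc e hv', ?_⟩
    · simpa [ParamAtlas.chart_par (𝒜 := atl a b) hc] using ⟨hs, h0⟩
    · rwa [Ne, ParamAtlas.mfderiv_comp_chart_eq_zero hc hu]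
    · refine (ParamAtlas.eventually_par hc).2 ?_
      filter_upwards [heq, (isOpen_dom k).mem_nhds hc] with c' h1 h2
      simp only [Function.comp_apply, ParamAtlas.chart_par (𝒜 := atl a b) h2, h1]
      ring
  · intro i p j q hpq hφpq
    obtain ⟨k, c, hc, h, u, w, e, hh, hu, hw, h0, hind, hv1, hv2, heq⟩ :=
      cross i (cpc p) j (cpc q) (by
        intro h
        apply hpq
        rw [Prod.mk.injEq] at h ⊢
        exact ⟨h.1, cpc_injective h.2⟩) (by rw [← hφ, ← hφ, hφpq])
    obtain ⟨s, hs, hloc⟩ := exists_isLocalEquation hv hc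
    have hsh : AnalyticAt ℂ (fun c => s * h c) c := analyticAt_const.mul hh
    have e2 : pt a b k c = P j (cpc q) := by rw [e, ← hφ, ← hφ, hφpq]
    rw [hpar hc e]
    refine ⟨_, _, _, _, hloc, ParamAtlas.holNear hc hsh, ParamAtlas.holNear hc hu,
      ParamAtlas.holNear hc hw, ?_, ?_, van hc e hv1, van hc e2 hv2, ?_⟩
    · simpa [ParamAtlas.chart_par (𝒜 := atl a b) hc] using ⟨hs, h0⟩
    · intro x h1 h2
      apply (ParamAtlas.dchart_bijective (𝒜 := atl a b) hc).1
      rw [map_zero]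
      exact hind _ ((ParamAtlas.mfderiv_comp_chart (𝒜 := atl a b) hc hu x).symm.trans h1)
        ((ParamAtlas.mfderiv_comp_chart (𝒜 := atl a b) hc hw x).symm.trans h2)
    · refine (ParamAtlas.eventually_par hc).2 ?_
      filter_upwards [heq, (isOpen_dom k).mem_nhds hc] with c' h1 h2
      simp only [Function.comp_apply, ParamAtlas.chart_par (𝒜 := atl a b) h2, h1]
      ring

/-! ### Chains of rational curves -/

/-- The points of the `i`-th curve in a chain of rational curves. -/
def stepseq (i : ℕ) (o : Option ℂ) (k : ℕ) : Option ℂ :=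
  if k < i then some 0 else if k = i then o else none

/-- Along the i-th curve A/Cⁱ is the coordinate, while A/Cᵏ is 0 for k < i and ∞ for k > i. The
curve is the axis u = 0 of chart i with coordinate v, and the axis v = 0 of chart i - 1 with
coordinate 1/u. -/
lemma tseq_zero_fst (i : ℕ) (s : ℂ) : tseq i (0, s) = stepseq i (some s) := by
  funext k
  rcases lt_trichotomy k i with h | rfl | h
  · rw [tseq_of_le h.le, stepseq, if_pos h]
    simp [Nat.sub_ne_zero_of_lt h]
  · rw [tseq_of_le le_rfl, stepseq, if_neg (lt_irrefl _), if_pos rfl]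
    simp
  · rw [tseq_of_lt h, stepseq, if_neg h.not_gt, if_neg h.ne']
    simp [oinv]

lemma tseq_zero_snd (i : ℕ) (s : ℂ) : tseq i (s, 0) = stepseq (i + 1) (oinv s) := by
  funext k
  rcases lt_trichotomy k (i + 1) with h | rfl | h
  · rw [tseq_of_le (by omega), stepseq, if_pos h]
    simp
  · rw [tseq_of_lt (by omega), stepseq, if_neg (lt_irrefl _), if_pos rfl]
    simp
  · rw [tseq_of_lt (by omega), stepseq, if_neg h.not_gt, if_neg h.ne']
    simp [oinv, show k - i - 1 ≠ 0 by omega]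

lemma stepseq_succ_none (i : ℕ) : stepseq (i + 1) none = stepseq i (some 0) := by
  rw [← tseq_zero_fst, tseq_zero_snd]
  simp [oinv]

lemma stepseq_eq_of_lt {i j : ℕ} {o o' : Option ℂ} (h : stepseq i o = stepseq j o') (hij : i < j) :
    j = i + 1 ∧ o = some 0 ∧ o' = none := by
  have h1 := congrFun h i
  have h2 := congrFun h j
  have h3 := congrFun h (i + 1)
  simp only [stepseq, lt_irrefl, if_false, if_true, hij, hij.not_gt, hij.ne'] at h1 h2
  refine ⟨?_, h1, h2.symm⟩
  by_contra h4
  simp [stepseq, show i + 1 < j by omega] at h3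

/-- Two curves of a chain meet only if they are consecutive: the parameter 0 of one is the parameter
∞ of the next. -/
lemma stepseq_eq {i j : ℕ} {o o' : Option ℂ} : stepseq i o = stepseq j o' ↔
    (i = j ∧ o = o') ∨ (j = i + 1 ∧ o = some 0 ∧ o' = none) ∨
      (i = j + 1 ∧ o = none ∧ o' = some 0) := by
  constructor
  · intro h
    rcases lt_trichotomy i j with hij | rfl | hij
    · exact Or.inr (Or.inl (stepseq_eq_of_lt h hij))
    · exact Or.inl ⟨rfl, by simpa [stepseq] using congrFun h i⟩
    · obtain ⟨h1, h2, h3⟩ := stepseq_eq_of_lt h.symm hij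
      exact Or.inr (Or.inr ⟨h1, h3, h2⟩)
  · rintro (⟨rfl, rfl⟩ | ⟨rfl, rfl, rfl⟩ | ⟨rfl, rfl, rfl⟩)
    · rfl
    · exact (stepseq_succ_none i).symm
    · exact stepseq_succ_none j

lemma hasDerivAt_prodMk_const_left {g : ℂ → ℂ} {d s : ℂ} (x : ℂ) (hd : d ≠ 0)
    (h : HasDerivAt g d s) : ∃ d, d ≠ 0 ∧ HasDerivAt (fun r => (x, g r)) d s :=
  ⟨(0, d), by simp [hd], (hasDerivAt_const s x).prodMk h⟩

lemma hasDerivAt_prodMk_const_right {g : ℂ → ℂ} {d s : ℂ} (x : ℂ) (hd : d ≠ 0)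
    (h : HasDerivAt g d s) : ∃ d, d ≠ 0 ∧ HasDerivAt (fun r => (g r, x)) d s :=
  ⟨(d, 0), by simp [hd], h.prodMk (hasDerivAt_const s x)⟩

lemma torA_zero_fst {i : ℕ} (hi : i ≠ 0) (s : ℂ) : torA i (0, s) = 0 := by simp [torA, hi]

lemma torA_zero_snd (i : ℕ) (s : ℂ) : torA i (s, 0) = 0 := by simp [torA]

lemma torB_zero_fst (n i : ℕ) (s : ℂ) : torB n i (0, s) = 0 := by simp [torB]

lemma torB_zero_snd {n i : ℕ} (hi : i + 1 < n) (s : ℂ) : torB n i (s, 0) = 0 := by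
  simp [torB, show n - 1 - i ≠ 0 by omega]

lemma torB_last {n i : ℕ} (hi : i + 1 = n) (c : ℂ × ℂ) : torB n i c = c.1 := by
  simp [torB, show n - 1 - i = 0 by omega]

/-- Reduced components near their regular points. -/
lemma exists_smooth {v : Fin 2 → ℂ} (hv : v ≠ 0) {P : Option ℂ → Pt} {o : Option ℂ} {k : Idx}
    {c : ℂ × ℂ} (hc : c ∈ dom a b k) (e : pt a b k c = P o) (hf : fderiv ℂ (fibEq v k) c ≠ 0)
    (hP : ∀ (p : Surf a b) o, toPt p = P o → theta a b p = Projectivization.mk ℂ v hv) :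
    ∃ k, ∃ c ∈ dom a b k, ∃ h u : ℂ × ℂ → ℂ, pt a b k c = P o ∧ AnalyticAt ℂ h c ∧
      AnalyticAt ℂ u c ∧ h c ≠ 0 ∧ fderiv ℂ u c ≠ 0 ∧ VanishesOn a b k u P o ∧
      ∀ᶠ c' in 𝓝 c, fibEq v k c' = h c' * u c' ^ 1 :=
  ⟨k, c, hc, fun _ => 1, fibEq v k, e, analyticAt_const, analyticAt_fibEq v k c, one_ne_zero, hf,
    .of_forall fun o _ hc e => fibEq_eq_zero hv hc (hP _ o ((toPt_par hc).trans e)),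
    Eventually.of_forall fun c' => by simp⟩

/-! ### The fibres of type `I` -/

section

variable {l : ℂ}

lemma isPath_exc_fst (hl : fP a b l ^ 2 = 1) {i : ℕ} (h0 : i ≠ 0) (hi : i < nmult a b l) (s : ℂ) :
    IsPath a b (.node l i) (fun o => .exc l (stepseq i o)) 0 s (fun r => (0, r)) := by
  have h1 : ∀ r : ℂ, torA i (0, r) = 0 := torA_zero_fst h0
  have h2 := torB_zero_fst (nmult a b l) i
  refine ⟨mem_dom_node hl hi (h1 s) (h2 s),
    hasDerivAt_prodMk_const_left 0 one_ne_zero (hasDerivAt_id s), Eventually.of_forall fun r => ?_⟩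
  rw [pt_node_special (h1 r) (h2 r), tseq_zero_fst]
  simp [cpAff]

lemma isPath_exc_snd (hl : fP a b l ^ 2 = 1) {i : ℕ} (hi : i + 1 < nmult a b l) (s : ℂ) :
    IsPath a b (.node l i) (fun o => .exc l (stepseq (i + 1) o)) 1 s (fun r => (r, 0)) := by
  have h1 := torA_zero_snd i
  have h2 : ∀ r : ℂ, torB (nmult a b l) i (r, 0) = 0 := torB_zero_snd hi
  refine ⟨mem_dom_node hl (by omega) (h1 s) (h2 s),
    hasDerivAt_prodMk_const_right 0 one_ne_zero (hasDerivAt_id s), Eventually.of_forall fun r => ?_⟩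
  rw [pt_node_special (h1 r) (h2 r), tseq_zero_snd]
  simp [cpAff]

variable (a b l) in
/-- The coordinate `y` on the strict transform of a nodal fibre. -/
def nodalY (t : ℂ) : ℂ := kap a b l * ((t - t⁻¹) / 2)

variable (a b l) in
/-- The strict transform of a nodal fibre. -/
def nodalCurve : Option ℂ → Pt
  | none => .sec false l
  | some t =>
    if t = 0 then .sec true l
    else if t = 1 then .exc l (stepseq (nmult a b l) none)
    else if t = -1 then .exc l (stepseq 0 (some 0))
    else .aff l (nodalY a b l t) (-fP a b l * t ^ 2)

lemma nodalCurve_of_ne {t : ℂ} (h0 : t ≠ 0) (h1 : t ^ 2 ≠ 1) :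
    nodalCurve a b l (some t) = .aff l (nodalY a b l t) (-fP a b l * t ^ 2) := by
  rw [sq_ne_one_iff] at h1
  simp [nodalCurve, h0, h1.1, h1.2]

lemma nodalY_ne_zero {t : ℂ} (h0 : t ≠ 0) (h1 : t ^ 2 ≠ 1) : nodalY a b l t ≠ 0 := by
  refine mul_ne_zero (kap_ne_zero a b l) fun h => h1 ?_
  field_simp at h
  linear_combination h

lemma affPt_nodal (hl : fP a b l ^ 2 = 1) {t : ℂ} (h0 : t ≠ 0) (h1 : t ^ 2 ≠ 1) :
    AffPt a b l (nodalY a b l t) (-fP a b l * t ^ 2) := by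
  have hε : fP a b l ≠ 0 := by intro h; rw [h] at hl; norm_num at hl
  refine ⟨by simp [hε, h0], ?_, fun h => nodalY_ne_zero h0 h1 h.1⟩
  have h2 : fh (-fP a b l * t ^ 2) = -fP a b l * (1 + 2 * ((t - t⁻¹) / 2) ^ 2) :=
    fh_nodeZ hl h0 (by ring)
  rw [h2, nodalY, mul_pow, kap_sq a b hl]
  ring

/-- z determines t up to sign by t² = -P(l)z, and the equation makes y equal to ±κ(t - 1/t)/2; the
sign of y selects the sign of t. -/
lemma exists_nodal (hl : fP a b l ^ 2 = 1) {y z : ℂ} (h : AffPt a b l y z) :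
    ∃ t, t ≠ 0 ∧ t ^ 2 ≠ 1 ∧ nodalY a b l t = y ∧ -fP a b l * t ^ 2 = z := by
  have hε : fP a b l ≠ 0 := by intro h; rw [h] at hl; norm_num at hl
  obtain ⟨hz, h1, h2⟩ := h
  set t := csqrt (-fP a b l * z) with ht
  have ht0 : t ≠ 0 := csqrt_ne_zero _
  have ht2 : t ^ 2 = -fP a b l * z := csqrt_sq (by simp [hε, hz])
  have htz : -fP a b l * t ^ 2 = z := by rw [ht2]; linear_combination z * hl
  have hy : y ^ 2 = nodalY a b l t ^ 2 := by
    have h3 : fh (-fP a b l * t ^ 2) = -fP a b l * (1 + 2 * ((t - t⁻¹) / 2) ^ 2) :=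
      fh_nodeZ hl ht0 (by ring)
    rw [h1, ← htz, h3, nodalY, mul_pow, kap_sq a b hl]
    ring
  have ht1 : t ^ 2 ≠ 1 := by
    intro h4
    have h5 : t - t⁻¹ = 0 := by
      field_simp
      linear_combination h4
    refine h2 ⟨?_, ?_⟩
    · have : y ^ 2 = 0 := by rw [hy, nodalY, h5]; ring
      simpa using this
    · rw [← htz, h4]; linear_combination hl
  rcases sq_eq_sq_iff_eq_or_eq_neg.1 hy with h4 | h4
  · exact ⟨t, ht0, ht1, h4.symm, htz⟩
  · refine ⟨-t, neg_ne_zero.2 ht0, by rwa [neg_sq], ?_, by rwa [neg_sq]⟩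
    rw [h4, nodalY, nodalY, inv_neg]; ring

/-- z = -P(l)t² leaves only t and -t, which have opposite nonzero values of y unless t² = 1. So the
parametrization can fail to be injective only at ±1, and for n = 1 these two parameters give the
node. -/
lemma nodalCurve_eq {o o' : Option ℂ} (hl : fP a b l ^ 2 = 1)
    (h : nodalCurve a b l o = nodalCurve a b l o') : o = o' ∨ o = some 1 ∨ o = some (-1) := by
  have hε : fP a b l ≠ 0 := by intro h; rw [h] at hl; norm_num at hl
  have key : ∀ {t : ℂ}, t ≠ 1 → t ≠ -1 → t ^ 2 ≠ 1 := fun h1 h2 h =>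
    ((sq_eq_sq_iff_eq_or_eq_neg (b := (1 : ℂ))).1 (by rw [h, one_pow])).elim h1 h2
  rcases o with _ | t <;> rcases o' with _ | t' <;> simp only [nodalCurve] at h
  · exact Or.inl rfl
  · split_ifs at h
    simp_all
  · split_ifs at h
    simp_all
  · by_cases h1 : t = 1
    · exact Or.inr (Or.inl (by rw [h1]))
    by_cases h2 : t = -1
    · exact Or.inr (Or.inr (by rw [h2]))
    left
    by_cases h0 : t = 0
    · simp only [h0, if_true] at h
      split_ifs at h with h3
      rw [h0, h3]
    simp only [h0, h1, h2, if_false] at h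
    split_ifs at h with h3 h4 h5
    simp only [Pt.aff.injEq, true_and] at h
    obtain ⟨h6, h7⟩ := h
    rcases sq_eq_sq_iff_eq_or_eq_neg.1 (mul_left_cancel₀ (neg_ne_zero.2 hε) h7) with h8 | h8
    · rw [h8]
    · exfalso
      apply nodalY_ne_zero h3 (key h4 h5) (a := a) (b := b) (l := l)
      rw [h8, nodalY, nodalY, inv_neg] at h6
      rw [nodalY]
      linear_combination -h6 / 2

/-- The points of the strict transform of a nodal fibre in the charts at the nodes. -/
lemma pt_node_nodal {j : ℕ} {c : ℂ × ℂ} {t σ : ℂ} (hC : torC c = 0) (h0 : t ≠ 0)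
    (h1 : t ^ 2 ≠ 1) (hσ : σ ^ 2 = 1) (ht : 0 < (σ * (t + t⁻¹) / 2).re)
    (hY : torA j c + nodeB a b l j c = 2 * nodalY a b l t)
    (hD : nodeB a b l j c - torA j c = 2 * σ * nodalY a b l t) :
    pt a b (.node l j) c = nodalCurve a b l (some t) := by
  have hκ := kap_ne_zero a b l
  have hD' : nodeD a b l j c = σ * ((t - t⁻¹) / 2) := by
    rw [nodeD, hD, nodalY]; field_simp
  -- The node charts use the square root of t² in the right half plane, which is σt with σ = ±1;
  -- accordingly √(1 + d²) = σ(t + 1/t)/2.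
  have hs : csqrt (1 + nodeD a b l j c ^ 2) = σ * (t + t⁻¹) / 2 := by
    refine csqrt_eq_of_sq ht ?_
    rw [hD']
    field_simp
    linear_combination (t ^ 2 + 1) ^ 2 * hσ - (t ^ 2 - 1) ^ 2 * hσ
  rw [nodalCurve_of_ne h0 h1]
  refine pt_eq_aff ?_ ?_ ?_ ?_
  · rintro ⟨h2, h3⟩
    apply nodalY_ne_zero h0 h1 (a := a) (b := b) (l := l)
    have h4 : nodeB a b l j c = 0 := by rw [nodeB, h3, mul_zero]
    rw [h2, h4] at hY
    linear_combination -hY / 2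
  · simp [cX, nodeX, hC]
  · simp only [cY, nodeY]
    linear_combination hY / 2
  · simp only [cZ, nodeZ, nodeT]
    rw [hs, hD']
    linear_combination -fP a b l * t ^ 2 * hσ

/-- Near t = 1 the chart's root is t itself, so A = y - κd = 0: the branch is the axis v = 0 of the
last chart, where u = B = 2y/q(l). -/
lemma isPath_nodal_one (hl : fP a b l ^ 2 = 1) {j : ℕ} (hj : j + 1 = nmult a b l) :
    IsPath a b (.node l j) (nodalCurve a b l) 0 1
      (fun r => (2 * nodalY a b l r / nquo a b l l, 0)) := by
  have hκ := kap_ne_zero a b l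
  have hq := nquo_self_ne_zero a b l
  have h1 : nodalY a b l 1 = 0 := by simp [nodalY]
  have hB : ∀ c, torB (nmult a b l) j c = c.1 := torB_last hj
  refine ⟨mem_dom_node hl (by omega) (torA_zero_snd _ _) (by simp [hB, h1]), ?_, ?_⟩
  · have h2 : HasDerivAt (nodalY a b l) (kap a b l * ((1 - -(1 ^ 2)⁻¹) / 2)) (1 : ℂ) :=
      (((hasDerivAt_id _).sub (hasDerivAt_inv one_ne_zero)).div_const 2).const_mul _
    refine hasDerivAt_prodMk_const_right 0 ?_ ((h2.const_mul 2).div_const _)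
    simp [hκ, hq]
  · have h2 : ∀ᶠ r : ℂ in 𝓝 1, 0 < (1 * (r + r⁻¹) / 2).re := by
      have h3 : ContinuousAt (fun r : ℂ => (1 * (r + r⁻¹) / 2).re) 1 := by
        refine Complex.continuous_re.continuousAt.comp ?_
        fun_prop (disch := norm_num)
      exact h3.eventually_const_lt (by norm_num)
    filter_upwards [h2, isOpen_ne.mem_nhds one_ne_zero,
      isOpen_ne.mem_nhds (show (1 : ℂ) ≠ -1 by norm_num)] with r h3 h4 h5
    by_cases h6 : r = 1
    · rw [h6, h1, pt_node_special (torA_zero_snd _ _) (by simp [hB]), tseq_zero_snd, hj]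
      simp [oinv, cpAff, nodalCurve]
    · have hC : torC (2 * nodalY a b l r / nquo a b l l, 0) = 0 := by simp [torC]
      have e : nodeB a b l j (2 * nodalY a b l r / nquo a b l l, 0) = 2 * nodalY a b l r := by
        rw [nodeB, nodeX, hC, hB, add_zero]; field_simp
      refine pt_node_nodal hC h4 (sq_ne_one_iff.2 ⟨h6, h5⟩) (one_pow 2) h3 ?_ ?_
      all_goals rw [e, torA_zero_snd]; ring

/-- Near t = -1 the chart's root is -t, so y = -κd and B = 0: the branch is the axis u = 0 of chart
0, where v = A = 2y. -/
lemma isPath_nodal_neg_one (hl : fP a b l ^ 2 = 1) :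
    IsPath a b (.node l 0) (nodalCurve a b l) 0 (-1) (fun r => (0, 2 * nodalY a b l r)) := by
  have hκ := kap_ne_zero a b l
  have h1 : nodalY a b l (-1) = 0 := by simp [nodalY]
  have hA : ∀ c, torA 0 c = c.2 := fun c => by simp [torA]
  have hB := torB_zero_fst (nmult a b l) 0
  refine ⟨mem_dom_node hl (nmult_pos a b l) (by simp [hA, h1]) (hB _), ?_, ?_⟩
  · have h2 : HasDerivAt (nodalY a b l) (kap a b l * ((1 - -((-1) ^ 2)⁻¹) / 2)) (-1 : ℂ) :=
      (((hasDerivAt_id _).sub (hasDerivAt_inv (by norm_num))).div_const 2).const_mul _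
    refine hasDerivAt_prodMk_const_left 0 ?_ (h2.const_mul 2)
    simp [hκ]
  · have h2 : ∀ᶠ r : ℂ in 𝓝 (-1), 0 < (-1 * (r + r⁻¹) / 2).re := by
      have h3 : ContinuousAt (fun r : ℂ => (-1 * (r + r⁻¹) / 2).re) (-1) := by
        refine Complex.continuous_re.continuousAt.comp ?_
        fun_prop (disch := norm_num)
      exact h3.eventually_const_lt (by norm_num)
    filter_upwards [h2, isOpen_ne.mem_nhds (show (-1 : ℂ) ≠ 0 by norm_num),
      isOpen_ne.mem_nhds (show (-1 : ℂ) ≠ 1 by norm_num)] with r h3 h4 h5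
    by_cases h6 : r = -1
    · rw [h6, h1, pt_node_special (by simp [hA]) (hB _), tseq_zero_fst]
      norm_num [cpAff, nodalCurve]
    · have e : nodeB a b l 0 (0, 2 * nodalY a b l r) = 0 := by rw [nodeB, hB, mul_zero]
      refine pt_node_nodal (by simp [torC]) h4 (sq_ne_one_iff.2 ⟨h5, h6⟩)
        (show (-1 : ℂ) ^ 2 = 1 by norm_num) h3 ?_ ?_
      all_goals rw [e, hA]; ring

lemma isPath_nodal_aff (hl : fP a b l ^ 2 = 1) {s : ℂ} (h0 : s ≠ 0) (h1 : s ^ 2 ≠ 1) :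
    IsPath a b (.xz (nodalY a b l s)) (nodalCurve a b l) 0 s
      (fun r => (l, -fP a b l * r ^ 2)) := by
  have hε : fP a b l ≠ 0 := by intro h; rw [h] at hl; norm_num at hl
  have hy := nodalY_ne_zero h0 h1 (a := a) (b := b) (l := l)
  have h2 : ∀ r : ℂ, r ≠ 0 → r ^ 2 ≠ 1 → (fP a b l + fh (-fP a b l * r ^ 2)) /
      nodalY a b l s ^ 2 = (nodalY a b l r / nodalY a b l s) ^ 2 := fun r hr hr' => by
    rw [div_pow, (affPt_nodal hl hr hr').2.1]
  refine ⟨⟨(affPt_nodal hl h0 h1).1, ?_⟩, ?_, ?_⟩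
  · rw [h2 s h0 h1, div_self hy]; simp
  · refine hasDerivAt_prodMk_const_left l ?_ ((hasDerivAt_pow 2 s).const_mul _)
    simp [hε, h0]
  · have h3 : ∀ᶠ r in 𝓝 s, 0 < (nodalY a b l r / nodalY a b l s).re := by
      have h4 : ContinuousAt (fun r : ℂ => (nodalY a b l r / nodalY a b l s).re) s := by
        refine Complex.continuous_re.continuousAt.comp ?_
        unfold nodalY
        fun_prop (disch := assumption)
      exact h4.eventually_const_lt (by simp [div_self hy])
    filter_upwards [h3, isOpen_ne.mem_nhds h0,
      (isOpen_ne.preimage (continuous_pow 2)).mem_nhds h1] with r h4 h5 h6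
    have e : cpAff 0 r = some r := by simp [cpAff]
    rw [e, nodalCurve_of_ne h5 h6]
    refine pt_eq_aff trivial rfl ?_ rfl
    simp only [cY]
    rw [h2 r h5 h6, csqrt_eq_of_sq h4 rfl, mul_div_cancel₀ _ hy]

/-- The strict transform of a nodal fibre near the sections. -/
lemma isPath_nodal_sec (hl : fP a b l ^ 2 = 1) (s : Bool) :
    IsPath a b (.sec s) (nodalCurve a b l) (if s then 0 else 1) 0 (fun r =>
      (l, (if s then 1 else -1) * 2 * r / (kap a b l * (r ^ 2 - 1)))) := by
  have hκ := kap_ne_zero a b l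
  have hε : fP a b l ≠ 0 := by intro h; rw [h] at hl; norm_num at hl
  set σ : ℂ := if s then 1 else -1 with hσ
  have hσ0 : σ ≠ 0 := by rw [hσ]; split_ifs <;> norm_num
  have hd : HasDerivAt (fun r : ℂ => σ * 2 * r / (kap a b l * (r ^ 2 - 1)))
      ((σ * 2 * 1 * (kap a b l * (0 ^ 2 - 1)) - σ * 2 * 0 * (kap a b l * (2 * 0 ^ 1))) /
        (kap a b l * (0 ^ 2 - 1)) ^ 2) 0 :=
    ((hasDerivAt_id (0 : ℂ)).const_mul _).div
      (by simpa using ((hasDerivAt_pow 2 (0 : ℂ)).sub_const 1).const_mul (kap a b l)) (by simp [hκ])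
  refine ⟨by simpa using zero_mem_dom_sec s l, hasDerivAt_prodMk_const_left l ?_ hd, ?_⟩
  · simp [hκ, hσ0]
  have h1 : ∀ᶠ r : ℂ in 𝓝 0,
      1 - (σ * 2 * r / (kap a b l * (r ^ 2 - 1))) ^ 2 * fP a b l ≠ 0 :=
    (continuousAt_const.sub ((hd.continuousAt.pow 2).mul continuousAt_const)).eventually_ne
      (by simp)
  have h2 : ∀ᶠ r : ℂ in 𝓝 0, ‖-fP a b l * r ^ 2‖ < 1 := by
    have h3 : ContinuousAt (fun r : ℂ => ‖-fP a b l * r ^ 2‖) 0 := by fun_prop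
    exact h3.eventually_lt_const (by simp)
  filter_upwards [h1, h2, (isOpen_ne.preimage (continuous_pow 2)).mem_nhds
    (show (0 : ℂ) ^ 2 ≠ 1 by simp)] with r h3 h4 h5
  have h5 : r ^ 2 ≠ 1 := h5
  have h6 : r ^ 2 - 1 ≠ 0 := sub_ne_zero.2 h5
  by_cases h0 : r = 0
  · subst h0
    cases s <;> simp [pt_sec_zero, cpAff, oinv, nodalCurve]
  obtain ⟨t, ht0, ht1, e1, e2, e3⟩ : ∃ t, t ≠ 0 ∧ t ^ 2 ≠ 1 ∧
      cpAff (if s then 0 else 1) r = some t ∧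
      (nodalY a b l t)⁻¹ = σ * 2 * r / (kap a b l * (r ^ 2 - 1)) ∧
      (if s then -fP a b l * t ^ 2 else (-fP a b l * t ^ 2)⁻¹) = -fP a b l * r ^ 2 := by
    cases s
    · refine ⟨r⁻¹, inv_ne_zero h0, by simpa using h5, by simp [cpAff, oinv, h0], ?_, ?_⟩
      · have : 1 - r ^ 2 ≠ 0 := by rw [← neg_sub]; exact neg_ne_zero.2 h6
        rw [nodalY, hσ, inv_inv]
        have e : r⁻¹ - r = -(r ^ 2 - 1) / r := by field_simp; ring
        rw [e]
        simp only [Bool.false_eq_true, if_false]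
        field_simp
      · simp only [Bool.false_eq_true, if_false]
        field_simp
        linear_combination hl
    · refine ⟨r, h0, h5, by simp [cpAff], ?_, by simp⟩
      rw [nodalY, hσ]
      have e : r - r⁻¹ = (r ^ 2 - 1) / r := by field_simp
      rw [e]
      simp only [if_true]
      field_simp
  rw [e1, nodalCurve_of_ne ht0 ht1, ← e2]
  rw [← e2] at h3
  exact pt_sec_eq (affPt_nodal hl ht0 ht1) (nodalY_ne_zero ht0 ht1) h3 (by rw [e3]; exact h4)

lemma exists_isPath_nodal (hl : fP a b l ^ 2 = 1) (n : Fin 2) (s : ℂ) :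
    ∃ k γ, IsPath a b k (nodalCurve a b l) n s γ := by
  refine exists_isPath (fun s => ?_) ⟨_, _, isPath_nodal_sec hl false⟩ n s
  by_cases h0 : s = 0
  · exact ⟨_, _, h0 ▸ isPath_nodal_sec hl true⟩
  by_cases h1 : s = 1
  · exact ⟨_, _, h1 ▸ isPath_nodal_one hl (Nat.sub_add_cancel (nmult_pos a b l))⟩
  by_cases h2 : s = -1
  · exact ⟨_, _, h2 ▸ isPath_nodal_neg_one hl⟩
  exact ⟨_, _, isPath_nodal_aff hl h0 (sq_ne_one_iff.2 ⟨h1, h2⟩)⟩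

/-- Cyclic predecessor in terms of representatives. The exceptional curves have labels 1, …, n - 1
and the strict transform plays both label 0 and label n; this includes n = 1, where 0 is its own
predecessor. -/
lemma val_sub_one {n : ℕ} [NeZero n] (i : ZMod n) :
    (i - 1).val + 1 = if i = 0 then n else i.val := by
  split_ifs with hi
  · obtain ⟨m, rfl⟩ := Nat.exists_eq_succ_of_ne_zero (NeZero.ne n)
    rw [hi, zero_sub, ZMod.val_neg_one]
  · have h1 : 0 < i.val := Nat.pos_of_ne_zero ((ZMod.val_eq_zero i).not.2 hi)
    have h2 : (1 : ZMod n).val = 1 := by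
      rw [ZMod.val_one_eq_one_mod, Nat.mod_eq_of_lt]
      have := i.val_lt
      omega
    rw [ZMod.val_sub (by omega), h2]
    omega

variable (a b l) in
/-- The curves in a fibre of type `I`. -/
def cycleCurve (i : ZMod (nmult a b l)) : Option ℂ → Pt :=
  if i = 0 then nodalCurve a b l else fun o => .exc l (stepseq i.val o)

/-- The parameter of the point where the curve meets the next one. -/
def tl {n : ℕ} (i : ZMod n) : Option ℂ := some (if i = 0 then -1 else 0)

/-- The parameter of the point where the curve meets the previous one. -/
def hd {n : ℕ} (i : ZMod n) : Option ℂ := if i = 0 then some 1 else none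

lemma tl_ne_hd {n : ℕ} (i j : ZMod n) : tl i ≠ hd j := by
  by_cases hi : i = 0 <;> by_cases hj : j = 0 <;> norm_num [tl, hd, hi, hj] <;>
    exact Option.some_ne_none _

instance (l : ℂ) : NeZero (nmult a b l) := ⟨(nmult_pos a b l).ne'⟩

lemma cycleCurve_tl (i : ZMod (nmult a b l)) :
    cycleCurve a b l i (tl i) = .exc l (stepseq i.val (some 0)) := by
  by_cases hi : i = 0
  · subst hi
    norm_num [cycleCurve, tl, nodalCurve]
  · simp [cycleCurve, tl, hi]

/-- The head of curve i is the origin of chart i - 1, which is also the tail of curve i - 1; so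
consecutive curves of the cycle meet at the origins of the n charts. -/
lemma cycleCurve_hd (i : ZMod (nmult a b l)) :
    cycleCurve a b l i (hd i) = .exc l (stepseq (i - 1).val (some 0)) := by
  rw [← stepseq_succ_none, val_sub_one]
  by_cases hi : i = 0
  · simp [cycleCurve, hd, nodalCurve, hi]
  · simp [cycleCurve, hd, hi]

lemma cycleCurve_eq (hl : fP a b l ^ 2 = 1) {i j : ZMod (nmult a b l)} {o o' : Option ℂ}
    (h : cycleCurve a b l i o = cycleCurve a b l j o') : (i, o) = (j, o') ∨ o = tl i ∨ o = hd i := by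
  have key : ∀ {o ρ}, nodalCurve a b l o = .exc l ρ → o = some 1 ∨ o = some (-1) := by
    rintro (_ | t) ρ h
    · simp [nodalCurve] at h
    · simp only [nodalCurve] at h
      split_ifs at h <;> simp_all
  by_cases hi : i = 0 <;> by_cases hj : j = 0
  · simp only [cycleCurve, hi, hj, if_true] at h
    rcases nodalCurve_eq hl h with h1 | h1 | h1 <;> simp [tl, hd, hi, hj, h1]
  · simp only [cycleCurve, hi, hj, if_true, if_false] at h
    rcases key h with h1 | h1 <;> simp [tl, hd, hi, h1]
  · simp only [cycleCurve, hi, hj, if_true, if_false] at h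
    have h1 : o = some 0 ∨ o = none := by
      rcases key h.symm with h2 | h2
      all_goals
        simp only [h2, nodalCurve] at h
        norm_num at h
        rcases stepseq_eq.1 h with h3 | h3 | h3
        all_goals simp [h3]
    rcases h1 with h1 | h1 <;> simp [tl, hd, hi, h1]
  · simp only [cycleCurve, hi, hj, if_false, Pt.exc.injEq, true_and] at h
    rcases stepseq_eq.1 h with ⟨h1, h2⟩ | h1 | h1
    · exact Or.inl (by rw [ZMod.val_injective _ h1, h2])
    all_goals simp [tl, hd, hi, h1]

/-- The description by ordered pairs of parameters is uniform in n. For n = 1 both alternatives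
concern one curve and give the two ordered parameter pairs of its node; for n = 2 they give the two
intersection points. -/
lemma cycleCurve_cross (hl : fP a b l ^ 2 = 1) {i j : ZMod (nmult a b l)} {o o' : Option ℂ} :
    ((i, o) ≠ (j, o') ∧ cycleCurve a b l i o = cycleCurve a b l j o') ↔
      (o = tl i ∧ o' = hd j ∧ j = i + 1) ∨ (o = hd i ∧ o' = tl j ∧ i = j + 1) := by
  constructor
  · rintro ⟨h, e⟩
    have key : ∀ {i j : ZMod (nmult a b l)}, stepseq i.val (some 0) = stepseq j.val (some 0) →
        i = j := by
      intro i j h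
      rcases stepseq_eq.1 h with h | h | h <;> simp_all
      exact ZMod.val_injective _ h
    have h1 := (cycleCurve_eq hl e).resolve_left h
    have h2 := (cycleCurve_eq hl e.symm).resolve_left (Ne.symm h)
    rcases h1 with rfl | rfl <;> rcases h2 with rfl | rfl <;>
      simp only [cycleCurve_tl, cycleCurve_hd, Pt.exc.injEq, true_and] at e <;> replace e := key e
    · exact absurd (by rw [e]) h
    · exact Or.inl ⟨rfl, rfl, by rw [e]; ring⟩
    · exact Or.inr ⟨rfl, rfl, by rw [← e]; ring⟩
    · exact absurd (by rw [sub_left_injective e]) h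
  · rintro (⟨rfl, rfl, rfl⟩ | ⟨rfl, rfl, rfl⟩)
    · exact ⟨fun h => tl_ne_hd _ _ (Prod.ext_iff.1 h).2,
        by rw [cycleCurve_tl, cycleCurve_hd, add_sub_cancel_right]⟩
    · exact ⟨fun h => tl_ne_hd _ _ (Prod.ext_iff.1 h).2.symm,
        by rw [cycleCurve_tl, cycleCurve_hd, add_sub_cancel_right]⟩

lemma exists_isPath_tl (hl : fP a b l ^ 2 = 1) (i : ZMod (nmult a b l)) : ∃ n s γ,
    cpAff n s = tl i ∧ (∀ r, (γ r).1 = 0) ∧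
      IsPath a b (.node l i.val) (cycleCurve a b l i) n s γ := by
  by_cases hi : i = 0
  · refine ⟨0, -1, fun r => (0, 2 * nodalY a b l r), by simp [tl, hi, cpAff], fun _ => rfl, ?_⟩
    rw [cycleCurve, if_pos hi, (ZMod.val_eq_zero i).2 hi]
    exact isPath_nodal_neg_one hl
  · refine ⟨0, 0, fun r => (0, r), by simp [tl, hi, cpAff], fun _ => rfl, ?_⟩
    rw [cycleCurve, if_neg hi]
    exact isPath_exc_fst hl ((ZMod.val_eq_zero i).not.2 hi) i.val_lt 0

lemma exists_isPath_hd (hl : fP a b l ^ 2 = 1) (i : ZMod (nmult a b l)) : ∃ n s γ,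
    cpAff n s = hd i ∧ (∀ r, (γ r).2 = 0) ∧
      IsPath a b (.node l (i - 1).val) (cycleCurve a b l i) n s γ := by
  have h := val_sub_one i
  by_cases hi : i = 0
  · refine ⟨0, 1, fun r => (2 * nodalY a b l r / nquo a b l l, 0), by simp [hd, hi, cpAff],
      fun _ => rfl, ?_⟩
    rw [cycleCurve, if_pos hi]
    exact isPath_nodal_one hl (by rw [h, if_pos hi])
  · refine ⟨1, 0, fun r => (r, 0), by simp [hd, hi, cpAff, oinv], fun _ => rfl, ?_⟩
    rw [if_neg hi] at h
    rw [cycleCurve, if_neg hi, ← h]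
    exact isPath_exc_snd hl (h.trans_lt i.val_lt) 0

lemma theta_cycleCurve (hl : fP a b l ^ 2 = 1) {p : Surf a b} :
    theta a b p = aff 0 l ↔ ∃ i o, toPt p = cycleCurve a b l i o := by
  rw [theta_eq_aff_zero]
  constructor
  · rintro (⟨y, z, h⟩ | ⟨ρ, h⟩ | ⟨s, h⟩)
    · obtain ⟨t, h1, h2, rfl, rfl⟩ := exists_nodal hl (affPt_of_toPt h)
      exact ⟨0, some t, by rw [h, cycleCurve, if_pos rfl, nodalCurve_of_ne h1 h2]⟩
    · obtain ⟨j, c, hc, -, rfl, hA, hB⟩ := exists_node_of_toPt h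
      have hj : j < nmult a b l := hc.2.1
      obtain ⟨u, v⟩ := c
      rw [h]
      by_cases hu : u = 0
      · subst hu
        rw [tseq_zero_fst]
        by_cases h0 : j = 0
        · subst h0
          have : v = 0 := by simpa [torA] using hA
          exact ⟨0, tl 0, by rw [cycleCurve_tl, this]; simp⟩
        · refine ⟨j, some v, ?_⟩
          rw [cycleCurve, if_neg, ZMod.val_natCast_of_lt hj]
          rwa [← ZMod.val_eq_zero, ZMod.val_natCast_of_lt hj]
      · have hv : v = 0 ∧ j + 1 < nmult a b l := by
          have h1 : v = 0 ∧ nmult a b l - 1 - j ≠ 0 := by simpa [torB, hu] using hB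
          exact ⟨h1.1, by omega⟩
        obtain ⟨rfl, hj'⟩ := hv
        refine ⟨(j + 1 : ℕ), oinv u, ?_⟩
        rw [tseq_zero_snd, cycleCurve, if_neg, ZMod.val_natCast_of_lt hj']
        rw [← ZMod.val_eq_zero, ZMod.val_natCast_of_lt hj']
        omega
    · cases s
      · exact ⟨0, none, by rw [h, cycleCurve, if_pos rfl, nodalCurve]⟩
      · exact ⟨0, some 0, by rw [h, cycleCurve, if_pos rfl, nodalCurve, if_pos rfl]⟩
  · rintro ⟨i, o, h⟩
    rw [h, cycleCurve]
    split_ifs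
    · rcases o with _ | t
      · simp [nodalCurve]
      · simp only [nodalCurve]
        split_ifs <;> simp
    · simp

/-- The fibres over `[l, 1]` with `P(l) ^ 2 = 1` are of type `I`. -/
theorem isTypeI (hl : fP a b l ^ 2 = 1) : IsTypeI (theta a b) (aff 0 l) (nmult a b l) := by
  have hv : (![l, 1] : Fin 2 → ℂ) ≠ 0 := by simp
  have hran : ∀ p : Surf a b, theta a b p = Projectivization.mk ℂ ![l, 1] hv ↔
      ∃ i o, toPt p = cycleCurve a b l i o := fun p => theta_cycleCurve hl
  have hdom : ∀ i : ZMod (nmult a b l), (0 : ℂ × ℂ) ∈ dom a b (.node l i.val) ∧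
      pt a b (.node l i.val) 0 = cycleCurve a b l i (tl i) := fun i =>
    have hA : torA i.val 0 = 0 := torA_zero_snd _ _
    have hB : torB (nmult a b l) i.val 0 = 0 := torB_zero_fst _ _ _
    ⟨mem_dom_node hl i.val_lt hA hB, by
      rw [pt_node_special hA hB, cycleCurve_tl, ← tseq_zero_fst]; rfl⟩
  have himm : ∀ (i : ZMod (nmult a b l)) n s, ∃ k γ, IsPath a b k (cycleCurve a b l i) n s γ := by
    intro i n s
    by_cases hi : i = 0
    · rw [cycleCurve, if_pos hi]
      exact exists_isPath_nodal hl n s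
    · have h := val_sub_one i
      have h1 := isPath_exc_fst hl ((ZMod.val_eq_zero i).not.2 hi) i.val_lt
      rw [if_neg hi] at h
      have h2 := isPath_exc_snd hl (h.trans_lt i.val_lt) 0
      rw [h] at h2
      rw [cycleCurve, if_neg hi]
      exact exists_isPath (fun s => ⟨_, _, h1 s⟩) ⟨_, _, h2⟩ n s
  have vtl : ∀ i, VanishesOn a b (.node l i.val) (fun c => c.1) (cycleCurve a b l i) (tl i) := by
    intro i
    obtain ⟨n, s, γ, h1, h2, h3⟩ := exists_isPath_tl hl i
    exact h1 ▸ h3.vanishesOn h2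
  have vhd : ∀ i, VanishesOn a b (.node l (i - 1).val) (fun c => c.2) (cycleCurve a b l i)
      (hd i) := by
    intro i
    obtain ⟨n, s, γ, h1, h2, h3⟩ := exists_isPath_hd hl i
    exact h1 ▸ h3.vanishesOn h2
  refine ⟨nmult_pos a b l, isFibreOfRationalCurves hv (cycleCurve a b l) himm hran ?_ ?_ ?_⟩
  · intro i j
    have e : {c : Option ℂ × Option ℂ | (i, c.1) ≠ (j, c.2) ∧
        cycleCurve a b l i c.1 = cycleCurve a b l j c.2} =
        (if j = i + 1 then {(tl i, hd j)} else ∅) ∪ (if i = j + 1 then {(hd i, tl j)} else ∅) := by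
      ext ⟨o, o'⟩
      rw [mem_ofPred_eq, cycleCurve_cross hl, mem_union]
      refine or_congr ?_ ?_
      all_goals
        split_ifs with h1
        · simp only [h1, and_true, mem_singleton_iff, Prod.mk.injEq]
        · simp only [h1, and_false, mem_empty_iff_false]
    -- The two alternatives stay disjoint even if j = i + 1 and i = j + 1 hold together, since tail
    -- and head have different parameters; the counts therefore add.
    have h := tl_ne_hd i i
    rw [e, encard_union_eq]
    · split_ifs <;> simp
      norm_num
    · split_ifs <;> simp [h]
  · intro i o ho
    obtain ⟨n, s, rfl⟩ := exists_cpAff o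
    obtain ⟨k, γ, h1, -, h2⟩ := himm i n s
    have h3 := h2.self_of_nhds
    have hp := (hran ((atl a b).par k (γ s))).2 ⟨i, _, (toPt_par h1).trans h3⟩
    obtain ⟨k', c, hc, e, hL, hX⟩ := exists_chart_finite hp
    have h4 : pt a b k' c = cycleCurve a b l i (cpAff n s) := by
      rw [← toPt_par hc, ← e, toPt_par h1, h3]
    refine exists_smooth hv hc h4 ?_ fun p o h => (hran p).2 ⟨i, o, h⟩
    have e1 : fibEq ![l, 1] k' = fun c => cX k' c - l := by
      funext c; simp [fibEq, hL]
    rw [e1, fderiv_sub_const]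
    -- If the differential vanished, the point would be the origin of a node chart, through which
    -- two branches pass; this contradicts the assumption that only one does.
    intro h5
    obtain ⟨-, j, rfl, rfl⟩ := hX h5
    have hj : ((j : ZMod (nmult a b l))).val = j := ZMod.val_natCast_of_lt hc.2.1
    have h6 := (hdom j).2
    rw [hj, h4] at h6
    have h7 := ho _ _ h6.symm
    have h8 := ho (j + 1) (hd (j + 1 : ZMod (nmult a b l))) (by
      rw [h6, cycleCurve_hd, cycleCurve_tl, add_sub_cancel_right])
    exact tl_ne_hd _ _ (Prod.ext_iff.1 (h7.trans h8.symm)).2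
  · intro i o j o' hne heq
    -- In every chart at the node x - l = uv: the two branches are the axes, each with multiplicity
    -- one.
    have key : ∀ i : ZMod (nmult a b l), ∀ᶠ c in 𝓝 (0 : ℂ × ℂ),
        fibEq ![l, 1] (.node l i.val) c = 1 * c.1 ^ 1 * c.2 ^ 1 := fun i =>
      Eventually.of_forall fun c => by simp [fibEq, thetaL, cX, nodeX, torC]
    have hind : ∀ x : ℂ × ℂ, fderiv ℂ (fun c : ℂ × ℂ => c.1) 0 x = 0 →
        fderiv ℂ (fun c : ℂ × ℂ => c.2) 0 x = 0 → x = 0 := by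
      intro x h1 h2
      rw [fderiv_fst] at h1
      rw [fderiv_snd] at h2
      exact Prod.ext h1 h2
    rcases (cycleCurve_cross hl).1 ⟨hne, heq⟩ with ⟨rfl, rfl, rfl⟩ | ⟨rfl, rfl, rfl⟩
    · have h := vhd (i + 1)
      rw [add_sub_cancel_right] at h
      exact ⟨_, 0, (hdom i).1, fun _ => 1, fun c => c.1, fun c => c.2, (hdom i).2,
        analyticAt_const, analyticAt_fst, analyticAt_snd, one_ne_zero, hind, vtl i, h, key i⟩
    · have h := vhd (j + 1)
      rw [add_sub_cancel_right] at h
      refine ⟨_, 0, (hdom j).1, fun _ => 1, fun c => c.2, fun c => c.1, (hdom j).2.trans heq.symm,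
        analyticAt_const, analyticAt_snd, analyticAt_fst, one_ne_zero,
        fun x h1 h2 => hind x h2 h1, h, vtl j, ?_⟩
      filter_upwards [key j] with c hc
      rw [hc]; ring

end

/-! ### The fibre of type `I*` -/

section

variable {s : Bool} {i : ℕ}

lemma isPath_inf_fst (h0 : i ≠ 0) (hi : i < 8) (t : ℂ) :
    IsPath a b (.chain s i) (fun o => .inf s (stepseq i o)) 0 t (fun r => (0, r)) := by
  have h1 : ∀ r : ℂ, torA i (0, r) = 0 := torA_zero_fst h0
  have h2 := torB_zero_fst 8 i
  refine ⟨mem_dom_chain s hi (h1 t) (h2 t),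
    hasDerivAt_prodMk_const_left 0 one_ne_zero (hasDerivAt_id t), Eventually.of_forall fun r => ?_⟩
  rw [pt_chain_special (h1 r) (h2 r), tseq_zero_fst]
  simp [cpAff]

lemma isPath_inf_snd (hi : i + 1 < 8) (t : ℂ) :
    IsPath a b (.chain s i) (fun o => .inf s (stepseq (i + 1) o)) 1 t (fun r => (r, 0)) := by
  have h1 := torA_zero_snd i
  have h2 : ∀ r : ℂ, torB 8 i (r, 0) = 0 := torB_zero_snd hi
  refine ⟨mem_dom_chain s (by omega) (h1 t) (h2 t),
    hasDerivAt_prodMk_const_right 0 one_ne_zero (hasDerivAt_id t), Eventually.of_forall fun r => ?_⟩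
  rw [pt_chain_special (h1 r) (h2 r), tseq_zero_snd]
  simp [cpAff]

/-- The two curves of multiplicity one in the fibre over `x = ∞` which do not meet the sections. -/
def tailCurve (s : Bool) : Option ℂ → Pt
  | none => .inf s (stepseq 2 (some (-1)))
  | some σ => .tail s σ

/-- The middle curve in the fibre over `x = ∞`. -/
def midCurve : Option ℂ → Pt
  | none => .inf false (stepseq 8 none)
  | some z => if z = 0 then .inf true (stepseq 8 none) else .mid z

lemma isPath_tail (t : ℂ) : IsPath a b (.tail s) (tailCurve s) 0 t (fun r => (r, 0)) :=
  ⟨zero_mem_dom_tail s t, hasDerivAt_prodMk_const_right 0 one_ne_zero (hasDerivAt_id t),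
    Eventually.of_forall fun r => by rw [pt_tail_zero]; simp [cpAff, tailCurve]⟩

/-- In chart 1 one has ξ = A + C² = uv²(1 + u), so the tail is the line u = -1. There C = -v, and v
= -2r makes y/x = √T/C = 2/(2r) = 1/r, the coordinate at infinity. -/
lemma isPath_tail_inf : IsPath a b (.chain s 1) (tailCurve s) 1 0 (fun r => (-1, -2 * r)) := by
  have h1 : torA 1 (-1, -2 * 0) = 0 := by simp [torA]
  have h2 : torB 8 1 (-1, -2 * 0) = 0 := by simp [torB]
  refine ⟨mem_dom_chain s (by norm_num) h1 h2, hasDerivAt_prodMk_const_left (-1) (d := -2)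
    (by norm_num) (hasDerivAt_const_mul (-2)),
    Eventually.of_forall fun r => ?_⟩
  by_cases hr : r = 0
  · subst hr
    have e : ((-1 : ℂ), (-2 : ℂ) * 0) = (-1, 0) := by simp
    rw [pt_chain_special h1 h2, e, tseq_zero_snd]
    norm_num [cpAff, oinv, tailCurve]
  · have hξ : chXi 1 (-1, -2 * r) = 0 := by simp [chXi, torA, torC]; ring
    have hC : torC (-1, -2 * r) = 2 * r := by simp [torC]
    rw [pt_of_not_isAff fun h : isAff a b (.chain s 1) (-1, -2 * r) => h.2 hξ]
    simp only [special, hC]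
    rw [if_pos (by simpa using hr), chQ, hξ, fT_zero, csqrt_four]
    simp only [cpAff, oinv, hr, one_ne_zero, if_false, tailCurve]
    congr 1
    field_simp

lemma isPath_mid {t : ℂ} (ht : t ≠ 0) : IsPath a b .mid midCurve 0 t (fun r => (0, r)) := by
  refine ⟨zero_mem_dom_mid ht, hasDerivAt_prodMk_const_left 0 one_ne_zero (hasDerivAt_id t), ?_⟩
  filter_upwards [isOpen_ne.mem_nhds ht] with r hr
  have hr : r ≠ 0 := hr
  simp [pt_mid_zero, cpAff, midCurve, hr]

/-- On the axis v = 0 of chart 7, A = C = 0 and w = B/8 = u/8. Prescribing z = r (or z = 1/r over ∞)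
means w = r/(1 + r²), hence u = 8r/(1 + r²). -/
lemma isPath_mid_inf : IsPath a b (.chain s 7) midCurve (if s then 0 else 1) 0
    (fun r => (8 * r / (1 + r ^ 2), 0)) := by
  have hd : HasDerivAt (fun r : ℂ => 8 * r / (1 + r ^ 2))
      ((8 * 1 * (1 + 0 ^ 2) - 8 * 0 * (2 * 0 ^ 1)) / (1 + 0 ^ 2) ^ 2) 0 :=
    ((hasDerivAt_id (0 : ℂ)).const_mul 8).div
      (by simpa using (hasDerivAt_pow 2 (0 : ℂ)).const_add 1) (by simp)
  refine ⟨mem_dom_chain s (by norm_num) (torA_zero_snd _ _) (by simp [torB]),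
    hasDerivAt_prodMk_const_right 0 (by norm_num) hd, ?_⟩
  have h1 : ∀ᶠ r : ℂ in 𝓝 0, ‖r‖ < 1 := continuous_norm.continuousAt.eventually_lt_const (by simp)
  have h2 : ∀ᶠ r : ℂ in 𝓝 0, 1 + r ^ 2 ≠ 0 :=
    ContinuousAt.eventually_ne (g := fun r : ℂ => 1 + r ^ 2) (by fun_prop) (by simp)
  filter_upwards [h1, h2] with r h3 h4
  by_cases hr : r = 0
  · subst hr
    have h5 : torA 7 ((8 : ℂ) * 0 / (1 + 0 ^ 2), 0) = 0 := torA_zero_snd _ _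
    have h6 : torB 8 7 ((8 : ℂ) * 0 / (1 + 0 ^ 2), 0) = 0 := by simp [torB]
    rw [pt_chain_special h5 h6, tseq_zero_snd]
    cases s <;> simp [cpAff, oinv, midCurve]
  · have h5 : torC (8 * r / (1 + r ^ 2), 0) = 0 := by simp [torC]
    have h6 : torA 7 (8 * r / (1 + r ^ 2), 0) = 0 := torA_zero_snd _ _
    have h7 : torB 8 7 (8 * r / (1 + r ^ 2), 0) = 8 * r / (1 + r ^ 2) := torB_last rfl _
    have h8 : chW a b 7 (8 * r / (1 + r ^ 2), 0) = r / (1 + r ^ 2) := by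
      rw [chW, chXi, h5, h6, h7]
      norm_num [fT_zero]
      field_simp
    have h9 : jou (r / (1 + r ^ 2)) = r := (jou_of_norm_lt_one h3 (div_mul_cancel₀ _ h4)).2
    rw [pt_of_not_isAff (by simp [isAff, h5])]
    simp only [special, h5, h6, h7, h8, ne_eq, not_true, if_false]
    rw [if_pos (div_ne_zero (mul_ne_zero (by norm_num) hr) h4)]
    cases s <;> simp [cpAff, oinv, midCurve, hr, zside, h9]

end

/-- The curves in the fibre over `x = ∞`: for `q.2 ≠ 0, 8` those of the two chains, for `q.2 = 8`
the middle curve. -/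
def starPt (q : Bool × ℕ) : Option ℂ → Pt :=
  if q.2 = 0 then tailCurve q.1
  else if q.2 = 8 then midCurve
  else fun o => .inf q.1 (stepseq q.2 o)

/-- The labels of the curves in the fibre over `x = ∞`. -/
def starIdx : Fin 13 ⊕ Fin 4 → Bool × ℕ
  | .inl i => if i.val ≤ 6 then (true, i.val + 2) else (false, 14 - i.val)
  | .inr k => (k.val < 2, 1 - k.val % 2)

/-- The curve `q` meets the curve `q'`, which does not lie before it in its chain. -/
abbrev Meets (q q' : Bool × ℕ) : Prop :=
  (q.1 = q'.1 ∧ q.2 ≠ 0 ∧ q'.2 = q.2 + 1 ∧ q.2 < 7) ∨ (q.2 = 7 ∧ q'.2 = 8) ∨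
    (q.1 = q'.1 ∧ q.2 = 2 ∧ q'.2 = 0)

/-- The parameter on the curve `q` of the point where it meets `q'`. -/
def meetL (q' : Bool × ℕ) : Option ℂ := some (if q'.2 = 0 then -1 else 0)

/-- The parameter on the curve `q'` of the point where it meets `q`. -/
def meetR (q q' : Bool × ℕ) : Option ℂ := if q'.2 = 8 ∧ q.1 then some 0 else none

/-- The labels that occur. -/
abbrev IsStar (q : Bool × ℕ) : Prop := q.2 ≤ 8 ∧ (q.2 = 8 → q.1 = true)

lemma starIdx_injective : Function.Injective starIdx := by unfold Function.Injective; decide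

lemma isStar_starIdx : ∀ i, IsStar (starIdx i) := by decide

lemma exists_starIdx {q : Bool × ℕ} (h : IsStar q) : ∃ i, starIdx i = q := by
  have key : ∀ s : Bool, ∀ k : Fin 9, IsStar (s, k.val) → ∃ i, starIdx i = (s, k.val) := by decide
  exact key q.1 ⟨q.2, Nat.lt_succ_of_le h.1⟩ h

/-- The 13 double curves are, in order, the curves 2 to 7 over z = 0, the middle curve 8, and the
curves 7 to 2 over z = ∞; the four simple ones are curve 1 and the tail (label 0) on either side.
The comparison is a finite check. -/
lemma starGraph_eq : ∀ i j, starGraph 12 i j =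
    if Meets (starIdx i) (starIdx j) ∨ Meets (starIdx j) (starIdx i) then 1 else 0 := by decide

lemma starPt_eq_inf {q : Bool × ℕ} {o : Option ℂ} {s : Bool} {ρ : ℕ → Option ℂ}
    (h : starPt q o = .inf s ρ) : (q.2 ≠ 0 ∧ q.2 ≠ 8 ∧ q.1 = s ∧ ρ = stepseq q.2 o) ∨
      (q.2 = 0 ∧ q.1 = s ∧ o = none ∧ ρ = stepseq 2 (some (-1))) ∨
      (q.2 = 8 ∧ o = (if s then some 0 else none) ∧ ρ = stepseq 8 none) := by
  unfold starPt at h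
  split_ifs at h with h1 h2
  · rcases o with _ | σ <;> simp only [tailCurve, reduceCtorEq, Pt.inf.injEq] at h
    exact Or.inr (Or.inl ⟨h1, h.1, rfl, h.2.symm⟩)
  · rcases o with _ | σ <;> simp only [midCurve] at h
    · simp only [Pt.inf.injEq] at h
      simp [h2, ← h.1, ← h.2]
    · split_ifs at h with h3
      simp only [Pt.inf.injEq] at h
      simp [h2, h3, ← h.1, ← h.2]
  · simp only [Pt.inf.injEq] at h
    exact Or.inl ⟨h1, h2, h.1, h.2.symm⟩

/-- Labels of tail or middle points reveal both the curve and the parameter. All crossings therefore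
have labels `Pt.inf`, and the middle curve must be listed only once, as (true, 8). -/
lemma starPt_eq {q q' : Bool × ℕ} (hq : IsStar q) (hq' : IsStar q') {o o' : Option ℂ}
    (h : starPt q o = starPt q' o') : (q, o) = (q', o') ∨ ∃ s ρ, starPt q o = .inf s ρ := by
  by_contra! hc
  obtain ⟨hne, hinf⟩ := hc
  apply hne
  have hinf' : ∀ s ρ, starPt q' o' ≠ .inf s ρ := by rwa [← h]
  have key : ∀ {q o}, IsStar q → (∀ s ρ, starPt q o ≠ .inf s ρ) →
      (q.2 = 0 ∧ ∃ σ, o = some σ ∧ starPt q o = .tail q.1 σ) ∨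
      (q = (true, 8) ∧ ∃ z, o = some z ∧ starPt q o = .mid z) := by
    rintro ⟨s, k⟩ o ⟨h1, h2⟩ h3
    unfold starPt at h3 ⊢
    split_ifs at h3 ⊢ with h4 h5
    · rcases o with _ | σ
      · exact absurd rfl (h3 _ _)
      · exact Or.inl ⟨h4, σ, rfl, rfl⟩
    · rcases o with _ | z
      · exact absurd rfl (h3 _ _)
      · refine Or.inr ⟨by rw [← h2 h5, ← h5], z, rfl, ?_⟩
        simp only [midCurve] at h3 ⊢
        split_ifs at h3 ⊢ with h6
        · exact absurd rfl (h3 _ _)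
        · rfl
    · exact absurd rfl (h3 _ _)
  rcases key hq hinf with ⟨h1, σ, rfl, h2⟩ | ⟨rfl, z, rfl, h2⟩ <;>
    rcases key hq' hinf' with ⟨h3, σ', rfl, h4⟩ | ⟨rfl, z', rfl, h4⟩ <;> rw [h2, h4] at h
  · simp only [Pt.tail.injEq] at h
    rw [h.2, Prod.ext h.1 (h1.trans h3.symm)]
  · simp at h
  · simp at h
  · simp only [Pt.mid.injEq] at h
    rw [h]

lemma starPt_meet {q q' : Bool × ℕ} (h : Meets q q') :
    starPt q (meetL q') = starPt q' (meetR q q') := by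
  rcases q with ⟨s, i⟩
  rcases q' with ⟨s', j⟩
  rcases h with ⟨rfl, h1, rfl, h2⟩ | ⟨rfl, rfl⟩ | ⟨rfl, rfl, rfl⟩
  · have h1 : i ≠ 0 := h1
    have h2 : i < 7 := h2
    simp [starPt, h1, meetL, meetR, show i ≠ 8 by omega, show i ≠ 7 by omega, stepseq_succ_none]
  · cases s <;> simp [starPt, meetL, meetR, midCurve, ← stepseq_succ_none]
  · simp [starPt, meetL, meetR, tailCurve]

/-- By `starPt_eq` a crossing is a label on one of the toric chains, and there `stepseq_eq` leaves
only consecutive curves and the point A/C² = -1 of the second curve, where the tail meets it. -/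
lemma starPt_cross {q q' : Bool × ℕ} (hq : IsStar q) (hq' : IsStar q') {o o' : Option ℂ} :
    ((q, o) ≠ (q', o') ∧ starPt q o = starPt q' o') ↔
      (Meets q q' ∧ o = meetL q' ∧ o' = meetR q q') ∨
        (Meets q' q ∧ o' = meetL q ∧ o = meetR q' q) := by
  constructor
  · rintro ⟨hne, h⟩
    obtain ⟨s, ρ, e⟩ := (starPt_eq hq hq' h).resolve_left hne
    rcases q with ⟨s₁, i⟩
    rcases q' with ⟨s₂, j⟩
    have h1 := starPt_eq_inf e
    have h2 := starPt_eq_inf (h.symm.trans e)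
    simp only at h1 h2
    rcases h1 with ⟨h3, h4, rfl, rfl⟩ | ⟨rfl, rfl, rfl, rfl⟩ | ⟨rfl, rfl, rfl⟩ <;>
      rcases h2 with ⟨h5, h6, rfl, h7⟩ | ⟨rfl, rfl, rfl, h7⟩ | ⟨rfl, rfl, h7⟩ <;>
      have h7 := stepseq_eq.1 h7
    · obtain ⟨h8, -⟩ := hq
      obtain ⟨h9, -⟩ := hq'
      simp only at h8 h9
      rcases h7 with ⟨rfl, rfl⟩ | ⟨rfl, rfl, rfl⟩ | ⟨rfl, rfl, rfl⟩
      · exact absurd rfl hne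
      · left
        refine ⟨Or.inl ⟨rfl, h3, rfl, by omega⟩, by simp [meetL], by simp [meetR]; omega⟩
      · right
        refine ⟨Or.inl ⟨rfl, h5, rfl, by omega⟩, by simp [meetL], by simp [meetR]; omega⟩
    · rcases h7 with ⟨rfl, rfl⟩ | h7 | h7
      · exact Or.inl ⟨Or.inr (Or.inr ⟨rfl, rfl, rfl⟩), by simp [meetL], by simp [meetR]⟩
      all_goals simp at h7
    · rcases h7 with ⟨rfl, -⟩ | ⟨h7, rfl, -⟩ | ⟨-, -, h7⟩
      · exact absurd rfl h4
      · exact Or.inl ⟨Or.inr (Or.inl ⟨by simp only; omega, rfl⟩), by simp [meetL], by simp [meetR]⟩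
      · simp at h7
    · rcases h7 with ⟨rfl, rfl⟩ | h7 | h7
      · exact Or.inr ⟨Or.inr (Or.inr ⟨rfl, rfl, rfl⟩), by simp [meetL], by simp [meetR]⟩
      all_goals simp at h7
    · exact absurd rfl hne
    · omega
    · rcases h7 with ⟨rfl, -⟩ | ⟨-, h7, -⟩ | ⟨h7, -, rfl⟩
      · exact absurd rfl h6
      · simp at h7
      · exact Or.inr ⟨Or.inr (Or.inl ⟨by simp only; omega, rfl⟩), by simp [meetL], by simp [meetR]⟩
    · omega
    · exact absurd (by rw [show s₁ = s₂ from (hq.2 rfl).trans (hq'.2 rfl).symm]) hne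
  · rintro (⟨h, rfl, rfl⟩ | ⟨h, rfl, rfl⟩)
    · refine ⟨fun e => ?_, starPt_meet h⟩
      rw [show q = q' from (Prod.ext_iff.1 e).1] at h
      simp only [Meets] at h
      omega
    · refine ⟨fun e => ?_, (starPt_meet h).symm⟩
      rw [show q = q' from (Prod.ext_iff.1 e).1] at h
      simp only [Meets] at h
      omega

lemma starPt_chain {q : Bool × ℕ} (h0 : q.2 ≠ 0) (h8 : q.2 ≠ 8) :
    starPt q = fun o => .inf q.1 (stepseq q.2 o) := by
  rw [starPt, if_neg h0, if_neg h8]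

lemma exists_isPath_star {q : Bool × ℕ} (hq : IsStar q) (n : Fin 2) (t : ℂ) :
    ∃ k γ, IsPath a b k (starPt q) n t γ := by
  unfold starPt
  split_ifs with h0 h8
  · exact exists_isPath (fun t => ⟨_, _, isPath_tail t⟩) ⟨_, _, isPath_tail_inf⟩ n t
  · refine exists_isPath (fun t => ?_) ⟨_, _, isPath_mid_inf (s := false)⟩ n t
    by_cases ht : t = 0
    · exact ⟨_, _, ht ▸ isPath_mid_inf (s := true)⟩
    · exact ⟨_, _, isPath_mid ht⟩
  · obtain ⟨m, hm⟩ := Nat.exists_eq_succ_of_ne_zero h0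
    have h9 : q.2 < 8 := lt_of_le_of_ne hq.1 h8
    have h2 := isPath_inf_snd (a := a) (b := b) (s := q.1) (i := m) (by omega) 0
    rw [← Nat.succ_eq_add_one, ← hm] at h2
    exact exists_isPath (fun t => ⟨_, _, isPath_inf_fst h0 h9 t⟩) ⟨_, _, h2⟩ n t

lemma theta_star {p : Surf a b} :
    theta a b p = aff 1 0 ↔ ∃ i o, toPt p = starPt (starIdx i) o := by
  have key : (∃ i o, toPt p = starPt (starIdx i) o) ↔ ∃ q, IsStar q ∧ ∃ o, toPt p = starPt q o := by
    constructor
    · rintro ⟨i, h⟩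
      exact ⟨_, isStar_starIdx i, h⟩
    · rintro ⟨q, hq, h⟩
      obtain ⟨i, rfl⟩ := exists_starIdx hq
      exact ⟨i, h⟩
  rw [theta_eq_aff_one, key]
  constructor
  · rintro (⟨s, σ, h⟩ | ⟨s, ρ, h⟩ | ⟨z, h⟩)
    · exact ⟨(s, 0), by simp [IsStar], some σ, h⟩
    · obtain ⟨j, ⟨u, v⟩, hc, -, rfl, hC, hA, hB⟩ := exists_chain_of_toPt h
      have hj : j < 8 := hc.1
      rw [h]
      have key : ∀ i o, i ≠ 0 → i < 8 → ∃ q, IsStar q ∧ ∃ o',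
          Pt.inf s (stepseq i o) = starPt q o' := fun i o h0 h8 =>
        ⟨(s, i), ⟨h8.le, fun h => absurd h h8.ne⟩, o, by rw [starPt_chain h0 h8.ne]⟩
      by_cases hu : u = 0
      · subst hu
        rw [tseq_zero_fst]
        by_cases h0 : j = 0
        · subst h0
          have : v = 0 := by simpa [torA] using hA
          rw [this, ← stepseq_succ_none]
          exact key 1 none one_ne_zero (by norm_num)
        · exact key j _ h0 hj
      · have hv : v = 0 := by simpa [torC, hu] using hC
        subst hv
        have h1 : 8 - 1 - j ≠ 0 := by simpa [torB, hu] using hB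
        rw [tseq_zero_snd]
        exact key _ _ j.succ_ne_zero (by omega)
    · exact ⟨(true, 8), by simp [IsStar], some z, by simp [h, starPt, midCurve, mid_ne_zero h]⟩
  · rintro ⟨q, -, o, h⟩
    rw [h]
    unfold starPt
    split_ifs
    · rcases o with _ | σ <;> simp [tailCurve]
    · rcases o with _ | z
      · simp [midCurve]
      · simp only [midCurve]
        split_ifs <;> simp
    · simp

lemma fibEq_chain (s : Bool) (i : ℕ) (c : ℂ × ℂ) : fibEq ![1, 0] (.chain s i) c = -chXi i c := by
  simp [fibEq, thetaL]

/-- The multiplicities of the curves in the fibre over `x = ∞`. -/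
def starMult (q : Bool × ℕ) : ℕ := if q.2 ≤ 1 then 1 else 2

/-- The multiplicities come from ξ = A + C² = C²(1 + ρ): order two along curve i for i ≥ 2, order
one along curve 1, where A dominates. Assuming that no other branch passes removes the zeros of the
cofactor. -/
lemma exists_star_smooth {q : Bool × ℕ} (hq : IsStar q) {o : Option ℂ}
    (h : ∀ q', IsStar q' → ∀ o', starPt q' o' = starPt q o → (q', o') = (q, o)) :
    ∃ k, ∃ c ∈ dom a b k, ∃ h u : ℂ × ℂ → ℂ, pt a b k c = starPt q o ∧ AnalyticAt ℂ h c ∧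
      AnalyticAt ℂ u c ∧ h c ≠ 0 ∧ fderiv ℂ u c ≠ 0 ∧ VanishesOn a b k u (starPt q) o ∧
      ∀ᶠ c' in 𝓝 c, fibEq ![1, 0] k c' = h c' * u c' ^ starMult q := by
  have hL : ∀ q', IsStar q' → Meets q q' → o ≠ meetL q' := by
    rintro q' hq' h1 rfl
    exact ((starPt_cross hq hq').2 (Or.inl ⟨h1, rfl, rfl⟩)).1
      (h q' hq' _ (starPt_meet h1).symm).symm
  have hR : ∀ q', IsStar q' → Meets q' q → o ≠ meetR q' q := by
    rintro q' hq' h1 rfl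
    exact ((starPt_cross hq hq').2 (Or.inr ⟨h1, rfl, rfl⟩)).1
      (h q' hq' _ (starPt_meet h1)).symm
  have hv : (![1, 0] : Fin 2 → ℂ) ≠ 0 := by simp
  have hP : ∀ (p : Surf a b) o, toPt p = starPt q o →
      theta a b p = Projectivization.mk ℂ ![1, 0] hv := by
    intro p o h
    obtain ⟨i, rfl⟩ := exists_starIdx hq
    exact theta_star.2 ⟨i, o, h⟩
  rcases q with ⟨s, i⟩
  have hi : i ≤ 8 := hq.1
  by_cases h0 : i = 0
  · subst h0
    rcases o with _ | σ
    · exact absurd rfl (hR (s, 2) (by simp [IsStar]) (by simp [Meets]))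
    refine exists_smooth hv (zero_mem_dom_tail s σ) (pt_tail_zero s σ) ?_ hP
    have e : fibEq ![1, 0] (.tail s) = fun c => -c.2 := by
      funext c; simp [fibEq, thetaL]
    rw [e, fderiv_fun_neg, fderiv_snd]
    intro h
    simpa using congrArg (fun L : ℂ × ℂ →L[ℂ] ℂ => L (0, 1)) h
  by_cases h1 : i = 1
  · subst h1
    have ho : o ≠ some 0 := hL (s, 2) (by simp [IsStar]) (by simp [Meets])
    obtain ⟨u, rfl⟩ : ∃ u, oinv u = o := by
      rcases o with _ | t
      · exact ⟨0, by simp [oinv]⟩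
      · have ht : t ≠ 0 := by rintro rfl; exact ho rfl
        exact ⟨t⁻¹, by simp [oinv, ht]⟩
    have hA := torA_zero_snd 0 u
    have hB : torB 8 0 (u, 0) = 0 := torB_zero_snd (by norm_num) u
    refine exists_smooth hv (mem_dom_chain s (by norm_num) hA hB) ?_ ?_ hP
    · rw [pt_chain_special hA hB, tseq_zero_snd]; rfl
    -- Curve 1 is the axis v = 0 of chart 0, where A = v and C = uv, so ξ = v(1 + u²v).
    have e : fibEq ![1, 0] (.chain s 0) = fun c => (-(1 + c.1 ^ 2 * c.2)) * c.2 := by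
      funext c; simp [fibEq_chain, chXi, torA, torC]; ring
    intro h
    have h2 := congrArg (fun L : ℂ × ℂ →L[ℂ] ℂ => L (0, 1)) h
    rw [e] at h2
    rw [fderiv_fun_mul_apply (by fun_prop) analyticAt_snd, fderiv_snd] at h2
    simp at h2
  have hm : starMult (s, i) = 2 := if_neg (by simp only; omega)
  rw [hm]
  by_cases h8 : i = 8
  · subst h8
    obtain rfl : s = true := hq.2 rfl
    rcases o with _ | z
    · exact absurd rfl (hR (false, 7) (by simp [IsStar]) (by simp [Meets]))
    have hz : z ≠ 0 := by
      rintro rfl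
      exact hR (true, 7) (by simp [IsStar]) (by simp [Meets]) (by simp [meetR])
    refine ⟨.mid, (0, z), zero_mem_dom_mid hz, fun _ => -1, fun c => c.1, ?_, analyticAt_const,
      analyticAt_fst, by simp, fderiv_fst_ne_zero _, (isPath_mid hz).vanishesOn fun _ => rfl,
      Eventually.of_forall fun c => by simp [fibEq, thetaL]⟩
    simp [pt_mid_zero, starPt, midCurve, hz]
  · rcases o with _ | z
    · have h2 := hR (s, i - 1) ⟨by simp only; omega, by simp only; omega⟩
        (Or.inl ⟨rfl, by simp only; omega, by simp only; omega, by simp only; omega⟩)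
      simp [meetR, h8] at h2
    have hz : z ≠ 0 := by
      rintro rfl
      by_cases h7 : i = 7
      · exact hL (true, 8) (by simp [IsStar]) (by simp [Meets, h7]) (by simp [meetL])
      · exact hL (s, i + 1) ⟨by simp only; omega, by simp only; omega⟩
          (Or.inl ⟨rfl, h0, rfl, by simp only; omega⟩) (by simp [meetL])
    have hi2 : 2 ≤ i := by omega
    -- ρ is the coordinate on curve 2 and vanishes on the later curves; 1 + ρ = 0 happens only at
    -- the crossing of curve 2 with the tail.
    have hρ : 1 + chRho i (0, z) ≠ 0 := by
      by_cases h2 : i = 2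
      · subst h2
        intro h3
        have h4 : z = -1 := by
          simp only [chRho] at h3
          linear_combination h3
        exact hL (s, 0) (by simp [IsStar]) (by simp [Meets]) (by simp [meetL, h4])
      · simp [chRho, show i - 2 ≠ 0 by omega]
    have hA := torA_zero_fst h0 z
    have hB := torB_zero_fst 8 i z
    have h9 : i < 8 := by omega
    refine ⟨.chain s i, (0, z), mem_dom_chain s h9 hA hB, fun c => -(c.2 ^ 2 * (1 + chRho i c)),
      fun c => c.1, ?_, ?_, analyticAt_fst, ?_, fderiv_fst_ne_zero _, ?_, ?_⟩
    · rw [pt_chain_special hA hB, tseq_zero_fst, starPt_chain h0 h8]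
    · exact ((analyticAt_snd.pow 2).mul (analyticAt_const.add (analyticAt_chRho _ _))).neg
    · exact neg_ne_zero.2 (mul_ne_zero (pow_ne_zero 2 hz) hρ)
    · rw [starPt_chain h0 h8]
      exact (isPath_inf_fst h0 h9 z).vanishesOn fun _ => rfl
    · refine Eventually.of_forall fun c => ?_
      rw [fibEq_chain, chXi_eq_chRho hi2, torC]
      ring

/-- At the origin of chart i the axis u = 0 is curve i and the axis v = 0 is curve i + 1 (the middle
curve for i = 7), so the fibre equation is a unit times powers of u and v. The tail crosses curve 2
away from the origin and is treated separately. -/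
lemma exists_star_cross {q q' : Bool × ℕ} (hq : IsStar q) (h : Meets q q') :
    ∃ k, ∃ c ∈ dom a b k, ∃ h u w : ℂ × ℂ → ℂ, pt a b k c = starPt q (meetL q') ∧
      AnalyticAt ℂ h c ∧ AnalyticAt ℂ u c ∧ AnalyticAt ℂ w c ∧ h c ≠ 0 ∧
      (∀ x, fderiv ℂ u c x = 0 → fderiv ℂ w c x = 0 → x = 0) ∧
      VanishesOn a b k u (starPt q) (meetL q') ∧ VanishesOn a b k w (starPt q') (meetR q q') ∧
      ∀ᶠ c' in 𝓝 c,
        fibEq ![1, 0] k c' = h c' * u c' ^ starMult q * w c' ^ starMult q' := by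
  rcases q with ⟨s, i⟩
  rcases q' with ⟨s', j⟩
  have hi : i ≤ 8 := hq.1
  have chain : ∀ (_ : i ≠ 0) (_ : i ≠ 8), j = i + 1 →
      VanishesOn a b (.chain s i) (fun c => c.2) (starPt (s', j)) (meetR (s, i) (s', j)) →
      ∃ k, ∃ c ∈ dom a b k, ∃ h u w : ℂ × ℂ → ℂ, pt a b k c = starPt (s, i) (meetL (s', j)) ∧
      AnalyticAt ℂ h c ∧ AnalyticAt ℂ u c ∧ AnalyticAt ℂ w c ∧ h c ≠ 0 ∧
      (∀ x, fderiv ℂ u c x = 0 → fderiv ℂ w c x = 0 → x = 0) ∧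
      VanishesOn a b k u (starPt (s, i)) (meetL (s', j)) ∧
      VanishesOn a b k w (starPt (s', j)) (meetR (s, i) (s', j)) ∧
      ∀ᶠ c' in 𝓝 c,
        fibEq ![1, 0] k c' = h c' * u c' ^ starMult (s, i) * w c' ^ starMult (s', j) := by
    intro h0 h8 hj hw
    have hL : meetL (s', j) = some 0 := by simp [meetL, hj]
    have hA := torA_zero_fst h0 0
    have hB := torB_zero_fst 8 i 0
    have hm : starMult (s', j) = 2 := if_neg (by simp only; omega)
    obtain ⟨h, h1, h2, h3⟩ : ∃ h : ℂ × ℂ → ℂ, AnalyticAt ℂ h (0, 0) ∧ h (0, 0) ≠ 0 ∧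
        ∀ c, -chXi i c = h c * c.1 ^ starMult (s, i) * c.2 ^ 2 := by
      -- In chart 1, ξ = uv²(1 + u), which has the factor u only once; in the later charts ξ =
      -- u²v²(1 + ρ).
      by_cases h1 : i = 1
      · subst h1
        refine ⟨fun c => -(1 + c.1), by fun_prop, by simp, fun c => ?_⟩
        simp [chXi, torA, torC, starMult]; ring
      · have hm' : starMult (s, i) = 2 := if_neg (by simp only; omega)
        refine ⟨fun c => -(1 + chRho i c), (analyticAt_const.add (analyticAt_chRho _ _)).neg,
          by simp [chRho], fun c => ?_⟩
        rw [chXi_eq_chRho (by omega), torC, hm']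
        ring
    refine ⟨.chain s i, (0, 0), mem_dom_chain s (by omega) hA hB, h, fun c => c.1, fun c => c.2, ?_,
      h1, analyticAt_fst, analyticAt_snd, h2, fun x h4 h5 => ?_, ?_, hw,
      Eventually.of_forall fun c => by rw [fibEq_chain, h3, hm]⟩
    · rw [pt_chain_special hA hB, tseq_zero_fst, hL, starPt_chain h0 h8]
    · rw [fderiv_fst] at h4
      rw [fderiv_snd] at h5
      exact Prod.ext h4 h5
    · rw [hL, starPt_chain h0 h8]
      exact (isPath_inf_fst h0 (by omega) 0).vanishesOn fun _ => rfl
  rcases h with ⟨rfl, h0, hj, h7⟩ | ⟨rfl, rfl⟩ | ⟨rfl, rfl, rfl⟩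
  · have hj : j = i + 1 := hj
    have h7 : i < 7 := h7
    subst hj
    refine chain h0 (by omega) rfl ?_
    have hR : meetR (s, i) (s, i + 1) = cpAff 1 0 := by
      simp [meetR, cpAff, oinv, show i ≠ 7 by omega]
    rw [hR, starPt_chain (q := (s, i + 1)) (by simp) (by simp only; omega)]
    exact (isPath_inf_snd (by omega) 0).vanishesOn fun _ => rfl
  · refine chain (by norm_num) (by norm_num) rfl ?_
    have hR : meetR (s, 7) (s', 8) = cpAff (if s then 0 else 1) 0 := by
      cases s <;> simp [meetR, cpAff, oinv]
    rw [hR]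
    exact isPath_mid_inf.vanishesOn fun _ => rfl
  -- Near (-1, 0) in chart 1, ξ = u·v²·(1 + u) is the unit u times the square of the equation of
  -- curve 2 times the equation of the tail.
  · have hA := torA_zero_snd 1 (-1)
    have hB : torB 8 1 (-1, 0) = 0 := by simp [torB]
    have hL : meetL (s, 0) = cpAff 1 (-1) := by norm_num [meetL, cpAff, oinv]
    have hR : meetR (s, 2) (s, 0) = cpAff 1 0 := by simp [meetR, cpAff, oinv]
    refine ⟨.chain s 1, (-1, 0), mem_dom_chain s (by norm_num) hA hB, fun c => -c.1, fun c => c.2,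
      fun c => 1 + c.1, ?_, by fun_prop, analyticAt_snd, by fun_prop, by simp, fun x h4 h5 => ?_,
      ?_, ?_, Eventually.of_forall fun c => ?_⟩
    · rw [pt_chain_special hA hB, tseq_zero_snd]
      norm_num [oinv, meetL, starPt]
    · rw [fderiv_snd] at h4
      rw [fderiv_const_add, fderiv_fst] at h5
      exact Prod.ext h5 h4
    · rw [hL]
      exact (isPath_inf_snd (by norm_num) (-1)).vanishesOn fun _ => rfl
    · rw [hR]
      exact isPath_tail_inf.vanishesOn fun _ => by simp
    · rw [fibEq_chain]
      simp [chXi, torA, torC, starMult]; ring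

/-- The fibre over `[1, 0]` is of type `I*_12`. -/
theorem isTypeIStar (a b : ℂ) : IsTypeIStar (theta a b) (aff 1 0) 12 := by
  have hm : (Sum.elim (fun _ : Fin 13 => 2) (fun _ : Fin 4 => 1)) = fun i => starMult (starIdx i) := by
    funext i
    revert i
    decide
  have hne : ∀ {i j o o'}, ((i, o) : (Fin 13 ⊕ Fin 4) × Option ℂ) ≠ (j, o') ↔
      (starIdx i, o) ≠ (starIdx j, o') := by
    intro i j o o'
    simp [starIdx_injective.eq_iff]
  have cross := fun i j => @starPt_cross _ _ (isStar_starIdx i) (isStar_starIdx j)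
  unfold IsTypeIStar
  rw [hm]
  refine isFibreOfRationalCurves (by simp) (fun i => starPt (starIdx i))
    (fun i => exists_isPath_star (isStar_starIdx i)) (fun p => theta_star) ?_ ?_ ?_
  · intro i j
    rw [starGraph_eq]
    simp only [hne, cross]
    split_ifs with h
    · rw [Nat.cast_one, encard_eq_one]
      have h2 : ¬(Meets (starIdx i) (starIdx j) ∧ Meets (starIdx j) (starIdx i)) := by
        simp only [Meets]; omega
      rcases h with h | h
      · exact ⟨(meetL (starIdx j), meetR (starIdx i) (starIdx j)), by
          ext ⟨o, o'⟩; simp [h, show ¬Meets (starIdx j) (starIdx i) from fun h' => h2 ⟨h, h'⟩]⟩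
      · exact ⟨(meetR (starIdx j) (starIdx i), meetL (starIdx i)), by
          ext ⟨o, o'⟩
          simp [h, show ¬Meets (starIdx i) (starIdx j) from fun h' => h2 ⟨h', h⟩, and_comm]⟩
    · rw [not_or] at h
      simp [h.1, h.2]
  · intro i o h
    refine exists_star_smooth (isStar_starIdx i) fun q' hq' o' e => ?_
    obtain ⟨j, rfl⟩ := exists_starIdx hq'
    obtain ⟨rfl, rfl⟩ := Prod.mk.inj (h j o' e)
    rfl
  · intro i o j o' h e
    rcases (cross i j).1 ⟨hne.1 h, e⟩ with ⟨h1, rfl, rfl⟩ | ⟨h1, rfl, rfl⟩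
    · exact exists_star_cross (isStar_starIdx i) h1
    · obtain ⟨k, c, hc, f, u, w, h2, h3, h4, h5, h6, h7, h8, h9, h10⟩ :=
        exists_star_cross (a := a) (b := b) (isStar_starIdx j) h1
      refine ⟨k, c, hc, f, w, u, h2.trans e.symm, h3, h5, h4, h6, fun x hx hx' => h7 x hx' hx, h9,
        h8, ?_⟩
      filter_upwards [h10] with c' h11
      rw [h11]; ring

/-! ## The polynomials -/

section

open Polynomial

/-- Shifting the value only changes b, so P - 1 and P + 1 belong to the same family and one analysis
of roots serves for both. -/
lemma poly_sub_C (a b t : ℂ) : poly a b - C t = poly a (b + t) := by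
  simp only [poly, map_add]; ring

lemma poly_sub_one (a b : ℂ) : poly a b - 1 = poly a (b + 1) := poly_sub_C a b 1

lemma poly_add_one (a b : ℂ) : poly a b + 1 = poly a (b - 1) := by
  rw [sub_eq_add_neg b, ← poly_sub_C, map_neg, sub_neg_eq_add, map_one]

lemma isRoot_poly {l : ℂ} : (poly a b).IsRoot l ↔ fP a b l = 0 := by rw [IsRoot, eval_poly]

lemma rootMultiplicity_of_eq {p q : ℂ[X]} {r : ℂ} {n : ℕ} (h : p = (X - C r) ^ n * q)
    (hq : q.eval r ≠ 0) : p.rootMultiplicity r = n := by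
  have hq0 : q ≠ 0 := by rintro rfl; simp at hq
  rw [h, rootMultiplicity_mul (mul_ne_zero (pow_ne_zero n (X_sub_C_ne_zero r)) hq0),
    rootMultiplicity_X_sub_C_pow, rootMultiplicity_eq_zero hq, add_zero]

/-- If 4l² = a, then P'(l) = 0 and P - P(l) = 4(X - l)²(X + 2l). -/
lemma nmult_eq_two {l : ℂ} (h : 4 * l ^ 2 = a) (hl : l ≠ 0) : nmult a b l = 2 := by
  refine rootMultiplicity_of_eq (q := 4 * (X + C (2 * l))) ?_ ?_
  · refine Polynomial.funext fun x => ?_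
    simp [poly, fP]
    linear_combination (3 * x - 3 * l) * h
  · simp only [eval_mul, eval_add, eval_X, eval_C, eval_ofNat]
    rw [← one_add_mul]
    exact mul_ne_zero (by norm_num) (mul_ne_zero (by norm_num) hl)

lemma nmult_eq_three (b : ℂ) : nmult 0 b 0 = 3 :=
  rootMultiplicity_of_eq (q := 4) (Polynomial.funext fun x => by simp [poly, fP]; ring) (by simp)

/-- The location of multiple roots. -/
lemma eq_of_derivative {l : ℂ} (h : fP a b l = 0) (h' : 12 * l ^ 2 - 3 * a = 0) :
    a ^ 3 = b ^ 2 ∧ 2 * a * l = -b := by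
  obtain rfl : a = 4 * l ^ 2 := by linear_combination -h' / 3
  obtain rfl : b = -8 * l ^ 3 := by rw [fP] at h; linear_combination -h
  exact ⟨by ring, by ring⟩

/-- A multiple root would be a common zero of P and P', which by `eq_of_derivative` forces the
discriminant relation a³ = b². -/
lemma ncard_roots (h : a ^ 3 ≠ b ^ 2) : {l | fP a b l = 0}.ncard = 3 := by
  have h0 : poly a b ≠ 0 := by simpa using poly_sub_C_ne_zero a b 0
  have hdeg : (poly a b).natDegree = 3 := by
    have e : poly a b = C 4 * X ^ 3 + C 0 * X ^ 2 + C (-(3 * a)) * X + C (-b) := by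
      simp only [poly, map_neg, map_zero]
      rw [show (C 4 : ℂ[X]) = 4 from rfl]
      ring
    rw [e, natDegree_cubic (by norm_num)]
  have hnd : (poly a b).roots.Nodup := by
    rw [Multiset.nodup_iff_count_le_one]
    intro l
    rw [count_roots]
    by_contra! h1
    obtain ⟨h2, h3⟩ := (one_lt_rootMultiplicity_iff_isRoot h0).1 h1
    refine h (eq_of_derivative (isRoot_poly.1 h2) ?_).1
    have h4 : (derivative (poly a b)).eval l = 12 * l ^ 2 - 3 * a := by
      simp [poly]; ring
    rwa [← h4]
  have e : {l | fP a b l = 0} = ((poly a b).roots.toFinset : Set ℂ) := by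
    ext l
    simp [h0, eval_poly]
  rw [e, ncard_coe_finset, Multiset.toFinset_card_of_nodup hnd,
    ← (IsAlgClosed.splits (poly a b)).natDegree_eq_card_roots, hdeg]

/-- Writing the two values as ε and -ε with ε = ±1 lets the second and the third case of the theorem
share one proof. -/
lemma singSet_eq {ε : ℂ} (hε : ε ^ 2 = 1) :
    singSet a b = {l | fP a (b + ε) l = 0} ∪ {l | fP a (b - ε) l = 0} := by
  ext l
  rw [mem_singSet, mem_union, mem_ofPred_eq, mem_ofPred_eq, ← mul_eq_zero, fP, fP, fP]
  constructor <;> intro h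
  · linear_combination h - hε
  · linear_combination h + hε

lemma ncard_singSet {ε : ℂ} (hε : ε ^ 2 = 1) : (singSet a b).ncard =
    {l | fP a (b + ε) l = 0}.ncard + {l | fP a (b - ε) l = 0}.ncard := by
  have hf : (singSet a b).Finite := finite_singSet
  rw [singSet_eq hε] at hf ⊢
  refine ncard_union_eq (disjoint_left.2 fun l h1 h2 => ?_) (hf.subset subset_union_left)
    (hf.subset subset_union_right)
  have h3 : ε = 0 := by
    simp only [mem_ofPred_eq, fP] at h1 h2
    linear_combination (h2 - h1) / 2
  simp [h3] at hε

/-- A point of the set is a root of P - ε or of P + ε. If it were critical, the corresponding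
discriminant relation would hold, and it would locate the root at 2al = -(b ± ε). -/
lemma nmult_eq_one_of_mem {l : ℂ} (hl : l ∈ singSet a b) {ε : ℂ} (hε : ε ^ 2 = 1)
    (h1 : a ^ 3 = (b + ε) ^ 2 → 2 * a * l ≠ -(b + ε)) (h2 : a ^ 3 ≠ (b - ε) ^ 2) :
    nmult a b l = 1 := by
  refine nmult_eq_one fun h => ?_
  rw [singSet_eq hε] at hl
  rcases hl with hl | hl
  · exact h1 (eq_of_derivative hl h).1 (eq_of_derivative hl h).2
  · exact h2 (eq_of_derivative hl h).1

lemma poly_eq_of_cube {β : ℂ} (ha : a ≠ 0) (h : a ^ 3 = β ^ 2) :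
    poly a β = (X - C (-β / (2 * a))) ^ 2 * (4 * (X - C (β / a))) := by
  refine Polynomial.funext fun x => ?_
  simp only [poly, eval_sub, eval_mul, eval_pow, eval_X, eval_C, eval_ofNat]
  field_simp
  linear_combination (-12 * x * a - 4 * β) * h

/-- The case of one double root. -/
lemma double_root {ε : ℂ} (hε : ε ^ 2 = 1) (h : a ^ 3 = (b + ε) ^ 2) (hb : b ≠ 0) (ha : a ≠ 0) :
    {l | fP a (b - ε) l = 0}.ncard = 3 ∧
    (poly a (b + ε)).rootMultiplicity (-(b + ε) / (2 * a)) = 2 ∧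
    (poly a (b + ε)).rootMultiplicity ((b + ε) / a) = 1 ∧
    (singSet a b).ncard = 5 ∧
    singSet a b = {-(b + ε) / (2 * a), (b + ε) / a} ∪ {l | fP a (b - ε) l = 0} ∧
    nmult a b (-(b + ε) / (2 * a)) = 2 ∧
    ∀ l ∈ singSet a b, l ≠ -(b + ε) / (2 * a) → nmult a b l = 1 := by
  have hε0 : ε ≠ 0 := by rintro rfl; simp at hε
  have hβ : b + ε ≠ 0 := by
    intro h0; rw [h0] at h; simp [ha] at h
  -- The squares (b + ε)² and (b - ε)² differ by 4bε, so for b ≠ 0 only one of the two cubics can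
  -- have a multiple root.
  have h2 : a ^ 3 ≠ (b - ε) ^ 2 := by
    intro h2
    have : 4 * b * ε = 0 := by linear_combination h2 - h
    simp [hb, hε0] at this
  have hp := poly_eq_of_cube ha h
  have h3 := ncard_roots h2
  have hd : -(b + ε) / (2 * a) ≠ (b + ε) / a := by
    intro h4
    field_simp at h4
    norm_num at h4
  have hr : {l | fP a (b + ε) l = 0} = {-(b + ε) / (2 * a), (b + ε) / a} := by
    ext l
    rw [mem_ofPred_eq, ← isRoot_poly, hp]
    simp [sub_eq_zero]
  refine ⟨h3, rootMultiplicity_of_eq hp ?_,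
    rootMultiplicity_of_eq (q := 4 * (X - C (-(b + ε) / (2 * a))) ^ 2) (by rw [hp]; ring) ?_, ?_, ?_,
    nmult_eq_two ?_ (div_ne_zero (neg_ne_zero.2 hβ) (mul_ne_zero two_ne_zero ha)), ?_⟩
  · simpa [sub_eq_zero] using hd
  · simpa [sub_eq_zero] using hd.symm
  · rw [ncard_singSet hε, h3, hr, ncard_pair hd]
  · rw [singSet_eq hε, hr]
  · field_simp
    linear_combination -4 * h
  · intro l hl hl'
    refine nmult_eq_one_of_mem hl hε (fun _ h5 => hl' ?_) h2
    rw [← h5]; field_simp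

lemma fP_eq_iff {l t : ℂ} : fP a b l = t ↔ fP a (b + t) l = 0 := by
  simp only [fP]
  constructor <;> intro h <;> linear_combination h

/-- The case without multiple roots. -/
lemma no_multiple_root (h1 : a ^ 3 ≠ (b + 1) ^ 2) (h2 : a ^ 3 ≠ (b - 1) ^ 2) :
    (singSet a b).ncard = 6 ∧ ∀ l ∈ singSet a b, nmult a b l = 1 :=
  ⟨by rw [ncard_singSet (one_pow 2), ncard_roots h1, ncard_roots h2],
    fun _ hl => nmult_eq_one_of_mem hl (one_pow 2) (fun h => absurd h h1) h2⟩

/-- The case of a triple root. -/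
lemma triple_root (hb : b = 1 ∨ b = -1) {c : ℂ} (hc : c ^ 3 = 2) : (singSet 0 b).ncard = 4 ∧
    singSet 0 b = {0} ∪ {l | ∃ θ : ℂ, θ ^ 3 = b ∧ l = 1 / c * θ} ∧
    ∀ l ∈ singSet 0 b, l ≠ 0 → nmult 0 b l = 1 := by
  have hb2 : b ^ 2 = 1 := by rcases hb with rfl | rfl <;> norm_num
  have hb0 : b ≠ 0 := by rintro rfl; norm_num at hb2
  have hc0 : c ≠ 0 := by rintro rfl; norm_num at hc
  have e1 : singSet 0 b = {0} ∪ {l | fP 0 (2 * b) l = 0} := by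
    ext l
    -- For a = 0 and b² = 1, P² - 1 = 4l³(4l³ - 2b): a triple root at 0 and the three cube roots of
    -- b/2.
    have : fP 0 b l ^ 2 - 1 = 4 * l ^ 3 * fP 0 (2 * b) l := by
      rw [fP, fP]; linear_combination hb2
    rw [mem_singSet, ← sub_eq_zero, this]
    simp
  have e2 : {l | fP 0 (2 * b) l = 0} = {l | ∃ θ : ℂ, θ ^ 3 = b ∧ l = 1 / c * θ} := by
    ext l
    constructor
    · intro h
      have h : fP 0 (2 * b) l = 0 := h
      rw [fP] at h
      exact ⟨c * l, by rw [mul_pow, hc]; linear_combination h / 2, by field_simp⟩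
    · rintro ⟨θ, rfl, rfl⟩
      rw [mem_ofPred_eq, fP]
      field_simp
      linear_combination -2 * θ ^ 3 * hc
  have h3 : (0 : ℂ) ^ 3 ≠ (2 * b) ^ 2 := by rw [mul_pow, hb2]; norm_num
  refine ⟨?_, by rw [e1, e2], fun l _ hl => nmult_eq_one (by simpa using hl)⟩
  rw [e1, ncard_union_eq (by simp [fP, hb0]) (by simp) (finite_of_ncard_ne_zero ?_), ncard_singleton,
    ncard_roots h3]
  rw [ncard_roots h3]
  norm_num

/-- The case of two double roots. -/
lemma two_double_roots (h : a ^ 3 = 1) :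
    poly a 0 + 1 = (2 * X - C (a ^ 2)) ^ 2 * (X + C (a ^ 2)) ∧
    poly a 0 - 1 = (2 * X + C (a ^ 2)) ^ 2 * (X - C (a ^ 2)) ∧
    (singSet a 0).ncard = 4 ∧ singSet a 0 = {a ^ 2 / 2, -(a ^ 2 / 2), -a ^ 2, a ^ 2} ∧
    nmult a 0 (a ^ 2 / 2) = 2 ∧ nmult a 0 (-(a ^ 2 / 2)) = 2 ∧
    nmult a 0 (-a ^ 2) = 1 ∧ nmult a 0 (a ^ 2) = 1 := by
  have ha : a ≠ 0 := by rintro rfl; norm_num at h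
  have ha2 : a ^ 2 ≠ 0 := pow_ne_zero 2 ha
  have e : singSet a 0 = {a ^ 2 / 2, -(a ^ 2 / 2), -a ^ 2, a ^ 2} := by
    ext l
    -- The product of the two factorizations of P ∓ 1, with a³ = 1 used to reduce the coefficients.
    have : fP a 0 l ^ 2 - 1 =
        16 * ((l - a ^ 2 / 2) * (l + a ^ 2 / 2)) ^ 2 * ((l + a ^ 2) * (l - a ^ 2)) := by
      rw [fP]
      linear_combination (24 * a * l ^ 4 - 9 * a ^ 2 * l ^ 2 * (a ^ 3 + 1) +
        (a ^ 9 + a ^ 6 + a ^ 3 + 1)) * h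
    rw [mem_singSet, ← sub_eq_zero, this]
    simp [sub_eq_zero, add_eq_zero_iff_eq_neg, or_assoc]
  have hs : ∀ x ∈ [a ^ 2 / 2, -(a ^ 2 / 2)], 4 * x ^ 2 = a := by
    simp only [List.mem_cons, List.not_mem_nil, or_false, forall_eq_or_imp, forall_eq]
    constructor <;> linear_combination a * h
  have hs' : ∀ x ∈ [-a ^ 2, a ^ 2], 12 * x ^ 2 - 3 * a ≠ 0 := by
    have : 12 * (a ^ 2) ^ 2 - 3 * a = 9 * a := by linear_combination 12 * a * h
    simp [this, ha]
  refine ⟨Polynomial.funext fun x => ?_, Polynomial.funext fun x => ?_, ?_, e,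
    nmult_eq_two (hs _ (by simp)) (by simp [ha]), nmult_eq_two (hs _ (by simp)) (by simp [ha]),
    nmult_eq_one (hs' _ (by simp)), nmult_eq_one (hs' _ (by simp))⟩
  · simp [poly]
    linear_combination (3 * a * x - a ^ 3 - 1) * h
  · simp [poly]
    linear_combination (3 * a * x + a ^ 3 + 1) * h
  · have key : ∀ r : ℂ, r ≠ 0 → r * a ^ 2 ≠ 0 := fun r hr => mul_ne_zero hr ha2
    rw [e, ncard_insert_of_notMem, ncard_insert_of_notMem, ncard_pair]
    · exact fun h1 => key 2 (by norm_num) (by linear_combination -h1)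
    · rintro (h1 | h1)
      · exact key (1 / 2) (by norm_num) (by linear_combination h1)
      · exact key (-3 / 2) (by norm_num) (by linear_combination mem_singleton_iff.1 h1)
    · rintro (h1 | h1 | h1)
      · exact key 1 (by norm_num) (by linear_combination h1)
      · exact key (3 / 2) (by norm_num) (by linear_combination h1)
      · exact key (-1 / 2) (by norm_num) (by linear_combination mem_singleton_iff.1 h1)

end

end Inose

end

/-! ### The theorem: assembly of the five cases -/

theorem mainTheorem8 (a b : ℂ) :
    ∃ (X : Type) (_ : TopologicalSpace X) (_ : ChartedSpace (ℂ × ℂ) X)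
      (_ : IsManifold Inose.I2 ω X) (π : X → Inose.CP 3) (Θ : X → Inose.CP 1),
      Inose.IsMinimalResolution a b π ∧ Inose.IsAlternateFibration π Θ ∧
      -- location of the singular fibres, and the fibre over `[1, 0]`
      (∀ t, Inose.IsSingularFibre Θ t ↔
        t = Inose.aff 1 0 ∨ ∃ l ∈ Inose.singSet a b, t = Inose.aff 0 l) ∧
      Inose.IsTypeIStar Θ (Inose.aff 1 0) 12 ∧
      -- the five cases below exhaust all possibilities
      ((a ^ 3 ≠ (b + 1) ^ 2 ∧ a ^ 3 ≠ (b - 1) ^ 2) ∨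
        (a ^ 3 = (b + 1) ^ 2 ∧ b ≠ 0 ∧ a ≠ 0) ∨
        (a ^ 3 = (b - 1) ^ 2 ∧ b ≠ 0 ∧ a ≠ 0) ∨
        (a = 0 ∧ (b = 1 ∨ b = -1)) ∨
        (a ^ 3 = 1 ∧ b = 0)) ∧
      -- first case
      (a ^ 3 ≠ (b + 1) ^ 2 → a ^ 3 ≠ (b - 1) ^ 2 →
        {l | (Inose.poly a b - 1).IsRoot l}.ncard = 3 ∧
        {l | (Inose.poly a b + 1).IsRoot l}.ncard = 3 ∧
        (Inose.singSet a b).ncard = 6 ∧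
        ∀ l ∈ Inose.singSet a b, Inose.IsTypeI Θ (Inose.aff 0 l) 1) ∧
      -- second case
      (a ^ 3 = (b + 1) ^ 2 → b ≠ 0 → a ≠ 0 →
        {l | (Inose.poly a b + 1).IsRoot l}.ncard = 3 ∧
        (Inose.poly a b - 1).rootMultiplicity (-(b + 1) / (2 * a)) = 2 ∧
        (Inose.poly a b - 1).rootMultiplicity ((b + 1) / a) = 1 ∧
        (Inose.singSet a b).ncard = 5 ∧
        Inose.singSet a b = {-(b + 1) / (2 * a), (b + 1) / a} ∪
          {l | (Inose.poly a b).eval l = -1} ∧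
        Inose.IsTypeI Θ (Inose.aff 0 (-(b + 1) / (2 * a))) 2 ∧
        ∀ l ∈ Inose.singSet a b, l ≠ -(b + 1) / (2 * a) →
          Inose.IsTypeI Θ (Inose.aff 0 l) 1) ∧
      -- third case
      (a ^ 3 = (b - 1) ^ 2 → b ≠ 0 → a ≠ 0 →
        {l | (Inose.poly a b - 1).IsRoot l}.ncard = 3 ∧
        (Inose.poly a b + 1).rootMultiplicity (-(b - 1) / (2 * a)) = 2 ∧
        (Inose.poly a b + 1).rootMultiplicity ((b - 1) / a) = 1 ∧
        (Inose.singSet a b).ncard = 5 ∧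
        Inose.singSet a b = {-(b - 1) / (2 * a), (b - 1) / a} ∪
          {l | (Inose.poly a b).eval l = 1} ∧
        Inose.IsTypeI Θ (Inose.aff 0 (-(b - 1) / (2 * a))) 2 ∧
        ∀ l ∈ Inose.singSet a b, l ≠ -(b - 1) / (2 * a) →
          Inose.IsTypeI Θ (Inose.aff 0 l) 1) ∧
      -- fourth case
      (a = 0 → (b = 1 ∨ b = -1) →
        (Inose.singSet a b).ncard = 4 ∧
        Inose.singSet a b = {0} ∪
          {l | ∃ θ : ℂ, θ ^ 3 = b ∧ l = 1 / (((2 : ℝ) ^ (1 / 3 : ℝ) : ℝ) : ℂ) * θ} ∧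
        Inose.IsTypeI Θ (Inose.aff 0 0) 3 ∧
        ∀ l ∈ Inose.singSet a b, l ≠ 0 → Inose.IsTypeI Θ (Inose.aff 0 l) 1) ∧
      -- fifth case
      (a ^ 3 = 1 → b = 0 →
        Inose.poly a b + 1 = (2 * Polynomial.X - Polynomial.C (a ^ 2)) ^ 2 *
          (Polynomial.X + Polynomial.C (a ^ 2)) ∧
        Inose.poly a b - 1 = (2 * Polynomial.X + Polynomial.C (a ^ 2)) ^ 2 *
          (Polynomial.X - Polynomial.C (a ^ 2)) ∧
        (Inose.singSet a b).ncard = 4 ∧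
        Inose.singSet a b = {a ^ 2 / 2, -(a ^ 2 / 2), -a ^ 2, a ^ 2} ∧
        Inose.IsTypeI Θ (Inose.aff 0 (a ^ 2 / 2)) 2 ∧
        Inose.IsTypeI Θ (Inose.aff 0 (-(a ^ 2 / 2))) 2 ∧
        Inose.IsTypeI Θ (Inose.aff 0 (-a ^ 2)) 1 ∧
        Inose.IsTypeI Θ (Inose.aff 0 (a ^ 2)) 1) := by
  have htype : ∀ {l : ℂ} {n : ℕ}, l ∈ Inose.singSet a b → Inose.nmult a b l = n →
      Inose.IsTypeI (Inose.theta a b) (Inose.aff 0 l) n := by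
    rintro l n hl rfl
    exact Inose.isTypeI (Inose.mem_singSet.1 hl)
  have e1 : ∀ l, Inose.fP a b l = 1 ↔ Inose.fP a (b + 1) l = 0 := fun l => Inose.fP_eq_iff
  have e2 : ∀ l, Inose.fP a b l = -1 ↔ Inose.fP a (b - 1) l = 0 := fun l => Inose.fP_eq_iff
  refine ⟨Inose.Surf a b, inferInstance, inferInstance, inferInstance, Inose.piMap a b,
    Inose.theta a b, Inose.isMinimalResolution_piMap, Inose.isAlternateFibration_theta,
    fun t => Inose.isSingularFibre_iff, Inose.isTypeIStar a b, ?_, ?_, ?_, ?_, ?_, ?_⟩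
  · by_cases h1 : a ^ 3 = (b + 1) ^ 2 <;> by_cases h2 : a ^ 3 = (b - 1) ^ 2
    -- If both discriminant relations hold, their difference is 4b = 0, and then a³ = 1. If exactly
    -- one holds, b ≠ 0, and a = 0 would give b = ∓1, the fourth case.
    · obtain rfl : b = 0 := by linear_combination (h2 - h1) / 4
      exact Or.inr (Or.inr (Or.inr (Or.inr ⟨by rw [h1]; norm_num, rfl⟩)))
    · by_cases ha : a = 0
      · refine Or.inr (Or.inr (Or.inr (Or.inl ⟨ha, Or.inr ?_⟩)))
        have h3 : (b + 1) ^ 2 = 0 := by rw [← h1, ha]; norm_num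
        linear_combination pow_eq_zero_iff two_ne_zero |>.1 h3
      · refine Or.inr (Or.inl ⟨h1, ?_, ha⟩)
        rintro rfl
        exact h2 (by rw [h1]; norm_num)
    · by_cases ha : a = 0
      · refine Or.inr (Or.inr (Or.inr (Or.inl ⟨ha, Or.inl ?_⟩)))
        have h3 : (b - 1) ^ 2 = 0 := by rw [← h2, ha]; norm_num
        linear_combination pow_eq_zero_iff two_ne_zero |>.1 h3
      · refine Or.inr (Or.inr (Or.inl ⟨h2, ?_, ha⟩))
        rintro rfl
        exact h1 (by rw [h2]; norm_num)
    · exact Or.inl ⟨h1, h2⟩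
  all_goals try simp only [Inose.poly_sub_one, Inose.poly_add_one, Inose.isRoot_poly, Inose.eval_poly,
    e1, e2]
  · intro h1 h2
    obtain ⟨h3, h4⟩ := Inose.no_multiple_root h1 h2
    exact ⟨Inose.ncard_roots h1, Inose.ncard_roots h2, h3, fun l hl => htype hl (h4 l hl)⟩
  · intro h hb ha
    obtain ⟨h1, h2, h3, h4, h5, h6, h7⟩ := Inose.double_root (one_pow 2) h hb ha
    exact ⟨h1, h2, h3, h4, h5, htype (by rw [h5]; simp) h6, fun l hl hl' => htype hl (h7 l hl hl')⟩
  · intro h hb ha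
    -- The third case is the second one with ε = -1.
    rw [sub_eq_add_neg] at h ⊢
    obtain ⟨h1, h2, h3, h4, h5, h6, h7⟩ := Inose.double_root (by norm_num) h hb ha
    rw [sub_neg_eq_add] at h1 h5
    exact ⟨h1, h2, h3, h4, h5, htype (by rw [h5]; simp) h6, fun l hl hl' => htype hl (h7 l hl hl')⟩
  · rintro rfl hb
    have hc : (((2 : ℝ) ^ (1 / 3 : ℝ) : ℝ) : ℂ) ^ 3 = 2 := by
      rw [← Complex.ofReal_pow, ← Real.rpow_natCast, ← Real.rpow_mul (by norm_num)]
      norm_num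
    obtain ⟨h1, h2, h3⟩ := Inose.triple_root hb hc
    exact ⟨h1, h2, htype (by rw [h2]; simp) (Inose.nmult_eq_three b),
      fun l hl hl' => htype hl (h3 l hl hl')⟩
  · rintro h rfl
    obtain ⟨h1, h2, h3, h4, h5, h6, h7, h8⟩ := Inose.two_double_roots h
    rw [Inose.poly_add_one] at h1
    rw [Inose.poly_sub_one] at h2
    exact ⟨h1, h2, h3, h4, htype (by rw [h4]; simp) h5, htype (by rw [h4]; simp) h6,
      htype (by rw [h4]; simp) h7, htype (by rw [h4]; simp) h8⟩
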